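/- Consider the complex Ginzburg–Landau equation (CGLe) $$A_t=\mu A+(1+i\alpha)A_{xx}-(1+i\beta)|A|^2A$$ in a box of length $L$ with periodic boundary conditions, with $\mu>0$ and real $\alpha,\beta$ such that $1+\alpha\beta<0$ (Benjamin–Feir–Newell unstable regime). Put $\kappa=\sqrt{-2\mu(1+\alpha\beta)/(1+\alpha^2)}$ and $L_0=2\pi/\kappa$. The homogeneously oscillating state (HOS) is $A=\sqrt\mu\,e^{-i\mu\beta t}$. A symmetric stationary solution is a solution $A=R(x)e^{i\phi(x)-i\omega t}$ with $R>0$ and $R,\phi$ even, $L$-periodic and $C^2$; it is a modulated amplitude wave (MAW) if $R$ is not constant. The linearization at such a solution is the operator $\mathcal L:(r,\theta)\mapsto(r_t,\theta_t)$ obtained by inserting $(R+r)e^{i(\phi-\omega t+\theta)}$ into the CGLe and keeping the linear terms, namely $$r_t=(\mu-\phi_x^2-\alpha\phi_{xx}-3R^2)r+r_{xx}-2\alpha\phi_xr_x-(2R\phi_x+2\alpha R_x)\theta_x-\alpha R\theta_{xx},$$ $$R\theta_t=(\omega-\alpha\phi_x^2+\phi_{xx}-3\beta R^2)r+\alpha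 r_{xx}+2\phi_xr_x+(2R_x-2\alpha R\phi_x)\theta_x+R\theta_{xx},$$ on complex-valued $L$-periodic $C^2$ functions $r,\theta$. The solution is called linearly stable (up to phase and translation) if the kernel of $\mathcal L$ is spanned by the phase mode $(0,1)$ and the translation mode $(R_x,\phi_x)$, the eigenvalue $0$ is semisimple, and every other eigenvalue of $\mathcal L$ has negative real part. Then there are constants $\delta,\eta,c,C>0$ and $K$, and for each $L\in(L_0,L_0+\delta)$ a MAW $(R_L,\phi_L,\omega_L)$ in the box of length $L$ and a number $\varepsilon_L>0$, such that the following hold. 1. (The MAW.) For $L\in(L_0,L_0+\delta)$ and $\Omega=2\pi/L$, uniformly in $x$, $$\Big|R_L^2-\mu-\tfrac{\varepsilon_L}{\beta-\alpha}\cos\Omega x\Big|\le K\varepsilon_L^2,\qquad \Big|\phi_L'-\tfrac{\varepsilon_L}{\Omega(1+\alpha^2)}\sin\Omega x\Big|\le K\varepsilon_L^2,$$ and $\omega_L\to\mu\beta$ and $\varepsilon_L^2/(L-L_0)\to C$ as $L\to L_0^+$. 2. (Stability.) For $L\in(L_0,L_0+\delta)$ the MAW is linearly stable. Its linearization has a real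 eigenvalue $\sigma_-(L)<0$, and no eigenvalue other than $0$ and $\sigma_-(L)$ has real part $>-c$. 3. (HOS.) For $0<L<L_0$ the HOS is linearly stable. For $L\in(L_0,L_0+\delta)$ its linearization has a real eigenvalue $\sigma_+(L)>0$, and no eigenvalue other than $0$ and $\sigma_+(L)$ has real part $>-c$. 4. (Eigenvalue relation.) As $L\to L_0^+$, $\sigma_\pm(L)\to0$ and $\sigma_-(L)/\sigma_+(L)\to-2$; that is, $2\sigma_+=-\sigma_-$ to leading order at the bifurcation point. 5. (Supercritical pitchfork.) Call $(R,\phi)$ near the HOS if there is a real $p$ with $|R(x)e^{i\phi(x)}-\sqrt\mu e^{ip}|<\eta$ for all $x$. For $L\in(L_0-\delta,L_0]$, the only symmetric stationary solution near the HOS is the HOS itself, up to a constant phase. For $L\in(L_0,L_0+\delta)$, the MAW is near the HOS, and the symmetric stationary solutions near the HOS are, up to a constant phase, only the HOS, the MAW, and the MAW translated by $L/2$. -/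

import Mathlib

open Filter Topology

noncomputable section

/-- `A x t` is a classical solution, in a box of length `L` with periodic boundary conditions, of
`A_t = μ A + (1 + iα) A_xx - (1 + iβ) |A|² A`. -/
def IsCGLSolution (μ α β L : ℝ) (A : ℝ → ℝ → ℂ) : Prop :=
  (∀ t, ContDiff ℝ 2 (fun x => A x t)) ∧
  (∀ t, Function.Periodic (fun x => A x t) L) ∧
  ∀ x t, HasDerivAt (fun s => A x s)
    ((μ : ℂ) * A x t
      + (1 + Complex.I * (α : ℂ)) * deriv (deriv (fun y => A y t)) x
      - (1 + Complex.I * (β : ℂ)) * ((‖A x t‖ ^ 2 : ℝ) : ℂ) * A x t) t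

/-- The field `R(x) exp(i φ(x) - i ω t)`. -/
def stationaryField (ω : ℝ) (R φ : ℝ → ℝ) (x t : ℝ) : ℂ :=
  (R x : ℂ) * Complex.exp (Complex.I * ((φ x - ω * t : ℝ) : ℂ))

/-- Stationary solutions with nowhere vanishing amplitude, in polar form, in the periodic box of
length `L`. -/
structure IsStationarySolution (μ α β L ω : ℝ) (R φ : ℝ → ℝ) : Prop where
  amplitude_pos : ∀ x, 0 < R x
  contDiff_amplitude : ContDiff ℝ 2 R
  contDiff_phase : ContDiff ℝ 2 φ
  periodic_amplitude : Function.Periodic R L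
  periodic_phase : Function.Periodic φ L
  solves : IsCGLSolution μ α β L (stationaryField ω R φ)

/-- Symmetric stationary solutions: amplitude and phase are even functions of `x`. -/
structure IsEvenStationarySolution (μ α β L ω : ℝ) (R φ : ℝ → ℝ) : Prop
    extends IsStationarySolution μ α β L ω R φ where
  even_amplitude : Function.Even R
  even_phase : Function.Even φ

/-- Stationary (symmetric) modulated amplitude waves: the amplitude is not constant. -/
structure IsMAW (μ α β L ω : ℝ) (R φ : ℝ → ℝ) : Prop
    extends IsEvenStationarySolution μ α β L ω R φ where
  modulated : ∃ x y, R x ≠ R y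

/-- Amplitude of the homogeneously oscillating state (HOS) `√μ exp(-i μ β t)`. -/
def hosR (μ : ℝ) : ℝ → ℝ := fun _ => Real.sqrt μ

/-- Spatial phase of the HOS. -/
def hosPhase : ℝ → ℝ := fun _ => 0

/-- Frequency of the HOS. -/
def hosFreq (μ β : ℝ) : ℝ := μ * β

/-- The profile `R e^{iφ}` is uniformly `η`-close to the HOS, up to a global phase. -/
def IsNearHOS (μ η : ℝ) (R φ : ℝ → ℝ) : Prop :=
  ∃ c : ℝ, ∀ x, ‖stationaryField 0 R φ x 0
    - (Real.sqrt μ : ℂ) * Complex.exp (Complex.I * (c : ℂ))‖ < η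

/-- `κ² = -2 μ (1 + αβ) / (1 + α²)`. -/
def criticalWavenumber (μ α β : ℝ) : ℝ :=
  Real.sqrt (-2 * μ * (1 + α * β) / (1 + α ^ 2))

/-- The box size `2π/κ` at the bifurcation. -/
def criticalLength (μ α β : ℝ) : ℝ := 2 * Real.pi / criticalWavenumber μ α β

/-- (Complexified) perturbations `(r, θ)` of amplitude and phase:
`Ā = (R + r) exp(i (φ - ω t + θ))`. -/
abbrev Perturbation : Type := (ℝ → ℂ) × (ℝ → ℂ)

/-- Admissible perturbations in the periodic box: both components `L`-periodic and `C²`. -/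
def IsAdmissible (L : ℝ) (w : Perturbation) : Prop :=
  ContDiff ℝ 2 w.1 ∧ ContDiff ℝ 2 w.2 ∧ Function.Periodic w.1 L ∧ Function.Periodic w.2 L

/-- The linearization of the CGLe about `R exp(i φ - i ω t)`, acting on `(r, θ)`:
the value is `(r_t, θ_t)`. -/
def linearization (μ α β ω : ℝ) (R φ : ℝ → ℝ) (w : Perturbation) : Perturbation :=
  (fun x =>
    ((μ - deriv φ x ^ 2 - α * deriv (deriv φ) x - 3 * R x ^ 2 : ℝ) : ℂ) * w.1 x
      + deriv (deriv w.1) x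
      - ((2 * α * deriv φ x : ℝ) : ℂ) * deriv w.1 x
      - ((2 * R x * deriv φ x + 2 * α * deriv R x : ℝ) : ℂ) * deriv w.2 x
      - ((α * R x : ℝ) : ℂ) * deriv (deriv w.2) x,
   fun x =>
    (((ω - α * deriv φ x ^ 2 + deriv (deriv φ) x - 3 * β * R x ^ 2 : ℝ) : ℂ) * w.1 x
      + (α : ℂ) * deriv (deriv w.1) x
      + ((2 * deriv φ x : ℝ) : ℂ) * deriv w.1 x
      + ((2 * deriv R x - 2 * α * R x * deriv φ x : ℝ) : ℂ) * deriv w.2 x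
      + ((R x : ℝ) : ℂ) * deriv (deriv w.2) x) / ((R x : ℝ) : ℂ))

/-- `σ` is an eigenvalue of the linearization in the periodic box of length `L`. -/
def IsStabilityEigenvalue (μ α β L ω : ℝ) (R φ : ℝ → ℝ) (σ : ℂ) : Prop :=
  ∃ w : Perturbation, w ≠ 0 ∧ IsAdmissible L w ∧ linearization μ α β ω R φ w = σ • w

/-- Infinitesimal global phase shift. -/
def phaseMode : Perturbation := (fun _ => 0, fun _ => 1)

/-- Infinitesimal spatial translation. -/
def translationMode (R φ : ℝ → ℝ) : Perturbation :=
  (fun x => ((deriv R x : ℝ) : ℂ), fun x => ((deriv φ x : ℝ) : ℂ))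

/-- The span of the phase mode and the translation mode; for a homogeneous state the translation
mode is `0`, and only the phase mode remains. -/
def neutralModes (R φ : ℝ → ℝ) : Submodule ℂ Perturbation :=
  Submodule.span ℂ {phaseMode, translationMode R φ}

/-- Linear stability up to phase and translation: the eigenvalue `0` has exactly the neutral modes
as eigenvectors, it is semisimple (no generalized eigenvectors), and every other eigenvalue has
negative real part. -/
structure IsLinearlyStable (μ α β L ω : ℝ) (R φ : ℝ → ℝ) : Prop where
  kernel : ∀ w : Perturbation,
    (IsAdmissible L w ∧ linearization μ α β ω R φ w = 0) ↔ w ∈ neutralModes R φ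
  semisimple : ∀ w : Perturbation, IsAdmissible L w →
    linearization μ α β ω R φ w ∈ neutralModes R φ → linearization μ α β ω R φ w = 0
  negative : ∀ σ : ℂ, IsStabilityEigenvalue μ α β L ω R φ σ → σ ≠ 0 → σ.re < 0

/-- Besides `0`, the real number `s` is the only eigenvalue with real part `> -c`, and it is an
eigenvalue. -/
def IsCriticalEigenvalue (μ α β L ω : ℝ) (R φ : ℝ → ℝ) (c s : ℝ) : Prop :=
  IsStabilityEigenvalue μ α β L ω R φ (s : ℂ) ∧
  ∀ σ : ℂ, IsStabilityEigenvalue μ α β L ω R φ σ → -c < σ.re → σ = 0 ∨ σ = (s : ℂ)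

/-- The stationary state `(ω, R, φ)` is the HOS up to a global phase. -/
def IsHOS (μ β ω : ℝ) (R φ : ℝ → ℝ) : Prop :=
  ω = hosFreq μ β ∧ R = hosR μ ∧ ∃ p : ℝ, φ = fun x => hosPhase x + p

end

open Filter Topology

noncomputable section

/-! Put s = Ωx, y = R_x/(ΩR), χ = φ_x/(Ωγ), E = h(R² − c₀)/Ω², where h is `bfParam`, γ is
`phaseRatio` and c₀ encodes the frequency. Symmetric stationary states become 2π-periodic solutions
(y, χ odd, E even) of the polynomial system y' = d − E − y² + γ²χ², χ' = E − 2yχ, E' = Λy + 2yE, and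
Ω²(Λ − 2hd) = 2hμ recovers the wavenumber. The HOS is the zero solution.

Existence. At zero with Λ = 1 the linear system y' = −E, χ' = E, E' = y resonates with sin s and cos
s. With the amplitude a as parameter, the terms of order a and a² are subtracted explicitly and the
rest is divided by a³. The remainders are fixed points of a map that does not depend on its unknown
at a = 0, so the implicit function theorem applies without any operator to invert
(`exists_fixedPoint_family`, `exists_branchFamily`). Solvability gives Λ − 2hd = 1 + a²k with k(0) >
0 (`BranchFamily.waveCoeff_zero_pos`), that is (L/L₀)² = 1 + a²k: the pitchfork is supercritical,
and a can be recovered from L (`exists_sq_inverse`).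

Uniqueness. Near the HOS all profile variables are small: the flux R²φ_x is periodic with derivative
proportional to R²E, so E changes sign, and this pins c₀ near μ (`exists_small_profile`). Two small
profiles of equal amplitude differ by a solution of the linear system with small forcing, hence
coincide (`BranchFamily.eq_of_small`). Consequently the member of amplitude −a is the half-period
translate of the member of amplitude a.

Spectrum. With r = Rρ the linearization about a member of the branch is a small perturbation of the
critical HOS operator, which acts on each Fourier mode by a 2×2 matrix. That operator has a
three-dimensional kernel (the phase mode, and one odd and one even vector at k = ±1); on the
complement its resolvent is bounded uniformly in a half plane Re σ ≥ −c. The bound survives the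
perturbation if three multipliers are admitted (`exists_coercive`). Phase and translation keep two
eigenvalues at 0. Two eigenvectors with a component along the even critical vector must have the
same eigenvalue, since a linear combination eliminates that component
(`Coercive.exists_alternative`). So it is enough to exhibit one nonzero eigenvalue. Differentiating
the branch in a gives an approximate eigenvector, and its correction is again a fixed point of a map
constant at the base point. This yields σ₋ = a²τ(a) with τ(0) = −2k(0)q₀(1 + α²)/(1 − αγ), where q₀
= 2hμ (`BranchFamily.exists_critical_eigenvalue`).

Ratio. The HOS eigenvalue is the larger root of an explicit quadratic, and σ₊/a² → (1 +
α²)q₀²k(0)/(2(q₀ + μ)). Dividing, k(0) cancels and h(1 − αγ) = 2h + 1 leaves −2. -/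

instance fact_two_pi_pos : Fact (0 < 2 * Real.pi) := ⟨Real.two_pi_pos⟩

/-! ### Periodic functions on the circle: mean, zero-mean primitive, reflection -/

/-- Continuous `2π`-periodic real functions, as functions on the circle. -/
abbrev PerFun : Type := C(AddCircle (2 * Real.pi), ℝ)

namespace PerFun

/-- The element of `PerFun` given by a continuous periodic function on the line. -/
def ofPeriodic (f : ℝ → ℝ) (hc : Continuous f) (hp : Function.Periodic f (2 * Real.pi)) : PerFun :=
  ⟨hp.lift, continuous_coinduced_dom.mpr hc⟩

@[simp] theorem ofPeriodic_coe (f : ℝ → ℝ) (hc : Continuous f)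
    (hp : Function.Periodic f (2 * Real.pi)) (s : ℝ) : ofPeriodic f hc hp (s : AddCircle _) = f s :=
  rfl

theorem continuous_coe (f : PerFun) :
    Continuous fun s : ℝ => f (s : AddCircle (2 * Real.pi)) :=
  f.continuous.comp (AddCircle.continuous_mk' _)

theorem periodic_coe (f : PerFun) :
    Function.Periodic (fun s : ℝ => f (s : AddCircle (2 * Real.pi))) (2 * Real.pi) := by
  intro s
  simp

theorem ext_coe {f g : PerFun}
    (h : ∀ s : ℝ, f (s : AddCircle (2 * Real.pi)) = g (s : AddCircle (2 * Real.pi))) : f = g := by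
  ext x
  induction x using QuotientAddGroup.induction_on with
  | H s => exact h s

theorem abs_coe_le (f : PerFun) (s : ℝ) : |f (s : AddCircle (2 * Real.pi))| ≤ ‖f‖ :=
  f.norm_coe_le_norm _

theorem norm_le_of_coe {f : PerFun} {C : ℝ} (hC : 0 ≤ C)
    (h : ∀ s ∈ Set.Ico 0 (2 * Real.pi), |f (s : AddCircle (2 * Real.pi))| ≤ C) : ‖f‖ ≤ C := by
  rw [ContinuousMap.norm_le _ hC]
  intro x
  obtain ⟨s, hs, rfl⟩ : ∃ s ∈ Set.Ico (0 : ℝ) (0 + 2 * Real.pi), (s : AddCircle _) = x := by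
    have := AddCircle.coe_image_Ico_eq (2 * Real.pi) 0
    have hx : x ∈ (Set.univ : Set (AddCircle (2 * Real.pi))) := trivial
    rw [← this] at hx
    exact hx
  rw [zero_add] at hs
  exact h s hs

@[simp] theorem algebraMap_coe (k : ℝ) (x : AddCircle (2 * Real.pi)) :
    algebraMap ℝ PerFun k x = k := by
  simp [Algebra.algebraMap_eq_smul_one]

@[simp] theorem two_coe (x : AddCircle (2 * Real.pi)) : (2 : PerFun) x = 2 := rfl

/-- The mean value over a period. -/
def mean : PerFun →L[ℝ] ℝ :=
  LinearMap.mkContinuous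
    { toFun := fun f => (2 * Real.pi)⁻¹ * ∫ t in (0 : ℝ)..(2 * Real.pi), f (t : AddCircle _)
      map_add' := by
        intro f g
        simp only [ContinuousMap.add_apply]
        rw [intervalIntegral.integral_add (f.continuous_coe.intervalIntegrable _ _)
          (g.continuous_coe.intervalIntegrable _ _), mul_add]
      map_smul' := by
        intro k f
        simp only [ContinuousMap.smul_apply, smul_eq_mul, intervalIntegral.integral_const_mul,
          RingHom.id_apply]
        ring }
    1 (by
      intro f
      have h := intervalIntegral.norm_integral_le_of_norm_le_const (a := 0) (b := 2 * Real.pi)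
        (f := fun t : ℝ => f (t : AddCircle _)) (C := ‖f‖) (fun t _ => f.norm_coe_le_norm _)
      simp only [LinearMap.coe_mk, AddHom.coe_mk, norm_mul, one_mul]
      rw [sub_zero, abs_of_pos Real.two_pi_pos] at h
      rw [norm_inv, Real.norm_of_nonneg Real.two_pi_pos.le, inv_mul_le_iff₀ Real.two_pi_pos]
      linarith)

theorem mean_apply (f : PerFun) :
    mean f = (2 * Real.pi)⁻¹ * ∫ t in (0 : ℝ)..(2 * Real.pi), f (t : AddCircle _) := rfl

theorem abs_mean_le (f : PerFun) : |mean f| ≤ ‖f‖ := by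
  have : ‖mean f‖ ≤ 1 * ‖f‖ := mean.le_of_opNorm_le
    (LinearMap.mkContinuous_norm_le _ zero_le_one _) f
  simpa using this

@[simp] theorem mean_algebraMap (k : ℝ) : mean (algebraMap ℝ PerFun k) = k := by
  rw [mean_apply]
  simp
  field_simp

@[simp] theorem mean_one : mean 1 = 1 := by
  simpa using mean_algebraMap 1

theorem integral_eq_mean (f : PerFun) :
    ∫ t in (0 : ℝ)..(2 * Real.pi), f (t : AddCircle _) = 2 * Real.pi * mean f := by
  rw [mean_apply]
  field_simp

/-- The primitive, vanishing at `0`, of a periodic function minus its mean. -/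
def primitive (f : PerFun) (s : ℝ) : ℝ :=
  ∫ t in (0 : ℝ)..s, (f (t : AddCircle (2 * Real.pi)) - mean f)

theorem hasDerivAt_primitive (f : PerFun) (s : ℝ) :
    HasDerivAt (primitive f) (f (s : AddCircle _) - mean f) s :=
  intervalIntegral.integral_hasDerivAt_right
    ((f.continuous_coe.sub continuous_const).intervalIntegrable _ _)
    ((f.continuous_coe.sub continuous_const).stronglyMeasurableAtFilter _ _)
    (f.continuous_coe.sub continuous_const).continuousAt

theorem continuous_primitive (f : PerFun) : Continuous (primitive f) :=
  continuous_iff_continuousAt.mpr fun s => (hasDerivAt_primitive f s).continuousAt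

theorem periodic_primitive (f : PerFun) : Function.Periodic (primitive f) (2 * Real.pi) := by
  intro s
  have hi : ∀ a b, IntervalIntegrable (fun t : ℝ => f (t : AddCircle (2 * Real.pi)) - mean f)
      MeasureTheory.volume a b := fun a b =>
    (f.continuous_coe.sub continuous_const).intervalIntegrable a b
  have hp : Function.Periodic (fun t : ℝ => f (t : AddCircle (2 * Real.pi)) - mean f)
      (2 * Real.pi) := fun t => by simp
  unfold primitive
  rw [← intervalIntegral.integral_add_adjacent_intervals (hi 0 s) (hi s (s + 2 * Real.pi)),
    hp.intervalIntegral_add_eq s 0, zero_add]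
  rw [intervalIntegral.integral_sub (a := 0) (b := 2 * Real.pi)
    (f.continuous_coe.intervalIntegrable _ _) (continuous_const.intervalIntegrable _ _),
    integral_eq_mean]
  simp

theorem abs_primitive_le (f : PerFun) {s : ℝ} (hs : s ∈ Set.Ico 0 (2 * Real.pi)) :
    |primitive f s| ≤ 4 * Real.pi * ‖f‖ := by
  have h := intervalIntegral.norm_integral_le_of_norm_le_const (a := 0) (b := s)
    (f := fun t : ℝ => f (t : AddCircle (2 * Real.pi)) - mean f) (C := 2 * ‖f‖) (fun t _ => by
      have h1 := abs_coe_le f t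
      have h2 := abs_mean_le f
      rw [Real.norm_eq_abs]
      exact (abs_sub _ _).trans (by linarith))
  rw [sub_zero, abs_of_nonneg hs.1, Real.norm_eq_abs] at h
  refine h.trans ?_
  nlinarith [hs.2, norm_nonneg f]

/-- The primitive of `f - mean f` vanishing at the origin, as a continuous linear map. -/
def primitiveCLM : PerFun →L[ℝ] PerFun :=
  LinearMap.mkContinuous
    { toFun := fun f => ofPeriodic (primitive f) (continuous_primitive f) (periodic_primitive f)
      map_add' := by
        intro f g
        refine ext_coe fun s => ?_
        simp only [ContinuousMap.add_apply, ofPeriodic_coe, primitive, map_add]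
        have h1 : Continuous fun t : ℝ => f (t : AddCircle (2 * Real.pi)) - mean f :=
          f.continuous_coe.sub continuous_const
        have h2 : Continuous fun t : ℝ => g (t : AddCircle (2 * Real.pi)) - mean g :=
          g.continuous_coe.sub continuous_const
        rw [← intervalIntegral.integral_add (h1.intervalIntegrable _ _)
          (h2.intervalIntegrable _ _)]
        congr 1
        ext t
        ring
      map_smul' := by
        intro k f
        refine ext_coe fun s => ?_
        simp only [ContinuousMap.smul_apply, ofPeriodic_coe, primitive, map_smul, smul_eq_mul,
          RingHom.id_apply]
        rw [← intervalIntegral.integral_const_mul]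
        congr 1
        ext t
        ring }
    (4 * Real.pi) (by
      intro f
      refine norm_le_of_coe (by positivity) fun s hs => ?_
      exact abs_primitive_le f hs)

theorem primitiveCLM_coe (f : PerFun) (s : ℝ) :
    primitiveCLM f (s : AddCircle (2 * Real.pi)) = primitive f s := rfl

theorem norm_primitiveCLM_le (f : PerFun) : ‖primitiveCLM f‖ ≤ 4 * Real.pi * ‖f‖ :=
  primitiveCLM.le_of_opNorm_le (LinearMap.mkContinuous_norm_le _ (by positivity) _) f

/-- The zero-mean primitive of `f - mean f`. -/
def J : PerFun →L[ℝ] PerFun :=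
  primitiveCLM - (Algebra.linearMap ℝ PerFun).toContinuousLinearMap.comp (mean.comp primitiveCLM)

theorem J_eq (f : PerFun) :
    J f = primitiveCLM f - algebraMap ℝ PerFun (mean (primitiveCLM f)) := rfl

theorem hasDerivAt_J (f : PerFun) (s : ℝ) :
    HasDerivAt (fun s : ℝ => J f (s : AddCircle (2 * Real.pi))) (f (s : AddCircle _) - mean f) s := by
  simp only [J_eq, ContinuousMap.sub_apply, primitiveCLM_coe, algebraMap_coe]
  exact (hasDerivAt_primitive f s).sub_const _

@[simp] theorem mean_J (f : PerFun) : mean (J f) = 0 := by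
  rw [J_eq, map_sub, mean_algebraMap, sub_self]

theorem norm_J_le (f : PerFun) : ‖J f‖ ≤ 8 * Real.pi * ‖f‖ := by
  rw [J_eq]
  have h1 := norm_primitiveCLM_le f
  have h2 := abs_mean_le (primitiveCLM f)
  refine (norm_sub_le _ _).trans ?_
  have h3 : ‖algebraMap ℝ PerFun (mean (primitiveCLM f))‖ = |mean (primitiveCLM f)| := by
    rw [norm_algebraMap', Real.norm_eq_abs]
  rw [h3]
  linarith

theorem mean_eq_zero_of_hasDerivAt {Y G : PerFun}
    (h : ∀ s : ℝ, HasDerivAt (fun s : ℝ => Y (s : AddCircle (2 * Real.pi)))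
      (G (s : AddCircle _)) s) : mean G = 0 := by
  rw [mean_apply, intervalIntegral.integral_eq_sub_of_hasDerivAt (fun s _ => h s)
    (G.continuous_coe.intervalIntegrable _ _)]
  have := Y.periodic_coe 0
  simp only [zero_add] at this
  rw [this, sub_self, mul_zero]

/-- The difference of two primitives is constant, and the mean identifies the constant. This turns a
periodic differential equation into an identity between bounded operators, which can be estimated
and differentiated in parameters. -/
theorem eq_J_of_hasDerivAt {Y G : PerFun}
    (h : ∀ s : ℝ, HasDerivAt (fun s : ℝ => Y (s : AddCircle (2 * Real.pi)))
      (G (s : AddCircle _)) s) : Y = J G + algebraMap ℝ PerFun (mean Y) := by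
  have hG := mean_eq_zero_of_hasDerivAt h
  have hd : ∀ s : ℝ, HasDerivAt (fun s : ℝ => Y (s : AddCircle (2 * Real.pi))
      - J G (s : AddCircle (2 * Real.pi))) 0 s := by
    intro s
    have := (h s).sub (hasDerivAt_J G s)
    rwa [hG, sub_zero, sub_self] at this
  have hconst := is_const_of_deriv_eq_zero (fun s => (hd s).differentiableAt)
    (fun s => (hd s).deriv)
  have heq : Y = J G + algebraMap ℝ PerFun (Y ((0 : ℝ) : AddCircle _) - J G ((0 : ℝ) : AddCircle _)) := by
    refine ext_coe fun s => ?_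
    have := hconst s 0
    simp only [ContinuousMap.add_apply, algebraMap_coe] at this ⊢
    linarith
  have hm : mean Y = Y ((0 : ℝ) : AddCircle _) - J G ((0 : ℝ) : AddCircle _) := by
    conv_lhs => rw [heq]
    rw [map_add, mean_J, mean_algebraMap, zero_add]
  rw [hm]
  exact heq

/-- Cosine as a periodic function. -/
def cosP : PerFun := ofPeriodic Real.cos Real.continuous_cos Real.cos_periodic

/-- Sine as a periodic function. -/
def sinP : PerFun := ofPeriodic Real.sin Real.continuous_sin Real.sin_periodic

@[simp] theorem cosP_coe (s : ℝ) : cosP (s : AddCircle (2 * Real.pi)) = Real.cos s := rfl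

@[simp] theorem sinP_coe (s : ℝ) : sinP (s : AddCircle (2 * Real.pi)) = Real.sin s := rfl

theorem norm_cosP_le : ‖cosP‖ ≤ 1 :=
  norm_le_of_coe zero_le_one fun s _ => Real.abs_cos_le_one s

theorem norm_sinP_le : ‖sinP‖ ≤ 1 :=
  norm_le_of_coe zero_le_one fun s _ => Real.abs_sin_le_one s

theorem sinP_sq : sinP ^ 2 = 1 - cosP ^ 2 := by
  refine ext_coe fun s => ?_
  simp [Real.sin_sq]

/-- Reflection `s ↦ -s`. -/
def reflect : PerFun →ₐ[ℝ] PerFun :=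
  ContinuousMap.compRightAlgHom ℝ ℝ ⟨fun x : AddCircle (2 * Real.pi) => -x, continuous_neg⟩

@[simp] theorem reflect_coe (f : PerFun) (s : ℝ) :
    reflect f (s : AddCircle (2 * Real.pi)) = f ((-s : ℝ) : AddCircle (2 * Real.pi)) := rfl

@[simp] theorem reflect_two : reflect 2 = 2 := map_ofNat reflect 2

@[simp] theorem reflect_cosP : reflect cosP = cosP := by
  refine ext_coe fun s => ?_
  rw [reflect_coe, cosP_coe, cosP_coe, Real.cos_neg]

@[simp] theorem reflect_sinP : reflect sinP = -sinP := by
  refine ext_coe fun s => ?_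
  rw [reflect_coe, ContinuousMap.neg_apply, sinP_coe, sinP_coe, Real.sin_neg]

theorem norm_reflect_le (f : PerFun) : ‖reflect f‖ ≤ ‖f‖ := by
  refine norm_le_of_coe (norm_nonneg _) fun s _ => ?_
  rw [reflect_coe]
  exact abs_coe_le f _

@[simp] theorem mean_reflect (f : PerFun) : mean (reflect f) = mean f := by
  rw [mean_apply, mean_apply]
  simp only [reflect_coe]
  rw [intervalIntegral.integral_comp_neg (fun t : ℝ => f (t : AddCircle (2 * Real.pi))), neg_zero]
  have := (f.periodic_coe).intervalIntegral_add_eq (-(2 * Real.pi)) 0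
  rw [neg_add_cancel, zero_add] at this
  rw [this]

/-- Integration exchanges even and odd functions. The zero-mean normalization of `J` matters here: a
primitive normalized at a point need not have a parity. -/
theorem reflect_J (f : PerFun) : reflect (J f) = -J (reflect f) := by
  have h : ∀ s : ℝ, HasDerivAt (fun s : ℝ => reflect (J f) (s : AddCircle (2 * Real.pi)))
      ((-(reflect f) + algebraMap ℝ PerFun (mean f)) (s : AddCircle _)) s := by
    intro s
    simp only [reflect_coe]
    have := (hasDerivAt_J f (-s)).comp s (hasDerivAt_neg s)
    refine this.congr_deriv ?_
    simp
    ring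
  have h2 := eq_J_of_hasDerivAt h
  rw [mean_reflect, mean_J, map_zero, add_zero, map_add, map_neg] at h2
  rw [h2]
  have : J (algebraMap ℝ PerFun (mean f)) = 0 := by
    rw [J_eq]
    have hz : primitiveCLM (algebraMap ℝ PerFun (mean f)) = 0 := by
      refine ext_coe fun s => ?_
      rw [primitiveCLM_coe, primitive, mean_algebraMap]
      simp
    rw [hz]
    simp
  rw [this, add_zero]

theorem mean_eq_zero_of_reflect {f : PerFun} (h : reflect f = -f) : mean f = 0 := by
  have := mean_reflect f
  rw [h, map_neg] at this
  linarith

end PerFun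

/-! ### Parameter-dependent fixed points and the solution operator of the linear profile system -/

/-- Fixed points of a family of maps that is constant at the base parameter. -/
theorem exists_fixedPoint_family {P X : Type*} [NormedAddCommGroup P] [NormedSpace ℝ P]
    [CompleteSpace P] [NormedAddCommGroup X] [NormedSpace ℝ X] [CompleteSpace X]
    (T : P × X → X) (hT : ContDiff ℝ 1 T) (p₀ : P) (x₀ : X) (h₀ : ∀ x, T (p₀, x) = x₀) :
    ∃ ξ : P → X, ContDiffAt ℝ 1 ξ p₀ ∧ ξ p₀ = x₀ ∧ (∀ᶠ p in 𝓝 p₀, T (p, ξ p) = ξ p) ∧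
      ∃ r > 0, ∀ᶠ p in 𝓝 p₀, ∀ x, ‖x - x₀‖ < r → T (p, x) = x → x = ξ p := by
  set f : P × X → X := fun v => v.2 - T v with hf
  have hfc : ContDiff ℝ 1 f := contDiff_snd.sub hT
  have hfu : f (p₀, x₀) = 0 := by simp [hf, h₀]
  -- Since the map is constant at the base parameter, the partial derivative of x − T(p, x) in x is
  -- the identity there.
  have hinv : (fderiv ℝ f (p₀, x₀) ∘L .inr ℝ P X).IsInvertible := by
    have h1 : HasFDerivAt f (fderiv ℝ f (p₀, x₀)) (p₀, x₀) :=
      (hfc.differentiable one_ne_zero _).hasFDerivAt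
    have h2 : HasFDerivAt (fun x : X => f (p₀, x)) (fderiv ℝ f (p₀, x₀) ∘L .inr ℝ P X) x₀ :=
      h1.comp x₀ (hasFDerivAt_prodMk_right p₀ x₀)
    have h3 : (fun x : X => f (p₀, x)) = fun x => x - x₀ := by
      ext x
      simp [hf, h₀]
    rw [h3] at h2
    rw [h2.unique ((hasFDerivAt_id x₀).sub_const x₀)]
    exact ContinuousLinearMap.isInvertible_equiv (f := ContinuousLinearEquiv.refl ℝ X)
  set ξ := hfc.contDiffAt.implicitFunction one_ne_zero hinv with hξ
  have hξ0 : ξ p₀ = x₀ := hfc.contDiffAt.implicitFunction_apply_self one_ne_zero hinv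
  have hev := hfc.contDiffAt.eventually_apply_implicitFunction one_ne_zero hinv
  have hiff := hfc.contDiffAt.eventually_apply_eq_iff_implicitFunction one_ne_zero hinv
  refine ⟨ξ, hfc.contDiffAt.contDiffAt_implicitFunction one_ne_zero hinv, hξ0, ?_, ?_⟩
  · filter_upwards [hev] with p hp
    rw [hfu] at hp
    exact (sub_eq_zero.mp hp).symm
  · rw [nhds_prod_eq] at hiff
    obtain ⟨pa, hpa, pb, hpb, hab⟩ := Filter.eventually_prod_iff.mp hiff
    obtain ⟨r, hr, hball⟩ := Metric.eventually_nhds_iff.mp hpb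
    refine ⟨r, hr, ?_⟩
    filter_upwards [hpa] with p hp x hx hTx
    have := (hab hp (hball (y := x) (by rwa [dist_eq_norm]))).mp (by
      rw [hfu]
      simp [hf, hTx])
    exact this.symm

namespace PerFun

/-- Solution operator of `Y' = -W + F₁`, `X' = W + F₂`, `W' = Y + F₃`: the component `Y`. -/
def coreY (F₁ F₃ : PerFun) : PerFun :=
  cosP * J (cosP * F₁ + sinP * F₃) - sinP * J (cosP * F₃ - sinP * F₁)

/-- The component `W` of the solution operator. -/
def coreW (F₁ F₃ : PerFun) : PerFun :=
  sinP * J (cosP * F₁ + sinP * F₃) + cosP * J (cosP * F₃ - sinP * F₁)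

/-- The component `X` of the solution operator. -/
def coreX (F₁ F₂ F₃ : PerFun) : PerFun := J (F₁ + F₂) - coreY F₁ F₃

/-- In the rotating frame U = cos·Y + sin·W, V = cos·W − sin·Y the system decouples to U' = cos·F₁ +
sin·F₃ and V' = cos·F₃ − sin·F₁. The two mean conditions say exactly that these have periodic
primitives. -/
theorem hasDerivAt_coreY {F₁ F₃ : PerFun} (h₁ : mean (cosP * F₁ + sinP * F₃) = 0)
    (h₂ : mean (cosP * F₃ - sinP * F₁) = 0) (s : ℝ) :
    HasDerivAt (fun s : ℝ => coreY F₁ F₃ (s : AddCircle (2 * Real.pi)))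
      (-coreW F₁ F₃ (s : AddCircle _) + F₁ (s : AddCircle _)) s := by
  have hU := hasDerivAt_J (cosP * F₁ + sinP * F₃) s
  have hV := hasDerivAt_J (cosP * F₃ - sinP * F₁) s
  rw [h₁] at hU
  rw [h₂] at hV
  have := ((Real.hasDerivAt_cos s).mul hU).sub ((Real.hasDerivAt_sin s).mul hV)
  refine this.congr_deriv ?_
  simp only [coreW, ContinuousMap.add_apply, ContinuousMap.sub_apply, ContinuousMap.mul_apply,
    cosP_coe, sinP_coe]
  linear_combination F₁ (s : AddCircle (2 * Real.pi)) * Real.sin_sq_add_cos_sq s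

theorem hasDerivAt_coreW {F₁ F₃ : PerFun} (h₁ : mean (cosP * F₁ + sinP * F₃) = 0)
    (h₂ : mean (cosP * F₃ - sinP * F₁) = 0) (s : ℝ) :
    HasDerivAt (fun s : ℝ => coreW F₁ F₃ (s : AddCircle (2 * Real.pi)))
      (coreY F₁ F₃ (s : AddCircle _) + F₃ (s : AddCircle _)) s := by
  have hU := hasDerivAt_J (cosP * F₁ + sinP * F₃) s
  have hV := hasDerivAt_J (cosP * F₃ - sinP * F₁) s
  rw [h₁] at hU
  rw [h₂] at hV
  have := ((Real.hasDerivAt_sin s).mul hU).add ((Real.hasDerivAt_cos s).mul hV)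
  refine this.congr_deriv ?_
  simp only [coreY, ContinuousMap.add_apply, ContinuousMap.sub_apply, ContinuousMap.mul_apply,
    cosP_coe, sinP_coe]
  linear_combination F₃ (s : AddCircle (2 * Real.pi)) * Real.sin_sq_add_cos_sq s

/-- The combination Y + X satisfies (Y + X)' = F₁ + F₂, which accounts for the third solvability
condition. -/
theorem hasDerivAt_coreX {F₁ F₂ F₃ : PerFun} (h₁ : mean (cosP * F₁ + sinP * F₃) = 0)
    (h₂ : mean (cosP * F₃ - sinP * F₁) = 0) (h₃ : mean (F₁ + F₂) = 0) (s : ℝ) :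
    HasDerivAt (fun s : ℝ => coreX F₁ F₂ F₃ (s : AddCircle (2 * Real.pi)))
      (coreW F₁ F₃ (s : AddCircle _) + F₂ (s : AddCircle _)) s := by
  have hJ := hasDerivAt_J (F₁ + F₂) s
  rw [h₃] at hJ
  refine (hJ.sub (hasDerivAt_coreY h₁ h₂ s)).congr_deriv ?_
  simp only [ContinuousMap.add_apply]
  ring

theorem reflect_coreY (F₁ F₃ : PerFun) :
    reflect (coreY F₁ F₃) = -coreY (reflect F₁) (-reflect F₃) := by
  simp only [coreY, map_sub, map_mul, reflect_cosP, reflect_sinP, reflect_J, map_add, mul_neg,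
    neg_mul, neg_neg, map_neg]
  ring

theorem reflect_coreW (F₁ F₃ : PerFun) :
    reflect (coreW F₁ F₃) = coreW (reflect F₁) (-reflect F₃) := by
  simp only [coreW, map_sub, map_mul, reflect_cosP, reflect_sinP, reflect_J, map_add, mul_neg,
    neg_mul, neg_neg, map_neg]
  ring

theorem reflect_coreX (F₁ F₂ F₃ : PerFun) :
    reflect (coreX F₁ F₂ F₃) = -coreX (reflect F₁) (reflect F₂) (-reflect F₃) := by
  simp only [coreX, map_sub, reflect_coreY, reflect_J, map_add]
  ring

/-- The rotated component V = cos·W − sin·Y has mean 1 on the even resonant solution (Y, W) = (−sin,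
cos). Its vanishing here means that corrections do not alter the amplitude a. -/
theorem mean_cosP_mul_coreW_sub (F₁ F₃ : PerFun) :
    mean (cosP * coreW F₁ F₃ - sinP * coreY F₁ F₃) = 0 := by
  have : cosP * coreW F₁ F₃ - sinP * coreY F₁ F₃ = J (cosP * F₃ - sinP * F₁) := by
    simp only [coreW, coreY]
    linear_combination J (cosP * F₃ - sinP * F₁) * sinP_sq
  rw [this, mean_J]

end PerFun

/-! ### The rescaled bifurcation problem and its solution branch -/

open PerFun

/-- Unknowns of the rescaled bifurcation problem. -/
abbrev BranchSpace : Type := PerFun × PerFun × PerFun × ℝ × ℝ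

/-- Coefficient of `cos 2s` in the second-order term of `E`. -/
def secondCoeff (γ : ℝ) : ℝ := (γ ^ 2 + 3) / 6

/-- With c = `secondCoeff`, the second-order terms are (1 − 2c) sin 2s, ((c − 1)/2) sin 2s and −1 +
c cos 2s. The constant −1 gives the forcing in the χ-equation zero mean; matching cos 2s in the
y-equation gives c, and matching the constant there gives −(γ² + 1)/2 for d. -/
def y₂ (γ : ℝ) : PerFun := (1 - 2 * secondCoeff γ) • (2 * sinP * cosP)
def χ₂ (γ : ℝ) : PerFun := ((secondCoeff γ - 1) / 2) • (2 * sinP * cosP)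
def E₂ (γ : ℝ) : PerFun := -1 + secondCoeff γ • (2 * cosP ^ 2 - 1)

def remY (γ : ℝ) (v : ℝ × BranchSpace) : PerFun := y₂ γ + v.1 • v.2.1
def remX (γ : ℝ) (v : ℝ × BranchSpace) : PerFun := χ₂ γ + v.1 • v.2.2.1
def remE (γ : ℝ) (v : ℝ × BranchSpace) : PerFun := E₂ γ + v.1 • v.2.2.2.1

/-- Terms of order a³ and higher in the y-equation, divided by a³, after inserting y = −a sin + a²ŷ
and χ = a sin + a²χ̂. The next two definitions do the same for χ and E. The contribution −ℓ sin of Λ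
is kept apart because ℓ has to be solved for. -/
def forceY (γ : ℝ) (v : ℝ × BranchSpace) : PerFun :=
  2 * sinP * remY γ v - v.1 • remY γ v ^ 2
    + γ ^ 2 • (2 * sinP * remX γ v + v.1 • remX γ v ^ 2)

def forceX (γ : ℝ) (v : ℝ × BranchSpace) : PerFun :=
  -2 * (-sinP * remX γ v + remY γ v * sinP + v.1 • (remY γ v * remX γ v))

def forceE (γ : ℝ) (v : ℝ × BranchSpace) : PerFun :=
  (v.1 * v.2.2.2.2.2) • remY γ v
    + 2 * (-sinP * remE γ v + remY γ v * cosP + v.1 • (remY γ v * remE γ v))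

/-- The value of ℓ that removes the resonance: the term −ℓ sin contributes −ℓ/2 to the mean of
cos·F₁ + sin·F₃. -/
def newEll (γ : ℝ) (v : ℝ × BranchSpace) : ℝ :=
  2 * mean (cosP * forceY γ v + sinP * forceE γ v)

def newD (γ : ℝ) (v : ℝ × BranchSpace) : ℝ := -mean (forceY γ v + forceX γ v)

/-- The map whose fixed points are the remainders of the bifurcating branch at amplitude `v.1`. -/
def branchMap (γ : ℝ) (v : ℝ × BranchSpace) : BranchSpace :=
  (coreY (newD γ v • 1 + forceY γ v) (newEll γ v • (-sinP) + forceE γ v),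
   coreX (newD γ v • 1 + forceY γ v) (forceX γ v) (newEll γ v • (-sinP) + forceE γ v),
   coreW (newD γ v • 1 + forceY γ v) (newEll γ v • (-sinP) + forceE γ v),
   newD γ v, newEll γ v)

/-- Everything is built from products in a Banach algebra and the continuous linear maps `J` and
`mean`. -/
theorem contDiff_branchMap (γ : ℝ) : ContDiff ℝ 1 (branchMap γ) := by
  have hY : ContDiff ℝ 1 (remY γ) := by unfold remY; fun_prop
  have hX : ContDiff ℝ 1 (remX γ) := by unfold remX; fun_prop
  have hE : ContDiff ℝ 1 (remE γ) := by unfold remE; fun_prop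
  have hfY : ContDiff ℝ 1 (forceY γ) := by unfold forceY; fun_prop
  have hfX : ContDiff ℝ 1 (forceX γ) := by unfold forceX; fun_prop
  have hfE : ContDiff ℝ 1 (forceE γ) := by unfold forceE; fun_prop
  have hl : ContDiff ℝ 1 (newEll γ) := by unfold newEll; fun_prop
  have hD : ContDiff ℝ 1 (newD γ) := by unfold newD; fun_prop
  unfold branchMap coreX coreY coreW
  fun_prop

open PerFun

theorem mean_sinP_sq : mean (sinP ^ 2) = 1 / 2 := by
  rw [mean_apply]
  simp only [ContinuousMap.pow_apply, sinP_coe, integral_sin_sq]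
  simp
  field_simp

theorem mean_sinP_sq_mul_cosP_sq : mean (sinP ^ 2 * cosP ^ 2) = 1 / 8 := by
  rw [mean_apply]
  simp only [ContinuousMap.pow_apply, ContinuousMap.mul_apply, sinP_coe, cosP_coe,
    integral_sin_sq_mul_cos_sq]
  have h : Real.sin (4 * (2 * Real.pi)) = 0 := by
    have := Real.sin_nat_mul_pi 8
    push_cast at this
    rw [← this]
    congr 1
    ring
  rw [h]
  simp
  field_simp

theorem mean_cosP : mean cosP = 0 := by
  rw [mean_apply]
  simp

/-- The function is the derivative of sin³/3. -/
theorem mean_sinP_sq_mul_cosP : mean (sinP ^ 2 * cosP) = 0 := by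
  have h : ∀ s : ℝ, HasDerivAt
      (fun s : ℝ => ((1 / 3 : ℝ) • sinP ^ 3 : PerFun) (s : AddCircle (2 * Real.pi)))
      ((sinP ^ 2 * cosP : PerFun) (s : AddCircle _)) s := by
    intro s
    refine (((Real.hasDerivAt_sin s).pow 3).const_mul (1 / 3 : ℝ)).congr_deriv ?_
    simp
    ring
  exact mean_eq_zero_of_hasDerivAt h

/-- The second-order coefficient of `Λ` along the branch. -/
def ellZero (γ : ℝ) : ℝ := 5 / 2 - 3 / 4 * γ ^ 2 + γ ^ 4 / 12

/-- As a quadratic in γ² it is smallest at γ² = 9/2, with value 13/16. -/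
theorem ellZero_pos (γ : ℝ) : 0 < ellZero γ := by
  unfold ellZero
  nlinarith [sq_nonneg (γ ^ 2 - 9 / 2)]

theorem newEll_zero (γ : ℝ) (x : BranchSpace) : newEll γ (0, x) = ellZero γ := by
  have h : cosP * forceY γ (0, x) + sinP * forceE γ (0, x)
      = (4 * ((1 - 2 * secondCoeff γ) + γ ^ 2 * (secondCoeff γ - 1) / 2)
          + 4 * (1 - 2 * secondCoeff γ) - 4 * secondCoeff γ) • (sinP ^ 2 * cosP ^ 2)
        + (2 + 2 * secondCoeff γ) • sinP ^ 2 := by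
    refine ext_coe fun s => ?_
    simp [forceY, forceE, remY, remX, remE, y₂, χ₂, E₂]
    ring
  rw [newEll, h, map_add, map_smul, map_smul, mean_sinP_sq, mean_sinP_sq_mul_cosP_sq]
  simp only [secondCoeff, ellZero, smul_eq_mul]
  ring

/-- Every occurrence of the unknowns carries a factor a. This is what makes
`exists_fixedPoint_family` applicable. -/
theorem branchMap_zero (γ : ℝ) (x : BranchSpace) : branchMap γ (0, x) = branchMap γ (0, 0) := by
  simp [branchMap, newEll, newD, forceY, forceE, forceX, remY, remX, remE]

/-- Reflection acting on the unknowns of the branch problem. -/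
def reflectBranch (x : BranchSpace) : BranchSpace :=
  (-reflect x.1, -reflect x.2.1, reflect x.2.2.1, x.2.2.2)

/-- Reflection must not leave the ball in which fixed points are unique; with equivariance of the
map this makes the fixed points symmetric. -/
theorem norm_reflectBranch_sub_le (x z : BranchSpace) :
    ‖reflectBranch x - reflectBranch z‖ ≤ ‖x - z‖ := by
  have key : ∀ f g : PerFun, ‖reflect f - reflect g‖ ≤ ‖f - g‖ := by
    intro f g
    rw [← map_sub]
    exact norm_reflect_le _
  simp only [Prod.norm_def, reflectBranch, Prod.fst_sub, Prod.snd_sub]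
  refine max_le_max ?_ (max_le_max ?_ (max_le_max (key _ _) le_rfl))
  · rw [neg_sub_neg, norm_sub_rev x.1]
    exact key _ _
  · rw [neg_sub_neg, norm_sub_rev x.2.1]
    exact key _ _

theorem reflect_y₂ (γ : ℝ) : reflect (y₂ γ) = -y₂ γ := by
  simp [y₂, map_smul]

theorem reflect_χ₂ (γ : ℝ) : reflect (χ₂ γ) = -χ₂ γ := by
  simp [χ₂, map_smul]

theorem reflect_E₂ (γ : ℝ) : reflect (E₂ γ) = E₂ γ := by
  simp [E₂, map_smul]

theorem remY_reflectBranch (γ a : ℝ) (x : BranchSpace) :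
    remY γ (a, reflectBranch x) = -reflect (remY γ (a, x)) := by
  simp only [remY, reflectBranch, map_add, reflect_y₂, map_smul, smul_neg, neg_add, neg_neg]

theorem remX_reflectBranch (γ a : ℝ) (x : BranchSpace) :
    remX γ (a, reflectBranch x) = -reflect (remX γ (a, x)) := by
  simp only [remX, reflectBranch, map_add, reflect_χ₂, map_smul, smul_neg, neg_add, neg_neg]

theorem remE_reflectBranch (γ a : ℝ) (x : BranchSpace) :
    remE γ (a, reflectBranch x) = reflect (remE γ (a, x)) := by
  simp only [remE, reflectBranch, map_add, reflect_E₂, map_smul]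

theorem forceY_reflectBranch (γ a : ℝ) (x : BranchSpace) :
    forceY γ (a, reflectBranch x) = reflect (forceY γ (a, x)) := by
  simp only [forceY, remY_reflectBranch, remX_reflectBranch, map_add, map_sub, map_mul, map_smul,
    map_pow, reflect_sinP, map_ofNat]
  simp

theorem forceX_reflectBranch (γ a : ℝ) (x : BranchSpace) :
    forceX γ (a, reflectBranch x) = reflect (forceX γ (a, x)) := by
  simp only [forceX, remY_reflectBranch, remX_reflectBranch, map_add, map_neg, map_mul, map_smul,
    reflect_sinP, map_ofNat]
  simp

theorem forceE_reflectBranch (γ a : ℝ) (x : BranchSpace) :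
    forceE γ (a, reflectBranch x) = -reflect (forceE γ (a, x)) := by
  simp only [forceE, remY_reflectBranch, remE_reflectBranch, map_add, map_neg, map_mul, map_smul,
    reflect_sinP, reflect_cosP, map_ofNat]
  have hx : (reflectBranch x).2.2.2.2 = x.2.2.2.2 := rfl
  simp only [hx]
  simp only [smul_neg, neg_mul, neg_neg]
  ring

theorem newEll_reflectBranch (γ a : ℝ) (x : BranchSpace) :
    newEll γ (a, reflectBranch x) = newEll γ (a, x) := by
  unfold newEll
  rw [forceY_reflectBranch, forceE_reflectBranch, ← mean_reflect (cosP * forceY γ (a, x) + _)]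
  simp

theorem newD_reflectBranch (γ a : ℝ) (x : BranchSpace) :
    newD γ (a, reflectBranch x) = newD γ (a, x) := by
  unfold newD
  rw [forceY_reflectBranch, forceX_reflectBranch, ← map_add, mean_reflect]

theorem branchMap_reflectBranch (γ a : ℝ) (x : BranchSpace) :
    branchMap γ (a, reflectBranch x) = reflectBranch (branchMap γ (a, x)) := by
  unfold branchMap
  rw [newEll_reflectBranch, newD_reflectBranch, forceY_reflectBranch, forceX_reflectBranch,
    forceE_reflectBranch]
  simp only [reflectBranch, reflect_coreX, reflect_coreY, reflect_coreW, map_add, map_smul, map_one,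
    map_neg, reflect_sinP, neg_neg, smul_neg, neg_add]

/-- A smooth one-parameter family of even periodic solutions of
`y' = d - E - y² + γ²χ²`, `χ' = E - 2yχ`, `E' = Λy + 2yE`, where
`y = -a sin + a² ŷ`, `χ = a sin + a² χ̂`, `E = a cos + a² Ê`, `d = a² d̂`, `Λ = 1 + a² ℓ`. -/
structure BranchFamily (γ : ℝ) where
  yh : ℝ → PerFun
  xh : ℝ → PerFun
  Eh : ℝ → PerFun
  dh : ℝ → ℝ
  ell : ℝ → ℝ
  contDiff_yh : ContDiffAt ℝ 1 yh 0
  contDiff_xh : ContDiffAt ℝ 1 xh 0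
  contDiff_Eh : ContDiffAt ℝ 1 Eh 0
  contDiff_dh : ContDiffAt ℝ 1 dh 0
  contDiff_ell : ContDiffAt ℝ 1 ell 0
  dh_zero : dh 0 = -(γ ^ 2 + 1) / 2
  ell_zero : ell 0 = ellZero γ

namespace BranchFamily

variable {γ : ℝ} (b : BranchFamily γ)

def y (a : ℝ) : PerFun := a • (-sinP) + a ^ 2 • b.yh a
def χ (a : ℝ) : PerFun := a • sinP + a ^ 2 • b.xh a
def E (a : ℝ) : PerFun := a • cosP + a ^ 2 • b.Eh a
def d (a : ℝ) : ℝ := a ^ 2 * b.dh a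
def Lam (a : ℝ) : ℝ := 1 + a ^ 2 * b.ell a

/-- The equations, parities and normalization satisfied by the member of amplitude `a`. -/
structure Good (a : ℝ) : Prop where
  reflect_y : reflect (b.y a) = -b.y a
  reflect_χ : reflect (b.χ a) = -b.χ a
  reflect_E : reflect (b.E a) = b.E a
  normalized : mean (cosP * b.E a - sinP * b.y a) = a
  deriv_y : ∀ s : ℝ, HasDerivAt (fun s : ℝ => b.y a (s : AddCircle (2 * Real.pi)))
    ((b.d a • (1 : PerFun) - b.E a - b.y a ^ 2 + γ ^ 2 • b.χ a ^ 2 : PerFun)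
      (s : AddCircle (2 * Real.pi))) s
  deriv_χ : ∀ s : ℝ, HasDerivAt (fun s : ℝ => b.χ a (s : AddCircle (2 * Real.pi)))
    ((b.E a - 2 * (b.y a * b.χ a) : PerFun) (s : AddCircle (2 * Real.pi))) s
  deriv_E : ∀ s : ℝ, HasDerivAt (fun s : ℝ => b.E a (s : AddCircle (2 * Real.pi)))
    ((b.Lam a • b.y a + 2 * (b.y a * b.E a) : PerFun) (s : AddCircle (2 * Real.pi))) s

end BranchFamily

theorem exists_branchFamily (γ : ℝ) : ∃ b : BranchFamily γ, ∀ᶠ a in 𝓝 (0 : ℝ), b.Good a := by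
  obtain ⟨ξ, hξc, hξ0, hfix, r, hr, huniq⟩ := exists_fixedPoint_family (branchMap γ)
    (contDiff_branchMap γ) 0 (branchMap γ (0, 0)) (branchMap_zero γ)
  set b : BranchFamily γ :=
          { yh := fun a => y₂ γ + a • (ξ a).1
            xh := fun a => χ₂ γ + a • (ξ a).2.1
            Eh := fun a => E₂ γ + a • (ξ a).2.2.1
            dh := fun a => -(γ ^ 2 + 1) / 2 + a * (ξ a).2.2.2.1
            ell := fun a => (ξ a).2.2.2.2
            contDiff_yh := by fun_prop
            contDiff_xh := by fun_prop
            contDiff_Eh := by fun_prop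
            contDiff_dh := by fun_prop
            contDiff_ell := by fun_prop
            dh_zero := by simp
            ell_zero := by
              rw [hξ0]
              exact newEll_zero γ 0 } with hb
  refine ⟨b, ?_⟩
  have hnear : ∀ᶠ a in 𝓝 (0 : ℝ), ‖ξ a - branchMap γ (0, 0)‖ < r := by
    have := hξc.continuousAt
    rw [ContinuousAt, hξ0, Metric.tendsto_nhds] at this
    simpa [dist_eq_norm] using this r hr
  have hrefl0 : reflectBranch (branchMap γ (0, 0)) = branchMap γ (0, 0) := by
    rw [← branchMap_reflectBranch, branchMap_zero]
  filter_upwards [hfix, huniq, hnear] with a hfix huniq hnear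
  -- The reflected fixed point is again a fixed point in the uniqueness ball.
  have hsym : reflectBranch (ξ a) = ξ a := by
    refine huniq _ ?_ ?_
    · rw [← hrefl0]
      exact (norm_reflectBranch_sub_le _ _).trans_lt hnear
    · rw [branchMap_reflectBranch, hfix]
  set F₁ := newD γ (a, ξ a) • (1 : PerFun) + forceY γ (a, ξ a) with hF₁
  set F₂ := forceX γ (a, ξ a) with hF₂
  set F₃ := newEll γ (a, ξ a) • (-sinP) + forceE γ (a, ξ a) with hF₃
  have hY : (ξ a).1 = coreY F₁ F₃ := (congrArg (fun x : BranchSpace => x.1) hfix).symm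
  have hX : (ξ a).2.1 = coreX F₁ F₂ F₃ := (congrArg (fun x : BranchSpace => x.2.1) hfix).symm
  have hW : (ξ a).2.2.1 = coreW F₁ F₃ := (congrArg (fun x : BranchSpace => x.2.2.1) hfix).symm
  have hD : (ξ a).2.2.2.1 = newD γ (a, ξ a) :=
    (congrArg (fun x : BranchSpace => x.2.2.2.1) hfix).symm
  have hL : (ξ a).2.2.2.2 = newEll γ (a, ξ a) :=
    (congrArg (fun x : BranchSpace => x.2.2.2.2) hfix).symm
  have hrY : reflect (ξ a).1 = -(ξ a).1 := by
    have := congrArg (fun x : BranchSpace => x.1) hsym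
    simp only [reflectBranch] at this
    rw [← neg_eq_iff_eq_neg, this]
  have hrX : reflect (ξ a).2.1 = -(ξ a).2.1 := by
    have := congrArg (fun x : BranchSpace => x.2.1) hsym
    simp only [reflectBranch] at this
    rw [← neg_eq_iff_eq_neg, this]
  have hrW : reflect (ξ a).2.2.1 = (ξ a).2.2.1 := congrArg (fun x : BranchSpace => x.2.2.1) hsym
  have hrF₁ : reflect F₁ = F₁ := by
    rw [hF₁, map_add, ← forceY_reflectBranch, hsym, map_smul, map_one]
  have hrF₃ : reflect F₃ = -F₃ := by
    have := forceE_reflectBranch γ a (ξ a)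
    rw [hsym] at this
    rw [hF₃, map_add, map_smul, map_neg, reflect_sinP, neg_add, ← smul_neg, ← neg_eq_iff_eq_neg.mpr this]
  have h₁ : mean (cosP * F₁ + sinP * F₃) = 0 := by
    have : cosP * F₁ + sinP * F₃ = newD γ (a, ξ a) • cosP - newEll γ (a, ξ a) • sinP ^ 2
        + (cosP * forceY γ (a, ξ a) + sinP * forceE γ (a, ξ a)) := by
      refine ext_coe fun s => ?_
      simp [hF₁, hF₃]
      ring
    rw [this, map_add, map_sub, map_smul, map_smul, mean_cosP, mean_sinP_sq]
    simp only [newEll, smul_eq_mul]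
    ring
  -- The third solvability condition costs no parameter: the function is odd.
  have h₂ : mean (cosP * F₃ - sinP * F₁) = 0 := by
    refine mean_eq_zero_of_reflect ?_
    rw [map_sub, map_mul, map_mul, hrF₁, hrF₃, reflect_cosP, reflect_sinP]
    ring
  have h₃ : mean (F₁ + F₂) = 0 := by
    rw [hF₁, hF₂, add_assoc, map_add, map_smul, mean_one]
    simp [newD]
  have hdY := hasDerivAt_coreY h₁ h₂
  have hdX := hasDerivAt_coreX h₁ h₂ h₃
  have hdW := hasDerivAt_coreW h₁ h₂
  rw [← hY, ← hW] at hdY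
  rw [← hX, ← hW] at hdX
  rw [← hW, ← hY] at hdW
  have hds := Real.hasDerivAt_sin
  have hdc := Real.hasDerivAt_cos
  refine ⟨?_, ?_, ?_, ?_, ?_, ?_, ?_⟩
  · simp only [hb, BranchFamily.y, map_add, map_smul, map_neg, reflect_sinP, reflect_y₂, hrY, neg_add,
      smul_neg, smul_add, neg_neg]
  · simp only [hb, BranchFamily.χ, map_add, map_smul, reflect_sinP, reflect_χ₂, hrX, neg_add,
      smul_neg, smul_add]
  · simp only [hb, BranchFamily.E, map_add, map_smul, reflect_cosP, reflect_E₂, hrW]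
  · have h : cosP * b.E a - sinP * b.y a
        = a • (1 : PerFun) + a ^ 2 • (cosP * E₂ γ - sinP * y₂ γ)
          + a ^ 3 • (cosP * (ξ a).2.2.1 - sinP * (ξ a).1) := by
      refine ext_coe fun s => ?_
      simp [BranchFamily.E, BranchFamily.y, hb]
      linear_combination a * Real.sin_sq_add_cos_sq s
    have h2 : mean (cosP * E₂ γ - sinP * y₂ γ) = 0 := by
      have : cosP * E₂ γ - sinP * y₂ γ = (secondCoeff γ - 1) • cosP
          + (2 * secondCoeff γ - 2) • (sinP ^ 2 * cosP) := by
        refine ext_coe fun s => ?_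
        simp [E₂, y₂]
        linear_combination (2 * secondCoeff γ * Real.cos s) * Real.sin_sq_add_cos_sq s
      rw [this, map_add, map_smul, map_smul, mean_cosP, mean_sinP_sq_mul_cosP]
      simp
    rw [h, map_add, map_add, map_smul, map_smul, map_smul, h2, hY, hW, mean_cosP_mul_coreW_sub]
    simp
  · intro s
    have := ((hds s).neg.const_mul a).add ((((((hds s).mul (hdc s)).const_mul 2).const_mul
      (1 - 2 * secondCoeff γ)).add ((hdY s).const_mul a)).const_mul (a ^ 2))
    refine (this.congr_deriv ?_).congr_of_eventuallyEq (Eventually.of_forall fun s => ?_)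
    · simp [BranchFamily.y, BranchFamily.χ, BranchFamily.E, BranchFamily.d, hb, hF₁, forceY, remY,
        remX, E₂, y₂, χ₂, hD]
      simp only [secondCoeff]
      linear_combination (a ^ 2 * (1 - γ ^ 2 / 3)) * Real.sin_sq_add_cos_sq s
    · simp [BranchFamily.y, hb, y₂]
      ring
  · intro s
    have := ((hds s).const_mul a).add ((((((hds s).mul (hdc s)).const_mul 2).const_mul
      ((secondCoeff γ - 1) / 2)).add ((hdX s).const_mul a)).const_mul (a ^ 2))
    refine (this.congr_deriv ?_).congr_of_eventuallyEq (Eventually.of_forall fun s => ?_)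
    · simp [BranchFamily.y, BranchFamily.χ, BranchFamily.E, hb, hF₂, forceX, remY,
        remX, E₂, y₂, χ₂]
      simp only [secondCoeff]
      linear_combination (-a ^ 2 * (3 / 2 + γ ^ 2 / 6)) * Real.sin_sq_add_cos_sq s
    · simp [BranchFamily.χ, hb, χ₂]
      ring
  · intro s
    have := ((hdc s).const_mul a).add ((((((hdc s).pow 2).const_mul 2).const_mul
      (secondCoeff γ)).add ((hdW s).const_mul a)).const_mul (a ^ 2))
    -- E₂ equals 2c cos² − (1 + c) with c = `secondCoeff`; the subtracted constant restores the part
    -- that differentiating cos² does not see.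
    refine ((this.sub_const (a ^ 2 * (1 + secondCoeff γ))).congr_deriv ?_).congr_of_eventuallyEq
      (Eventually.of_forall fun s => ?_)
    · simp [BranchFamily.y, BranchFamily.Lam, BranchFamily.E, hb, hF₃, forceE, remY,
        remE, E₂, y₂, hL]
      simp only [secondCoeff]
      ring
    · simp [BranchFamily.E, hb, E₂]
      ring

/-! ### Polar form of the CGLe; passage between stationary states and profiles -/

/-- The real equations for amplitude and phase of a stationary solution. -/
def PolarEq (μ α β ω : ℝ) (R φ : ℝ → ℝ) (x : ℝ) : Prop :=
  deriv (deriv R) x - R x * deriv φ x ^ 2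
      - α * (2 * deriv R x * deriv φ x + R x * deriv (deriv φ) x) + μ * R x - R x ^ 3 = 0 ∧
  α * (deriv (deriv R) x - R x * deriv φ x ^ 2)
      + (2 * deriv R x * deriv φ x + R x * deriv (deriv φ) x) + ω * R x - β * R x ^ 3 = 0

theorem hasDerivAt_of_contDiff_two {F : Type*} [NormedAddCommGroup F] [NormedSpace ℝ F]
    {f : ℝ → F} (hf : ContDiff ℝ 2 f) (x : ℝ) :
    HasDerivAt f (deriv f x) x ∧ HasDerivAt (deriv f) (deriv (deriv f) x) x := by
  refine ⟨(hf.differentiable two_ne_zero x).hasDerivAt, ?_⟩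
  have : ContDiff ℝ 1 (deriv f) := by
    have h := contDiff_succ_iff_deriv (n := 1) (f := f) (𝕜 := ℝ)
    exact (h.mp (by simpa [one_add_one_eq_two] using hf)).2.2
  exact (this.differentiable one_ne_zero x).hasDerivAt

theorem hasDerivAt_phaseFactor {φ : ℝ → ℝ} {φ' x : ℝ} (h : HasDerivAt φ φ' x) (k : ℝ) :
    HasDerivAt (fun x => Complex.exp (Complex.I * ((φ x - k : ℝ) : ℂ)))
      (Complex.I * φ' * Complex.exp (Complex.I * ((φ x - k : ℝ) : ℂ))) x := by
  have := ((h.sub_const k).ofReal_comp.const_mul Complex.I).cexp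
  refine this.congr_deriv ?_
  ring

theorem hasDerivAt_stationaryField {R φ : ℝ → ℝ} (hR : ContDiff ℝ 2 R) (hφ : ContDiff ℝ 2 φ)
    (ω t x : ℝ) :
    HasDerivAt (fun y => stationaryField ω R φ y t)
      ((((deriv R x : ℝ) : ℂ) + Complex.I * ((R x : ℂ) * ((deriv φ x : ℝ) : ℂ)))
        * Complex.exp (Complex.I * ((φ x - ω * t : ℝ) : ℂ))) x := by
  have h1 := (hasDerivAt_of_contDiff_two hR x).1.ofReal_comp
  have h2 := hasDerivAt_phaseFactor (hasDerivAt_of_contDiff_two hφ x).1 (ω * t)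
  refine (h1.mul h2).congr_deriv ?_
  ring

theorem deriv_deriv_stationaryField {R φ : ℝ → ℝ} (hR : ContDiff ℝ 2 R) (hφ : ContDiff ℝ 2 φ)
    (ω t x : ℝ) :
    deriv (deriv (fun y => stationaryField ω R φ y t)) x =
      (((deriv (deriv R) x - R x * deriv φ x ^ 2 : ℝ) : ℂ)
        + Complex.I * ((2 * deriv R x * deriv φ x + R x * deriv (deriv φ) x : ℝ) : ℂ))
        * Complex.exp (Complex.I * ((φ x - ω * t : ℝ) : ℂ)) := by
  rw [funext fun x => (hasDerivAt_stationaryField hR hφ ω t x).deriv]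
  have h1 := (hasDerivAt_of_contDiff_two hR x).1.ofReal_comp
  have h1' := (hasDerivAt_of_contDiff_two hR x).2.ofReal_comp
  have h2 := hasDerivAt_phaseFactor (hasDerivAt_of_contDiff_two hφ x).1 (ω * t)
  have h2' := (hasDerivAt_of_contDiff_two hφ x).2.ofReal_comp
  have := ((h1'.add ((h1.mul h2').const_mul Complex.I)).mul h2).deriv
  simp only [Pi.mul_def, Pi.add_def] at this
  refine this.trans ?_
  push_cast
  linear_combination ((R x : ℂ) * ((deriv φ x : ℝ) : ℂ) ^ 2
    * Complex.exp (Complex.I * ((φ x : ℂ) - ω * t))) * Complex.I_sq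

theorem norm_stationaryField_sq (ω : ℝ) (R φ : ℝ → ℝ) (x t : ℝ) :
    ‖stationaryField ω R φ x t‖ ^ 2 = R x ^ 2 := by
  rw [stationaryField, norm_mul, mul_comm Complex.I, Complex.norm_exp_ofReal_mul_I, mul_one,
    Complex.norm_real, Real.norm_eq_abs, sq_abs]

theorem hasDerivAt_time_stationaryField (ω : ℝ) (R φ : ℝ → ℝ) (x t : ℝ) :
    HasDerivAt (fun s => stationaryField ω R φ x s)
      (-(Complex.I * ω) * stationaryField ω R φ x t) t := by
  have h : HasDerivAt (fun s : ℝ => φ x - ω * s) (-ω) t := by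
    simpa using ((hasDerivAt_id t).const_mul ω).const_sub (φ x)
  have := ((h.ofReal_comp.const_mul Complex.I).cexp).const_mul (R x : ℂ)
  refine this.congr_deriv ?_
  simp only [stationaryField]
  push_cast
  ring

/-- The two polar equations are the real and imaginary parts of the CGLe after division by the
common phase factor. -/
theorem polar_complex_iff (μ α β ω : ℝ) (R φ : ℝ → ℝ) (x : ℝ) :
    PolarEq μ α β ω R φ x ↔
      (((deriv (deriv R) x - R x * deriv φ x ^ 2 : ℝ) : ℂ)
        + Complex.I * ((2 * deriv R x * deriv φ x + R x * deriv (deriv φ) x : ℝ) : ℂ))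
        * (1 + Complex.I * α) + (μ + Complex.I * ω) * R x
        - (1 + Complex.I * β) * ((R x ^ 2 : ℝ) : ℂ) * R x = 0 := by
  rw [Complex.ext_iff, PolarEq]
  generalize deriv (deriv R) x = R2
  generalize deriv (deriv φ) x = p2
  simp [pow_succ]
  constructor
  · rintro ⟨h1, h2⟩
    exact ⟨by linear_combination h1, by linear_combination h2⟩
  · rintro ⟨h1, h2⟩
    exact ⟨by linear_combination h1, by linear_combination h2⟩

/-- Time enters only through the factor exp(−iωt), which cancels; hence the equation at t = 0
already contains all the information. -/
theorem isCGLSolution_stationaryField_iff {μ α β L ω : ℝ} {R φ : ℝ → ℝ} (hR : ContDiff ℝ 2 R)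
    (hφ : ContDiff ℝ 2 φ) (hRp : Function.Periodic R L) (hφp : Function.Periodic φ L) :
    IsCGLSolution μ α β L (stationaryField ω R φ) ↔ ∀ x, PolarEq μ α β ω R φ x := by
  constructor
  · rintro ⟨-, -, h⟩ x
    have h1 := (h x 0).unique (hasDerivAt_time_stationaryField ω R φ x 0)
    rw [deriv_deriv_stationaryField hR hφ, norm_stationaryField_sq] at h1
    rw [polar_complex_iff]
    have he := Complex.exp_ne_zero (Complex.I * ((φ x - ω * 0 : ℝ) : ℂ))
    refine mul_right_cancel₀ he ?_
    simp only [stationaryField] at h1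
    linear_combination h1
  · intro h
    refine ⟨fun t => ?_, fun t x => ?_, fun x t => ?_⟩
    · unfold stationaryField
      exact (Complex.ofRealCLM.contDiff.comp hR).mul ((contDiff_const.mul
        (Complex.ofRealCLM.contDiff.comp (hφ.sub contDiff_const))).cexp)
    · simp only [stationaryField]
      rw [hRp x, hφp x]
    · refine (hasDerivAt_time_stationaryField ω R φ x t).congr_deriv ?_
      rw [deriv_deriv_stationaryField hR hφ, norm_stationaryField_sq]
      have := (polar_complex_iff μ α β ω R φ x).mp (h x)
      simp only [stationaryField]
      linear_combination (-Complex.exp (Complex.I * ((φ x - ω * t : ℝ) : ℂ))) * this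

/-- Half of `κ²/μ`. -/
def bfParam (α β : ℝ) : ℝ := -(1 + α * β) / (1 + α ^ 2)

/-- Ratio of the phase gradient to the rescaled variable `χ`. -/
def phaseRatio (α β : ℝ) : ℝ := -(β - α) / (1 + α * β)

theorem bfParam_pos {α β : ℝ} (hBF : 1 + α * β < 0) : 0 < bfParam α β :=
  div_pos (by linarith) (by positivity)

theorem beta_sub_alpha_ne_zero {α β : ℝ} (hBF : 1 + α * β < 0) : β - α ≠ 0 := by
  intro h
  have : β = α := by linarith
  subst this
  nlinarith [sq_nonneg β]

theorem phaseRatio_ne_zero {α β : ℝ} (hBF : 1 + α * β < 0) : phaseRatio α β ≠ 0 :=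
  div_ne_zero (neg_ne_zero.mpr (beta_sub_alpha_ne_zero hBF)) hBF.ne

/-- Solving the polar equations for R_xx − Rφ_x² and 2R_xφ_x + Rφ_xx produces the cubic coefficients
−h and hγ. This identity and the next two carry most later algebra involving α, β, h and γ. -/
theorem bfParam_mul_phaseRatio {α β : ℝ} (hBF : 1 + α * β < 0) :
    bfParam α β * phaseRatio α β * (1 + α ^ 2) = β - α := by
  have h1 : 1 + α ^ 2 ≠ 0 := by positivity
  have h2 := hBF.ne
  unfold bfParam phaseRatio
  field_simp

theorem bfParam_mul_one_add {α β : ℝ} (hBF : 1 + α * β < 0) :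
    bfParam α β * (1 + α * phaseRatio α β) = -1 := by
  have h1 : 1 + α ^ 2 ≠ 0 := by positivity
  have h2 := hBF.ne
  unfold bfParam phaseRatio
  field_simp
  ring

theorem bfParam_mul_phaseRatio_eq {α β : ℝ} (hBF : 1 + α * β < 0) :
    bfParam α β * phaseRatio α β = bfParam α β * α + β := by
  have h1 : 1 + α ^ 2 ≠ 0 := by positivity
  have h2 := hBF.ne
  unfold bfParam phaseRatio
  field_simp
  ring

/-- Solutions of the rescaled stationary equations. -/
structure IsProfile (γ d Λ : ℝ) (y χ E : ℝ → ℝ) : Prop where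
  deriv_y : ∀ s, HasDerivAt y (d - E s - y s ^ 2 + γ ^ 2 * χ s ^ 2) s
  deriv_χ : ∀ s, HasDerivAt χ (E s - 2 * (y s * χ s)) s
  deriv_E : ∀ s, HasDerivAt E (Λ * y s + 2 * (y s * E s)) s

/-- Periodic solutions with the parities of a symmetric stationary state. -/
structure IsEvenProfile (γ d Λ : ℝ) (y χ E : ℝ → ℝ) : Prop extends IsProfile γ d Λ y χ E where
  periodic_y : Function.Periodic y (2 * Real.pi)
  periodic_χ : Function.Periodic χ (2 * Real.pi)
  periodic_E : Function.Periodic E (2 * Real.pi)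
  odd_y : ∀ s, y (-s) = -y s
  odd_χ : ∀ s, χ (-s) = -χ s
  even_E : ∀ s, E (-s) = E s

/-- Bootstrapping: the right-hand sides are polynomial in the unknowns. -/
theorem IsProfile.contDiff {γ d Λ : ℝ} {y χ E : ℝ → ℝ} (h : IsProfile γ d Λ y χ E) (n : ℕ) :
    ContDiff ℝ n y ∧ ContDiff ℝ n χ ∧ ContDiff ℝ n E := by
  have hstep : ∀ {f g : ℝ → ℝ} {n : ℕ}, (∀ s, HasDerivAt f (g s) s) → ContDiff ℝ n g →
      ContDiff ℝ (n + 1 : ℕ) f := by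
    intro f g n hf hg
    push_cast
    refine contDiff_succ_iff_deriv.mpr ⟨fun s => (hf s).differentiableAt, by simp, ?_⟩
    rwa [show deriv f = g from funext fun s => (hf s).deriv]
  induction n with
  | zero =>
    have : ∀ {f g : ℝ → ℝ}, (∀ s, HasDerivAt f (g s) s) → ContDiff ℝ (0 : ℕ) f := fun hf => by
      rw [Nat.cast_zero, contDiff_zero]
      exact continuous_iff_continuousAt.mpr fun s => (hf s).continuousAt
    exact ⟨this h.deriv_y, this h.deriv_χ, this h.deriv_E⟩
  | succ n ih =>
    obtain ⟨hy, hχ, hE⟩ := ih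
    exact ⟨hstep h.deriv_y (by fun_prop), hstep h.deriv_χ (by fun_prop),
      hstep h.deriv_E (by fun_prop)⟩

/-- Amplitude belonging to a profile. -/
def profileR (h Λ Ω : ℝ) (E : ℝ → ℝ) (x : ℝ) : ℝ :=
  Real.sqrt (Ω ^ 2 * (Λ + 2 * E (Ω * x)) / (2 * h))

/-- Phase belonging to a profile. -/
def profilePhase (γ Ω : ℝ) (χ : ℝ → ℝ) (x : ℝ) : ℝ := γ * ∫ s in (0 : ℝ)..(Ω * x), χ s

theorem profileR_sq {h Λ Ω : ℝ} {E : ℝ → ℝ} (hh : 0 < h) (hE : ∀ s, 0 < Λ + 2 * E s) (x : ℝ) :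
    profileR h Λ Ω E x ^ 2 = Ω ^ 2 * (Λ + 2 * E (Ω * x)) / (2 * h) :=
  Real.sq_sqrt (div_nonneg (mul_nonneg (sq_nonneg _) (hE _).le) (by linarith))

theorem profileR_pos {h Λ Ω : ℝ} {E : ℝ → ℝ} (hh : 0 < h) (hΩ : Ω ≠ 0)
    (hE : ∀ s, 0 < Λ + 2 * E s) (x : ℝ) : 0 < profileR h Λ Ω E x :=
  Real.sqrt_pos.mpr (div_pos (mul_pos (by positivity) (hE _)) (by linarith))

theorem hasDerivAt_comp_mul {f : ℝ → ℝ} {f' Ω x : ℝ} (h : HasDerivAt f f' (Ω * x)) :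
    HasDerivAt (fun x => f (Ω * x)) (Ω * f') x := by
  have h1 : HasDerivAt (fun x : ℝ => Ω * x) Ω x := by
    simpa using (hasDerivAt_id x).const_mul Ω
  exact (h.comp x h1).congr_deriv (mul_comm _ _)

/-- The E-equation reads E' = y(Λ + 2E), so y is the logarithmic derivative of √(Λ + 2E). -/
theorem hasDerivAt_profileR {h d γ Λ Ω : ℝ} {y χ E : ℝ → ℝ} (hp : IsProfile γ d Λ y χ E)
    (hh : 0 < h) (hΩ : Ω ≠ 0) (hE : ∀ s, 0 < Λ + 2 * E s) (x : ℝ) :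
    HasDerivAt (profileR h Λ Ω E) (Ω * y (Ω * x) * profileR h Λ Ω E x) x := by
  have hR := profileR_pos hh hΩ hE x
  have h1 := (((hasDerivAt_comp_mul (hp.deriv_E (Ω * x))).const_mul 2).const_add Λ).const_mul
    (Ω ^ 2) |>.div_const (2 * h)
  have hne : Ω ^ 2 * (Λ + 2 * E (Ω * x)) / (2 * h) ≠ 0 := by
    rw [← profileR_sq hh hE]
    positivity
  refine (h1.sqrt hne).congr_deriv ?_
  change _ / (2 * profileR h Λ Ω E x) = _
  have hsq := profileR_sq (Ω := Ω) hh hE x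
  rw [div_eq_iff (by positivity)]
  have : Ω * y (Ω * x) * profileR h Λ Ω E x * (2 * profileR h Λ Ω E x)
      = 2 * Ω * y (Ω * x) * profileR h Λ Ω E x ^ 2 := by ring
  rw [this, hsq]
  field_simp

theorem hasDerivAt_profilePhase {d γ Λ Ω : ℝ} {y χ E : ℝ → ℝ} (hp : IsProfile γ d Λ y χ E)
    (x : ℝ) : HasDerivAt (profilePhase γ Ω χ) (Ω * γ * χ (Ω * x)) x := by
  have hc : Continuous χ := (hp.contDiff 0).2.1.continuous
  have h1 : HasDerivAt (fun u => ∫ s in (0 : ℝ)..u, χ s) (χ (Ω * x)) (Ω * x) :=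
    intervalIntegral.integral_hasDerivAt_right (hc.intervalIntegrable _ _)
      (hc.stronglyMeasurableAtFilter _ _) hc.continuousAt
  refine ((hasDerivAt_comp_mul h1).const_mul γ).congr_deriv ?_
  ring

/-- Inserting the profile into the polar equations leaves terms in E, which vanish by the identities
for h and γ, and a term in R, which vanishes by the relation between Ω, Λ, d and μ. -/
theorem isEvenStationarySolution_of_profile {μ α β d Λ Ω : ℝ} {y χ E : ℝ → ℝ}
    (hBF : 1 + α * β < 0) (hp : IsEvenProfile (phaseRatio α β) d Λ y χ E) (hΩ : 0 < Ω)
    (hE : ∀ s, 0 < Λ + 2 * E s) (hμ : Ω ^ 2 * (Λ - 2 * bfParam α β * d) = 2 * bfParam α β * μ) :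
    IsEvenStationarySolution μ α β (2 * Real.pi / Ω)
      (α * μ + (β - α) * (Λ * Ω ^ 2 / (2 * bfParam α β)))
      (profileR (bfParam α β) Λ Ω E) (profilePhase (phaseRatio α β) Ω χ) := by
  set h := bfParam α β with hh
  set γ := phaseRatio α β with hγ
  have hpos : 0 < h := bfParam_pos hBF
  have hper : ∀ x, Ω * (x + 2 * Real.pi / Ω) = Ω * x + 2 * Real.pi := by
    intro x
    field_simp
  have hdR := hasDerivAt_profileR hp.toIsProfile hpos hΩ.ne' hE
  have hdφ := hasDerivAt_profilePhase (Ω := Ω) hp.toIsProfile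
  have hderR : deriv (profileR h Λ Ω E) = fun x => Ω * y (Ω * x) * profileR h Λ Ω E x :=
    funext fun x => (hdR x).deriv
  have hderφ : deriv (profilePhase γ Ω χ) = fun x => Ω * γ * χ (Ω * x) :=
    funext fun x => (hdφ x).deriv
  have hcR : ContDiff ℝ 2 (profileR h Λ Ω E) := by
    have hc := (hp.toIsProfile.contDiff 2).2.2
    unfold profileR
    refine ContDiff.sqrt (by fun_prop) fun x => ?_
    exact (div_pos (mul_pos (by positivity) (hE _)) (by linarith)).ne'
  have hcφ : ContDiff ℝ 2 (profilePhase γ Ω χ) := by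
    have hc := (hp.toIsProfile.contDiff 1).2.1
    have : ContDiff ℝ (1 + 1) (profilePhase γ Ω χ) := by
      refine contDiff_succ_iff_deriv.mpr ⟨fun s => (hdφ s).differentiableAt, by simp, ?_⟩
      rw [hderφ]
      exact contDiff_const.mul (hc.comp (contDiff_const.mul contDiff_id))
    simpa [one_add_one_eq_two] using this
  have hpR : Function.Periodic (profileR h Λ Ω E) (2 * Real.pi / Ω) := by
    intro x
    simp only [profileR, hper, hp.periodic_E (Ω * x)]
  have hcχ : Continuous χ := (hp.toIsProfile.contDiff 0).2.1.continuous
  have hsymm : ∀ u : ℝ, ∫ s in (0 : ℝ)..(-u), χ s = ∫ s in (0 : ℝ)..u, χ s := by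
    intro u
    have h1 := intervalIntegral.integral_comp_neg (a := 0) (b := u) χ
    simp only [hp.odd_χ, intervalIntegral.integral_neg, neg_zero] at h1
    rw [intervalIntegral.integral_symm, ← h1, neg_neg]
  have hpφ : Function.Periodic (profilePhase γ Ω χ) (2 * Real.pi / Ω) := by
    intro x
    simp only [profilePhase, hper]
    have hi : ∀ a b, IntervalIntegrable χ MeasureTheory.volume a b := fun a b =>
      hcχ.intervalIntegrable a b
    rw [← intervalIntegral.integral_add_adjacent_intervals (hi 0 (Ω * x))
      (hi (Ω * x) (Ω * x + 2 * Real.pi)), hp.periodic_χ.intervalIntegral_add_eq (Ω * x) (-Real.pi)]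
    -- An odd gradient has no net winding, so the phase itself is periodic.
    have h1 : ∫ s in (-Real.pi)..(-Real.pi + 2 * Real.pi), χ s = 0 := by
      rw [show -Real.pi + 2 * Real.pi = Real.pi by ring,
        ← intervalIntegral.integral_add_adjacent_intervals (hi (-Real.pi) 0) (hi 0 Real.pi),
        intervalIntegral.integral_symm, hsymm, neg_add_cancel]
    rw [h1, add_zero]
  refine { amplitude_pos := profileR_pos hpos hΩ.ne' hE
           contDiff_amplitude := hcR
           contDiff_phase := hcφ
           periodic_amplitude := hpR
           periodic_phase := hpφ
           solves := (isCGLSolution_stationaryField_iff hcR hcφ hpR hpφ).mpr fun x => ?_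
           even_amplitude := fun x => ?_
           even_phase := fun x => ?_ }
  · have h2R : deriv (deriv (profileR h Λ Ω E)) x = (Ω ^ 2 * (d - E (Ω * x) - y (Ω * x) ^ 2
        + γ ^ 2 * χ (Ω * x) ^ 2) + Ω ^ 2 * y (Ω * x) ^ 2) * profileR h Λ Ω E x := by
      rw [hderR]
      have := (((hasDerivAt_comp_mul (hp.deriv_y (Ω * x))).const_mul Ω).mul (hdR x)).deriv
      refine this.trans ?_
      ring
    have h2φ : deriv (deriv (profilePhase γ Ω χ)) x = Ω ^ 2 * γ * (E (Ω * x)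
        - 2 * (y (Ω * x) * χ (Ω * x))) := by
      rw [hderφ]
      have := ((hasDerivAt_comp_mul (hp.deriv_χ (Ω * x))).const_mul (Ω * γ)).deriv
      refine this.trans ?_
      ring
    have hsq := profileR_sq (Ω := Ω) hpos hE x
    have c1 := bfParam_mul_one_add hBF
    have c2 := bfParam_mul_phaseRatio_eq hBF
    rw [← hh, ← hγ] at c1 c2
    set R := profileR h Λ Ω E x with hRdef
    have hsq' : 2 * h * R ^ 2 = Ω ^ 2 * (Λ + 2 * E (Ω * x)) := by
      rw [hsq]
      field_simp
    rw [PolarEq, h2R, h2φ, hderR, hderφ, ← hRdef]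
    have hh2 : (2 * h) ≠ 0 := by positivity
    constructor
    · refine mul_left_cancel₀ hh2 ?_
      linear_combination (-R) * hμ - R * hsq' - 2 * Ω ^ 2 * E (Ω * x) * R * c1
    · refine mul_left_cancel₀ hh2 ?_
      have : 2 * h * (Λ * Ω ^ 2 / (2 * h)) = Λ * Ω ^ 2 := by field_simp
      linear_combination (β - α) * R * this - α * R * hμ - β * R * hsq'
        + 2 * Ω ^ 2 * E (Ω * x) * R * c2
  · simp only [profileR, mul_neg, hp.even_E]
  · simp only [profilePhase, mul_neg, hsymm]

/-- Parameter `c₀` of a stationary solution of frequency `ω`. -/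
def refIntensity (μ α β ω : ℝ) : ℝ := (ω - α * μ) / (β - α)

/-- The profile variable `y` of a stationary solution. -/
def solY (Ω : ℝ) (R : ℝ → ℝ) (s : ℝ) : ℝ := deriv R (s / Ω) / (Ω * R (s / Ω))

/-- The profile variable `χ` of a stationary solution. -/
def solχ (γ Ω : ℝ) (φ : ℝ → ℝ) (s : ℝ) : ℝ := deriv φ (s / Ω) / (Ω * γ)

/-- The profile variable `E` of a stationary solution. -/
def solE (h c₀ Ω : ℝ) (R : ℝ → ℝ) (s : ℝ) : ℝ := h * (R (s / Ω) ^ 2 - c₀) / Ω ^ 2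

theorem hasDerivAt_comp_div {f : ℝ → ℝ} {f' Ω s : ℝ} (h : HasDerivAt f f' (s / Ω)) :
    HasDerivAt (fun s => f (s / Ω)) (f' / Ω) s := by
  have h1 : HasDerivAt (fun s : ℝ => s / Ω) (1 / Ω) s := (hasDerivAt_id s).div_const Ω
  exact (h.comp s h1).congr_deriv (by ring)

theorem Function.Even.deriv_neg {f : ℝ → ℝ} (h : Function.Even f) (x : ℝ) :
    deriv f (-x) = -deriv f x := by
  have h1 : (fun x => f (-x)) = f := funext h
  have h2 := deriv_comp_neg f (x := x)
  rw [h1] at h2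
  rw [h2, neg_neg]

theorem Function.Periodic.deriv_add {f : ℝ → ℝ} {c : ℝ} (h : Function.Periodic f c) (x : ℝ) :
    deriv f (x + c) = deriv f x := by
  rw [← deriv_comp_add_const, show (fun x => f (x + c)) = f from funext h]

/-- Writing ω = αμ + (β − α)c₀ trades the frequency for the intensity c₀ at which the phase forcing
hγ(R² − c₀) vanishes. The polar equations solved for the second-order terms then become the profile
system. -/
theorem IsEvenStationarySolution.isEvenProfile {μ α β L ω : ℝ} {R φ : ℝ → ℝ}
    (hBF : 1 + α * β < 0) (hL : 0 < L) (hs : IsEvenStationarySolution μ α β L ω R φ) :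
    IsEvenProfile (phaseRatio α β)
      ((refIntensity μ α β ω - μ) / (2 * Real.pi / L) ^ 2)
      (2 * bfParam α β * refIntensity μ α β ω / (2 * Real.pi / L) ^ 2)
      (solY (2 * Real.pi / L) R) (solχ (phaseRatio α β) (2 * Real.pi / L) φ)
      (solE (bfParam α β) (refIntensity μ α β ω) (2 * Real.pi / L) R) := by
  set h := bfParam α β with hh
  set γ := phaseRatio α β with hγ
  set Ω := 2 * Real.pi / L with hΩdef
  set c₀ := refIntensity μ α β ω with hc₀
  have hΩ : 0 < Ω := div_pos Real.two_pi_pos hL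
  have hpos : 0 < h := bfParam_pos hBF
  have hγ0 : γ ≠ 0 := phaseRatio_ne_zero hBF
  have hβα := beta_sub_alpha_ne_zero hBF
  have hω : ω = α * μ + (β - α) * c₀ := by
    rw [hc₀, refIntensity]
    field_simp
    ring
  have c1 := bfParam_mul_one_add hBF
  have c2 := bfParam_mul_phaseRatio hBF
  have c3 : (1 + α ^ 2) * h = -(1 + α * β) := by
    rw [hh, bfParam]
    field_simp
  rw [← hh, ← hγ] at c1 c2
  have hα : (1 + α ^ 2) ≠ 0 := by positivity
  have hpolar := (isCGLSolution_stationaryField_iff hs.contDiff_amplitude hs.contDiff_phase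
    hs.periodic_amplitude hs.periodic_phase).mp hs.solves
  have hamp : ∀ x, deriv (deriv R) x - R x * deriv φ x ^ 2
      = R x * (c₀ - μ - h * (R x ^ 2 - c₀)) := by
    intro x
    obtain ⟨p1, p2⟩ := hpolar x
    rw [hω] at p2
    refine mul_left_cancel₀ hα ?_
    linear_combination p1 + α * p2 - R x * c₀ * α * c2 + R x * (R x ^ 2) * c3
      + (1 + α ^ 2) * R x * c₀ * c1 - 2 * R x * c₀ * c3
  have hph : ∀ x, 2 * deriv R x * deriv φ x + R x * deriv (deriv φ) x
      = R x * (h * γ * (R x ^ 2 - c₀)) := by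
    intro x
    obtain ⟨p1, p2⟩ := hpolar x
    rw [hω] at p2
    refine mul_left_cancel₀ hα ?_
    linear_combination p2 - α * p1 - R x * (R x ^ 2 - c₀) * c2
  have hper : ∀ s, (s + 2 * Real.pi) / Ω = s / Ω + L := by
    intro s
    rw [hΩdef]
    field_simp
  refine { deriv_y := fun s => ?_, deriv_χ := fun s => ?_, deriv_E := fun s => ?_,
           periodic_y := fun s => ?_, periodic_χ := fun s => ?_, periodic_E := fun s => ?_,
           odd_y := fun s => ?_, odd_χ := fun s => ?_, even_E := fun s => ?_ }
  · have hR := hs.amplitude_pos (s / Ω)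
    have h1 := hasDerivAt_comp_div (hasDerivAt_of_contDiff_two hs.contDiff_amplitude (s / Ω)).2
    have h2 := (hasDerivAt_comp_div
      (hasDerivAt_of_contDiff_two hs.contDiff_amplitude (s / Ω)).1).const_mul Ω
    refine (h1.div h2 (by positivity)).congr_deriv ?_
    have := hamp (s / Ω)
    simp only [solE, solY, solχ]
    field_simp
    linear_combination R (s / Ω) * this
  · have hR := hs.amplitude_pos (s / Ω)
    refine ((hasDerivAt_comp_div (hasDerivAt_of_contDiff_two hs.contDiff_phase
      (s / Ω)).2).div_const (Ω * γ)).congr_deriv ?_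
    have := hph (s / Ω)
    simp only [solE, solY, solχ]
    field_simp
    linear_combination this
  · have hR := hs.amplitude_pos (s / Ω)
    refine ((((hasDerivAt_comp_div (hasDerivAt_of_contDiff_two hs.contDiff_amplitude
      (s / Ω)).1).pow 2).sub_const c₀).const_mul h |>.div_const (Ω ^ 2)).congr_deriv ?_
    simp only [solE, solY]
    field_simp
    ring
  · simp only [solY, hper, hs.periodic_amplitude (s / Ω), hs.periodic_amplitude.deriv_add]
  · simp only [solχ, hper, hs.periodic_phase.deriv_add]
  · simp only [solE, hper, hs.periodic_amplitude (s / Ω)]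
  · simp only [solY, neg_div, hs.even_amplitude.deriv_neg, hs.even_amplitude (s / Ω)]
  · simp only [solχ, neg_div, hs.even_phase.deriv_neg]
  · simp only [solE, neg_div, hs.even_amplitude (s / Ω)]

/-! ### A priori estimate and local uniqueness of small profiles -/

open PerFun

namespace PerFun

/-- `G` is the derivative of the periodic function `Y`. -/
def IsDeriv (Y G : PerFun) : Prop :=
  ∀ s : ℝ, HasDerivAt (fun s : ℝ => Y (s : AddCircle (2 * Real.pi))) (G (s : AddCircle _)) s

theorem IsDeriv.add {Y G Z H : PerFun} (h₁ : IsDeriv Y G) (h₂ : IsDeriv Z H) :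
    IsDeriv (Y + Z) (G + H) := fun s => (h₁ s).add (h₂ s)

theorem IsDeriv.sub {Y G Z H : PerFun} (h₁ : IsDeriv Y G) (h₂ : IsDeriv Z H) :
    IsDeriv (Y - Z) (G - H) := fun s => (h₁ s).sub (h₂ s)

theorem IsDeriv.mul {Y G Z H : PerFun} (h₁ : IsDeriv Y G) (h₂ : IsDeriv Z H) :
    IsDeriv (Y * Z) (G * Z + Y * H) := fun s => (h₁ s).mul (h₂ s)

theorem IsDeriv.smul {Y G : PerFun} (k : ℝ) (h₁ : IsDeriv Y G) : IsDeriv (k • Y) (k • G) :=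
  fun s => (h₁ s).const_mul k

theorem IsDeriv.congr {Y G G' : PerFun} (h₁ : IsDeriv Y G) (h : G = G') : IsDeriv Y G' := h ▸ h₁

theorem isDeriv_cosP : IsDeriv cosP (-sinP) := fun s => Real.hasDerivAt_cos s

theorem isDeriv_sinP : IsDeriv sinP cosP := fun s => Real.hasDerivAt_sin s

theorem norm_cosP_mul_le (f : PerFun) : ‖cosP * f‖ ≤ ‖f‖ :=
  (norm_mul_le _ _).trans (mul_le_of_le_one_left (norm_nonneg _) norm_cosP_le)

theorem norm_sinP_mul_le (f : PerFun) : ‖sinP * f‖ ≤ ‖f‖ :=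
  (norm_mul_le _ _).trans (mul_le_of_le_one_left (norm_nonneg _) norm_sinP_le)

theorem norm_smul_one_le (k : ℝ) : ‖k • (1 : PerFun)‖ ≤ |k| := by
  rw [norm_smul, Real.norm_eq_abs, norm_one, mul_one]

/-- A priori estimate for `Y' = -W + F₁`, `X' = W + F₂`, `W' = Y + F₃` with the parities and
normalization of symmetric states. -/
theorem core_estimate {Y X W F₁ F₂ F₃ : PerFun} (hY : IsDeriv Y (-W + F₁))
    (hX : IsDeriv X (W + F₂)) (hW : IsDeriv W (Y + F₃)) (rY : reflect Y = -Y)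
    (rX : reflect X = -X) (rW : reflect W = W) (hn : mean (cosP * W - sinP * Y) = 0) :
    mean (cosP * F₁ + sinP * F₃) = 0 ∧ mean (F₁ + F₂) = 0 ∧
      ‖Y‖ ≤ 16 * Real.pi * (‖F₁‖ + ‖F₃‖) ∧ ‖W‖ ≤ 16 * Real.pi * (‖F₁‖ + ‖F₃‖) ∧
      ‖X‖ ≤ 8 * Real.pi * (‖F₁‖ + ‖F₂‖) + 16 * Real.pi * (‖F₁‖ + ‖F₃‖) := by
  -- Rotating frame, in which the homogeneous part disappears.
  have h1 : IsDeriv (cosP * Y + sinP * W) (cosP * F₁ + sinP * F₃) :=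
    ((isDeriv_cosP.mul hY).add (isDeriv_sinP.mul hW)).congr (by ring)
  have h2 : IsDeriv (cosP * W - sinP * Y) (cosP * F₃ - sinP * F₁) :=
    ((isDeriv_cosP.mul hW).sub (isDeriv_sinP.mul hY)).congr (by ring)
  have h3 : IsDeriv (Y + X) (F₁ + F₂) := (hY.add hX).congr (by ring)
  have e1 := eq_J_of_hasDerivAt h1
  have e2 := eq_J_of_hasDerivAt h2
  have e3 := eq_J_of_hasDerivAt h3
  -- Parity removes the mean of the first rotated component and of Y + X; the normalization removes
  -- that of the second. Thus each is `J` of its derivative.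
  have m1 : mean (cosP * Y + sinP * W) = 0 := by
    refine mean_eq_zero_of_reflect ?_
    simp only [map_add, map_mul, rY, rW, reflect_cosP, reflect_sinP]
    ring
  have m3 : mean (Y + X) = 0 := by
    refine mean_eq_zero_of_reflect ?_
    rw [map_add, rY, rX]
    ring
  rw [m1, map_zero, add_zero] at e1
  rw [hn, map_zero, add_zero] at e2
  rw [m3, map_zero, add_zero] at e3
  have hYe : Y = cosP * J (cosP * F₁ + sinP * F₃) - sinP * J (cosP * F₃ - sinP * F₁) := by
    rw [← e1, ← e2]
    linear_combination -Y * sinP_sq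
  have hWe : W = sinP * J (cosP * F₁ + sinP * F₃) + cosP * J (cosP * F₃ - sinP * F₁) := by
    rw [← e1, ← e2]
    linear_combination -W * sinP_sq
  have b1 : ‖J (cosP * F₁ + sinP * F₃)‖ ≤ 8 * Real.pi * (‖F₁‖ + ‖F₃‖) := by
    refine (norm_J_le _).trans (mul_le_mul_of_nonneg_left ?_ (by positivity))
    exact (norm_add_le _ _).trans (add_le_add (norm_cosP_mul_le _) (norm_sinP_mul_le _))
  have b2 : ‖J (cosP * F₃ - sinP * F₁)‖ ≤ 8 * Real.pi * (‖F₁‖ + ‖F₃‖) := by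
    refine (norm_J_le _).trans (mul_le_mul_of_nonneg_left ?_ (by positivity))
    rw [add_comm ‖F₁‖]
    exact (norm_sub_le _ _).trans (add_le_add (norm_cosP_mul_le _) (norm_sinP_mul_le _))
  have b3 : ‖J (F₁ + F₂)‖ ≤ 8 * Real.pi * (‖F₁‖ + ‖F₂‖) :=
    (norm_J_le _).trans (mul_le_mul_of_nonneg_left (norm_add_le _ _) (by positivity))
  have bY : ‖Y‖ ≤ 16 * Real.pi * (‖F₁‖ + ‖F₃‖) := by
    rw [hYe]
    have := (norm_sub_le (cosP * J (cosP * F₁ + sinP * F₃)) (sinP * J (cosP * F₃ - sinP * F₁)))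
    linarith [norm_cosP_mul_le (J (cosP * F₁ + sinP * F₃)),
      norm_sinP_mul_le (J (cosP * F₃ - sinP * F₁))]
  have bW : ‖W‖ ≤ 16 * Real.pi * (‖F₁‖ + ‖F₃‖) := by
    rw [hWe]
    have := (norm_add_le (sinP * J (cosP * F₁ + sinP * F₃)) (cosP * J (cosP * F₃ - sinP * F₁)))
    linarith [norm_sinP_mul_le (J (cosP * F₁ + sinP * F₃)),
      norm_cosP_mul_le (J (cosP * F₃ - sinP * F₁))]
  refine ⟨mean_eq_zero_of_hasDerivAt h1, mean_eq_zero_of_hasDerivAt h3, bY, bW, ?_⟩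
  have hXe : X = J (F₁ + F₂) - Y := by
    rw [← e3]
    ring
  rw [hXe]
  exact (norm_sub_le _ _).trans (add_le_add b3 bY)

end PerFun

set_option maxHeartbeats 1000000 in
/-- Small normalized profiles coincide with the branch member of the same amplitude. -/
theorem BranchFamily.eq_of_small {γ : ℝ} (b : BranchFamily γ) {a τ d Λ : ℝ} (hg : b.Good a)
    (hτ : 10000 * (1 + γ ^ 2) * τ ≤ 1) {y χ E : PerFun}
    (hy : IsDeriv y (d • 1 - E - y ^ 2 + γ ^ 2 • χ ^ 2)) (hχ : IsDeriv χ (E - 2 * (y * χ)))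
    (hE : IsDeriv E (Λ • y + 2 * (y * E))) (ry : reflect y = -y) (rχ : reflect χ = -χ)
    (rE : reflect E = E) (hn : mean (cosP * E - sinP * y) = a) (hΛ : |Λ - 1| ≤ τ)
    (by₁ : ‖y‖ ≤ τ) (by₂ : ‖b.y a‖ ≤ τ) (bχ₁ : ‖χ‖ ≤ τ) (bχ₂ : ‖b.χ a‖ ≤ τ)
    (bE₁ : ‖E‖ ≤ τ) (bE₂ : ‖b.E a‖ ≤ τ) (hyh : |a| * ‖b.yh a‖ ≤ 1 / 4) :
    y = b.y a ∧ χ = b.χ a ∧ E = b.E a ∧ d = b.d a ∧ (a = 0 ∨ Λ = b.Lam a) := by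
  set Y := y - b.y a with hYd
  set X := χ - b.χ a with hXd
  set W := E - b.E a with hWd
  set m := (Λ - b.Lam a) * a with hm
  set G₁ : PerFun := -((y + b.y a) * Y) + γ ^ 2 • ((χ + b.χ a) * X) with hG₁
  set G₂ : PerFun := -(2 * (y * X + b.χ a * Y)) with hG₂
  set G₃ : PerFun := (Λ - 1) • Y + 2 * (y * W + b.E a * Y) with hG₃
  set F₁ : PerFun := (d - b.d a) • 1 + G₁ with hF₁
  set F₃ : PerFun := G₃ + m • (-sinP + a • b.yh a) with hF₃
  have hYi : IsDeriv Y (-W + F₁) := by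
    refine (IsDeriv.sub hy hg.deriv_y).congr ?_
    refine ext_coe fun s => ?_
    simp [hF₁, hG₁, hWd, hYd, hXd]
    ring
  have hXi : IsDeriv X (W + G₂) := by
    refine (IsDeriv.sub hχ hg.deriv_χ).congr ?_
    simp only [hG₂, hWd, hYd, hXd]
    ring
  have hWi : IsDeriv W (Y + F₃) := by
    refine (IsDeriv.sub hE hg.deriv_E).congr ?_
    refine ext_coe fun s => ?_
    simp [hF₃, hG₃, hWd, hYd, hm, BranchFamily.y]
    ring
  have rY : reflect Y = -Y := by
    rw [hYd, map_sub, ry, hg.reflect_y]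
    ring
  have rX : reflect X = -X := by
    rw [hXd, map_sub, rχ, hg.reflect_χ]
    ring
  have rW : reflect W = W := by rw [hWd, map_sub, rE, hg.reflect_E]
  have hn0 : mean (cosP * W - sinP * Y) = 0 := by
    have : cosP * W - sinP * Y = (cosP * E - sinP * y) - (cosP * b.E a - sinP * b.y a) := by
      simp only [hWd, hYd]
      ring
    rw [this, map_sub, hn, hg.normalized, sub_self]
  obtain ⟨e1, e2, nY, nW, nX⟩ := core_estimate hYi hXi hWi rY rX rW hn0
  set K := 1 + γ ^ 2 with hK
  have hK1 : 1 ≤ K := by nlinarith [sq_nonneg γ]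
  set S := ‖Y‖ + ‖X‖ + ‖W‖ with hS
  have hY0 := norm_nonneg Y
  have hX0 := norm_nonneg X
  have hW0 := norm_nonneg W
  have hτ0 : 0 ≤ τ := (abs_nonneg _).trans hΛ
  have hS0 : 0 ≤ S := by positivity
  have hτS : 0 ≤ τ * S := by positivity
  have hτSe : τ * S = τ * ‖Y‖ + τ * ‖X‖ + τ * ‖W‖ := by
    rw [hS]
    ring
  have n2 : ∀ f : PerFun, ‖2 * f‖ ≤ 2 * ‖f‖ := fun f => by
    have := norm_add_le f f
    rw [← two_mul f] at this
    linarith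
  have nG₁ : ‖G₁‖ ≤ 2 * K * (τ * S) := by
    have t1 : ‖(y + b.y a) * Y‖ ≤ (2 * τ) * ‖Y‖ := (norm_mul_le _ _).trans
      (mul_le_mul_of_nonneg_right ((norm_add_le _ _).trans (by linarith)) hY0)
    have t2 : ‖γ ^ 2 • ((χ + b.χ a) * X)‖ ≤ γ ^ 2 * ((2 * τ) * ‖X‖) := by
      rw [norm_smul, Real.norm_of_nonneg (sq_nonneg γ)]
      exact mul_le_mul_of_nonneg_left ((norm_mul_le _ _).trans
        (mul_le_mul_of_nonneg_right ((norm_add_le _ _).trans (by linarith)) hX0)) (sq_nonneg γ)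
    have t3 := norm_add_le (-((y + b.y a) * Y)) (γ ^ 2 • ((χ + b.χ a) * X))
    rw [norm_neg] at t3
    have t4 : (2 * τ) * ‖Y‖ + γ ^ 2 * ((2 * τ) * ‖X‖) ≤ 2 * K * (τ * S) := by
      have q1 : 0 ≤ γ ^ 2 * (τ * ‖Y‖) := by positivity
      have q2 : 0 ≤ τ * ‖X‖ := by positivity
      have q3 : 0 ≤ K * (τ * ‖W‖) := by positivity
      have q4 : K * (τ * S) = τ * ‖Y‖ + γ ^ 2 * (τ * ‖Y‖) + τ * ‖X‖ + γ ^ 2 * (τ * ‖X‖)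
          + K * (τ * ‖W‖) := by
        rw [hτSe, hK]
        ring
      linarith
    linarith
  have nG₂ : ‖G₂‖ ≤ 2 * (τ * S) := by
    rw [hG₂, norm_neg]
    have t1 : ‖y * X‖ ≤ τ * ‖X‖ :=
      (norm_mul_le _ _).trans (mul_le_mul_of_nonneg_right by₁ hX0)
    have t2 : ‖b.χ a * Y‖ ≤ τ * ‖Y‖ :=
      (norm_mul_le _ _).trans (mul_le_mul_of_nonneg_right bχ₂ hY0)
    have t3 := n2 (y * X + b.χ a * Y)
    have t4 := norm_add_le (y * X) (b.χ a * Y)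
    have q3 : 0 ≤ τ * ‖W‖ := by positivity
    rw [hτSe]
    linarith
  have nG₃ : ‖G₃‖ ≤ 3 * (τ * S) := by
    have t0 : ‖(Λ - 1) • Y‖ ≤ τ * ‖Y‖ := by
      rw [norm_smul, Real.norm_eq_abs]
      exact mul_le_mul_of_nonneg_right hΛ hY0
    have t1 : ‖y * W‖ ≤ τ * ‖W‖ :=
      (norm_mul_le _ _).trans (mul_le_mul_of_nonneg_right by₁ hW0)
    have t2 : ‖b.E a * Y‖ ≤ τ * ‖Y‖ :=
      (norm_mul_le _ _).trans (mul_le_mul_of_nonneg_right bE₂ hY0)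
    have t3 := n2 (y * W + b.E a * Y)
    have t4 := norm_add_le (y * W) (b.E a * Y)
    have t5 := norm_add_le ((Λ - 1) • Y) (2 * (y * W + b.E a * Y))
    have q3 : 0 ≤ τ * ‖X‖ := by positivity
    have q4 : 0 ≤ τ * ‖W‖ := by positivity
    rw [hτSe]
    linarith
  have hKS : τ * S ≤ K * (τ * S) := le_mul_of_one_le_left hτS hK1
  have nd : |d - b.d a| ≤ 4 * K * (τ * S) := by
    have : d - b.d a = -mean (G₁ + G₂) := by
      rw [hF₁, add_assoc, map_add, map_smul, mean_one] at e2
      simp only [smul_eq_mul, mul_one] at e2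
      linarith
    rw [this, abs_neg]
    have := (abs_mean_le (G₁ + G₂)).trans (norm_add_le _ _)
    linarith
  -- The resonance condition determines m: its coefficient 1/2 − a·mean(sin·ŷ) is at least 1/4 in
  -- absolute value.
  have nm : |m| ≤ 20 * K * (τ * S) := by
    have h1 : cosP * F₁ + sinP * F₃ = (d - b.d a) • cosP + (cosP * G₁ + sinP * G₃)
        + m • (-(sinP ^ 2) + a • (sinP * b.yh a)) := by
      refine ext_coe fun s => ?_
      simp [hF₁, hF₃]
      ring
    have h1' : mean (cosP * F₁ + sinP * F₃) = (d - b.d a) * mean cosP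
        + mean (cosP * G₁ + sinP * G₃)
        + m * (-mean (sinP ^ 2) + a * mean (sinP * b.yh a)) := by
      rw [h1]
      simp only [map_add, map_smul, map_neg, smul_eq_mul]
    rw [h1', mean_cosP, mean_sinP_sq, mul_zero, zero_add] at e1
    have h2 : |mean (cosP * G₁ + sinP * G₃)| ≤ 5 * K * (τ * S) := by
      have := (abs_mean_le (cosP * G₁ + sinP * G₃)).trans (norm_add_le _ _)
      have t1 := norm_cosP_mul_le G₁
      have t2 := norm_sinP_mul_le G₃
      linarith
    have h3 : |a * mean (sinP * b.yh a)| ≤ 1 / 4 := by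
      rw [abs_mul]
      refine (mul_le_mul_of_nonneg_left ((abs_mean_le _).trans (norm_sinP_mul_le _))
        (abs_nonneg a)).trans hyh
    have h4 : m * (1 / 2 - a * mean (sinP * b.yh a)) = mean (cosP * G₁ + sinP * G₃) := by
      linarith
    have h5 : 1 / 4 ≤ |1 / 2 - a * mean (sinP * b.yh a)| := by
      have := (abs_le.mp h3).2
      exact le_trans (by linarith) (le_abs_self _)
    have h6 : |m| * (1 / 4) ≤ 5 * K * (τ * S) := by
      rw [← h4, abs_mul] at h2
      exact (mul_le_mul_of_nonneg_left h5 (abs_nonneg m)).trans h2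
    linarith
  have nF₁ : ‖F₁‖ ≤ 6 * K * (τ * S) := by
    have := norm_add_le ((d - b.d a) • (1 : PerFun)) G₁
    have t := norm_smul_one_le (d - b.d a)
    rw [hF₁]
    linarith
  have nF₃ : ‖F₃‖ ≤ 28 * K * (τ * S) := by
    have t1 := norm_add_le G₃ (m • (-sinP + a • b.yh a))
    have t2 : ‖m • (-sinP + a • b.yh a)‖ ≤ |m| * (5 / 4) := by
      rw [norm_smul, Real.norm_eq_abs]
      refine mul_le_mul_of_nonneg_left ?_ (abs_nonneg m)
      have := norm_add_le (-sinP) (a • b.yh a)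
      rw [norm_neg, norm_smul, Real.norm_eq_abs] at this
      linarith [norm_sinP_le]
    rw [hF₃]
    linarith
  have hπ := Real.pi_lt_d2
  have hπ0 := Real.pi_pos
  -- Here 1696 = 3·16·34 + 8·8 collects the three core bounds. With π < 3.15 it gives less than
  -- 10000, which is where the constant in the smallness hypothesis comes from.
  have hSS : S ≤ 1696 * Real.pi * (K * (τ * S)) := by
    have u1 : 16 * Real.pi * (‖F₁‖ + ‖F₃‖) ≤ 16 * Real.pi * (34 * (K * (τ * S))) :=
      mul_le_mul_of_nonneg_left (by linarith) (by positivity)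
    have u2 : 8 * Real.pi * (‖F₁‖ + ‖G₂‖) ≤ 8 * Real.pi * (8 * (K * (τ * S))) :=
      mul_le_mul_of_nonneg_left (by linarith) (by positivity)
    linarith
  have hKτ : K * (τ * S) ≤ S / 10000 := by
    have := mul_le_mul_of_nonneg_right hτ hS0
    linarith
  have hSz : S = 0 := by
    have h1 : 1696 * Real.pi * (K * (τ * S)) ≤ 1696 * Real.pi * (S / 10000) :=
      mul_le_mul_of_nonneg_left hKτ (by positivity)
    have h2 : 1696 * Real.pi * (S / 10000) ≤ 1696 * 3.15 * (S / 10000) := by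
      refine mul_le_mul_of_nonneg_right ?_ (by positivity)
      linarith
    linarith
  have hYz : Y = 0 := norm_eq_zero.mp (by linarith)
  have hXz : X = 0 := norm_eq_zero.mp (by linarith)
  have hWz : W = 0 := norm_eq_zero.mp (by linarith)
  rw [hSz, mul_zero, mul_zero] at nd nm
  refine ⟨sub_eq_zero.mp hYz, sub_eq_zero.mp hXz, sub_eq_zero.mp hWz,
    sub_eq_zero.mp (abs_nonpos_iff.mp nd), ?_⟩
  rcases mul_eq_zero.mp (abs_nonpos_iff.mp nm) with h | h
  · exact Or.inr (sub_eq_zero.mp h)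
  · exact Or.inl h

/-! ### The linearization in scaled variables -/

/-- First component of the linearization in the variables `r = R ρ` and `s = Ω x`. -/
def scaledOp₁ (α lam : ℝ) (P y ψ : ℝ → ℝ) (ρ θ : ℝ → ℂ) (s : ℝ) : ℂ :=
  lam * (deriv (deriv ρ) s - α * deriv (deriv θ) s + 2 * (y s * deriv ρ s - ψ s * deriv θ s)
    - 2 * α * (y s * deriv θ s + ψ s * deriv ρ s)) - 2 * P s * ρ s

/-- Second component of the linearization in the variables `r = R ρ` and `s = Ω x`. -/
def scaledOp₂ (α β lam : ℝ) (P y ψ : ℝ → ℝ) (ρ θ : ℝ → ℂ) (s : ℝ) : ℂ :=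
  lam * (α * deriv (deriv ρ) s + deriv (deriv θ) s + 2 * α * (y s * deriv ρ s - ψ s * deriv θ s)
    + 2 * (y s * deriv θ s + ψ s * deriv ρ s)) - 2 * β * P s * ρ s

/-- The perturbation `(R(x) ρ(Ωx), θ(Ωx))`. -/
def toPert (R : ℝ → ℝ) (Ω : ℝ) (ρ θ : ℝ → ℂ) : Perturbation :=
  (fun x => (R x : ℂ) * ρ (Ω * x), fun x => θ (Ω * x))

theorem hasDerivAt_comp_mul_complex {f : ℝ → ℂ} {f' : ℂ} {Ω x : ℝ} (h : HasDerivAt f f' (Ω * x)) :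
    HasDerivAt (fun x => f (Ω * x)) (Ω * f') x := by
  have h1 : HasDerivAt (fun x : ℝ => Ω * x) Ω x := by
    simpa using (hasDerivAt_id x).const_mul Ω
  refine (h.scomp x h1).congr_deriv ?_
  simp

/-- With r = Rρ the zeroth-order terms in ρ combine to ρ times the polar equations, apart from the
contributions −2R²ρ and −2βR²ρ. -/
theorem linearization_toPert {μ α β ω Ω : ℝ} {R φ y ψ : ℝ → ℝ} (hR0 : ∀ x, R x ≠ 0)
    (hR : ContDiff ℝ 2 R) (hpolar : ∀ x, PolarEq μ α β ω R φ x) (hΩ : Ω ≠ 0)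
    (hy : ∀ x, deriv R x = Ω * y (Ω * x) * R x) (hψ : ∀ x, deriv φ x = Ω * ψ (Ω * x))
    {P : ℝ → ℝ} (hP : ∀ x, P (Ω * x) = R x ^ 2) {ρ θ : ℝ → ℂ} (hρ : ContDiff ℝ 2 ρ)
    (hθ : ContDiff ℝ 2 θ) :
    linearization μ α β ω R φ (toPert R Ω ρ θ) =
      toPert R Ω (scaledOp₁ α (Ω ^ 2) P y ψ ρ θ) (scaledOp₂ α β (Ω ^ 2) P y ψ ρ θ) := by
  have hθ1 : ∀ x, HasDerivAt (fun x => θ (Ω * x)) (Ω * deriv θ (Ω * x)) x := fun x =>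
    hasDerivAt_comp_mul_complex (hasDerivAt_of_contDiff_two hθ _).1
  have hθ2 : ∀ x, HasDerivAt (fun x => (Ω : ℂ) * deriv θ (Ω * x))
      (Ω * (Ω * deriv (deriv θ) (Ω * x))) x := fun x =>
    (hasDerivAt_comp_mul_complex (hasDerivAt_of_contDiff_two hθ _).2).const_mul _
  have hρ1 : ∀ x, HasDerivAt (fun x => ρ (Ω * x)) (Ω * deriv ρ (Ω * x)) x := fun x =>
    hasDerivAt_comp_mul_complex (hasDerivAt_of_contDiff_two hρ _).1
  have hρ2 : ∀ x, HasDerivAt (fun x => (Ω : ℂ) * deriv ρ (Ω * x))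
      (Ω * (Ω * deriv (deriv ρ) (Ω * x))) x := fun x =>
    (hasDerivAt_comp_mul_complex (hasDerivAt_of_contDiff_two hρ _).2).const_mul _
  have hR1 : ∀ x, HasDerivAt (fun x => (R x : ℂ)) ((deriv R x : ℝ) : ℂ) x := fun x =>
    (hasDerivAt_of_contDiff_two hR x).1.ofReal_comp
  have hR2 : ∀ x, HasDerivAt (fun x => ((deriv R x : ℝ) : ℂ)) ((deriv (deriv R) x : ℝ) : ℂ) x :=
    fun x => (hasDerivAt_of_contDiff_two hR x).2.ofReal_comp
  have dθ1 : deriv (fun x => θ (Ω * x)) = fun x => (Ω : ℂ) * deriv θ (Ω * x) :=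
    funext fun x => (hθ1 x).deriv
  have dr1 : deriv (fun x => (R x : ℂ) * ρ (Ω * x)) = fun x =>
      ((deriv R x : ℝ) : ℂ) * ρ (Ω * x) + R x * (Ω * deriv ρ (Ω * x)) :=
    funext fun x => ((hR1 x).mul (hρ1 x)).deriv
  have dθ2 : ∀ x, deriv (fun x => (Ω : ℂ) * deriv θ (Ω * x)) x
      = Ω * (Ω * deriv (deriv θ) (Ω * x)) := fun x => (hθ2 x).deriv
  have dr2 : ∀ x, deriv (fun x => ((deriv R x : ℝ) : ℂ) * ρ (Ω * x)
      + R x * (Ω * deriv ρ (Ω * x))) x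
      = ((deriv (deriv R) x : ℝ) : ℂ) * ρ (Ω * x) + ((deriv R x : ℝ) : ℂ) * (Ω * deriv ρ (Ω * x))
        + (((deriv R x : ℝ) : ℂ) * (Ω * deriv ρ (Ω * x))
          + R x * (Ω * (Ω * deriv (deriv ρ) (Ω * x)))) :=
    fun x => (((hR2 x).mul (hρ1 x)).add ((hR1 x).mul (hρ2 x))).deriv
  have key : ∀ x, ((deriv (deriv R) x : ℝ) : ℂ) - R x * ((deriv φ x : ℝ) : ℂ) ^ 2
      - α * (2 * ((deriv R x : ℝ) : ℂ) * ((deriv φ x : ℝ) : ℂ)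
        + R x * ((deriv (deriv φ) x : ℝ) : ℂ)) + μ * R x - R x ^ 3 = 0 ∧
      α * (((deriv (deriv R) x : ℝ) : ℂ) - R x * ((deriv φ x : ℝ) : ℂ) ^ 2)
      + (2 * ((deriv R x : ℝ) : ℂ) * ((deriv φ x : ℝ) : ℂ)
        + R x * ((deriv (deriv φ) x : ℝ) : ℂ)) + ω * R x - β * R x ^ 3 = 0 := by
    intro x
    obtain ⟨h1, h2⟩ := hpolar x
    exact ⟨by exact_mod_cast h1, by exact_mod_cast h2⟩
  unfold linearization toPert
  simp only [dθ1, dr1, dθ2, dr2]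
  refine Prod.ext (funext fun x => ?_) (funext fun x => ?_)
  · obtain ⟨h1, h2⟩ := key x
    simp only [scaledOp₁, hP]
    push_cast
    rw [hy x, hψ x] at *
    push_cast at h1 h2 ⊢
    linear_combination ρ (Ω * x) * h1
  · obtain ⟨h1, h2⟩ := key x
    have hRx : (R x : ℂ) ≠ 0 := by exact_mod_cast hR0 x
    simp only [scaledOp₂, hP]
    rw [div_eq_iff hRx]
    push_cast
    rw [hy x, hψ x] at *
    push_cast at h1 h2 ⊢
    linear_combination ρ (Ω * x) * h2

/-- Pairs of `C²` functions of period `2π`. -/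
def IsC2Per (ρ : ℝ → ℂ) : Prop := ContDiff ℝ 2 ρ ∧ Function.Periodic ρ (2 * Real.pi)

theorem isAdmissible_toPert {R : ℝ → ℝ} {Ω : ℝ} {ρ θ : ℝ → ℂ} (hΩ : Ω ≠ 0) (hR : ContDiff ℝ 2 R)
    (hRp : Function.Periodic R (2 * Real.pi / Ω)) (hρ : IsC2Per ρ) (hθ : IsC2Per θ) :
    IsAdmissible (2 * Real.pi / Ω) (toPert R Ω ρ θ) := by
  have hper : ∀ x, Ω * (x + 2 * Real.pi / Ω) = Ω * x + 2 * Real.pi := by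
    intro x
    field_simp
  have hl : ContDiff ℝ 2 (fun x : ℝ => Ω * x) := contDiff_const.mul contDiff_id
  refine ⟨(Complex.ofRealCLM.contDiff.comp hR).mul (hρ.1.comp hl), hθ.1.comp hl, fun x => ?_,
    fun x => ?_⟩
  · simp only [toPert, hper, hρ.2 (Ω * x), hRp x]
  · simp only [toPert, hper, hθ.2 (Ω * x)]

/-- Division by the nowhere vanishing R makes the substitution r = Rρ a bijection of admissible
perturbations. -/
theorem exists_eq_toPert {R : ℝ → ℝ} {Ω : ℝ} {w : Perturbation} (hΩ : Ω ≠ 0)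
    (hR0 : ∀ x, R x ≠ 0) (hR : ContDiff ℝ 2 R) (hRp : Function.Periodic R (2 * Real.pi / Ω))
    (hw : IsAdmissible (2 * Real.pi / Ω) w) :
    ∃ ρ θ, IsC2Per ρ ∧ IsC2Per θ ∧ w = toPert R Ω ρ θ := by
  obtain ⟨w1, w2⟩ := w
  obtain ⟨h1, h2, h3, h4⟩ := hw
  have hper : ∀ s, (s + 2 * Real.pi) / Ω = s / Ω + 2 * Real.pi / Ω := fun s => add_div _ _ _
  have hl : ContDiff ℝ 2 (fun s : ℝ => s / Ω) := contDiff_id.div_const Ω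
  have hRc : ContDiff ℝ 2 (fun s : ℝ => (((R (s / Ω))⁻¹ : ℝ) : ℂ)) :=
    Complex.ofRealCLM.contDiff.comp ((hR.comp hl).inv fun s => hR0 _)
  refine ⟨fun s => w1 (s / Ω) * (((R (s / Ω))⁻¹ : ℝ) : ℂ), fun s => w2 (s / Ω), ⟨?_, fun s => ?_⟩,
    ⟨h2.comp hl, fun s => ?_⟩, ?_⟩
  · exact (h1.comp hl).mul hRc
  · simp only [hper, hRp (s / Ω)]
    rw [show w1 (s / Ω + 2 * Real.pi / Ω) = w1 (s / Ω) from h3 _]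
  · simp only [hper]
    exact h4 _
  · refine Prod.ext (funext fun x => ?_) (funext fun x => ?_)
    · have : (R x : ℂ) ≠ 0 := by exact_mod_cast hR0 x
      simp only [toPert, mul_div_cancel_left₀ x hΩ]
      push_cast
      field_simp
    · simp only [toPert, mul_div_cancel_left₀ x hΩ]

theorem toPert_inj {R : ℝ → ℝ} {Ω : ℝ} {ρ θ ρ' θ' : ℝ → ℂ} (hΩ : Ω ≠ 0) (hR0 : ∀ x, R x ≠ 0) :
    toPert R Ω ρ θ = toPert R Ω ρ' θ' ↔ ρ = ρ' ∧ θ = θ' := by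
  constructor
  · intro h
    have h1 := congrArg Prod.fst h
    have h2 := congrArg Prod.snd h
    refine ⟨funext fun s => ?_, funext fun s => ?_⟩
    · have := congrFun h1 (s / Ω)
      simp only [toPert, mul_div_cancel₀ s hΩ] at this
      exact mul_left_cancel₀ (by exact_mod_cast hR0 _) this
    · have := congrFun h2 (s / Ω)
      simpa only [toPert, mul_div_cancel₀ s hΩ] using this
  · rintro ⟨rfl, rfl⟩
    rfl

theorem smul_toPert (R : ℝ → ℝ) (Ω : ℝ) (σ : ℂ) (ρ θ : ℝ → ℂ) :
    σ • toPert R Ω ρ θ = toPert R Ω (fun s => σ * ρ s) (fun s => σ * θ s) := by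
  refine Prod.ext (funext fun x => ?_) (funext fun x => ?_)
  · simp [toPert]
    ring
  · simp [toPert]

theorem add_toPert (R : ℝ → ℝ) (Ω : ℝ) (ρ θ ρ' θ' : ℝ → ℂ) :
    toPert R Ω ρ θ + toPert R Ω ρ' θ' = toPert R Ω (fun s => ρ s + ρ' s) (fun s => θ s + θ' s) := by
  refine Prod.ext (funext fun x => ?_) (funext fun x => ?_)
  · simp [toPert]
    ring
  · simp [toPert]

theorem phaseMode_eq_toPert (R : ℝ → ℝ) (Ω : ℝ) :
    phaseMode = toPert R Ω (fun _ => 0) (fun _ => 1) := by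
  simp [phaseMode, toPert]

theorem translationMode_eq_toPert {R φ y ψ : ℝ → ℝ} {Ω : ℝ}
    (hy : ∀ x, deriv R x = Ω * y (Ω * x) * R x) (hψ : ∀ x, deriv φ x = Ω * ψ (Ω * x)) :
    translationMode R φ
      = (Ω : ℂ) • toPert R Ω (fun s => (y s : ℂ)) (fun s => (ψ s : ℂ)) := by
  refine Prod.ext (funext fun x => ?_) (funext fun x => ?_)
  · simp [translationMode, toPert, hy]
    ring
  · simp [translationMode, toPert, hψ]

/-! ### Resolvent estimates for single Fourier modes -/

/-- Multiply the polynomial by the conjugate of σ: the real part is |σ|² Re σ + a|σ|² + D Re σ, and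
the first and last terms are nonnegative. This bound serves for large σ. -/
theorem mul_norm_le_norm_quadratic {a D : ℝ} (hD : 0 ≤ D) {σ : ℂ} (hre : 0 ≤ σ.re) :
    a * ‖σ‖ ≤ ‖σ ^ 2 + (a : ℂ) * σ + (D : ℂ)‖ := by
  set p := σ ^ 2 + (a : ℂ) * σ + (D : ℂ) with hp
  rcases eq_or_ne σ 0 with h0 | h0
  · rw [h0, norm_zero, mul_zero]
    exact norm_nonneg _
  · have hn : 0 < ‖σ‖ := norm_pos_iff.mpr h0
    have h1 : (p * (starRingEnd ℂ) σ).re = ‖σ‖ ^ 2 * σ.re + a * ‖σ‖ ^ 2 + D * σ.re := by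
      rw [← Complex.normSq_eq_norm_sq, Complex.normSq_apply]
      simp [hp, pow_two]
      ring
    have h2 : (p * (starRingEnd ℂ) σ).re ≤ ‖p‖ * ‖σ‖ := by
      refine (Complex.re_le_norm _).trans ?_
      rw [norm_mul, RCLike.norm_conj]
    rw [h1] at h2
    have q1 : 0 ≤ ‖σ‖ ^ 2 * σ.re := by positivity
    have q2 : 0 ≤ D * σ.re := mul_nonneg hD hre
    refine le_of_mul_le_mul_right ?_ hn
    linarith [pow_two ‖σ‖, mul_assoc a ‖σ‖ ‖σ‖]

/-- Triangle inequality with the constant term dominant; it serves for small σ. -/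
theorem sub_le_norm_quadratic {a D : ℝ} (ha : 0 ≤ a) (σ : ℂ) :
    D - a * ‖σ‖ - ‖σ‖ ^ 2 ≤ ‖σ ^ 2 + (a : ℂ) * σ + (D : ℂ)‖ := by
  set p := σ ^ 2 + (a : ℂ) * σ + (D : ℂ) with hp
  have h1 : (D : ℂ) = p - (a : ℂ) * σ - σ ^ 2 := by rw [hp]; ring
  have h2 : ‖(D : ℂ)‖ ≤ ‖p‖ + a * ‖σ‖ + ‖σ‖ ^ 2 := by
    rw [h1]
    refine (norm_sub_le _ _).trans ?_
    rw [norm_pow]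
    refine add_le_add ((norm_sub_le _ _).trans ?_) le_rfl
    rw [norm_mul, Complex.norm_real, Real.norm_of_nonneg ha]
  rw [Complex.norm_real, Real.norm_eq_abs] at h2
  linarith [le_abs_self D]

/-- Lower bound for the characteristic polynomial of the higher Fourier modes. -/
theorem exists_charPoly_lower_bound {μ q₀ : ℝ} (α : ℝ) (hμ : 0 < μ) (hq₀ : 0 < q₀) :
    ∃ c > 0, c ≤ μ ∧ ∃ m > 0, ∀ q : ℝ, 3 * q₀ ≤ q → ∀ σ : ℂ, -c ≤ σ.re →
      m * (q * (q + ‖σ‖)) ≤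
        ‖σ ^ 2 + ((2 * q + 2 * μ : ℝ) : ℂ) * σ + (((1 + α ^ 2) * (q * (q - q₀)) : ℝ) : ℂ)‖ := by
  -- The three bounds keep the shifted polynomial in σ + c good: linear coefficient at least 2q,
  -- constant term at least q²/2.
  set c := min μ (min (q₀ / 8) (q₀ ^ 2 / (4 * μ))) with hc
  have hc0 : 0 < c := lt_min hμ (lt_min (by positivity) (by positivity))
  have hc1 : c ≤ μ := min_le_left _ _
  have hc2 : c ≤ q₀ / 8 := (min_le_right _ _).trans (min_le_left _ _)
  have hc3 : c ≤ q₀ ^ 2 / (4 * μ) := (min_le_right _ _).trans (min_le_right _ _)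
  have hc3' : 4 * μ * c ≤ q₀ ^ 2 := by
    rw [le_div_iff₀ (by positivity)] at hc3
    linarith
  set A := 2 + 2 * μ / (3 * q₀) with hA
  have hA2 : 2 ≤ A := by
    have : 0 ≤ 2 * μ / (3 * q₀) := by positivity
    linarith
  -- The ratio |σ'|/q that separates the regime of the constant term from that of the linear term;
  -- tA = 1/8 bounds the linear term by q²/8 in the former.
  set t := 1 / (8 * A) with ht
  have ht0 : 0 < t := by positivity
  have htA : t * A = 1 / 8 := by
    rw [ht]
    field_simp
  have ht1 : t ≤ 1 / 16 := by linarith [mul_le_mul_of_nonneg_left hA2 ht0.le]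
  refine ⟨c, hc0, hc1, t / 2, by positivity, fun q hq σ hσ => ?_⟩
  have hqpos : 0 < q := by linarith
  set σ' : ℂ := σ + c with hσ'
  have hre : 0 ≤ σ'.re := by
    simp [hσ']
    linarith
  set a' : ℝ := 2 * q + 2 * μ - 2 * c with ha'
  set D' : ℝ := (1 + α ^ 2) * (q * (q - q₀)) - (2 * q + 2 * μ) * c + c ^ 2 with hD'
  have hp : σ ^ 2 + ((2 * q + 2 * μ : ℝ) : ℂ) * σ + (((1 + α ^ 2) * (q * (q - q₀)) : ℝ) : ℂ)
      = σ' ^ 2 + (a' : ℂ) * σ' + (D' : ℂ) := by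
    rw [hσ', ha', hD']
    push_cast
    ring
  rw [hp]
  set p := σ' ^ 2 + (a' : ℂ) * σ' + (D' : ℂ) with hpdef
  have ha'1 : 2 * q ≤ a' := by linarith
  have ha'2 : a' ≤ A * q := by
    have : 2 * μ ≤ 2 * μ / (3 * q₀) * q := by
      rw [div_mul_eq_mul_div, le_div_iff₀ (by positivity)]
      nlinarith
    rw [hA]
    linarith
  have hD'1 : q ^ 2 / 2 ≤ D' := by
    have h0 := mul_le_mul_of_nonneg_left hq hqpos.le
    have h1 : 2 / 3 * q ^ 2 ≤ q * (q - q₀) := by linarith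
    have h2 : q * (q - q₀) ≤ (1 + α ^ 2) * (q * (q - q₀)) :=
      le_mul_of_one_le_left (le_trans (by positivity) h1) (by linarith [sq_nonneg α])
    have h3 : 2 * q * c ≤ q ^ 2 / 12 := by
      have : 2 * q * c ≤ 2 * q * (q / 24) := mul_le_mul_of_nonneg_left (by linarith) (by positivity)
      linarith
    have h4 : 2 * μ * c ≤ q ^ 2 / 12 := by
      have : (3 * q₀) ^ 2 ≤ q ^ 2 := pow_le_pow_left₀ (by positivity) hq 2
      linarith [sq_nonneg q₀]
    linarith [sq_nonneg c]
  have hD'0 : 0 ≤ D' := le_trans (by positivity) hD'1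
  have hb1 : 2 * q * ‖σ'‖ ≤ ‖p‖ := (mul_le_mul_of_nonneg_right ha'1 (norm_nonneg _)).trans
    (mul_norm_le_norm_quadratic hD'0 hre)
  have hσσ' : ‖σ‖ ≤ ‖σ'‖ + c := by
    have : σ = σ' - c := by rw [hσ']; ring
    rw [this]
    refine (norm_sub_le _ _).trans ?_
    rw [Complex.norm_real, Real.norm_of_nonneg hc0.le]
  have hfin : q * (q + ‖σ‖) ≤ 2 * (q * (q + ‖σ'‖)) := by
    have : q + ‖σ‖ ≤ 2 * (q + ‖σ'‖) := by linarith [norm_nonneg σ']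
    linarith [mul_le_mul_of_nonneg_left this hqpos.le]
  suffices h : t * (q * (q + ‖σ'‖)) ≤ ‖p‖ by
    linarith [mul_le_mul_of_nonneg_left hfin ht0.le]
  have htq : t * q ≤ q / 16 := by linarith [mul_le_mul_of_nonneg_right ht1 hqpos.le]
  rcases le_total ‖σ'‖ (t * q) with hs | hs
  · have h1 : D' - a' * ‖σ'‖ - ‖σ'‖ ^ 2 ≤ ‖p‖ := sub_le_norm_quadratic (by linarith) σ'
    have h2 : a' * ‖σ'‖ ≤ q ^ 2 / 8 := by
      have : a' * ‖σ'‖ ≤ (A * q) * (t * q) :=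
        mul_le_mul ha'2 hs (norm_nonneg _) (by positivity)
      calc _ ≤ _ := this
        _ = (t * A) * q ^ 2 := by ring
        _ = q ^ 2 / 8 := by rw [htA]; ring
    have h3 : ‖σ'‖ ^ 2 ≤ q ^ 2 / 256 := by
      have := pow_le_pow_left₀ (norm_nonneg σ') (hs.trans htq) 2
      linarith
    have h4 : t * (q * (q + ‖σ'‖)) ≤ 1 / 16 * (q * (2 * q)) := by
      have : ‖σ'‖ ≤ q := hs.trans (by linarith)
      refine mul_le_mul ht1 (mul_le_mul_of_nonneg_left (by linarith) hqpos.le) (by positivity)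
        (by norm_num)
    linarith [sq_nonneg q]
  · have : t * (q + ‖σ'‖) ≤ 2 * ‖σ'‖ := by
      linarith [mul_le_mul_of_nonneg_right ht1 (norm_nonneg σ'), norm_nonneg σ']
    linarith [mul_le_mul_of_nonneg_left this hqpos.le]

/-- Estimate for a `2 × 2` system by Cramer's rule, for the higher Fourier modes. -/
theorem mode_estimate_high {μ q₀ m : ℝ} {α β : ℝ} (hμ : 0 < μ) (hq₀ : 0 < q₀) (hm : 0 < m)
    (hκ : (1 + α ^ 2) * q₀ = -2 * μ * (1 + α * β)) {q : ℝ} (hq : 3 * q₀ ≤ q) {σ : ℂ}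
    (hp : m * (q * (q + ‖σ‖)) ≤
      ‖σ ^ 2 + ((2 * q + 2 * μ : ℝ) : ℂ) * σ + (((1 + α ^ 2) * (q * (q - q₀)) : ℝ) : ℂ)‖)
    {u v f₁ f₂ : ℂ} (h₁ : f₁ = -q * (u - α * v) - 2 * μ * u - σ * u)
    (h₂ : f₂ = -q * (α * u + v) - 2 * β * μ * u - σ * v) :
    q * ‖u‖ ≤ (1 + |α| + μ * (1 + |β|) / q₀) / m * (‖f₁‖ + ‖f₂‖) ∧
      q * ‖v‖ ≤ (1 + |α| + μ * (1 + |β|) / q₀) / m * (‖f₁‖ + ‖f₂‖) := by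
  set p := σ ^ 2 + ((2 * q + 2 * μ : ℝ) : ℂ) * σ + (((1 + α ^ 2) * (q * (q - q₀)) : ℝ) : ℂ) with hpd
  have hqpos : 0 < q := by linarith
  have hκ' : ((1 + α ^ 2) * q₀ : ℂ) = -2 * μ * (1 + α * β) := by exact_mod_cast hκ
  -- Cramer's rule. The relation for q₀ makes p the determinant of the mode matrix.
  have hu : p * u = (-q - σ) * f₁ - α * q * f₂ := by
    rw [h₁, h₂, hpd]
    push_cast
    linear_combination (-(q * u) : ℂ) * hκ'
  have hv : p * v = (-q - 2 * μ - σ) * f₂ + (α * q + 2 * β * μ) * f₁ := by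
    rw [h₁, h₂, hpd]
    push_cast
    linear_combination (-(q * v) : ℂ) * hκ'
  set B := 1 + |α| + μ * (1 + |β|) / q₀ with hB
  have hBpos : 0 < B := by positivity
  have hσ := norm_nonneg σ
  have hf₁ := norm_nonneg f₁
  have hf₂ := norm_nonneg f₂
  have hμq : 2 * μ ≤ (μ / q₀) * q := by
    rw [div_mul_eq_mul_div, le_div_iff₀ hq₀]
    nlinarith
  have hBe : B = 1 + |α| + μ / q₀ + μ / q₀ * |β| := by
    rw [hB]
    ring
  have hμq₀ : 0 ≤ μ / q₀ := by positivity
  have main : ∀ z : ℂ, ‖p * z‖ ≤ B * (q + ‖σ‖) * (‖f₁‖ + ‖f₂‖) →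
      q * ‖z‖ ≤ B / m * (‖f₁‖ + ‖f₂‖) := by
    intro z hz
    rw [norm_mul] at hz
    have h1 : m * (q * (q + ‖σ‖)) * ‖z‖ ≤ B * (q + ‖σ‖) * (‖f₁‖ + ‖f₂‖) :=
      (mul_le_mul_of_nonneg_right hp (norm_nonneg z)).trans hz
    have h2 : m * (q * ‖z‖) ≤ B * (‖f₁‖ + ‖f₂‖) := by
      refine le_of_mul_le_mul_right ?_ (show 0 < q + ‖σ‖ by linarith)
      linarith
    rw [div_mul_eq_mul_div, le_div_iff₀ hm]
    linarith
  have hnq : ‖(q : ℂ)‖ = q := by rw [Complex.norm_real, Real.norm_of_nonneg hqpos.le]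
  have hnμ : ‖(μ : ℂ)‖ = μ := by rw [Complex.norm_real, Real.norm_of_nonneg hμ.le]
  have hnα : ‖(α : ℂ)‖ = |α| := by rw [Complex.norm_real, Real.norm_eq_abs]
  have hnβ : ‖(β : ℂ)‖ = |β| := by rw [Complex.norm_real, Real.norm_eq_abs]
  have hα := abs_nonneg α
  have hβ := abs_nonneg β
  have e1 : q + ‖σ‖ ≤ B * (q + ‖σ‖) :=
    le_mul_of_one_le_left (by positivity) (by rw [hBe]; nlinarith [mul_nonneg hμq₀ hβ])
  constructor
  · refine main u ?_
    rw [hu]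
    refine (norm_sub_le _ _).trans ?_
    rw [norm_mul, norm_mul, norm_mul, hnα, hnq]
    have t1 : ‖-(q : ℂ) - σ‖ ≤ q + ‖σ‖ := by
      refine (norm_sub_le _ _).trans ?_
      rw [norm_neg, hnq]
    have t2 : |α| * q ≤ B * (q + ‖σ‖) :=
      mul_le_mul (by rw [hBe]; nlinarith [mul_nonneg hμq₀ hβ]) (by linarith) hqpos.le hBpos.le
    calc _ ≤ B * (q + ‖σ‖) * ‖f₁‖ + B * (q + ‖σ‖) * ‖f₂‖ := by
          gcongr
          exact t1.trans e1
      _ = _ := by ring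
  · refine main v ?_
    rw [hv]
    refine (norm_add_le _ _).trans ?_
    rw [norm_mul, norm_mul]
    have t1 : ‖-(q : ℂ) - 2 * μ - σ‖ ≤ B * (q + ‖σ‖) := by
      refine (norm_sub_le _ _).trans ?_
      have : ‖-(q : ℂ) - 2 * μ‖ ≤ q + 2 * μ := by
        refine (norm_sub_le _ _).trans ?_
        rw [norm_neg, hnq, norm_mul, hnμ]
        simp
      have h3 : (1 + μ / q₀) * (q + ‖σ‖) ≤ B * (q + ‖σ‖) := by
        refine mul_le_mul_of_nonneg_right ?_ (by positivity)
        rw [hBe]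
        nlinarith [mul_nonneg hμq₀ hβ]
      nlinarith [mul_nonneg hμq₀ hσ]
    have t2 : ‖(α * q + 2 * β * μ : ℂ)‖ ≤ B * (q + ‖σ‖) := by
      refine (norm_add_le _ _).trans ?_
      rw [norm_mul, norm_mul, norm_mul, hnα, hnβ, hnq, hnμ, Complex.norm_ofNat]
      have h3 : (|α| + μ / q₀ * |β|) * (q + ‖σ‖) ≤ B * (q + ‖σ‖) := by
        refine mul_le_mul_of_nonneg_right ?_ (by positivity)
        rw [hBe]
        linarith
      nlinarith [mul_nonneg (mul_nonneg hμq₀ hβ) hσ, mul_nonneg hα hσ,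
        mul_le_mul_of_nonneg_left hμq hβ]
    calc _ ≤ B * (q + ‖σ‖) * ‖f₂‖ + B * (q + ‖σ‖) * ‖f₁‖ := by
          gcongr
      _ = _ := by ring

/-- Resolvent estimate for all Fourier modes, uniform for spectral parameters in a half plane. -/
theorem exists_mode_estimate {μ q₀ α β : ℝ} (hμ : 0 < μ) (hq₀ : 0 < q₀)
    (hκ : (1 + α ^ 2) * q₀ = -2 * μ * (1 + α * β)) :
    ∃ c > 0, c ≤ μ ∧ (∃ m > 0, ∀ q : ℝ, 3 * q₀ ≤ q → ∀ σ : ℂ, -c ≤ σ.re →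
      m * (q * (q + ‖σ‖)) ≤
        ‖σ ^ 2 + ((2 * q + 2 * μ : ℝ) : ℂ) * σ + (((1 + α ^ 2) * (q * (q - q₀)) : ℝ) : ℂ)‖) ∧
      ∃ M > 0, ∀ σ : ℂ, -c ≤ σ.re → ∀ k : ℤ, ∀ u v f₁ f₂ : ℂ,
        (k = 0 → v = β * u) → (k = 1 ∨ k = -1 → u + α * v = 0) →
        f₁ = -(q₀ * k ^ 2 : ℝ) * (u - α * v) - 2 * μ * u - σ * u →
        f₂ = -(q₀ * k ^ 2 : ℝ) * (α * u + v) - 2 * β * μ * u - σ * v →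
        (1 + (k : ℝ) ^ 2) ^ 2 * (‖u‖ ^ 2 + ‖v‖ ^ 2) ≤ M * (‖f₁‖ ^ 2 + ‖f₂‖ ^ 2) := by
  obtain ⟨c, hc, hcμ, m, hm, hp⟩ := exists_charPoly_lower_bound α hμ hq₀
  refine ⟨c, hc, hcμ, ⟨m, hm, hp⟩, ?_⟩
  set B := (1 + |α| + μ * (1 + |β|) / q₀) / m with hB
  have hB0 : 0 < B := by positivity
  refine ⟨(1 + β ^ 2) / μ ^ 2 + 4 * (1 + α ^ 2) / μ ^ 2 + 16 * B ^ 2 / q₀ ^ 2, by positivity,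
    fun σ hσ k u v f₁ f₂ h0 h1 e₁ e₂ => ?_⟩
  have hα2 : 0 ≤ 4 * (1 + α ^ 2) / μ ^ 2 := by positivity
  have hβ2 : 0 ≤ (1 + β ^ 2) / μ ^ 2 := by positivity
  have hB2 : 0 ≤ 16 * B ^ 2 / q₀ ^ 2 := by positivity
  have hf₁ : 0 ≤ ‖f₁‖ ^ 2 := by positivity
  have hf₂ : 0 ≤ ‖f₂‖ ^ 2 := by positivity
  have hdiv : ∀ (r : ℝ) (z : ℂ), μ ≤ r + σ.re → μ ^ 2 * ‖z‖ ^ 2 ≤ ‖((r : ℂ) + σ) * z‖ ^ 2 := by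
    intro r z hr
    rw [norm_mul, mul_pow]
    have : μ ≤ ‖(r : ℂ) + σ‖ := hr.trans ((by simp : r + σ.re = ((r : ℂ) + σ).re).le.trans
      (Complex.re_le_norm _))
    gcongr
  -- The condition v = βu selects the eigenvector of the mode-0 matrix with eigenvalue −2μ, so the
  -- kernel is excluded and f₁ alone controls u and v.
  by_cases hk0 : k = 0
  · subst hk0
    have hv := h0 rfl
    have hfu : f₁ = -(((2 * μ : ℝ) : ℂ) + σ) * u := by
      rw [e₁]
      push_cast
      ring
    have h3 := hdiv (2 * μ) u (by linarith)
    have h4 : ‖f₁‖ ^ 2 = ‖(((2 * μ : ℝ) : ℂ) + σ) * u‖ ^ 2 := by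
      rw [hfu, neg_mul, norm_neg]
    rw [← h4] at h3
    have h5 : ‖v‖ ^ 2 = β ^ 2 * ‖u‖ ^ 2 := by
      rw [hv, norm_mul, mul_pow, Complex.norm_real, Real.norm_eq_abs, sq_abs]
    have h6 : ‖u‖ ^ 2 + ‖v‖ ^ 2 ≤ (1 + β ^ 2) / μ ^ 2 * ‖f₁‖ ^ 2 := by
      rw [h5, div_mul_eq_mul_div, le_div_iff₀ (by positivity)]
      nlinarith [mul_le_mul_of_nonneg_left h3 (show 0 ≤ 1 + β ^ 2 by positivity)]
    simp only [Int.cast_zero]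
    nlinarith [mul_nonneg hα2 hf₁, mul_nonneg hB2 hf₁, mul_nonneg hα2 hf₂, mul_nonneg hB2 hf₂,
      mul_nonneg hβ2 hf₂]
  -- The condition u + αv = 0 describes the range of the critical matrix, which is its eigenspace
  -- for −(2q₀ + 2μ).
  by_cases hk1 : k = 1 ∨ k = -1
  · have hu : u = -(α * v) := by linear_combination h1 hk1
    have hk2 : (k : ℝ) ^ 2 = 1 := by
      rcases hk1 with h | h <;> simp [h]
    have hκ' : ((1 + α ^ 2) * q₀ : ℂ) = -2 * μ * (1 + α * β) := by exact_mod_cast hκ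
    have hfv : f₂ = -(((2 * q₀ + 2 * μ : ℝ) : ℂ) + σ) * v := by
      rw [e₂, hu, hk2]
      push_cast
      linear_combination v * hκ'
    have h3 := hdiv (2 * q₀ + 2 * μ) v (by linarith)
    have h4 : ‖f₂‖ ^ 2 = ‖(((2 * q₀ + 2 * μ : ℝ) : ℂ) + σ) * v‖ ^ 2 := by
      rw [hfv, neg_mul, norm_neg]
    rw [← h4] at h3
    have h5 : ‖u‖ ^ 2 = α ^ 2 * ‖v‖ ^ 2 := by
      rw [hu, norm_neg, norm_mul, mul_pow, Complex.norm_real, Real.norm_eq_abs, sq_abs]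
    have h6 : 4 * (‖u‖ ^ 2 + ‖v‖ ^ 2) ≤ 4 * (1 + α ^ 2) / μ ^ 2 * ‖f₂‖ ^ 2 := by
      rw [h5, div_mul_eq_mul_div, le_div_iff₀ (by positivity)]
      nlinarith [mul_le_mul_of_nonneg_left h3 (show 0 ≤ 1 + α ^ 2 by positivity)]
    rw [hk2]
    nlinarith [mul_nonneg hβ2 hf₁, mul_nonneg hB2 hf₁, mul_nonneg hα2 hf₁, mul_nonneg hB2 hf₂,
      mul_nonneg hβ2 hf₂]
  · have hk4 : (4 : ℝ) ≤ (k : ℝ) ^ 2 := by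
      have : (2 : ℤ) ≤ |k| := by
        push Not at hk1
        rcases abs_cases k with h | h <;> omega
      have h2 : (4 : ℤ) ≤ k ^ 2 := by
        rw [← sq_abs]
        nlinarith
      exact_mod_cast h2
    set q := q₀ * (k : ℝ) ^ 2 with hq
    have hq3 : 3 * q₀ ≤ q := by nlinarith
    obtain ⟨hu, hv⟩ := mode_estimate_high hμ hq₀ hm hκ hq3 (hp q hq3 σ hσ) (u := u) (v := v)
      (f₁ := f₁) (f₂ := f₂) (by rw [e₁]) (by rw [e₂])
    rw [← hB] at hu hv
    have hk : (1 + (k : ℝ) ^ 2) ^ 2 ≤ 4 / q₀ ^ 2 * q ^ 2 := by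
      have : 4 / q₀ ^ 2 * q ^ 2 = (2 * (k : ℝ) ^ 2) ^ 2 := by
        rw [hq]
        field_simp
        ring
      rw [this]
      gcongr
      linarith
    have hsq : ∀ z : ℂ, q * ‖z‖ ≤ B * (‖f₁‖ + ‖f₂‖) →
        q ^ 2 * ‖z‖ ^ 2 ≤ 2 * B ^ 2 * (‖f₁‖ ^ 2 + ‖f₂‖ ^ 2) := by
      intro z hz
      have hq0 : 0 ≤ q * ‖z‖ := mul_nonneg (by linarith) (norm_nonneg z)
      have h1 : (q * ‖z‖) ^ 2 ≤ (B * (‖f₁‖ + ‖f₂‖)) ^ 2 := pow_le_pow_left₀ hq0 hz 2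
      have h2 : (‖f₁‖ + ‖f₂‖) ^ 2 ≤ 2 * (‖f₁‖ ^ 2 + ‖f₂‖ ^ 2) := add_sq_le
      calc q ^ 2 * ‖z‖ ^ 2 = (q * ‖z‖) ^ 2 := by ring
        _ ≤ B ^ 2 * (‖f₁‖ + ‖f₂‖) ^ 2 := by rw [← mul_pow]; exact h1
        _ ≤ B ^ 2 * (2 * (‖f₁‖ ^ 2 + ‖f₂‖ ^ 2)) := by gcongr
        _ = _ := by ring
    have h3 := hsq u hu
    have h4 := hsq v hv
    have h5 : (1 + (k : ℝ) ^ 2) ^ 2 * (‖u‖ ^ 2 + ‖v‖ ^ 2)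
        ≤ 16 * B ^ 2 / q₀ ^ 2 * (‖f₁‖ ^ 2 + ‖f₂‖ ^ 2) := by
      calc _ ≤ 4 / q₀ ^ 2 * q ^ 2 * (‖u‖ ^ 2 + ‖v‖ ^ 2) := by gcongr
        _ = 4 / q₀ ^ 2 * (q ^ 2 * ‖u‖ ^ 2 + q ^ 2 * ‖v‖ ^ 2) := by ring
        _ ≤ 4 / q₀ ^ 2 * (2 * B ^ 2 * (‖f₁‖ ^ 2 + ‖f₂‖ ^ 2)
            + 2 * B ^ 2 * (‖f₁‖ ^ 2 + ‖f₂‖ ^ 2)) := by gcongr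
        _ = _ := by ring
    nlinarith [mul_nonneg hβ2 hf₁, mul_nonneg hα2 hf₁, mul_nonneg hα2 hf₂, mul_nonneg hβ2 hf₂]

/-! ### Fourier coefficients, mean squares and the Sobolev norm -/

/-- Fourier coefficients on `[0, 2π]`. -/
def fc (f : ℝ → ℂ) (k : ℤ) : ℂ := fourierCoeffOn Real.two_pi_pos f k

theorem fc_eq_integral (f : ℝ → ℂ) (k : ℤ) :
    fc f k = (1 / (2 * Real.pi) : ℝ) •
      ∫ x in (0 : ℝ)..(2 * Real.pi), fourier (-k) (x : AddCircle (2 * Real.pi - 0)) * f x := by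
  rw [fc, fourierCoeffOn_eq_integral]
  simp [sub_zero]

theorem continuous_fourier_coe (k : ℤ) :
    Continuous fun x : ℝ => fourier k (x : AddCircle (2 * Real.pi - 0)) :=
  (fourier k).continuous.comp (AddCircle.continuous_mk' _)

theorem fc_add {f g : ℝ → ℂ} (hf : Continuous f) (hg : Continuous g) (k : ℤ) :
    fc (fun x => f x + g x) k = fc f k + fc g k := by
  simp only [fc_eq_integral, mul_add]
  have h1 : Continuous fun x : ℝ => fourier (-k) (x : AddCircle (2 * Real.pi - 0)) * f x :=
    (continuous_fourier_coe (-k)).mul hf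
  have h2 : Continuous fun x : ℝ => fourier (-k) (x : AddCircle (2 * Real.pi - 0)) * g x :=
    (continuous_fourier_coe (-k)).mul hg
  rw [intervalIntegral.integral_add (h1.intervalIntegrable _ _) (h2.intervalIntegrable _ _),
    smul_add]

theorem fc_const_mul (c : ℂ) (f : ℝ → ℂ) (k : ℤ) : fc (fun x => c * f x) k = c * fc f k :=
  fourierCoeffOn.const_mul f c k _

theorem fc_neg (f : ℝ → ℂ) (k : ℤ) : fc (fun x => -f x) k = -fc f k := by
  have := fc_const_mul (-1) f k
  simpa using this

/-- Integration by parts. Frequency zero is treated apart because the library identity divides by k.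
-/
theorem fc_hasDerivAt {f f' : ℝ → ℂ} (hp : Function.Periodic f (2 * Real.pi))
    (hd : ∀ x, HasDerivAt f (f' x) x) (hc : Continuous f') (k : ℤ) :
    fc f' k = Complex.I * k * fc f k := by
  have hper : f (2 * Real.pi) = f 0 := by simpa using hp 0
  by_cases hk : k = 0
  · subst hk
    rw [fc_eq_integral]
    simp only [neg_zero, fourier_zero, one_mul, Int.cast_zero, mul_zero, zero_mul]
    rw [intervalIntegral.integral_eq_sub_of_hasDerivAt (fun x _ => hd x)
      (hc.intervalIntegrable _ _), hper, sub_self, smul_zero]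
  · have h := fourierCoeffOn_of_hasDerivAt Real.two_pi_pos hk (fun x _ => hd x)
      (hc.intervalIntegrable _ _)
    rw [hper, sub_self, mul_zero, zero_sub] at h
    rw [fc, fc, h]
    have hkc : (k : ℂ) ≠ 0 := by exact_mod_cast hk
    have hπ : (Real.pi : ℂ) ≠ 0 := by exact_mod_cast Real.pi_ne_zero
    push_cast
    field_simp
    ring

theorem Function.Periodic.deriv_add_complex {f : ℝ → ℂ} {c : ℝ} (h : Function.Periodic f c)
    (x : ℝ) : deriv f (x + c) = deriv f x := by
  rw [← deriv_comp_add_const, show (fun x => f (x + c)) = f from funext h]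

theorem IsC2Per.continuous {f : ℝ → ℂ} (hf : IsC2Per f) : Continuous f := hf.1.continuous

theorem IsC2Per.continuous_deriv {f : ℝ → ℂ} (hf : IsC2Per f) : Continuous (deriv f) :=
  continuous_iff_continuousAt.mpr fun x => (hasDerivAt_of_contDiff_two hf.1 x).2.continuousAt

theorem IsC2Per.continuous_deriv_deriv {f : ℝ → ℂ} (hf : IsC2Per f) :
    Continuous (deriv (deriv f)) := by
  have h := contDiff_succ_iff_deriv (n := 1) (f := f) (𝕜 := ℝ)
  have h1 : ContDiff ℝ 1 (deriv f) := (h.mp (by simpa [one_add_one_eq_two] using hf.1)).2.2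
  exact h1.continuous_deriv le_rfl

theorem IsC2Per.fc_deriv {f : ℝ → ℂ} (hf : IsC2Per f) (k : ℤ) :
    fc (deriv f) k = Complex.I * k * fc f k :=
  fc_hasDerivAt hf.2 (fun x => (hasDerivAt_of_contDiff_two hf.1 x).1) hf.continuous_deriv k

theorem IsC2Per.fc_deriv_deriv {f : ℝ → ℂ} (hf : IsC2Per f) (k : ℤ) :
    fc (deriv (deriv f)) k = -(k : ℂ) ^ 2 * fc f k := by
  rw [fc_hasDerivAt hf.2.deriv_add_complex (fun x => (hasDerivAt_of_contDiff_two hf.1 x).2)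
    hf.continuous_deriv_deriv k, hf.fc_deriv]
  linear_combination (k : ℂ) ^ 2 * fc f k * Complex.I_sq

theorem fc_one_zero : fc (fun _ => 1) 0 = 1 := by
  rw [fc_eq_integral]
  simp
  field_simp

theorem fc_one_of_ne {k : ℤ} (hk : k ≠ 0) : fc (fun _ => 1) k = 0 := by
  have := fc_hasDerivAt (f := fun _ => (1 : ℂ)) (f' := fun _ => 0) (fun _ => rfl)
    (fun x => hasDerivAt_const x _) continuous_const k
  have h0 : fc (fun _ => (0 : ℂ)) k = 0 := by
    simpa using fc_const_mul 0 (fun _ => 1) k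
  rw [h0] at this
  have hkc : (k : ℂ) ≠ 0 := by exact_mod_cast hk
  simpa [hkc] using this.symm

/-- Complex-valued cosine of a real variable. -/
def ccos (x : ℝ) : ℂ := (Real.cos x : ℂ)

/-- Complex-valued sine of a real variable. -/
def csin (x : ℝ) : ℂ := (Real.sin x : ℂ)

theorem hasDerivAt_ccos (x : ℝ) : HasDerivAt ccos (-csin x) x := by
  have := (Real.hasDerivAt_cos x).ofReal_comp
  exact this.congr_deriv (by simp [csin])

theorem hasDerivAt_csin (x : ℝ) : HasDerivAt csin (ccos x) x :=
  (Real.hasDerivAt_sin x).ofReal_comp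

theorem isC2Per_ccos : IsC2Per ccos :=
  ⟨Complex.ofRealCLM.contDiff.comp Real.contDiff_cos, fun x => by simp [ccos]⟩

theorem isC2Per_csin : IsC2Per csin :=
  ⟨Complex.ofRealCLM.contDiff.comp Real.contDiff_sin, fun x => by simp [csin]⟩

theorem deriv_realCos : deriv ccos = fun x => -csin x := funext fun x => (hasDerivAt_ccos x).deriv

theorem deriv2_realCos : deriv (deriv ccos) = fun x => -ccos x := by
  rw [deriv_realCos]
  exact funext fun x => (hasDerivAt_csin x).neg.deriv

theorem fc_csin_eq (k : ℤ) : fc csin k = -(Complex.I * k * fc ccos k) := by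
  have := isC2Per_ccos.fc_deriv k
  rw [deriv_realCos, fc_neg] at this
  linear_combination -this

/-- From cos'' = −cos every coefficient satisfies (k² − 1)c_k = 0. -/
theorem fc_ccos_of_ne {k : ℤ} (h : (k : ℂ) ^ 2 ≠ 1) : fc ccos k = 0 := by
  have h1 := isC2Per_ccos.fc_deriv_deriv k
  rw [deriv2_realCos, fc_neg] at h1
  have h2 : ((k : ℂ) ^ 2 - 1) * fc ccos k = 0 := by linear_combination h1
  exact (mul_eq_zero.mp h2).resolve_left (sub_ne_zero.mpr h)

theorem fc_ccos_zero : fc ccos 0 = 0 := fc_ccos_of_ne (by simp)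

theorem fc_exp_self (k : ℤ) : fc (fun x : ℝ => Complex.exp (Complex.I * k * x)) k = 1 := by
  rw [fc_eq_integral]
  have : ∀ x : ℝ, fourier (-k) (x : AddCircle (2 * Real.pi - 0)) * Complex.exp (Complex.I * k * x)
      = 1 := by
    intro x
    rw [fourier_coe_apply, ← Complex.exp_add, ← Complex.exp_zero]
    congr 1
    have hπ : (Real.pi : ℂ) ≠ 0 := by exact_mod_cast Real.pi_ne_zero
    push_cast
    rw [sub_zero]
    field_simp
    ring
  simp only [this]
  simp
  field_simp

theorem fc_ccos_one : fc ccos 1 = 1 / 2 := by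
  have h1 : (fun x : ℝ => Complex.exp (Complex.I * (1 : ℤ) * x))
      = fun x => ccos x + Complex.I * csin x := by
    funext x
    rw [Int.cast_one, mul_one, mul_comm, Complex.exp_mul_I, ccos, csin]
    push_cast
    ring
  have h2 := fc_exp_self 1
  have h3 : Continuous fun x => Complex.I * csin x :=
    continuous_const.mul isC2Per_csin.continuous
  rw [h1, fc_add isC2Per_ccos.continuous h3, fc_const_mul, fc_csin_eq] at h2
  push_cast at h2
  linear_combination (1 / 2 : ℂ) * h2 + (1 / 2 : ℂ) * fc ccos 1 * Complex.I_sq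

theorem fc_ccos_neg_one : fc ccos (-1) = 1 / 2 := by
  have h1 : (fun x : ℝ => Complex.exp (Complex.I * (-1 : ℤ) * x))
      = fun x => ccos x + (-Complex.I) * csin x := by
    funext x
    have : Complex.I * ((-1 : ℤ) : ℂ) * (x : ℂ) = ((-x : ℝ) : ℂ) * Complex.I := by
      push_cast
      ring
    rw [this, Complex.exp_mul_I, ccos, csin, ← Complex.ofReal_cos, ← Complex.ofReal_sin,
      Real.cos_neg, Real.sin_neg]
    push_cast
    ring
  have h2 := fc_exp_self (-1)
  have h3 : Continuous fun x => (-Complex.I) * csin x :=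
    continuous_const.mul isC2Per_csin.continuous
  rw [h1, fc_add isC2Per_ccos.continuous h3, fc_const_mul, fc_csin_eq] at h2
  push_cast at h2
  linear_combination (1 / 2 : ℂ) * h2 + (1 / 2 : ℂ) * fc ccos (-1) * Complex.I_sq

theorem fc_csin_one : fc csin 1 = -Complex.I / 2 := by
  rw [fc_csin_eq, fc_ccos_one]
  push_cast
  ring

/-- Mean value over a period of a real function. -/
def avg (g : ℝ → ℝ) : ℝ := (2 * Real.pi)⁻¹ * ∫ x in (0 : ℝ)..(2 * Real.pi), g x

/-- Mean square over a period. -/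
def msq (f : ℝ → ℂ) : ℝ := avg fun x => ‖f x‖ ^ 2

theorem avg_mono {g g' : ℝ → ℝ} (hg : Continuous g) (hg' : Continuous g') (h : ∀ x, g x ≤ g' x) :
    avg g ≤ avg g' := by
  refine mul_le_mul_of_nonneg_left ?_ (by positivity)
  exact intervalIntegral.integral_mono_on Real.two_pi_pos.le (hg.intervalIntegrable _ _)
    (hg'.intervalIntegrable _ _) fun x _ => h x

theorem avg_add {g g' : ℝ → ℝ} (hg : Continuous g) (hg' : Continuous g') :
    avg (fun x => g x + g' x) = avg g + avg g' := by
  unfold avg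
  rw [intervalIntegral.integral_add (hg.intervalIntegrable _ _) (hg'.intervalIntegrable _ _),
    mul_add]

theorem avg_const_mul (c : ℝ) (g : ℝ → ℝ) : avg (fun x => c * g x) = c * avg g := by
  unfold avg
  rw [intervalIntegral.integral_const_mul]
  ring

theorem avg_const (c : ℝ) : avg (fun _ => c) = c := by
  unfold avg
  simp
  field_simp

theorem msq_nonneg (f : ℝ → ℂ) : 0 ≤ msq f :=
  mul_nonneg (by positivity) (intervalIntegral.integral_nonneg Real.two_pi_pos.le
    fun x _ => by positivity)

theorem msq_le_of_bound {f : ℝ → ℂ} (hf : Continuous f) {C : ℝ} (h : ∀ x, ‖f x‖ ^ 2 ≤ C) :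
    msq f ≤ C := by
  have := avg_mono (hf.norm.pow 2) continuous_const h
  rwa [avg_const] at this

theorem msq_const_mul (c : ℂ) (f : ℝ → ℂ) : msq (fun x => c * f x) = ‖c‖ ^ 2 * msq f := by
  unfold msq
  rw [← avg_const_mul]
  simp only [norm_mul, mul_pow]

theorem msq_add_le {f g : ℝ → ℂ} (hf : Continuous f) (hg : Continuous g) :
    msq (fun x => f x + g x) ≤ 2 * msq f + 2 * msq g := by
  unfold msq
  have c1 : Continuous fun x => 2 * ‖f x‖ ^ 2 := continuous_const.mul (hf.norm.pow 2)
  have c2 : Continuous fun x => 2 * ‖g x‖ ^ 2 := continuous_const.mul (hg.norm.pow 2)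
  rw [← avg_const_mul, ← avg_const_mul, ← avg_add c1 c2]
  refine avg_mono ((hf.add hg).norm.pow 2) (c1.add c2) fun x => ?_
  have h1 : ‖f x + g x‖ ^ 2 ≤ (‖f x‖ + ‖g x‖) ^ 2 :=
    pow_le_pow_left₀ (norm_nonneg _) (norm_add_le _ _) 2
  have h2 : (‖f x‖ + ‖g x‖) ^ 2 ≤ 2 * (‖f x‖ ^ 2 + ‖g x‖ ^ 2) := add_sq_le
  linarith

/-- Parseval's identity; continuity on the compact period gives square integrability. -/
theorem hasSum_fc_sq {f : ℝ → ℂ} (hf : Continuous f) :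
    HasSum (fun k : ℤ => ‖fc f k‖ ^ 2) (msq f) := by
  have hL : MeasureTheory.MemLp f 2
      (MeasureTheory.volume.restrict (Set.Ioc 0 (2 * Real.pi))) := by
    obtain ⟨C, hC⟩ := (isCompact_Icc (a := (0 : ℝ)) (b := 2 * Real.pi)).exists_bound_of_continuousOn
      hf.continuousOn
    refine MeasureTheory.MemLp.of_bound hf.aestronglyMeasurable C ?_
    exact (MeasureTheory.ae_restrict_iff' measurableSet_Ioc).mpr
      (Filter.Eventually.of_forall fun x hx => hC x (Set.Ioc_subset_Icc_self hx))
  have := hasSum_sq_fourierCoeffOn Real.two_pi_pos hL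
  rw [sub_zero, smul_eq_mul] at this
  exact this

theorem norm_fc_sq_le {f : ℝ → ℂ} (hf : Continuous f) (k : ℤ) : ‖fc f k‖ ^ 2 ≤ msq f :=
  le_hasSum (hasSum_fc_sq hf) k fun _ _ => by positivity

theorem eq_zero_of_msq_eq_zero {f : ℝ → ℂ} (hf : Continuous f)
    (hp : Function.Periodic f (2 * Real.pi)) (h : msq f = 0) : f = 0 := by
  have h1 : ∫ x in (0 : ℝ)..(2 * Real.pi), ‖f x‖ ^ 2 = 0 := by
    have h2 : (2 * Real.pi)⁻¹ ≠ 0 := by positivity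
    exact (mul_eq_zero.mp h).resolve_left h2
  have h3 : ∀ x ∈ Set.Ioc 0 (2 * Real.pi), f x = 0 := by
    intro x hx
    by_contra hne
    have := intervalIntegral.integral_pos Real.two_pi_pos (f := fun x => ‖f x‖ ^ 2)
      (hf.norm.pow 2).continuousOn (fun x _ => by positivity)
      ⟨x, Set.Ioc_subset_Icc_self hx, by positivity⟩
    linarith
  funext x
  obtain ⟨y, hy, hxy⟩ := hp.exists_mem_Ioc Real.two_pi_pos x 0
  rw [zero_add] at hy
  rw [hxy, h3 y hy]
  rfl

theorem eq_zero_of_fc_eq_zero {f : ℝ → ℂ} (hf : Continuous f)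
    (hp : Function.Periodic f (2 * Real.pi)) (h : ∀ k, fc f k = 0) : f = 0 := by
  refine eq_zero_of_msq_eq_zero hf hp ?_
  have := hasSum_fc_sq hf
  simp only [h, norm_zero] at this
  exact this.unique (by simpa using hasSum_zero)

/-- Mean square of a function and its first two derivatives. -/
def sobSq (u : ℝ → ℂ) : ℝ := msq u + msq (deriv u) + msq (deriv (deriv u))

theorem sobSq_nonneg (u : ℝ → ℂ) : 0 ≤ sobSq u :=
  add_nonneg (add_nonneg (msq_nonneg _) (msq_nonneg _)) (msq_nonneg _)

theorem msq_le_sobSq (u : ℝ → ℂ) : msq u ≤ sobSq u := by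
  have h1 := msq_nonneg (deriv u)
  have h2 := msq_nonneg (deriv (deriv u))
  unfold sobSq
  linarith

theorem fc_lincomb_three {f g h : ℝ → ℂ} (hf : Continuous f) (hg : Continuous g)
    (hh : Continuous h) (a b c : ℂ) (k : ℤ) :
    fc (fun x => a * f x + b * g x + c * h x) k = a * fc f k + b * fc g k + c * fc h k := by
  have h1 : Continuous fun x => a * f x := continuous_const.mul hf
  have h2 : Continuous fun x => b * g x := continuous_const.mul hg
  have h3 : Continuous fun x => c * h x := continuous_const.mul hh
  have h4 : Continuous fun x => a * f x + b * g x := h1.add h2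
  rw [fc_add h4 h3, fc_add h1 h2, fc_const_mul, fc_const_mul, fc_const_mul]

theorem IsC2Per.hasSum_sobSq {u : ℝ → ℂ} (hu : IsC2Per u) :
    HasSum (fun k : ℤ => (1 + (k : ℝ) ^ 2 + (k : ℝ) ^ 4) * ‖fc u k‖ ^ 2) (sobSq u) := by
  have h := ((hasSum_fc_sq hu.continuous).add (hasSum_fc_sq hu.continuous_deriv)).add
    (hasSum_fc_sq hu.continuous_deriv_deriv)
  have e : (fun k : ℤ => (1 + (k : ℝ) ^ 2 + (k : ℝ) ^ 4) * ‖fc u k‖ ^ 2)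
      = fun k => ‖fc u k‖ ^ 2 + ‖fc (deriv u) k‖ ^ 2 + ‖fc (deriv (deriv u)) k‖ ^ 2 := by
    funext k
    rw [hu.fc_deriv, hu.fc_deriv_deriv, norm_mul, norm_mul, norm_mul, Complex.norm_I, norm_neg,
      norm_pow, Complex.norm_intCast, sq_abs]
    have := sq_abs (k : ℝ)
    linear_combination -‖fc u k‖ ^ 2 * this
  rw [e]
  exact h

/-- Parseval, together with 1 + k² + k⁴ ≤ (1 + k²)². The weight (1 + k²)² in the mode estimate is
exactly what controls second derivatives. -/
theorem sobSq_le_of_modes {u v H₁ H₂ : ℝ → ℂ} (hu : IsC2Per u) (hv : IsC2Per v)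
    (h₁ : Continuous H₁) (h₂ : Continuous H₂) {M : ℝ}
    (h : ∀ k : ℤ, (1 + (k : ℝ) ^ 2) ^ 2 * (‖fc u k‖ ^ 2 + ‖fc v k‖ ^ 2)
      ≤ M * (‖fc H₁ k‖ ^ 2 + ‖fc H₂ k‖ ^ 2)) :
    sobSq u + sobSq v ≤ M * (msq H₁ + msq H₂) := by
  refine hasSum_le (fun k => ?_) (hu.hasSum_sobSq.add hv.hasSum_sobSq)
    (((hasSum_fc_sq h₁).add (hasSum_fc_sq h₂)).mul_left M)
  refine le_trans ?_ (h k)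
  rw [← mul_add]
  gcongr
  nlinarith [sq_nonneg (k : ℝ)]

/-! ### Coercivity near the critical operator -/

/-- The coefficients of the scaled linearization are within `ϵ` of the critical homogeneous ones. -/
structure NearCritical (μ q₀ ϵ lam : ℝ) (P y ψ : ℝ → ℝ) : Prop where
  continuous_P : Continuous P
  continuous_y : Continuous y
  continuous_ψ : Continuous ψ
  lam_le : |lam - q₀| ≤ ϵ
  P_le : ∀ s, |P s - μ| ≤ ϵ
  y_le : ∀ s, |y s| ≤ ϵ
  ψ_le : ∀ s, |ψ s| ≤ ϵ

/-- Bound for the size of the coefficients in the perturbation of the critical operator. -/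
def opConst (α β q₀ : ℝ) : ℝ := 10 * (1 + |α|) * (2 + |q₀|) + 2 * (1 + |β|)

theorem opConst_pos (α β q₀ : ℝ) : 0 < opConst α β q₀ := by
  unfold opConst
  positivity

/-- Sum of the squared norms of two functions and their first two derivatives. -/
def jetSq (u v : ℝ → ℂ) (s : ℝ) : ℝ :=
  ‖u s‖ ^ 2 + ‖deriv u s‖ ^ 2 + ‖deriv (deriv u) s‖ ^ 2
    + (‖v s‖ ^ 2 + ‖deriv v s‖ ^ 2 + ‖deriv (deriv v) s‖ ^ 2)

theorem continuous_jetSq {u v : ℝ → ℂ} (hu : IsC2Per u) (hv : IsC2Per v) :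
    Continuous (jetSq u v) :=
  (((hu.continuous.norm.pow 2).add (hu.continuous_deriv.norm.pow 2)).add
    (hu.continuous_deriv_deriv.norm.pow 2)).add
  (((hv.continuous.norm.pow 2).add (hv.continuous_deriv.norm.pow 2)).add
    (hv.continuous_deriv_deriv.norm.pow 2))

theorem avg_jetSq {u v : ℝ → ℂ} (hu : IsC2Per u) (hv : IsC2Per v) :
    avg (jetSq u v) = sobSq u + sobSq v := by
  have a1 := hu.continuous.norm.pow 2
  have a2 := hu.continuous_deriv.norm.pow 2
  have a3 := hu.continuous_deriv_deriv.norm.pow 2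
  have b1 := hv.continuous.norm.pow 2
  have b2 := hv.continuous_deriv.norm.pow 2
  have b3 := hv.continuous_deriv_deriv.norm.pow 2
  exact (avg_add ((a1.add a2).add a3) ((b1.add b2).add b3)).trans (congrArg₂ (· + ·)
    ((avg_add (a1.add a2) a3).trans (congrArg₂ (· + ·) (avg_add a1 a2) rfl))
    ((avg_add (b1.add b2) b3).trans (congrArg₂ (· + ·) (avg_add b1 b2) rfl)))

theorem sum_sq_le_jet (u v : ℝ → ℂ) (s : ℝ) :
    (‖u s‖ + ‖deriv u s‖ + ‖deriv (deriv u) s‖ + ‖v s‖ + ‖deriv v s‖ + ‖deriv (deriv v) s‖) ^ 2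
      ≤ 6 * jetSq u v s := by
  unfold jetSq
  generalize ‖u s‖ = a, ‖deriv u s‖ = b, ‖deriv (deriv u) s‖ = c, ‖v s‖ = d, ‖deriv v s‖ = e,
    ‖deriv (deriv v) s‖ = f
  nlinarith [sq_nonneg (a - b), sq_nonneg (a - c), sq_nonneg (a - d), sq_nonneg (a - e),
    sq_nonneg (a - f), sq_nonneg (b - c), sq_nonneg (b - d), sq_nonneg (b - e), sq_nonneg (b - f),
    sq_nonneg (c - d), sq_nonneg (c - e), sq_nonneg (c - f), sq_nonneg (d - e), sq_nonneg (d - f),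
    sq_nonneg (e - f)]

section

variable {μ q₀ ϵ lam α β γ : ℝ} {P y ψ : ℝ → ℝ}

/-- Each coefficient of the difference contains a factor λ − q₀, P − μ, y or ψ, hence is of order ϵ.
Second derivatives are perturbed too, which is why the estimate must control the full 2-jet. -/
theorem NearCritical.norm_scaledOp₁_sub_le (hN : NearCritical μ q₀ ϵ lam P y ψ) (hϵ : ϵ ≤ 1)
    (α β : ℝ) (u v : ℝ → ℂ) (s : ℝ) :
    ‖scaledOp₁ α lam P y ψ u v s - scaledOp₁ α q₀ (fun _ => μ) (fun _ => 0) (fun _ => 0) u v s‖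
      ≤ ϵ * opConst α β q₀ * (‖u s‖ + ‖deriv u s‖ + ‖deriv (deriv u) s‖ + ‖v s‖ + ‖deriv v s‖
        + ‖deriv (deriv v) s‖) := by
  have hϵ0 : 0 ≤ ϵ := (abs_nonneg _).trans hN.lam_le
  have hl : |lam| ≤ 1 + |q₀| := by
    have := abs_sub_abs_le_abs_sub lam q₀
    linarith [hN.lam_le]
  have e : scaledOp₁ α lam P y ψ u v s
      - scaledOp₁ α q₀ (fun _ => μ) (fun _ => 0) (fun _ => 0) u v s
      = ((lam - q₀ : ℝ) : ℂ) * deriv (deriv u) s + ((-(lam - q₀) * α : ℝ) : ℂ) * deriv (deriv v) s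
        + ((2 * lam * (y s - α * ψ s) : ℝ) : ℂ) * deriv u s
        + ((-(2 * lam * (ψ s + α * y s)) : ℝ) : ℂ) * deriv v s
        + ((-2 * (P s - μ) : ℝ) : ℂ) * u s := by
    unfold scaledOp₁
    push_cast
    ring
  rw [e]
  have c1 : |lam - q₀| ≤ ϵ * opConst α β q₀ := by
    have : 1 ≤ opConst α β q₀ := by
      unfold opConst
      nlinarith [abs_nonneg α, abs_nonneg β, abs_nonneg q₀, mul_nonneg (abs_nonneg α) (abs_nonneg q₀)]
    nlinarith [hN.lam_le]
  have c2 : |-(lam - q₀) * α| ≤ ϵ * opConst α β q₀ := by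
    rw [abs_mul, abs_neg]
    have : |α| ≤ opConst α β q₀ := by
      unfold opConst
      nlinarith [abs_nonneg α, abs_nonneg β, abs_nonneg q₀, mul_nonneg (abs_nonneg α) (abs_nonneg q₀)]
    exact mul_le_mul hN.lam_le this (abs_nonneg _) hϵ0
  have hop : 2 * (1 + |q₀|) * (1 + |α|) ≤ opConst α β q₀ := by
    unfold opConst
    nlinarith [abs_nonneg α, abs_nonneg β, abs_nonneg q₀, mul_nonneg (abs_nonneg α) (abs_nonneg q₀)]
  have c3 : |2 * lam * (y s - α * ψ s)| ≤ ϵ * opConst α β q₀ := by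
    have h1 : |y s - α * ψ s| ≤ (1 + |α|) * ϵ := by
      refine (abs_sub _ _).trans ?_
      rw [abs_mul]
      nlinarith [hN.y_le s, mul_le_mul_of_nonneg_left (hN.ψ_le s) (abs_nonneg α)]
    rw [abs_mul, abs_mul, abs_two]
    calc 2 * |lam| * |y s - α * ψ s| ≤ 2 * (1 + |q₀|) * ((1 + |α|) * ϵ) := by gcongr
      _ = ϵ * (2 * (1 + |q₀|) * (1 + |α|)) := by ring
      _ ≤ _ := by gcongr
  have c4 : |-(2 * lam * (ψ s + α * y s))| ≤ ϵ * opConst α β q₀ := by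
    have h1 : |ψ s + α * y s| ≤ (1 + |α|) * ϵ := by
      refine (abs_add_le _ _).trans ?_
      rw [abs_mul]
      nlinarith [hN.ψ_le s, mul_le_mul_of_nonneg_left (hN.y_le s) (abs_nonneg α)]
    rw [abs_neg, abs_mul, abs_mul, abs_two]
    calc 2 * |lam| * |ψ s + α * y s| ≤ 2 * (1 + |q₀|) * ((1 + |α|) * ϵ) := by gcongr
      _ = ϵ * (2 * (1 + |q₀|) * (1 + |α|)) := by ring
      _ ≤ _ := by gcongr
  have c5 : |-2 * (P s - μ)| ≤ ϵ * opConst α β q₀ := by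
    have : 2 ≤ opConst α β q₀ := by
      unfold opConst
      nlinarith [abs_nonneg α, abs_nonneg β, abs_nonneg q₀, mul_nonneg (abs_nonneg α) (abs_nonneg q₀)]
    rw [abs_mul, abs_neg, abs_two]
    nlinarith [hN.P_le s]
  have hb : ∀ (r : ℝ) (z : ℂ), |r| ≤ ϵ * opConst α β q₀ →
      ‖(r : ℂ) * z‖ ≤ ϵ * opConst α β q₀ * ‖z‖ := by
    intro r z hr
    rw [norm_mul, Complex.norm_real, Real.norm_eq_abs]
    gcongr
  have hv0 : 0 ≤ ϵ * opConst α β q₀ * ‖v s‖ :=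
    mul_nonneg (mul_nonneg hϵ0 (opConst_pos _ _ _).le) (norm_nonneg _)
  refine (norm_add_le_of_le (norm_add_le_of_le (norm_add_le_of_le (norm_add_le_of_le
    (hb _ _ c1) (hb _ _ c2)) (hb _ _ c3)) (hb _ _ c4)) (hb _ _ c5)).trans ?_
  linarith

theorem NearCritical.norm_scaledOp₂_sub_le (hN : NearCritical μ q₀ ϵ lam P y ψ) (hϵ : ϵ ≤ 1)
    (α β : ℝ) (u v : ℝ → ℂ) (s : ℝ) :
    ‖scaledOp₂ α β lam P y ψ u v s
      - scaledOp₂ α β q₀ (fun _ => μ) (fun _ => 0) (fun _ => 0) u v s‖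
      ≤ ϵ * opConst α β q₀ * (‖u s‖ + ‖deriv u s‖ + ‖deriv (deriv u) s‖ + ‖v s‖ + ‖deriv v s‖
        + ‖deriv (deriv v) s‖) := by
  have hϵ0 : 0 ≤ ϵ := (abs_nonneg _).trans hN.lam_le
  have hl : |lam| ≤ 1 + |q₀| := by
    have := abs_sub_abs_le_abs_sub lam q₀
    linarith [hN.lam_le]
  have e : scaledOp₂ α β lam P y ψ u v s
      - scaledOp₂ α β q₀ (fun _ => μ) (fun _ => 0) (fun _ => 0) u v s
      = (((lam - q₀) * α : ℝ) : ℂ) * deriv (deriv u) s + ((lam - q₀ : ℝ) : ℂ) * deriv (deriv v) s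
        + ((2 * lam * (ψ s + α * y s) : ℝ) : ℂ) * deriv u s
        + ((2 * lam * (y s - α * ψ s) : ℝ) : ℂ) * deriv v s
        + ((-2 * β * (P s - μ) : ℝ) : ℂ) * u s := by
    unfold scaledOp₂
    push_cast
    ring
  rw [e]
  have c1 : |lam - q₀| ≤ ϵ * opConst α β q₀ := by
    have : 1 ≤ opConst α β q₀ := by
      unfold opConst
      nlinarith [abs_nonneg α, abs_nonneg β, abs_nonneg q₀, mul_nonneg (abs_nonneg α) (abs_nonneg q₀)]
    nlinarith [hN.lam_le]
  have c2 : |(lam - q₀) * α| ≤ ϵ * opConst α β q₀ := by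
    rw [abs_mul]
    have : |α| ≤ opConst α β q₀ := by
      unfold opConst
      nlinarith [abs_nonneg α, abs_nonneg β, abs_nonneg q₀, mul_nonneg (abs_nonneg α) (abs_nonneg q₀)]
    exact mul_le_mul hN.lam_le this (abs_nonneg _) hϵ0
  have hop : 2 * (1 + |q₀|) * (1 + |α|) ≤ opConst α β q₀ := by
    unfold opConst
    nlinarith [abs_nonneg α, abs_nonneg β, abs_nonneg q₀, mul_nonneg (abs_nonneg α) (abs_nonneg q₀)]
  have c3 : |2 * lam * (y s - α * ψ s)| ≤ ϵ * opConst α β q₀ := by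
    have h1 : |y s - α * ψ s| ≤ (1 + |α|) * ϵ := by
      refine (abs_sub _ _).trans ?_
      rw [abs_mul]
      nlinarith [hN.y_le s, mul_le_mul_of_nonneg_left (hN.ψ_le s) (abs_nonneg α)]
    rw [abs_mul, abs_mul, abs_two]
    calc 2 * |lam| * |y s - α * ψ s| ≤ 2 * (1 + |q₀|) * ((1 + |α|) * ϵ) := by gcongr
      _ = ϵ * (2 * (1 + |q₀|) * (1 + |α|)) := by ring
      _ ≤ _ := by gcongr
  have c4 : |2 * lam * (ψ s + α * y s)| ≤ ϵ * opConst α β q₀ := by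
    have h1 : |ψ s + α * y s| ≤ (1 + |α|) * ϵ := by
      refine (abs_add_le _ _).trans ?_
      rw [abs_mul]
      nlinarith [hN.ψ_le s, mul_le_mul_of_nonneg_left (hN.y_le s) (abs_nonneg α)]
    rw [abs_mul, abs_mul, abs_two]
    calc 2 * |lam| * |ψ s + α * y s| ≤ 2 * (1 + |q₀|) * ((1 + |α|) * ϵ) := by gcongr
      _ = ϵ * (2 * (1 + |q₀|) * (1 + |α|)) := by ring
      _ ≤ _ := by gcongr
  have c5 : |-2 * β * (P s - μ)| ≤ ϵ * opConst α β q₀ := by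
    have : 2 * |β| ≤ opConst α β q₀ := by
      unfold opConst
      nlinarith [abs_nonneg α, abs_nonneg β, abs_nonneg q₀, mul_nonneg (abs_nonneg α) (abs_nonneg q₀)]
    rw [abs_mul, abs_mul, abs_neg, abs_two]
    calc 2 * |β| * |P s - μ| ≤ opConst α β q₀ * ϵ := mul_le_mul this (hN.P_le s) (abs_nonneg _)
          (opConst_pos _ _ _).le
      _ = _ := mul_comm _ _
  have hb : ∀ (r : ℝ) (z : ℂ), |r| ≤ ϵ * opConst α β q₀ →
      ‖(r : ℂ) * z‖ ≤ ϵ * opConst α β q₀ * ‖z‖ := by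
    intro r z hr
    rw [norm_mul, Complex.norm_real, Real.norm_eq_abs]
    gcongr
  have hv0 : 0 ≤ ϵ * opConst α β q₀ * ‖v s‖ :=
    mul_nonneg (mul_nonneg hϵ0 (opConst_pos _ _ _).le) (norm_nonneg _)
  refine (norm_add_le_of_le (norm_add_le_of_le (norm_add_le_of_le (norm_add_le_of_le
    (hb _ _ c2) (hb _ _ c1)) (hb _ _ c4)) (hb _ _ c3)) (hb _ _ c5)).trans ?_
  linarith

theorem continuous_scaledOp₁ (hP : Continuous P) (hy : Continuous y) (hψ : Continuous ψ)
    {u v : ℝ → ℂ} (hu : IsC2Per u) (hv : IsC2Per v) :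
    Continuous (scaledOp₁ α lam P y ψ u v) := by
  have h1 := hu.continuous
  have h2 := hu.continuous_deriv
  have h3 := hu.continuous_deriv_deriv
  have h5 := hv.continuous_deriv
  have h6 := hv.continuous_deriv_deriv
  unfold scaledOp₁
  fun_prop

theorem continuous_scaledOp₂ (hP : Continuous P) (hy : Continuous y) (hψ : Continuous ψ)
    {u v : ℝ → ℂ} (hu : IsC2Per u) (hv : IsC2Per v) :
    Continuous (scaledOp₂ α β lam P y ψ u v) := by
  have h1 := hu.continuous
  have h2 := hu.continuous_deriv
  have h3 := hu.continuous_deriv_deriv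
  have h5 := hv.continuous_deriv
  have h6 := hv.continuous_deriv_deriv
  unfold scaledOp₂
  fun_prop

/-- The factor 6 is Cauchy–Schwarz for the six entries of the jet. -/
theorem msq_le_of_norm_le_jet {f u v : ℝ → ℂ} (hf : Continuous f) (hu : IsC2Per u)
    (hv : IsC2Per v) {K : ℝ} (h : ∀ s, ‖f s‖ ≤ K * (‖u s‖ + ‖deriv u s‖ + ‖deriv (deriv u) s‖
      + ‖v s‖ + ‖deriv v s‖ + ‖deriv (deriv v) s‖)) :
    msq f ≤ 6 * K ^ 2 * (sobSq u + sobSq v) := by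
  rw [← avg_jetSq hu hv, ← avg_const_mul]
  refine avg_mono (hf.norm.pow 2) (continuous_const.mul (continuous_jetSq hu hv)) fun s => ?_
  calc ‖f s‖ ^ 2 ≤ _ := pow_le_pow_left₀ (norm_nonneg _) (h s) 2
    _ ≤ K ^ 2 * (6 * jetSq u v s) := by
      rw [mul_pow]
      exact mul_le_mul_of_nonneg_left (sum_sq_le_jet u v s) (sq_nonneg _)
    _ = _ := by ring

end

/-- A pair of odd functions which is transversal to the range of the critical operator. -/
structure TransversalOddPair (α B m₀ : ℝ) (τ₁ τ₂ : ℝ → ℂ) : Prop where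
  isC2Per₁ : IsC2Per τ₁
  isC2Per₂ : IsC2Per τ₂
  norm_le₁ : ∀ s, ‖τ₁ s‖ ≤ B
  norm_le₂ : ∀ s, ‖τ₂ s‖ ≤ B
  fc_zero₁ : fc τ₁ 0 = 0
  fc_zero₂ : fc τ₂ 0 = 0
  fc_neg₁ : fc τ₁ (-1) = -fc τ₁ 1
  fc_neg₂ : fc τ₂ (-1) = -fc τ₂ 1
  le_norm : m₀ ≤ ‖fc τ₁ 1 + α * fc τ₂ 1‖

/-- The codimension-three conditions on the Fourier modes `0, ±1` which complement the critical
eigenvectors. -/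
structure ModeConditions (α β : ℝ) (u v : ℝ → ℂ) : Prop where
  isC2Per₁ : IsC2Per u
  isC2Per₂ : IsC2Per v
  zero : fc v 0 = β * fc u 0
  one : fc u 1 + α * fc v 1 = 0
  neg_one : fc u (-1) + α * fc v (-1) = 0

/-- The critical operator has constant coefficients, so it acts on every Fourier mode by a 2×2
matrix. -/
theorem fc_base₁ {u v : ℝ → ℂ} (hu : IsC2Per u) (hv : IsC2Per v) (α μ q₀ : ℝ) (σ : ℂ) (k : ℤ) :
    fc (fun s => scaledOp₁ α q₀ (fun _ => μ) (fun _ => 0) (fun _ => 0) u v s - σ * u s) k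
      = -(q₀ * k ^ 2 : ℝ) * (fc u k - α * fc v k) - 2 * μ * fc u k - σ * fc u k := by
  have e : (fun s => scaledOp₁ α q₀ (fun _ => μ) (fun _ => 0) (fun _ => 0) u v s - σ * u s)
      = fun s => (q₀ : ℂ) * deriv (deriv u) s + (-(q₀ * α) : ℂ) * deriv (deriv v) s
        + (-2 * μ - σ) * u s := by
    funext s
    unfold scaledOp₁
    push_cast
    ring
  rw [e, fc_lincomb_three hu.continuous_deriv_deriv hv.continuous_deriv_deriv hu.continuous,
    hu.fc_deriv_deriv, hv.fc_deriv_deriv]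
  push_cast
  ring

theorem fc_base₂ {u v : ℝ → ℂ} (hu : IsC2Per u) (hv : IsC2Per v) (α β μ q₀ : ℝ) (σ : ℂ) (k : ℤ) :
    fc (fun s => scaledOp₂ α β q₀ (fun _ => μ) (fun _ => 0) (fun _ => 0) u v s - σ * v s) k
      = -(q₀ * k ^ 2 : ℝ) * (α * fc u k + fc v k) - 2 * β * μ * fc u k - σ * fc v k := by
  have e : (fun s => scaledOp₂ α β q₀ (fun _ => μ) (fun _ => 0) (fun _ => 0) u v s - σ * v s)
      = fun s => (1 : ℂ) * ((q₀ * α : ℂ) * deriv (deriv u) s + (q₀ : ℂ) * deriv (deriv v) s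
        + (-2 * β * μ) * u s) + (-σ) * v s + 0 * u s := by
    funext s
    unfold scaledOp₂
    push_cast
    ring
  have hc : Continuous fun s => (q₀ * α : ℂ) * deriv (deriv u) s + (q₀ : ℂ) * deriv (deriv v) s
        + (-2 * β * μ) * u s := by
    have h1 := hu.continuous
    have h3 := hu.continuous_deriv_deriv
    have h6 := hv.continuous_deriv_deriv
    fun_prop
  rw [e, fc_lincomb_three hc hv.continuous hu.continuous,
    fc_lincomb_three hu.continuous_deriv_deriv hv.continuous_deriv_deriv hu.continuous,
    hu.fc_deriv_deriv, hv.fc_deriv_deriv]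
  push_cast
  ring

theorem norm_sq_lincomb_le {a b : ℂ} {r A B : ℝ} (ha : ‖a‖ ^ 2 ≤ A) (hb : ‖b‖ ^ 2 ≤ B) :
    ‖a + r * b‖ ^ 2 ≤ 2 * (1 + r ^ 2) * (A + B) := by
  have h1 : ‖a + r * b‖ ^ 2 ≤ (‖a‖ + |r| * ‖b‖) ^ 2 := by
    refine pow_le_pow_left₀ (norm_nonneg _) ((norm_add_le _ _).trans_eq ?_) 2
    rw [norm_mul, Complex.norm_real, Real.norm_eq_abs]
  have h2 : (‖a‖ + |r| * ‖b‖) ^ 2 ≤ 2 * (‖a‖ ^ 2 + (|r| * ‖b‖) ^ 2) := add_sq_le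
  rw [mul_pow, sq_abs] at h2
  have hA := (sq_nonneg ‖a‖).trans ha
  have hB := (sq_nonneg ‖b‖).trans hb
  nlinarith [mul_le_mul_of_nonneg_left hb (sq_nonneg r), mul_nonneg (sq_nonneg r) hA]

theorem norm_sq_add_le (a b : ℂ) : ‖a + b‖ ^ 2 ≤ 2 * (‖a‖ ^ 2 + ‖b‖ ^ 2) :=
  (pow_le_pow_left₀ (norm_nonneg _) (norm_add_le _ _) 2).trans add_sq_le

/-- Solvability conditions at the modes `0, ±1` determine the three multipliers. -/
theorem ModeConditions.multiplier_bound {μ q₀ α β γ B m₀ : ℝ}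
    (hκ : (1 + α ^ 2) * q₀ = -2 * μ * (1 + α * β)) (hγ : 2 ≤ 1 - α * γ) (hm₀ : 0 < m₀)
    {τ₁ τ₂ u v g₁ g₂ : ℝ → ℂ} (hτ : TransversalOddPair α B m₀ τ₁ τ₂)
    (hq : ModeConditions α β u v) (hg₁ : Continuous g₁) (hg₂ : Continuous g₂) {σ s t ζ : ℂ}
    (h₁ : ∀ x, scaledOp₁ α q₀ (fun _ => μ) (fun _ => 0) (fun _ => 0) u v x - σ * u x
      = g₁ x + t * τ₁ x + ζ * ccos x)
    (h₂ : ∀ x, scaledOp₂ α β q₀ (fun _ => μ) (fun _ => 0) (fun _ => 0) u v x - σ * v x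
      = g₂ x + s + t * τ₂ x - γ * ζ * ccos x) :
    ‖s‖ ^ 2 ≤ 2 * (1 + β ^ 2) * (msq g₁ + msq g₂) ∧
      ‖t‖ ^ 2 ≤ 2 * (1 + α ^ 2) / m₀ ^ 2 * (msq g₁ + msq g₂) ∧
      ‖ζ‖ ^ 2 ≤ 2 * (1 + α ^ 2) * (msq g₁ + msq g₂) := by
  have hτ₁ := hτ.isC2Per₁.continuous
  have hτ₂ := hτ.isC2Per₂.continuous
  have hcos := isC2Per_ccos.continuous
  have E₁ : ∀ k : ℤ, -(q₀ * k ^ 2 : ℝ) * (fc u k - α * fc v k) - 2 * μ * fc u k - σ * fc u k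
      = fc g₁ k + t * fc τ₁ k + ζ * fc ccos k := by
    intro k
    rw [← fc_base₁ hq.isC2Per₁ hq.isC2Per₂, funext h₁]
    have := fc_lincomb_three hg₁ hτ₁ hcos 1 t ζ k
    simpa only [one_mul] using this
  have E₂ : ∀ k : ℤ, -(q₀ * k ^ 2 : ℝ) * (α * fc u k + fc v k) - 2 * β * μ * fc u k - σ * fc v k
      = fc g₂ k + s * fc (fun _ => 1) k + t * fc τ₂ k - γ * ζ * fc ccos k := by
    intro k
    rw [← fc_base₂ hq.isC2Per₁ hq.isC2Per₂, funext h₂]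
    have hc : Continuous fun x => g₂ x + s := hg₂.add continuous_const
    have e1 := fc_lincomb_three hc hτ₂ hcos 1 t (-(γ * ζ)) k
    have e2 := fc_lincomb_three hg₂ (continuous_const (y := (1 : ℂ))) hcos 1 s 0 k
    simp only [one_mul, mul_one, zero_mul, add_zero, neg_mul, ← sub_eq_add_neg] at e1 e2
    rw [e1, e2]
  have n := fun k => norm_fc_sq_le hg₁ k
  have n' := fun k => norm_fc_sq_le hg₂ k
  have hκ' : ((1 + α ^ 2) * q₀ : ℂ) = -2 * μ * (1 + α * β) := by exact_mod_cast hκ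
  have hw1 := norm_sq_lincomb_le (r := α) (n 1) (n' 1)
  have hw2 := norm_sq_lincomb_le (r := α) (n (-1)) (n' (-1))
  have a1 := E₁ 1
  have a2 := E₂ 1
  have b1 := E₁ (-1)
  have b2 := E₂ (-1)
  rw [fc_ccos_one] at a1 a2
  rw [fc_ccos_neg_one] at b1 b2
  rw [fc_one_of_ne (by decide)] at a2 b2
  rw [hτ.fc_neg₁] at b1
  rw [hτ.fc_neg₂] at b2
  push_cast at a1 a2 b1 b2
  set w₁ := fc g₁ 1 + α * fc g₂ 1 with hw₁
  set w₂ := fc g₁ (-1) + α * fc g₂ (-1) with hw₂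
  set T := fc τ₁ 1 + α * fc τ₂ 1 with hT
  -- The row vector (1, α) annihilates the critical matrix at k = 1, and by the mode condition also
  -- the term with σ. Only forcing and multipliers remain; at k = −1 the odd pair enters with the
  -- opposite sign, so sum and difference isolate ζ and t.
  have A : w₁ + t * T + ζ * ((1 - α * γ) / 2) = 0 := by
    rw [hw₁, hT]
    linear_combination -a1 - α * a2 - fc u 1 * hκ' - σ * hq.one
  have A' : w₂ - t * T + ζ * ((1 - α * γ) / 2) = 0 := by
    rw [hw₂, hT]
    linear_combination -b1 - α * b2 - fc u (-1) * hκ' - σ * hq.neg_one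
  refine ⟨?_, ?_, ?_⟩
  · have c1 := E₁ 0
    have c2 := E₂ 0
    rw [fc_ccos_zero, hτ.fc_zero₁] at c1
    rw [fc_ccos_zero, hτ.fc_zero₂, fc_one_zero] at c2
    push_cast at c1 c2
    -- At k = 0 the annihilating row vector is (−β, 1).
    have hs : -s = fc g₂ 0 + ((-β : ℝ) : ℂ) * fc g₁ 0 := by
      push_cast
      linear_combination c2 - β * c1 + σ * hq.zero
    rw [← norm_neg, hs, add_comm (msq g₁)]
    have := norm_sq_lincomb_le (r := -β) (n' 0) (n 0)
    rwa [neg_sq] at this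
  · have h : w₂ - w₁ = 2 * t * T := by linear_combination A' - A
    have h1 : ‖w₂ - w₁‖ ^ 2 ≤ 2 * (‖w₂‖ ^ 2 + ‖w₁‖ ^ 2) := by
      have := norm_sq_add_le w₂ (-w₁)
      rwa [norm_neg, ← sub_eq_add_neg] at this
    rw [h, norm_mul, norm_mul, Complex.norm_two] at h1
    have h2 : m₀ ^ 2 ≤ ‖T‖ ^ 2 := pow_le_pow_left₀ hm₀.le hτ.le_norm 2
    rw [div_mul_eq_mul_div, le_div_iff₀ (by positivity)]
    nlinarith [mul_le_mul_of_nonneg_left h2 (sq_nonneg ‖t‖)]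
  · have h : w₂ + w₁ = -(((1 - α * γ : ℝ) : ℂ) * ζ) := by
      push_cast
      linear_combination A' + A
    have h1 := norm_sq_add_le w₂ w₁
    rw [h, norm_neg, norm_mul, Complex.norm_real, Real.norm_eq_abs, mul_pow, sq_abs] at h1
    have h2 : (4 : ℝ) ≤ (1 - α * γ) ^ 2 := by nlinarith
    nlinarith [mul_le_mul_of_nonneg_right h2 (sq_nonneg ‖ζ‖)]

theorem msq_add_three_le {f g h : ℝ → ℂ} (hf : Continuous f) (hg : Continuous g)
    (hh : Continuous h) :
    msq (fun x => f x + g x + h x) ≤ 4 * (msq f + msq g + msq h) := by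
  have h1 : Continuous fun x => f x + g x := hf.add hg
  have := msq_add_le h1 hh
  have h2 := msq_add_le hf hg
  linarith [msq_nonneg h]

/-- Constants `c`, `ϵ₀`, `C` for which the coercivity estimate holds near the critical operator. -/
def Coercive (μ α β γ q₀ B m₀ c ϵ₀ C : ℝ) : Prop :=
  ∀ (ϵ lam : ℝ) (P y ψ : ℝ → ℝ), NearCritical μ q₀ ϵ lam P y ψ → ϵ ≤ ϵ₀ →
    ∀ τ₁ τ₂ : ℝ → ℂ, TransversalOddPair α B m₀ τ₁ τ₂ →
    ∀ u v : ℝ → ℂ, ModeConditions α β u v → ∀ G₁ G₂ : ℝ → ℂ, Continuous G₁ → Continuous G₂ →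
    ∀ σ s t ζ : ℂ, -c ≤ σ.re →
    (∀ x, scaledOp₁ α lam P y ψ u v x - σ * u x = G₁ x + t * τ₁ x + ζ * ccos x) →
    (∀ x, scaledOp₂ α β lam P y ψ u v x - σ * v x
      = G₂ x + s + t * τ₂ x - γ * ζ * ccos x) →
    sobSq u + sobSq v + ‖s‖ ^ 2 + ‖t‖ ^ 2 + ‖ζ‖ ^ 2 ≤ C * (msq G₁ + msq G₂)

set_option maxHeartbeats 800000 in
-- The deviation from the critical operator is moved into the forcing. The solvability conditions
-- bound the multipliers, the mode estimates summed by Parseval bound the functions, and for small ϵ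
-- the deviation is absorbed on the left.
theorem exists_coercive {μ α β γ q₀ c M : ℝ}
    (hκ : (1 + α ^ 2) * q₀ = -2 * μ * (1 + α * β)) (hγ : 2 ≤ 1 - α * γ) (hM : 0 < M)
    (hmode : ∀ σ : ℂ, -c ≤ σ.re → ∀ k : ℤ, ∀ u v f₁ f₂ : ℂ,
        (k = 0 → v = β * u) → (k = 1 ∨ k = -1 → u + α * v = 0) →
        f₁ = -(q₀ * k ^ 2 : ℝ) * (u - α * v) - 2 * μ * u - σ * u →
        f₂ = -(q₀ * k ^ 2 : ℝ) * (α * u + v) - 2 * β * μ * u - σ * v →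
        (1 + (k : ℝ) ^ 2) ^ 2 * (‖u‖ ^ 2 + ‖v‖ ^ 2) ≤ M * (‖f₁‖ ^ 2 + ‖f₂‖ ^ 2))
    {B m₀ : ℝ} (hB : 0 ≤ B) (hm₀ : 0 < m₀) :
    ∃ ϵ₀ > 0, ϵ₀ ≤ 1 ∧ ∃ C > 0, Coercive μ α β γ q₀ B m₀ c ϵ₀ C := by
  set Ks := 2 * (1 + β ^ 2) with hKs
  set Kt := 2 * (1 + α ^ 2) / m₀ ^ 2 with hKt
  set Kz := 2 * (1 + α ^ 2) with hKz
  have hKs0 : 0 < Ks := by positivity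
  have hKt0 : 0 < Kt := by positivity
  have hKz0 : 0 < Kz := by positivity
  set C₁ := M * (8 * (1 + Ks + 2 * Kt * B ^ 2 + Kz * (1 + γ ^ 2))) + Ks + Kt + Kz with hC₁
  have hC₁0 : 0 < C₁ := by positivity
  set K := opConst α β q₀ with hK
  have hK0 : 0 < K := opConst_pos _ _ _
  set D := 48 * C₁ * K ^ 2 with hD
  have hD0 : 0 < D := by positivity
  -- This choice of ϵ₀ gives Dϵ² ≤ 1, so the deviation costs at most half of the Sobolev norm; the
  -- final constant 4C₁ includes the resulting factor 2.
  refine ⟨(1 + D)⁻¹, by positivity, inv_le_one_of_one_le₀ (by linarith), 4 * C₁, by positivity, ?_⟩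
  intro ϵ lam P y ψ hN hϵ τ₁ τ₂ hτ u v hq G₁ G₂ hG₁ hG₂ σ s t ζ hσ h₁ h₂
  have hϵ0 : 0 ≤ ϵ := (abs_nonneg _).trans hN.lam_le
  have hϵ1 : ϵ ≤ 1 := hϵ.trans (inv_le_one_of_one_le₀ (by linarith))
  set Δ₁ : ℝ → ℂ := fun x => scaledOp₁ α lam P y ψ u v x
    - scaledOp₁ α q₀ (fun _ => μ) (fun _ => 0) (fun _ => 0) u v x with hΔ₁
  set Δ₂ : ℝ → ℂ := fun x => scaledOp₂ α β lam P y ψ u v x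
    - scaledOp₂ α β q₀ (fun _ => μ) (fun _ => 0) (fun _ => 0) u v x with hΔ₂
  have cb₁ := continuous_scaledOp₁ (α := α) (lam := q₀) (continuous_const (y := μ))
    (continuous_const (y := (0 : ℝ))) (continuous_const (y := (0 : ℝ))) hq.isC2Per₁ hq.isC2Per₂
  have cb₂ := continuous_scaledOp₂ (α := α) (β := β) (lam := q₀) (continuous_const (y := μ))
    (continuous_const (y := (0 : ℝ))) (continuous_const (y := (0 : ℝ))) hq.isC2Per₁ hq.isC2Per₂
  have cΔ₁ : Continuous Δ₁ := (continuous_scaledOp₁ hN.continuous_P hN.continuous_y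
    hN.continuous_ψ hq.isC2Per₁ hq.isC2Per₂).sub cb₁
  have cΔ₂ : Continuous Δ₂ := (continuous_scaledOp₂ hN.continuous_P hN.continuous_y
    hN.continuous_ψ hq.isC2Per₁ hq.isC2Per₂).sub cb₂
  have mΔ₁ : msq Δ₁ ≤ 6 * (ϵ * K) ^ 2 * (sobSq u + sobSq v) :=
    msq_le_of_norm_le_jet cΔ₁ hq.isC2Per₁ hq.isC2Per₂ (hN.norm_scaledOp₁_sub_le hϵ1 α β u v)
  have mΔ₂ : msq Δ₂ ≤ 6 * (ϵ * K) ^ 2 * (sobSq u + sobSq v) :=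
    msq_le_of_norm_le_jet cΔ₂ hq.isC2Per₁ hq.isC2Per₂ (hN.norm_scaledOp₂_sub_le hϵ1 α β u v)
  set g₁ : ℝ → ℂ := fun x => G₁ x + (-1) * Δ₁ x with hg₁
  set g₂ : ℝ → ℂ := fun x => G₂ x + (-1) * Δ₂ x with hg₂
  have cm₁ : Continuous fun x => (-1 : ℂ) * Δ₁ x := continuous_const.mul cΔ₁
  have cm₂ : Continuous fun x => (-1 : ℂ) * Δ₂ x := continuous_const.mul cΔ₂
  have cg₁ : Continuous g₁ := hG₁.add cm₁
  have cg₂ : Continuous g₂ := hG₂.add cm₂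
  have mg₁ : msq g₁ ≤ 2 * msq G₁ + 2 * msq Δ₁ := by
    have := msq_add_le hG₁ cm₁
    rwa [msq_const_mul, norm_neg, norm_one, one_pow, one_mul] at this
  have mg₂ : msq g₂ ≤ 2 * msq G₂ + 2 * msq Δ₂ := by
    have := msq_add_le hG₂ cm₂
    rwa [msq_const_mul, norm_neg, norm_one, one_pow, one_mul] at this
  have e₁ : ∀ x, scaledOp₁ α q₀ (fun _ => μ) (fun _ => 0) (fun _ => 0) u v x - σ * u x
      = g₁ x + t * τ₁ x + ζ * ccos x := by
    intro x
    simp only [hg₁, hΔ₁]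
    linear_combination h₁ x
  have e₂ : ∀ x, scaledOp₂ α β q₀ (fun _ => μ) (fun _ => 0) (fun _ => 0) u v x - σ * v x
      = g₂ x + s + t * τ₂ x - γ * ζ * ccos x := by
    intro x
    simp only [hg₂, hΔ₂]
    linear_combination h₂ x
  obtain ⟨hs, ht, hz⟩ := hq.multiplier_bound hκ hγ hm₀ hτ cg₁ cg₂ e₁ e₂
  rw [← hKs] at hs
  rw [← hKt] at ht
  rw [← hKz] at hz
  set mg := msq g₁ + msq g₂ with hmg
  have hmg0 : 0 ≤ mg := add_nonneg (msq_nonneg _) (msq_nonneg _)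
  set H₁ : ℝ → ℂ := fun x => g₁ x + t * τ₁ x + ζ * ccos x with hH₁
  set H₂ : ℝ → ℂ := fun x => (g₂ x + s) + t * τ₂ x + (-(γ * ζ)) * ccos x with hH₂
  have hcos := isC2Per_ccos.continuous
  have hcos1 : msq ccos ≤ 1 := by
    refine msq_le_of_bound hcos fun x => ?_
    rw [ccos, Complex.norm_real, Real.norm_eq_abs, sq_abs]
    exact Real.cos_sq_le_one x
  have mτ₁ : msq τ₁ ≤ B ^ 2 := msq_le_of_bound hτ.isC2Per₁.continuous fun x =>
    pow_le_pow_left₀ (norm_nonneg _) (hτ.norm_le₁ x) 2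
  have mτ₂ : msq τ₂ ≤ B ^ 2 := msq_le_of_bound hτ.isC2Per₂.continuous fun x =>
    pow_le_pow_left₀ (norm_nonneg _) (hτ.norm_le₂ x) 2
  have c1 : Continuous fun x => t * τ₁ x := continuous_const.mul hτ.isC2Per₁.continuous
  have c2 : Continuous fun x => t * τ₂ x := continuous_const.mul hτ.isC2Per₂.continuous
  have c3 : Continuous fun x => ζ * ccos x := continuous_const.mul hcos
  have c4 : Continuous fun x => (-(γ * ζ)) * ccos x := continuous_const.mul hcos
  have c5 : Continuous fun x => g₂ x + s := cg₂.add continuous_const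
  have cH₁ : Continuous H₁ := (cg₁.add c1).add c3
  have cH₂ : Continuous H₂ := (c5.add c2).add c4
  have mH₁ := msq_add_three_le cg₁ c1 c3
  have mH₂ := msq_add_three_le c5 c2 c4
  have mgs := msq_add_le cg₂ (continuous_const (y := s))
  have ms : msq (fun _ : ℝ => s) = ‖s‖ ^ 2 := avg_const _
  rw [ms] at mgs
  rw [msq_const_mul, msq_const_mul] at mH₁ mH₂
  rw [norm_neg, norm_mul, Complex.norm_real, mul_pow, Real.norm_eq_abs, sq_abs] at mH₂
  have p1 : ‖t‖ ^ 2 * msq τ₁ ≤ Kt * mg * B ^ 2 := mul_le_mul ht mτ₁ (msq_nonneg _) (by positivity)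
  have p2 : ‖t‖ ^ 2 * msq τ₂ ≤ Kt * mg * B ^ 2 := mul_le_mul ht mτ₂ (msq_nonneg _) (by positivity)
  have p3 : ‖ζ‖ ^ 2 * msq ccos ≤ Kz * mg * 1 := mul_le_mul hz hcos1 (msq_nonneg _) (by positivity)
  have p4 : γ ^ 2 * ‖ζ‖ ^ 2 * msq ccos ≤ γ ^ 2 * (Kz * mg * 1) := by
    rw [mul_assoc]
    exact mul_le_mul_of_nonneg_left p3 (sq_nonneg _)
  have hH : msq H₁ + msq H₂ ≤ 8 * (1 + Ks + 2 * Kt * B ^ 2 + Kz * (1 + γ ^ 2)) * mg := by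
    have q1 : 0 ≤ Kt * mg * B ^ 2 := by positivity
    have q2 : 0 ≤ Kz * mg := by positivity
    have q3 : 0 ≤ γ ^ 2 * (Kz * mg * 1) := by positivity
    have q4 : 0 ≤ msq g₁ := msq_nonneg _
    have q5 : msq H₁ ≤ 4 * (msq g₁ + Kt * mg * B ^ 2 + Kz * mg * 1) := by
      refine mH₁.trans ?_
      gcongr
    have q6 : msq H₂ ≤ 4 * (2 * msq g₂ + 2 * (Ks * mg) + Kt * mg * B ^ 2
        + γ ^ 2 * (Kz * mg * 1)) := by
      refine mH₂.trans ?_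
      gcongr
      linarith
    have q7 : 0 ≤ Ks * mg := by positivity
    have q8 : 8 * (1 + Ks + 2 * Kt * B ^ 2 + Kz * (1 + γ ^ 2)) * mg
        = 8 * mg + 8 * (Ks * mg) + 16 * (Kt * mg * B ^ 2) + 8 * (Kz * mg)
          + 8 * (γ ^ 2 * (Kz * mg * 1)) := by ring
    rw [q8]
    linarith
  have hsob : sobSq u + sobSq v ≤ M * (msq H₁ + msq H₂) := by
    refine sobSq_le_of_modes hq.isC2Per₁ hq.isC2Per₂ cH₁ cH₂ fun k => ?_
    refine hmode σ hσ k _ _ _ _ (fun hk => by rw [hk]; exact hq.zero) ?_ ?_ ?_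
    · rintro (hk | hk)
      · rw [hk]; exact hq.one
      · rw [hk]; exact hq.neg_one
    · rw [← fc_base₁ hq.isC2Per₁ hq.isC2Per₂, funext e₁]
    · rw [← fc_base₂ hq.isC2Per₁ hq.isC2Per₂, funext e₂]
      congr 1
      funext x
      simp only [hH₂]
      ring
  set N := sobSq u + sobSq v with hNdef
  have hN0 : 0 ≤ N := add_nonneg (sobSq_nonneg _) (sobSq_nonneg _)
  have hNmg : N + ‖s‖ ^ 2 + ‖t‖ ^ 2 + ‖ζ‖ ^ 2 ≤ C₁ * mg := by
    have : M * (msq H₁ + msq H₂)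
        ≤ M * (8 * (1 + Ks + 2 * Kt * B ^ 2 + Kz * (1 + γ ^ 2)) * mg) := by gcongr
    rw [hC₁]
    linarith
  have hmgle : mg ≤ 2 * (msq G₁ + msq G₂) + 24 * (ϵ * K) ^ 2 * N := by
    rw [hmg]
    linarith
  have hsmall : C₁ * (24 * (ϵ * K) ^ 2 * N) ≤ N / 2 := by
    have h1 : ϵ ^ 2 ≤ (1 + D)⁻¹ := by nlinarith
    have h2 : D * ϵ ^ 2 ≤ 1 := by
      calc D * ϵ ^ 2 ≤ D * (1 + D)⁻¹ := by gcongr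
        _ ≤ 1 := by
          rw [← div_eq_mul_inv, div_le_one (by positivity)]
          linarith
    calc C₁ * (24 * (ϵ * K) ^ 2 * N) = (D * ϵ ^ 2) * N / 2 := by rw [hD]; ring
      _ ≤ 1 * N / 2 := by gcongr
      _ = N / 2 := by ring
  have : C₁ * mg ≤ C₁ * (2 * (msq G₁ + msq G₂) + 24 * (ϵ * K) ^ 2 * N) := by gcongr
  rw [mul_add] at this
  linarith [sq_nonneg ‖s‖, sq_nonneg ‖t‖, sq_nonneg ‖ζ‖]

/-! ### Decomposition along the critical modes and the spectral alternative -/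

theorem IsC2Per.add_const_mul {u w : ℝ → ℂ} (hu : IsC2Per u) (hw : IsC2Per w) (c : ℂ) :
    IsC2Per fun x => u x + c * w x :=
  ⟨hu.1.add (contDiff_const.mul hw.1), fun x => by simp only [hu.2 x, hw.2 x]⟩

theorem IsC2Per.const_mul {u : ℝ → ℂ} (hu : IsC2Per u) (c : ℂ) : IsC2Per fun x => c * u x :=
  ⟨contDiff_const.mul hu.1, fun x => by simp only [hu.2 x]⟩

theorem isC2Per_const (c : ℂ) : IsC2Per fun _ => c := ⟨contDiff_const, fun _ => rfl⟩

theorem IsC2Per.deriv_add_const_mul {u w : ℝ → ℂ} (hu : IsC2Per u) (hw : IsC2Per w) (c : ℂ) :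
    deriv (fun x => u x + c * w x) = fun x => deriv u x + c * deriv w x :=
  funext fun x => ((hasDerivAt_of_contDiff_two hu.1 x).1.add
    ((hasDerivAt_of_contDiff_two hw.1 x).1.const_mul c)).deriv

theorem IsC2Per.deriv_deriv_add_const_mul {u w : ℝ → ℂ} (hu : IsC2Per u) (hw : IsC2Per w) (c : ℂ) :
    deriv (deriv fun x => u x + c * w x) = fun x => deriv (deriv u) x + c * deriv (deriv w) x := by
  rw [hu.deriv_add_const_mul hw]
  exact funext fun x => ((hasDerivAt_of_contDiff_two hu.1 x).2.add
    ((hasDerivAt_of_contDiff_two hw.1 x).2.const_mul c)).deriv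

theorem scaledOp₁_add_const_mul {u v w z : ℝ → ℂ} (hu : IsC2Per u) (hv : IsC2Per v)
    (hw : IsC2Per w) (hz : IsC2Per z) (c : ℂ) (α lam : ℝ) (P y ψ : ℝ → ℝ) (x : ℝ) :
    scaledOp₁ α lam P y ψ (fun x => u x + c * w x) (fun x => v x + c * z x) x
      = scaledOp₁ α lam P y ψ u v x + c * scaledOp₁ α lam P y ψ w z x := by
  unfold scaledOp₁
  rw [hu.deriv_deriv_add_const_mul hw, hv.deriv_deriv_add_const_mul hz, hu.deriv_add_const_mul hw,
    hv.deriv_add_const_mul hz]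
  ring

theorem scaledOp₂_add_const_mul {u v w z : ℝ → ℂ} (hu : IsC2Per u) (hv : IsC2Per v)
    (hw : IsC2Per w) (hz : IsC2Per z) (c : ℂ) (α β lam : ℝ) (P y ψ : ℝ → ℝ) (x : ℝ) :
    scaledOp₂ α β lam P y ψ (fun x => u x + c * w x) (fun x => v x + c * z x) x
      = scaledOp₂ α β lam P y ψ u v x + c * scaledOp₂ α β lam P y ψ w z x := by
  unfold scaledOp₂
  rw [hu.deriv_deriv_add_const_mul hw, hv.deriv_deriv_add_const_mul hz, hu.deriv_add_const_mul hw,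
    hv.deriv_add_const_mul hz]
  ring

theorem scaledOp₁_const (α lam : ℝ) (P y ψ : ℝ → ℝ) (x : ℝ) :
    scaledOp₁ α lam P y ψ (fun _ => 0) (fun _ => 1) x = 0 := by
  simp [scaledOp₁]

theorem scaledOp₂_const (α β lam : ℝ) (P y ψ : ℝ → ℝ) (x : ℝ) :
    scaledOp₂ α β lam P y ψ (fun _ => 0) (fun _ => 1) x = 0 := by
  simp [scaledOp₂]

theorem IsC2Per.fc_add_const_mul {u w : ℝ → ℂ} (hu : IsC2Per u) (hw : IsC2Per w) (c : ℂ) (k : ℤ) :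
    fc (fun x => u x + c * w x) k = fc u k + c * fc w k := by
  have h : Continuous fun x => c * w x := continuous_const.mul hw.continuous
  rw [fc_add hu.continuous h, fc_const_mul]

theorem ModeConditions.add_const_mul {α β : ℝ} {u v u' v' : ℝ → ℂ} (h : ModeConditions α β u v)
    (h' : ModeConditions α β u' v') (c : ℂ) :
    ModeConditions α β (fun x => u x + c * u' x) (fun x => v x + c * v' x) where
  isC2Per₁ := h.isC2Per₁.add_const_mul h'.isC2Per₁ c
  isC2Per₂ := h.isC2Per₂.add_const_mul h'.isC2Per₂ c
  zero := by
    rw [h.isC2Per₁.fc_add_const_mul h'.isC2Per₁, h.isC2Per₂.fc_add_const_mul h'.isC2Per₂]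
    linear_combination h.zero + c * h'.zero
  one := by
    rw [h.isC2Per₁.fc_add_const_mul h'.isC2Per₁, h.isC2Per₂.fc_add_const_mul h'.isC2Per₂]
    linear_combination h.one + c * h'.one
  neg_one := by
    rw [h.isC2Per₁.fc_add_const_mul h'.isC2Per₁, h.isC2Per₂.fc_add_const_mul h'.isC2Per₂]
    linear_combination h.neg_one + c * h'.neg_one

theorem ModeConditions.const_mul {α β : ℝ} {u v : ℝ → ℂ} (h : ModeConditions α β u v) (c : ℂ) :
    ModeConditions α β (fun x => c * u x) (fun x => c * v x) where
  isC2Per₁ := h.isC2Per₁.const_mul c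
  isC2Per₂ := h.isC2Per₂.const_mul c
  zero := by
    rw [fc_const_mul, fc_const_mul]
    linear_combination c * h.zero
  one := by
    rw [fc_const_mul, fc_const_mul]
    linear_combination c * h.one
  neg_one := by
    rw [fc_const_mul, fc_const_mul]
    linear_combination c * h.neg_one

/-- Second component of the critical even mode. -/
def evenMode₂ (γ : ℝ) (x : ℝ) : ℂ := -γ * ccos x

theorem isC2Per_evenMode₂ (γ : ℝ) : IsC2Per (evenMode₂ γ) := isC2Per_ccos.const_mul _

/-- The three conditions decouple. Mode 0 fixes the phase component a. At k = ±1 cosine has equal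
and the odd pair opposite coefficients, so the sum of the two conditions gives η and their
difference gives b. -/
theorem exists_mode_decomposition {α γ B m₀ : ℝ} (β : ℝ) (hγ : 2 ≤ 1 - α * γ) (hm₀ : 0 < m₀)
    {τ₁ τ₂ z₁ z₂ : ℝ → ℂ} (hτ : TransversalOddPair α B m₀ τ₁ τ₂) (hz₁ : IsC2Per z₁)
    (hz₂ : IsC2Per z₂) :
    ∃ (η a b : ℂ) (u v : ℝ → ℂ), ModeConditions α β u v ∧
      (∀ x, u x = z₁ x + (-b) * τ₁ x + (-η) * ccos x + (-a) * 0) ∧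
      (∀ x, v x = z₂ x + (-b) * τ₂ x + (-η) * evenMode₂ γ x + (-a) * 1) := by
  set T := fc τ₁ 1 + α * fc τ₂ 1 with hT
  have hT0 : T ≠ 0 := by
    intro h
    have := hτ.le_norm
    rw [← hT, h, norm_zero] at this
    linarith
  have hg0 : (1 - α * γ : ℂ) ≠ 0 := by
    have : (1 - α * γ : ℝ) ≠ 0 := by linarith
    exact_mod_cast this
  set w := fc z₁ 1 + α * fc z₂ 1 with hw
  set w' := fc z₁ (-1) + α * fc z₂ (-1) with hw'
  set η := (w + w') / (1 - α * γ) with hη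
  set b := (w - w') / (2 * T) with hb
  set a := fc z₂ 0 - β * fc z₁ 0 with ha
  have hη' : η * (1 - α * γ) = w + w' := by rw [hη]; field_simp
  have hb' : b * (2 * T) = w - w' := by rw [hb]; field_simp
  have d₁ := (hz₁.add_const_mul hτ.isC2Per₁ (-b))
  have d₁' := d₁.add_const_mul isC2Per_ccos (-η)
  have d₂ := (hz₂.add_const_mul hτ.isC2Per₂ (-b))
  have d₂' := d₂.add_const_mul (isC2Per_evenMode₂ γ) (-η)
  have f₁ : ∀ k, fc (fun x => z₁ x + (-b) * τ₁ x + (-η) * ccos x + (-a) * 0) k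
      = fc z₁ k - b * fc τ₁ k - η * fc ccos k := by
    intro k
    simp only [mul_zero, add_zero]
    rw [d₁.fc_add_const_mul isC2Per_ccos, hz₁.fc_add_const_mul hτ.isC2Per₁]
    ring
  have f₂ : ∀ k, fc (fun x => z₂ x + (-b) * τ₂ x + (-η) * evenMode₂ γ x + (-a) * 1) k
      = fc z₂ k - b * fc τ₂ k + η * γ * fc ccos k - a * fc (fun _ => 1) k := by
    intro k
    have : fc (evenMode₂ γ) k = -γ * fc ccos k := fc_const_mul _ _ _
    rw [d₂'.fc_add_const_mul (isC2Per_const 1), d₂.fc_add_const_mul (isC2Per_evenMode₂ γ),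
      hz₂.fc_add_const_mul hτ.isC2Per₂, this]
    ring
  refine ⟨η, a, b, _, _, ⟨d₁'.add_const_mul (isC2Per_const 0) _,
    d₂'.add_const_mul (isC2Per_const 1) _, ?_, ?_, ?_⟩, fun _ => rfl, fun _ => rfl⟩
  · rw [f₁, f₂, hτ.fc_zero₁, hτ.fc_zero₂, fc_ccos_zero, fc_one_zero, ha]
    ring
  · rw [f₁, f₂, fc_ccos_one, fc_one_of_ne (by decide)]
    linear_combination -(1 / 2 : ℂ) * hη' - (1 / 2 : ℂ) * hb' - hw + b * hT
  · rw [f₁, f₂, fc_ccos_neg_one, fc_one_of_ne (by decide), hτ.fc_neg₁, hτ.fc_neg₂]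
    linear_combination -(1 / 2 : ℂ) * hη' + (1 / 2 : ℂ) * hb' - hw' - b * hT

theorem ModeConditions.eq_zero {α β : ℝ} {u v : ℝ → ℂ} (h : ModeConditions α β u v)
    (h0 : sobSq u + sobSq v ≤ 0) : (∀ x, u x = 0) ∧ ∀ x, v x = 0 := by
  have h1 := sobSq_nonneg u
  have h2 := sobSq_nonneg v
  have h3 := msq_le_sobSq u
  have h4 := msq_le_sobSq v
  refine ⟨fun x => congrFun (eq_zero_of_msq_eq_zero h.isC2Per₁.continuous h.isC2Per₁.2 ?_) x,
    fun x => congrFun (eq_zero_of_msq_eq_zero h.isC2Per₂.continuous h.isC2Per₂.2 ?_) x⟩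
  · exact le_antisymm (by linarith) (msq_nonneg u)
  · exact le_antisymm (by linarith) (msq_nonneg v)

/-- The vector (1, −γ) spans the kernel of the critical matrix at k = ±1. For members of the branch
(cos, −γ cos) is only approximately annihilated, with an error of order ϵ. -/
theorem scaledOp₁_evenMode {μ q₀ α γ : ℝ} (h : (1 + α * γ) * q₀ = -2 * μ) (x : ℝ) :
    scaledOp₁ α q₀ (fun _ => μ) (fun _ => 0) (fun _ => 0) ccos (evenMode₂ γ) x = 0 := by
  have d : deriv (deriv (evenMode₂ γ)) x = γ * ccos x := by
    have h1 : deriv (evenMode₂ γ) = fun x => -γ * -csin x :=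
      funext fun x => ((hasDerivAt_ccos x).const_mul _).deriv
    rw [h1]
    have := ((hasDerivAt_csin x).neg.const_mul (-γ : ℂ)).deriv
    rw [show (fun x => -(γ : ℂ) * -csin x) = fun x => -(γ : ℂ) * (-csin) x from rfl, this]
    ring
  have h' : ((1 + α * γ) * q₀ : ℂ) = -2 * μ := by exact_mod_cast h
  unfold scaledOp₁
  rw [d, deriv2_realCos]
  push_cast
  linear_combination -ccos x * h'

theorem scaledOp₂_evenMode {μ q₀ α β γ : ℝ} (h : (γ - α) * q₀ = 2 * μ * β) (x : ℝ) :
    scaledOp₂ α β q₀ (fun _ => μ) (fun _ => 0) (fun _ => 0) ccos (evenMode₂ γ) x = 0 := by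
  have d : deriv (deriv (evenMode₂ γ)) x = γ * ccos x := by
    have h1 : deriv (evenMode₂ γ) = fun x => -γ * -csin x :=
      funext fun x => ((hasDerivAt_ccos x).const_mul _).deriv
    rw [h1]
    have := ((hasDerivAt_csin x).neg.const_mul (-γ : ℂ)).deriv
    rw [show (fun x => -(γ : ℂ) * -csin x) = fun x => -(γ : ℂ) * (-csin) x from rfl, this]
    ring
  have h' : ((γ - α) * q₀ : ℂ) = 2 * μ * β := by exact_mod_cast h
  unfold scaledOp₂
  rw [d, deriv2_realCos]
  push_cast
  linear_combination ccos x * h'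

/-- The phase mode and τ are exact kernel vectors, so subtracting them only shifts the multipliers s
and t. The even vector leaves its own small image and the multiplier ση. -/
theorem mode_residual {α β γ lam : ℝ} {P y ψ : ℝ → ℝ} {τ₁ τ₂ z₁ z₂ u v : ℝ → ℂ}
    {η a b σ s t : ℂ} (hτ₁ : IsC2Per τ₁) (hτ₂ : IsC2Per τ₂) (hz₁ : IsC2Per z₁) (hz₂ : IsC2Per z₂)
    (k₁ : ∀ x, scaledOp₁ α lam P y ψ τ₁ τ₂ x = 0) (k₂ : ∀ x, scaledOp₂ α β lam P y ψ τ₁ τ₂ x = 0)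
    (h₁ : ∀ x, scaledOp₁ α lam P y ψ z₁ z₂ x - σ * z₁ x = t * τ₁ x)
    (h₂ : ∀ x, scaledOp₂ α β lam P y ψ z₁ z₂ x - σ * z₂ x = s + t * τ₂ x)
    (hu : ∀ x, u x = z₁ x + (-b) * τ₁ x + (-η) * ccos x + (-a) * 0)
    (hv : ∀ x, v x = z₂ x + (-b) * τ₂ x + (-η) * evenMode₂ γ x + (-a) * 1) :
    (∀ x, scaledOp₁ α lam P y ψ u v x - σ * u x
      = -η * scaledOp₁ α lam P y ψ ccos (evenMode₂ γ) x + (t + σ * b) * τ₁ x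
        + σ * η * ccos x) ∧
    ∀ x, scaledOp₂ α β lam P y ψ u v x - σ * v x
      = -η * scaledOp₂ α β lam P y ψ ccos (evenMode₂ γ) x + (s + σ * a) + (t + σ * b) * τ₂ x
        - γ * (σ * η) * ccos x := by
  have d₁ := (hz₁.add_const_mul hτ₁ (-b))
  have d₁' := d₁.add_const_mul isC2Per_ccos (-η)
  have d₂ := (hz₂.add_const_mul hτ₂ (-b))
  have d₂' := d₂.add_const_mul (isC2Per_evenMode₂ γ) (-η)
  have e : ∀ x, evenMode₂ γ x = -γ * ccos x := fun _ => rfl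
  constructor
  · intro x
    rw [funext hu, funext hv, scaledOp₁_add_const_mul d₁' d₂' (isC2Per_const 0) (isC2Per_const 1),
      scaledOp₁_const, scaledOp₁_add_const_mul d₁ d₂ isC2Per_ccos (isC2Per_evenMode₂ γ),
      scaledOp₁_add_const_mul hz₁ hz₂ hτ₁ hτ₂, k₁]
    linear_combination h₁ x
  · intro x
    rw [funext hu, funext hv, scaledOp₂_add_const_mul d₁' d₂' (isC2Per_const 0) (isC2Per_const 1),
      scaledOp₂_const, scaledOp₂_add_const_mul d₁ d₂ isC2Per_ccos (isC2Per_evenMode₂ γ),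
      scaledOp₂_add_const_mul hz₁ hz₂ hτ₁ hτ₂, k₂]
    linear_combination h₂ x + σ * η * e x

/-- Near the critical operator, the part of the spectrum to the right of `-c` consists of `0`,
whose generalized eigenvectors are spanned by the phase mode and the odd mode `τ`, and at most one
further eigenvalue. -/
theorem Coercive.exists_alternative {μ α β γ q₀ B m₀ c ϵ₀ C : ℝ}
    (hco : Coercive μ α β γ q₀ B m₀ c ϵ₀ C) (hϵ₀ : 0 < ϵ₀) (hϵ₀1 : ϵ₀ ≤ 1) (hC : 0 < C)
    (hγ : 2 ≤ 1 - α * γ) (hm₀ : 0 < m₀) (hq₁ : (1 + α * γ) * q₀ = -2 * μ)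
    (hq₂ : (γ - α) * q₀ = 2 * μ * β) :
    ∃ ϵ₁ > 0, ∀ (ϵ lam : ℝ) (P y ψ : ℝ → ℝ), NearCritical μ q₀ ϵ lam P y ψ → ϵ ≤ ϵ₁ →
      ∀ τ₁ τ₂ : ℝ → ℂ, TransversalOddPair α B m₀ τ₁ τ₂ →
      (∀ x, scaledOp₁ α lam P y ψ τ₁ τ₂ x = 0) → (∀ x, scaledOp₂ α β lam P y ψ τ₁ τ₂ x = 0) →
      ∀ (w₁ w₂ : ℝ → ℂ) (σ₀ : ℂ), IsC2Per w₁ → IsC2Per w₂ → ¬(w₁ = 0 ∧ w₂ = 0) → σ₀ ≠ 0 →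
      -c ≤ σ₀.re → (∀ x, scaledOp₁ α lam P y ψ w₁ w₂ x = σ₀ * w₁ x) →
      (∀ x, scaledOp₂ α β lam P y ψ w₁ w₂ x = σ₀ * w₂ x) →
      ∀ (z₁ z₂ : ℝ → ℂ) (σ s t : ℂ), IsC2Per z₁ → IsC2Per z₂ → -c ≤ σ.re →
      (∀ x, scaledOp₁ α lam P y ψ z₁ z₂ x - σ * z₁ x = t * τ₁ x) →
      (∀ x, scaledOp₂ α β lam P y ψ z₁ z₂ x - σ * z₂ x = s + t * τ₂ x) →
      (∃ a b : ℂ, (∀ x, z₁ x = b * τ₁ x) ∧ ∀ x, z₂ x = a + b * τ₂ x) ∨ σ = σ₀ := by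
  set S := sobSq ccos + sobSq (evenMode₂ γ) with hS
  have hS0 : 0 ≤ S := add_nonneg (sobSq_nonneg _) (sobSq_nonneg _)
  set K := opConst α β q₀ with hK
  have hK0 : 0 < K := opConst_pos _ _ _
  set D := C ^ 2 * (12 * K ^ 2 * S) with hD
  have hD0 : 0 ≤ D := by positivity
  refine ⟨min ϵ₀ (1 + D)⁻¹, by positivity, ?_⟩
  intro ϵ lam P y ψ hN hϵ τ₁ τ₂ hτ k₁ k₂ w₁ w₂ σ₀ hw₁ hw₂ hw hσ₀ hσ₀c e₁ e₂ z₁ z₂ σ s t hz₁ hz₂ hσ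
    h₁ h₂
  have hϵ0 : 0 ≤ ϵ := (abs_nonneg _).trans hN.lam_le
  have hϵϵ₀ : ϵ ≤ ϵ₀ := hϵ.trans (min_le_left _ _)
  have hϵ1 : ϵ ≤ 1 := hϵϵ₀.trans hϵ₀1
  have hDϵ : D * ϵ ^ 2 < 1 := by
    have h2 : ϵ ≤ (1 + D)⁻¹ := hϵ.trans (min_le_right _ _)
    have h1 : ϵ ^ 2 ≤ (1 + D)⁻¹ := by nlinarith
    calc D * ϵ ^ 2 ≤ D * (1 + D)⁻¹ := by gcongr
      _ < 1 := by
        rw [← div_eq_mul_inv, div_lt_one (by positivity)]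
        linarith
  set W₁ := scaledOp₁ α lam P y ψ ccos (evenMode₂ γ) with hW₁
  set W₂ := scaledOp₂ α β lam P y ψ ccos (evenMode₂ γ) with hW₂
  have cW₁ : Continuous W₁ := continuous_scaledOp₁ hN.continuous_P hN.continuous_y
    hN.continuous_ψ isC2Per_ccos (isC2Per_evenMode₂ γ)
  have cW₂ : Continuous W₂ := continuous_scaledOp₂ hN.continuous_P hN.continuous_y
    hN.continuous_ψ isC2Per_ccos (isC2Per_evenMode₂ γ)
  have mW₁ : msq W₁ ≤ 6 * (ϵ * K) ^ 2 * S := by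
    refine msq_le_of_norm_le_jet cW₁ isC2Per_ccos (isC2Per_evenMode₂ γ) fun x => ?_
    have := hN.norm_scaledOp₁_sub_le hϵ1 α β ccos (evenMode₂ γ) x
    rwa [scaledOp₁_evenMode hq₁, sub_zero] at this
  have mW₂ : msq W₂ ≤ 6 * (ϵ * K) ^ 2 * S := by
    refine msq_le_of_norm_le_jet cW₂ isC2Per_ccos (isC2Per_evenMode₂ γ) fun x => ?_
    have := hN.norm_scaledOp₂_sub_le hϵ1 α β ccos (evenMode₂ γ) x
    rwa [scaledOp₂_evenMode hq₂, sub_zero] at this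
  obtain ⟨η, a, b, u, v, huv, hu, hv⟩ := exists_mode_decomposition β hγ hm₀ hτ hz₁ hz₂
  obtain ⟨η', a', b', u', v', huv', hu', hv'⟩ := exists_mode_decomposition β hγ hm₀ hτ hw₁ hw₂
  obtain ⟨r₁, r₂⟩ := mode_residual hτ.isC2Per₁ hτ.isC2Per₂ hz₁ hz₂ k₁ k₂ h₁ h₂ hu hv
  obtain ⟨r₁', r₂'⟩ := mode_residual (s := 0) (t := 0) (σ := σ₀) hτ.isC2Per₁
    hτ.isC2Per₂ hw₁ hw₂ k₁ k₂ (fun x => by rw [e₁]; ring) (fun x => by rw [e₂]; ring) hu' hv'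
  -- The noncritical part is slaved to η: the only forcing is −η times the image of the even vector.
  have est : ∀ {η σ s t : ℂ} {u v : ℝ → ℂ}, ModeConditions α β u v → -c ≤ σ.re →
      (∀ x, scaledOp₁ α lam P y ψ u v x - σ * u x = -η * W₁ x + t * τ₁ x + σ * η * ccos x) →
      (∀ x, scaledOp₂ α β lam P y ψ u v x - σ * v x
        = -η * W₂ x + s + t * τ₂ x - γ * (σ * η) * ccos x) →
      sobSq u + sobSq v ≤ C * (12 * K ^ 2 * S) * ϵ ^ 2 * ‖η‖ ^ 2 := by
    intro η σ s t u v huv hσ r₁ r₂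
    have c₁ : Continuous fun x => -η * W₁ x := continuous_const.mul cW₁
    have c₂ : Continuous fun x => -η * W₂ x := continuous_const.mul cW₂
    have := hco ϵ lam P y ψ hN hϵϵ₀ τ₁ τ₂ hτ u v huv _ _ c₁ c₂ σ s t (σ * η) hσ r₁ r₂
    rw [msq_const_mul, msq_const_mul, norm_neg] at this
    have h3 : ‖η‖ ^ 2 * msq W₁ + ‖η‖ ^ 2 * msq W₂ ≤ ‖η‖ ^ 2 * (12 * (ϵ * K) ^ 2 * S) := by
      rw [← mul_add]
      gcongr
      linarith
    have h4 := mul_le_mul_of_nonneg_left h3 hC.le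
    have h5 : C * (‖η‖ ^ 2 * (12 * (ϵ * K) ^ 2 * S)) = C * (12 * K ^ 2 * S) * ϵ ^ 2 * ‖η‖ ^ 2 := by
      ring
    linarith [sq_nonneg ‖s‖, sq_nonneg ‖t‖, sq_nonneg ‖σ * η‖]
  have est₀ := est huv hσ r₁ r₂
  have est₀' := est huv' hσ₀c r₁' r₂'
  by_cases hη : η = 0
  · left
    rw [hη, norm_zero] at est₀
    obtain ⟨hu0, hv0⟩ := huv.eq_zero (by simpa using est₀)
    refine ⟨a, b, fun x => ?_, fun x => ?_⟩
    · have := hu x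
      rw [hu0 x, hη] at this
      linear_combination -this
    · have := hv x
      rw [hv0 x, hη] at this
      linear_combination -this
  right
  -- Without an even component the given eigenvector would lie in the kernel, contradicting σ₀ ≠ 0.
  have hη' : η' ≠ 0 := by
    intro hη'
    rw [hη', norm_zero] at est₀'
    obtain ⟨hu0, hv0⟩ := huv'.eq_zero (by simpa using est₀')
    have x₁ : ∀ x, w₁ x = (fun _ => (0 : ℂ)) x + b' * τ₁ x + a' * 0 := by
      intro x
      have := hu' x
      rw [hu0 x, hη'] at this
      linear_combination -this
    have x₂ : ∀ x, w₂ x = (fun _ => (0 : ℂ)) x + b' * τ₂ x + a' * 1 := by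
      intro x
      have := hv' x
      rw [hv0 x, hη'] at this
      linear_combination -this
    have y₁ : ∀ x, σ₀ * w₁ x = 0 := by
      intro x
      have z0 : scaledOp₁ α lam P y ψ (fun _ => 0) (fun _ => 0) x = 0 := by simp [scaledOp₁]
      rw [← e₁, funext x₁, funext x₂, scaledOp₁_add_const_mul
        ((isC2Per_const 0).add_const_mul hτ.isC2Per₁ b')
        ((isC2Per_const 0).add_const_mul hτ.isC2Per₂ b') (isC2Per_const 0) (isC2Per_const 1),
        scaledOp₁_const, scaledOp₁_add_const_mul (isC2Per_const 0) (isC2Per_const 0)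
        hτ.isC2Per₁ hτ.isC2Per₂, k₁, z0]
      ring
    have y₂ : ∀ x, σ₀ * w₂ x = 0 := by
      intro x
      have z0 : scaledOp₂ α β lam P y ψ (fun _ => 0) (fun _ => 0) x = 0 := by simp [scaledOp₂]
      rw [← e₂, funext x₁, funext x₂, scaledOp₂_add_const_mul
        ((isC2Per_const 0).add_const_mul hτ.isC2Per₁ b')
        ((isC2Per_const 0).add_const_mul hτ.isC2Per₂ b') (isC2Per_const 0) (isC2Per_const 1),
        scaledOp₂_const, scaledOp₂_add_const_mul (isC2Per_const 0) (isC2Per_const 0)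
        hτ.isC2Per₁ hτ.isC2Per₂, k₂, z0]
      ring
    exact hw ⟨funext fun x => (mul_eq_zero.mp (y₁ x)).resolve_left hσ₀,
      funext fun x => (mul_eq_zero.mp (y₂ x)).resolve_left hσ₀⟩
  by_contra hne
  -- This is the noncritical part of η'z − ηw. The images of the even vector cancel, and what is
  -- left is a forcing proportional to u', v' and the multiplier ζ = ηη'(σ − σ₀).
  have hmc := (huv.const_mul η').add_const_mul huv' (-η)
  have hδ : 0 < ‖σ - σ₀‖ := norm_pos_iff.mpr (sub_ne_zero.mpr hne)
  have z0₁ : ∀ x, scaledOp₁ α lam P y ψ (fun x => η' * u x) (fun x => η' * v x) x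
      = η' * scaledOp₁ α lam P y ψ u v x := by
    intro x
    have z0 : scaledOp₁ α lam P y ψ (fun _ => 0) (fun _ => 0) x = 0 := by simp [scaledOp₁]
    have := scaledOp₁_add_const_mul (isC2Per_const 0) (isC2Per_const 0) huv.isC2Per₁ huv.isC2Per₂
      η' α lam P y ψ x
    simpa only [zero_add, z0] using this
  have z0₂ : ∀ x, scaledOp₂ α β lam P y ψ (fun x => η' * u x) (fun x => η' * v x) x
      = η' * scaledOp₂ α β lam P y ψ u v x := by
    intro x
    have z0 : scaledOp₂ α β lam P y ψ (fun _ => 0) (fun _ => 0) x = 0 := by simp [scaledOp₂]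
    have := scaledOp₂_add_const_mul (isC2Per_const 0) (isC2Per_const 0) huv.isC2Per₁ huv.isC2Per₂
      η' α β lam P y ψ x
    simpa only [zero_add, z0] using this
  have cu : Continuous fun x => η * (σ - σ₀) * u' x :=
    continuous_const.mul huv'.isC2Per₁.continuous
  have cv : Continuous fun x => η * (σ - σ₀) * v' x :=
    continuous_const.mul huv'.isC2Per₂.continuous
  have key := hco ϵ lam P y ψ hN hϵϵ₀ τ₁ τ₂ hτ _ _ hmc _ _ cu cv σ
    (η' * (s + σ * a) - η * (0 + σ₀ * a')) (η' * (t + σ * b) - η * (0 + σ₀ * b'))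
    (η * η' * (σ - σ₀)) hσ
    (fun x => by
      rw [scaledOp₁_add_const_mul (huv.const_mul η').isC2Per₁ (huv.const_mul η').isC2Per₂
        huv'.isC2Per₁ huv'.isC2Per₂, z0₁]
      linear_combination η' * r₁ x - η * r₁' x)
    (fun x => by
      rw [scaledOp₂_add_const_mul (huv.const_mul η').isC2Per₁ (huv.const_mul η').isC2Per₂
        huv'.isC2Per₁ huv'.isC2Per₂, z0₂]
      linear_combination η' * r₂ x - η * r₂' x)
  rw [msq_const_mul, msq_const_mul, ← mul_add] at key
  have hm : msq u' + msq v' ≤ C * (12 * K ^ 2 * S) * ϵ ^ 2 * ‖η'‖ ^ 2 := by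
    linarith [msq_le_sobSq u', msq_le_sobSq v']
  -- Coercivity bounds ζ by the forcing, which is itself of order ϵη'. Hence |ζ|² ≤ Dϵ²|ζ|² with Dϵ²
  -- < 1, which is impossible unless ζ = 0.
  have k3 : ‖η * η' * (σ - σ₀)‖ ^ 2
      ≤ C * (‖η * (σ - σ₀)‖ ^ 2 * (C * (12 * K ^ 2 * S) * ϵ ^ 2 * ‖η'‖ ^ 2)) := by
    have := mul_le_mul_of_nonneg_left (mul_le_mul_of_nonneg_left hm (sq_nonneg ‖η * (σ - σ₀)‖)) hC.le
    have s1 := sobSq_nonneg (fun x => η' * u x + -η * u' x)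
    have s2 := sobSq_nonneg (fun x => η' * v x + -η * v' x)
    refine le_trans ?_ (key.trans this)
    have s3 := sq_nonneg ‖η' * (s + σ * a) - η * (0 + σ₀ * a')‖
    have s4 := sq_nonneg ‖η' * (t + σ * b) - η * (0 + σ₀ * b')‖
    linarith
  have k4 : C * (‖η * (σ - σ₀)‖ ^ 2 * (C * (12 * K ^ 2 * S) * ϵ ^ 2 * ‖η'‖ ^ 2))
      = D * ϵ ^ 2 * ‖η * η' * (σ - σ₀)‖ ^ 2 := by
    rw [norm_mul, norm_mul, norm_mul, hD]
    ring
  rw [k4] at k3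
  have k5 : 0 < ‖η * η' * (σ - σ₀)‖ ^ 2 := by
    have := norm_pos_iff.mpr (mul_ne_zero (mul_ne_zero hη hη') (sub_ne_zero.mpr hne))
    positivity
  nlinarith

/-! ### The rescaled eigenvalue problem -/

open PerFun

/-- Coefficients of the rescaled eigenvalue problem: `y`, `χ`, `e = Λ - 1 + 2E`, the leading parts
of the amplitude and phase perturbations, two forcing terms, the factor `ν` and the scale `a²`. -/
abbrev EigParam : Type :=
  PerFun × PerFun × PerFun × PerFun × PerFun × PerFun × PerFun × ℝ × ℝ

theorem completeSpace_eigParam : CompleteSpace EigParam := by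
  haveI h1 : CompleteSpace (PerFun × ℝ × ℝ) := inferInstance
  haveI h2 : CompleteSpace (PerFun × PerFun × ℝ × ℝ) := inferInstance
  haveI h3 : CompleteSpace (PerFun × PerFun × PerFun × ℝ × ℝ) := CompleteSpace.prod
  haveI h4 : CompleteSpace (PerFun × PerFun × PerFun × PerFun × ℝ × ℝ) := CompleteSpace.prod
  haveI h5 : CompleteSpace (PerFun × PerFun × PerFun × PerFun × PerFun × ℝ × ℝ) :=
    CompleteSpace.prod
  haveI h6 : CompleteSpace (PerFun × PerFun × PerFun × PerFun × PerFun × PerFun × ℝ × ℝ) :=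
    CompleteSpace.prod
  exact CompleteSpace.prod

/-- Total amplitude perturbation. -/
def eigRho (v : EigParam × BranchSpace) : PerFun :=
  v.1.2.2.2.1 + v.1.2.2.2.2.2.2.2.2 • v.2.2.2.1

/-- Total phase perturbation. -/
def eigTheta (γ : ℝ) (v : EigParam × BranchSpace) : PerFun :=
  v.1.2.2.2.2.1 + (v.1.2.2.2.2.2.2.2.2 * γ) • J v.2.2.1

/-- Forcing of the first corrected equation. The two subtracted ν₀-terms are the values of the τ-
and S-terms at the bifurcation point; `eigRhsY` restores them with the updated τ and S. In this way
the unknowns drop out at the base point. -/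
def eigForceY (α γ ν₀ : ℝ) (v : EigParam × BranchSpace) : PerFun :=
  -(v.1.2.2.1 * v.2.2.2.1) - 2 * (v.1.1 * v.2.1) + (2 * γ ^ 2) • (v.1.2.1 * v.2.2.1)
    + (v.1.2.2.2.2.2.2.2.1 * v.2.2.2.2.1) • (eigRho v + α • eigTheta γ v)
    + (v.1.2.2.2.2.2.2.2.1 * α * v.2.2.2.2.2) • (1 : PerFun)
    - (ν₀ * v.2.2.2.2.1 * (1 - α * γ)) • cosP - (ν₀ * α * v.2.2.2.2.2) • (1 : PerFun)
    + v.1.2.2.2.2.2.1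

def eigForceX (α γ ν₀ : ℝ) (v : EigParam × BranchSpace) : PerFun :=
  v.1.2.2.1 * v.2.2.2.1 - 2 * (v.1.1 * v.2.2.1) - 2 * (v.1.2.1 * v.2.1)
    + (v.1.2.2.2.2.2.2.2.1 / γ * v.2.2.2.2.1) • (eigTheta γ v - α • eigRho v)
    + (v.1.2.2.2.2.2.2.2.1 / γ * v.2.2.2.2.2) • (1 : PerFun)
    + (ν₀ / γ * v.2.2.2.2.1 * (γ + α)) • cosP - (ν₀ / γ * v.2.2.2.2.2) • (1 : PerFun)
    + v.1.2.2.2.2.2.2.1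

/-- Solvability against cos, where cos² has mean 1/2. The condition against sin holds by parity.
This is where the rescaled critical eigenvalue is determined. -/
def newTau (α γ ν₀ : ℝ) (v : EigParam × BranchSpace) : ℝ :=
  -2 / (ν₀ * (1 - α * γ)) * mean (cosP * eigForceY α γ ν₀ v)

/-- Solvability of the equation for the sum of the first two components, in which S has coefficient
ν₀(1 + αγ)/γ. -/
def newS (α γ ν₀ : ℝ) (v : EigParam × BranchSpace) : ℝ :=
  -γ / (ν₀ * (1 + α * γ)) * mean (eigForceY α γ ν₀ v + eigForceX α γ ν₀ v)

def eigRhsY (α γ ν₀ : ℝ) (v : EigParam × BranchSpace) : PerFun :=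
  eigForceY α γ ν₀ v + (ν₀ * newTau α γ ν₀ v * (1 - α * γ)) • cosP
    + (ν₀ * α * newS α γ ν₀ v) • (1 : PerFun)

def eigRhsX (α γ ν₀ : ℝ) (v : EigParam × BranchSpace) : PerFun :=
  eigForceX α γ ν₀ v - (ν₀ / γ * newTau α γ ν₀ v * (γ + α)) • cosP
    + (ν₀ / γ * newS α γ ν₀ v) • (1 : PerFun)

/-- The map whose fixed points give the corrections to the critical eigenfunction. -/
def eigMap (α γ ν₀ : ℝ) (v : EigParam × BranchSpace) : BranchSpace :=
  (coreY (eigRhsY α γ ν₀ v) 0, coreX (eigRhsY α γ ν₀ v) (eigRhsX α γ ν₀ v) 0,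
    coreW (eigRhsY α γ ν₀ v) 0, newTau α γ ν₀ v, newS α γ ν₀ v)

theorem contDiff_eigMap (α γ ν₀ : ℝ) : ContDiff ℝ 1 (eigMap α γ ν₀) := by
  have h1 : ContDiff ℝ 1 eigRho := by unfold eigRho; fun_prop
  have h2 : ContDiff ℝ 1 (eigTheta γ) := by unfold eigTheta; fun_prop
  have h3 : ContDiff ℝ 1 (eigForceY α γ ν₀) := by unfold eigForceY; fun_prop
  have h4 : ContDiff ℝ 1 (eigForceX α γ ν₀) := by
    unfold eigForceX
    simp only [div_eq_mul_inv]
    fun_prop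
  have h5 : ContDiff ℝ 1 (newTau α γ ν₀) := by unfold newTau; fun_prop
  have h6 : ContDiff ℝ 1 (newS α γ ν₀) := by unfold newS; fun_prop
  have h7 : ContDiff ℝ 1 (eigRhsY α γ ν₀) := by unfold eigRhsY; fun_prop
  have h8 : ContDiff ℝ 1 (eigRhsX α γ ν₀) := by unfold eigRhsX; fun_prop
  unfold eigMap coreX coreY coreW
  fun_prop

/-- Coefficients at the bifurcation point. -/
def eigBase (γ ν₀ k₀ : ℝ) : EigParam :=
  (0, 0, 0, cosP, -γ • cosP, (2 * k₀) • cosP, (-2 * k₀) • cosP, ν₀, 0)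

theorem eigForceY_base (α γ ν₀ k₀ : ℝ) (x : BranchSpace) :
    eigForceY α γ ν₀ (eigBase γ ν₀ k₀, x) = (2 * k₀) • cosP := by
  refine ext_coe fun s => ?_
  simp [eigForceY, eigBase, eigRho, eigTheta]
  ring

theorem eigForceX_base {γ : ℝ} (hγ : γ ≠ 0) (α ν₀ k₀ : ℝ) (x : BranchSpace) :
    eigForceX α γ ν₀ (eigBase γ ν₀ k₀, x) = (-2 * k₀) • cosP := by
  refine ext_coe fun s => ?_
  simp [eigForceX, eigBase, eigRho, eigTheta]
  ring

/-- As for the branch, independence of the unknown at the base point replaces the inversion of a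
linearized operator. -/
theorem eigMap_base {γ : ℝ} (hγ : γ ≠ 0) (α ν₀ k₀ : ℝ) (x : BranchSpace) :
    eigMap α γ ν₀ (eigBase γ ν₀ k₀, x) = eigMap α γ ν₀ (eigBase γ ν₀ k₀, 0) := by
  simp only [eigMap, eigRhsY, eigRhsX, newTau, newS, eigForceY_base, eigForceX_base hγ]

theorem mean_cosP_mul_cosP : mean (cosP * cosP) = 1 / 2 := by
  have : cosP * cosP = 1 - sinP ^ 2 := by rw [sinP_sq]; ring
  rw [this, map_sub, mean_one, mean_sinP_sq]
  norm_num

/-- The leading coefficient of σ₋ is read off from the forcing 2k₀ cos. -/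
theorem newTau_base (α γ ν₀ k₀ : ℝ) (x : BranchSpace) :
    newTau α γ ν₀ (eigBase γ ν₀ k₀, x) = -2 * k₀ / (ν₀ * (1 - α * γ)) := by
  rw [newTau, eigForceY_base, mul_smul_comm, map_smul, mean_cosP_mul_cosP, smul_eq_mul]
  ring

/-- Parity of the coefficients. -/
structure EigParam.Sym (p : EigParam) : Prop where
  y : reflect p.1 = -p.1
  χ : reflect p.2.1 = -p.2.1
  e : reflect p.2.2.1 = p.2.2.1
  rho : reflect p.2.2.2.1 = p.2.2.2.1
  theta : reflect p.2.2.2.2.1 = p.2.2.2.2.1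
  f₁ : reflect p.2.2.2.2.2.1 = p.2.2.2.2.2.1
  f₂ : reflect p.2.2.2.2.2.2.1 = p.2.2.2.2.2.2.1

theorem eigRho_reflect {p : EigParam} (hp : p.Sym) (x : BranchSpace) :
    eigRho (p, reflectBranch x) = reflect (eigRho (p, x)) := by
  simp only [eigRho, reflectBranch, map_add, map_smul, hp.rho]

theorem eigTheta_reflect {p : EigParam} (hp : p.Sym) (γ : ℝ) (x : BranchSpace) :
    eigTheta γ (p, reflectBranch x) = reflect (eigTheta γ (p, x)) := by
  simp only [eigTheta, reflectBranch, map_add, map_smul, hp.theta, reflect_J, map_neg]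

theorem eigForceY_reflect {p : EigParam} (hp : p.Sym) (α γ ν₀ : ℝ) (x : BranchSpace) :
    eigForceY α γ ν₀ (p, reflectBranch x) = reflect (eigForceY α γ ν₀ (p, x)) := by
  simp only [eigForceY, eigRho_reflect hp, eigTheta_reflect hp, map_add, map_sub, map_neg, map_mul,
    map_smul, map_one, reflect_two, reflect_cosP, hp.y, hp.χ, hp.e, hp.f₁]
  simp only [reflectBranch, mul_neg, neg_mul]

theorem eigForceX_reflect {p : EigParam} (hp : p.Sym) (α γ ν₀ : ℝ) (x : BranchSpace) :
    eigForceX α γ ν₀ (p, reflectBranch x) = reflect (eigForceX α γ ν₀ (p, x)) := by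
  simp only [eigForceX, eigRho_reflect hp, eigTheta_reflect hp, map_add, map_sub, map_neg, map_mul,
    map_smul, map_one, reflect_two, reflect_cosP, hp.y, hp.χ, hp.e, hp.f₂]
  simp only [reflectBranch, mul_neg, neg_mul]

theorem newTau_reflect {p : EigParam} (hp : p.Sym) (α γ ν₀ : ℝ) (x : BranchSpace) :
    newTau α γ ν₀ (p, reflectBranch x) = newTau α γ ν₀ (p, x) := by
  rw [newTau, newTau, eigForceY_reflect hp, ← mean_reflect (cosP * eigForceY α γ ν₀ (p, x)),
    map_mul reflect, reflect_cosP]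

theorem newS_reflect {p : EigParam} (hp : p.Sym) (α γ ν₀ : ℝ) (x : BranchSpace) :
    newS α γ ν₀ (p, reflectBranch x) = newS α γ ν₀ (p, x) := by
  rw [newS, newS, eigForceY_reflect hp, eigForceX_reflect hp, ← map_add, mean_reflect]

theorem eigMap_reflect {p : EigParam} (hp : p.Sym) (α γ ν₀ : ℝ) (x : BranchSpace) :
    eigMap α γ ν₀ (p, reflectBranch x) = reflectBranch (eigMap α γ ν₀ (p, x)) := by
  simp only [eigMap, eigRhsY, eigRhsX, newTau_reflect hp, newS_reflect hp, eigForceY_reflect hp,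
    eigForceX_reflect hp]
  simp only [reflectBranch, reflect_coreX, reflect_coreY, reflect_coreW, map_add,
    map_sub, map_smul, map_one, reflect_cosP, map_zero, neg_zero, neg_neg]

theorem eigBase_sym (γ ν₀ k₀ : ℝ) : (eigBase γ ν₀ k₀).Sym := by
  constructor <;> simp [eigBase, map_smul]

/-- Solvability of the rescaled eigenvalue problem near the bifurcation point. -/
theorem exists_eigSolution {α γ ν₀ : ℝ} (hγ : γ ≠ 0) (hν : ν₀ ≠ 0) (h₁ : 1 - α * γ ≠ 0)
    (h₂ : 1 + α * γ ≠ 0) (k₀ : ℝ) :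
    ∃ ξ : EigParam → BranchSpace, ContinuousAt ξ (eigBase γ ν₀ k₀) ∧
      (ξ (eigBase γ ν₀ k₀)).2.2.2.1 = -2 * k₀ / (ν₀ * (1 - α * γ)) ∧
      ∀ᶠ p in 𝓝 (eigBase γ ν₀ k₀), p.Sym →
        mean (ξ p).2.1 = 0 ∧
        IsDeriv (ξ p).1 (-((1 + p.2.2.1) * (ξ p).2.2.1) - 2 * (p.1 * (ξ p).1)
          + (2 * γ ^ 2) • (p.2.1 * (ξ p).2.1)
          + (p.2.2.2.2.2.2.2.1 * (ξ p).2.2.2.1) • (eigRho (p, ξ p) + α • eigTheta γ (p, ξ p))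
          + (p.2.2.2.2.2.2.2.1 * α * (ξ p).2.2.2.2) • (1 : PerFun) + p.2.2.2.2.2.1) ∧
        IsDeriv (ξ p).2.1 ((1 + p.2.2.1) * (ξ p).2.2.1 - 2 * (p.1 * (ξ p).2.1)
          - 2 * (p.2.1 * (ξ p).1)
          + (p.2.2.2.2.2.2.2.1 / γ * (ξ p).2.2.2.1) • (eigTheta γ (p, ξ p) - α • eigRho (p, ξ p))
          + (p.2.2.2.2.2.2.2.1 / γ * (ξ p).2.2.2.2) • (1 : PerFun) + p.2.2.2.2.2.2.1) ∧
        IsDeriv (ξ p).2.2.1 (ξ p).1 := by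
  haveI := completeSpace_eigParam
  obtain ⟨ξ, hξc, hξ0, hfix, r, hr, huniq⟩ := exists_fixedPoint_family (eigMap α γ ν₀)
    (contDiff_eigMap α γ ν₀) (eigBase γ ν₀ k₀) (eigMap α γ ν₀ (eigBase γ ν₀ k₀, 0))
    (eigMap_base hγ α ν₀ k₀)
  refine ⟨ξ, hξc.continuousAt, ?_, ?_⟩
  · rw [hξ0]
    exact newTau_base α γ ν₀ k₀ 0
  have hnear : ∀ᶠ p in 𝓝 (eigBase γ ν₀ k₀),
      ‖ξ p - eigMap α γ ν₀ (eigBase γ ν₀ k₀, 0)‖ < r := by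
    have := hξc.continuousAt
    rw [ContinuousAt, hξ0, Metric.tendsto_nhds] at this
    simpa [dist_eq_norm] using this r hr
  have hrefl0 : reflectBranch (eigMap α γ ν₀ (eigBase γ ν₀ k₀, 0))
      = eigMap α γ ν₀ (eigBase γ ν₀ k₀, 0) := by
    rw [← eigMap_reflect (eigBase_sym γ ν₀ k₀), eigMap_base hγ]
  filter_upwards [hfix, huniq, hnear] with p hfix huniq hnear hp
  -- Uniqueness of the fixed point again yields symmetry, which supplies the remaining solvability
  -- condition m₂ and the zero mean of the second component.
  have hsym : reflectBranch (ξ p) = ξ p := by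
    refine huniq _ ?_ ?_
    · rw [← hrefl0]
      exact (norm_reflectBranch_sub_le _ _).trans_lt hnear
    · rw [eigMap_reflect hp, hfix]
  set F₁ := eigRhsY α γ ν₀ (p, ξ p) with hF₁
  set F₂ := eigRhsX α γ ν₀ (p, ξ p) with hF₂
  have hY : (ξ p).1 = coreY F₁ 0 := (congrArg (fun x : BranchSpace => x.1) hfix).symm
  have hX : (ξ p).2.1 = coreX F₁ F₂ 0 := (congrArg (fun x : BranchSpace => x.2.1) hfix).symm
  have hW : (ξ p).2.2.1 = coreW F₁ 0 := (congrArg (fun x : BranchSpace => x.2.2.1) hfix).symm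
  have hT : (ξ p).2.2.2.1 = newTau α γ ν₀ (p, ξ p) :=
    (congrArg (fun x : BranchSpace => x.2.2.2.1) hfix).symm
  have hS : (ξ p).2.2.2.2 = newS α γ ν₀ (p, ξ p) :=
    (congrArg (fun x : BranchSpace => x.2.2.2.2) hfix).symm
  have hrX : reflect (ξ p).2.1 = -(ξ p).2.1 := by
    have := congrArg (fun x : BranchSpace => x.2.1) hsym
    simp only [reflectBranch] at this
    rw [← neg_eq_iff_eq_neg, this]
  have hrG : reflect (eigForceY α γ ν₀ (p, ξ p)) = eigForceY α γ ν₀ (p, ξ p) := by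
    rw [← eigForceY_reflect hp, hsym]
  have hrF₁ : reflect F₁ = F₁ := by
    rw [hF₁, eigRhsY, map_add, map_add, hrG, map_smul, map_smul, map_one, reflect_cosP]
  have m₁ : mean (cosP * F₁ + sinP * 0) = 0 := by
    have : cosP * F₁ + sinP * 0 = cosP * eigForceY α γ ν₀ (p, ξ p)
        + (ν₀ * newTau α γ ν₀ (p, ξ p) * (1 - α * γ)) • (cosP * cosP)
        + (ν₀ * α * newS α γ ν₀ (p, ξ p)) • cosP := by
      rw [hF₁, eigRhsY, mul_zero, add_zero, mul_add, mul_add, mul_smul_comm, mul_smul_comm, mul_one]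
    rw [this, map_add, map_add, map_smul, map_smul, mean_cosP, mean_cosP_mul_cosP]
    simp only [newTau, smul_eq_mul]
    field_simp
    ring
  have m₂ : mean (cosP * 0 - sinP * F₁) = 0 := by
    refine mean_eq_zero_of_reflect ?_
    rw [mul_zero, zero_sub, map_neg, map_mul, hrF₁, reflect_sinP]
    ring
  have m₃ : mean (F₁ + F₂) = 0 := by
    have : F₁ + F₂ = eigForceY α γ ν₀ (p, ξ p) + eigForceX α γ ν₀ (p, ξ p)
        + (ν₀ * newTau α γ ν₀ (p, ξ p) * (1 - α * γ) - ν₀ / γ * newTau α γ ν₀ (p, ξ p) * (γ + α))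
          • cosP
        + (ν₀ * (1 + α * γ) / γ * newS α γ ν₀ (p, ξ p)) • (1 : PerFun) := by
      refine ext_coe fun s => ?_
      simp [hF₁, hF₂, eigRhsY, eigRhsX]
      field_simp
      ring
    rw [this, map_add, map_add, map_smul, map_smul, mean_cosP, mean_one]
    simp only [newS, smul_eq_mul]
    field_simp
    ring
  have hdY := hasDerivAt_coreY m₁ m₂
  have hdX := hasDerivAt_coreX m₁ m₂ m₃
  have hdW := hasDerivAt_coreW m₁ m₂
  rw [← hY, ← hW] at hdY
  rw [← hX, ← hW] at hdX
  rw [← hW, ← hY] at hdW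
  refine ⟨mean_eq_zero_of_reflect hrX, fun s => (hdY s).congr_deriv ?_,
    fun s => (hdX s).congr_deriv ?_, fun s => (hdW s).congr_deriv ?_⟩
  · simp [hF₁, eigRhsY, eigForceY, ← hT, ← hS]
    ring
  · simp [hF₂, eigRhsX, eigForceX, ← hT, ← hS]
    ring
  · simp

/-! ### Differentiating the branch with respect to the amplitude -/

open PerFun

namespace PerFun

/-- A periodic function as a function on the line. -/
def fn (f : PerFun) (s : ℝ) : ℝ := f (s : AddCircle (2 * Real.pi))

/-- A periodic function as a complex-valued function on the line. -/
def cx (f : PerFun) (s : ℝ) : ℂ := (f (s : AddCircle (2 * Real.pi)) : ℂ)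

theorem IsDeriv.hasDerivAt_cx {Y G : PerFun} (h : IsDeriv Y G) (s : ℝ) :
    HasDerivAt Y.cx (G.cx s) s := (h s).ofReal_comp

theorem IsDeriv.deriv_cx {Y G : PerFun} (h : IsDeriv Y G) : deriv Y.cx = G.cx :=
  funext fun s => (h.hasDerivAt_cx s).deriv

theorem continuous_cx (f : PerFun) : Continuous f.cx :=
  Complex.continuous_ofReal.comp f.continuous_coe

theorem periodic_cx (f : PerFun) : Function.Periodic f.cx (2 * Real.pi) := fun s =>
  congrArg (fun x : ℝ => (x : ℂ)) (f.periodic_coe s)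

theorem isC2Per_cx {Y G H : PerFun} (h₁ : IsDeriv Y G) (h₂ : IsDeriv G H) : IsC2Per Y.cx := by
  refine ⟨?_, Y.periodic_cx⟩
  have e : (2 : WithTop ℕ∞) = 1 + 1 := by norm_num
  have hG : ContDiff ℝ 1 G.cx := by
    rw [contDiff_one_iff_deriv, h₂.deriv_cx]
    exact ⟨fun s => (h₂.hasDerivAt_cx s).differentiableAt, H.continuous_cx⟩
  rw [e, contDiff_succ_iff_deriv, h₁.deriv_cx]
  exact ⟨fun s => (h₁.hasDerivAt_cx s).differentiableAt, by simp, hG⟩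

/-- Differentiation of a family of periodic solutions with respect to a parameter. -/
theorem isDeriv_of_hasDerivAt {Y G : ℝ → PerFun} {Y' G' : PerFun} {a : ℝ}
    (h : ∀ᶠ a' in 𝓝 a, IsDeriv (Y a') (G a')) (hY : HasDerivAt Y Y' a) (hG : HasDerivAt G G' a) :
    IsDeriv Y' G' := by
  -- In the integrated form Y = J G + mean Y the differential equation is a linear relation, which
  -- differentiates termwise in the parameter.
  have h1 : HasDerivAt (fun a' => J (G a') + algebraMap ℝ PerFun (mean (Y a')))
      (J G' + algebraMap ℝ PerFun (mean Y')) a :=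
    (J.hasFDerivAt.comp_hasDerivAt a hG).add
      (((Algebra.linearMap ℝ PerFun).toContinuousLinearMap.comp mean).hasFDerivAt.comp_hasDerivAt
        a hY)
  have h2 : Y =ᶠ[𝓝 a] fun a' => J (G a') + algebraMap ℝ PerFun (mean (Y a')) :=
    h.mono fun a' ha' => eq_J_of_hasDerivAt ha'
  have h3 : Y' = J G' + algebraMap ℝ PerFun (mean Y') := hY.unique (h1.congr_of_eventuallyEq h2)
  have h4 : mean G' = 0 := by
    have h5 : HasDerivAt (fun a' => mean (G a')) (mean G') a :=
      mean.hasFDerivAt.comp_hasDerivAt a hG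
    have h6 : (fun a' => mean (G a')) =ᶠ[𝓝 a] fun _ => 0 :=
      h.mono fun a' ha' => mean_eq_zero_of_hasDerivAt ha'
    exact h5.unique ((hasDerivAt_const a (0 : ℝ)).congr_of_eventuallyEq h6)
  intro s
  have h7 := (hasDerivAt_J G' s).add_const (mean Y')
  rw [h4, sub_zero] at h7
  rw [h3]
  refine h7.congr_of_eventuallyEq (Eventually.of_forall fun s => ?_)
  simp

/-- Reflection as a continuous linear map. -/
def reflectCLM : PerFun →L[ℝ] PerFun :=
  LinearMap.mkContinuous reflect.toLinearMap 1 fun f => by simpa using norm_reflect_le f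

theorem reflect_of_hasDerivAt {Y : ℝ → PerFun} {Y' : PerFun} {a c : ℝ}
    (h : ∀ᶠ a' in 𝓝 a, reflect (Y a') = c • Y a') (hY : HasDerivAt Y Y' a) :
    reflect Y' = c • Y' := by
  have h1 : HasDerivAt (fun a' => reflect (Y a')) (reflect Y') a :=
    reflectCLM.hasFDerivAt.comp_hasDerivAt a hY
  exact h1.unique ((hY.const_smul c).congr_of_eventuallyEq h)

theorem J_sinP : J sinP = -cosP := by
  have h : IsDeriv (-cosP) sinP := by
    intro s
    exact (Real.hasDerivAt_cos s).neg.congr_deriv (by simp)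
  have := eq_J_of_hasDerivAt h
  rw [map_neg, mean_cosP, neg_zero, map_zero, add_zero] at this
  exact this.symm

theorem isDeriv_J {f : PerFun} (h : mean f = 0) : IsDeriv (J f) f := by
  intro s
  have := hasDerivAt_J f s
  rwa [h, sub_zero] at this

end PerFun

theorem ContDiffAt.continuousAt_deriv_one {F : Type*} [NormedAddCommGroup F] [NormedSpace ℝ F]
    {f : ℝ → F} {x : ℝ} (hf : ContDiffAt ℝ 1 f x) : ContinuousAt (deriv f) x := by
  have h := hf.continuousAt_fderiv one_ne_zero
  have : deriv f = fun x => fderiv ℝ f x 1 := funext fun x => (fderiv_apply_one_eq_deriv).symm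
  rw [this]
  exact h.clm_apply continuousAt_const

namespace BranchFamily

variable {γ : ℝ} (b : BranchFamily γ)

theorem contDiff_y : ContDiffAt ℝ 1 b.y 0 := by
  have := b.contDiff_yh
  unfold BranchFamily.y
  fun_prop

theorem contDiff_χ : ContDiffAt ℝ 1 b.χ 0 := by
  have := b.contDiff_xh
  unfold BranchFamily.χ
  fun_prop

theorem contDiff_E : ContDiffAt ℝ 1 b.E 0 := by
  have := b.contDiff_Eh
  unfold BranchFamily.E
  fun_prop

theorem contDiff_d : ContDiffAt ℝ 1 b.d 0 := by
  have := b.contDiff_dh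
  unfold BranchFamily.d
  fun_prop

theorem contDiff_Lam : ContDiffAt ℝ 1 b.Lam 0 := by
  have := b.contDiff_ell
  unfold BranchFamily.Lam
  fun_prop

/-- The coefficient `k` in `Λ - 2hd = 1 + a²k`. -/
def waveCoeff (h a : ℝ) : ℝ := b.ell a - 2 * h * b.dh a

theorem contDiff_waveCoeff (h : ℝ) : ContDiffAt ℝ 1 (b.waveCoeff h) 0 := by
  have := b.contDiff_ell
  have := b.contDiff_dh
  unfold BranchFamily.waveCoeff
  fun_prop

/-- By Ω²(Λ − 2hd) = 2hμ this quantity is q₀/Ω², so `waveCoeff` measures how the box length depends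
on the amplitude. -/
theorem Lam_sub (h a : ℝ) : b.Lam a - 2 * h * b.d a = 1 + a ^ 2 * b.waveCoeff h a := by
  unfold Lam d waveCoeff
  ring

/-- Both parts are positive: ℓ(0) by `ellZero_pos`, and −2h times the negative value of d̂(0). This
is the supercriticality of the pitchfork. -/
theorem waveCoeff_zero_pos {h : ℝ} (hh : 0 < h) : 0 < b.waveCoeff h 0 := by
  unfold waveCoeff
  rw [b.ell_zero, b.dh_zero]
  have := ellZero_pos γ
  nlinarith [sq_nonneg γ, mul_nonneg hh.le (sq_nonneg γ)]

/-- The squared wavenumber along the branch. -/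
def lam (h q₀ a : ℝ) : ℝ := q₀ / (1 + a ^ 2 * b.waveCoeff h a)

/-- The logarithmic derivative of the squared wavenumber, divided by `a`. -/
def logSlope (h a : ℝ) : ℝ :=
  -(2 * b.waveCoeff h a + a * deriv (b.waveCoeff h) a) / (1 + a ^ 2 * b.waveCoeff h a)

/-- The rescaled intensity `Λ + 2E`. -/
def intensity (a : ℝ) : PerFun := b.Lam a • (1 : PerFun) + 2 * b.E a

/-- The derivative of log R in a at fixed s: R² is proportional to the squared wavenumber times Λ +
2E, and the logarithmic derivative of the former is a times `logSlope`. -/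
def rhoDot (h a : ℝ) : PerFun :=
  Ring.inverse (b.intensity a) * ((deriv b.Lam a / 2) • (1 : PerFun) + deriv b.E a)
    + (a * b.logSlope h a / 2) • (1 : PerFun)

/-- Coefficients of the eigenvalue problem along the branch. -/
def eigParam (α h q₀ a : ℝ) : EigParam :=
  (b.y a, b.χ a, b.intensity a - 1, b.rhoDot h a, γ • J (deriv b.χ a),
    -(b.logSlope h a • (cosP + a • b.Eh a - (a * b.dh a) • (1 : PerFun))),
    b.logSlope h a • (cosP + a • b.Eh a),
    (1 + a ^ 2 * b.waveCoeff h a) / (q₀ * (1 + α ^ 2)), a ^ 2)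

theorem hasDerivAt_zero_of_sq {F : Type*} [NormedAddCommGroup F] [NormedSpace ℝ F] {f : ℝ → F}
    (hf : ContDiffAt ℝ 1 f 0) (v : F) :
    HasDerivAt (fun a : ℝ => a • v + a ^ 2 • f a) v 0 := by
  have h1 : HasDerivAt (fun a : ℝ => a • v) ((1 : ℝ) • v) 0 := (hasDerivAt_id (0 : ℝ)).smul_const v
  have h2 := ((hasDerivAt_pow 2 (0 : ℝ)).smul (hf.differentiableAt one_ne_zero).hasDerivAt)
  refine (h1.add h2).congr_deriv ?_
  simp

theorem deriv_y_zero : deriv b.y 0 = -sinP := (hasDerivAt_zero_of_sq b.contDiff_yh _).deriv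

theorem deriv_χ_zero : deriv b.χ 0 = sinP := (hasDerivAt_zero_of_sq b.contDiff_xh _).deriv

theorem deriv_E_zero : deriv b.E 0 = cosP := (hasDerivAt_zero_of_sq b.contDiff_Eh _).deriv

theorem deriv_Lam_zero : deriv b.Lam 0 = 0 := by
  have := (hasDerivAt_zero_of_sq b.contDiff_ell (0 : ℝ)).const_add 1
  have h : HasDerivAt b.Lam 0 0 :=
    this.congr_of_eventuallyEq (Eventually.of_forall fun a => by simp [Lam])
  exact h.deriv

theorem intensity_zero : b.intensity 0 = 1 := by
  simp [intensity, Lam, E]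

/-- At a = 0 the slope is −2k(0), which produces the forcings ±2k₀ cos, and the derivative of the
branch is the even critical vector. -/
theorem eigParam_zero (α h q₀ : ℝ) :
    b.eigParam α h q₀ 0 = eigBase γ (1 / (q₀ * (1 + α ^ 2))) (b.waveCoeff h 0) := by
  simp [eigParam, eigBase, rhoDot, intensity_zero, deriv_E_zero, deriv_Lam_zero, deriv_χ_zero,
    J_sinP, logSlope, y, χ]

theorem continuousAt_eigParam (α h q₀ : ℝ) : ContinuousAt (b.eigParam α h q₀) 0 := by
  have hy := b.contDiff_y.continuousAt
  have hχ := b.contDiff_χ.continuousAt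
  have hE := b.contDiff_E.continuousAt
  have hL := b.contDiff_Lam.continuousAt
  have hEh := b.contDiff_Eh.continuousAt
  have hdh := b.contDiff_dh.continuousAt
  have hdχ := b.contDiff_χ.continuousAt_deriv_one
  have hdE := b.contDiff_E.continuousAt_deriv_one
  have hdL := b.contDiff_Lam.continuousAt_deriv_one
  have hk := (b.contDiff_waveCoeff h).continuousAt
  have hdk := (b.contDiff_waveCoeff h).continuousAt_deriv_one
  have hN : ContinuousAt b.intensity 0 := by
    unfold intensity
    fun_prop
  have hinv : ContinuousAt (fun a => Ring.inverse (b.intensity a)) 0 := by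
    have h1 : ContinuousAt Ring.inverse (b.intensity 0) := by
      rw [intensity_zero]
      exact NormedRing.inverse_continuousAt (1 : PerFunˣ)
    exact ContinuousAt.comp (f := b.intensity) h1 hN
  have hls : ContinuousAt (b.logSlope h) 0 := by
    unfold logSlope
    refine ContinuousAt.div (by fun_prop) (by fun_prop) (by simp)
  have hrho : ContinuousAt (b.rhoDot h) 0 := by
    unfold rhoDot
    refine ContinuousAt.add (hinv.mul ?_) ?_
    · fun_prop
    · fun_prop
  have hJ : ContinuousAt (fun a => J (deriv b.χ a)) 0 :=
    J.continuous.continuousAt.comp hdχ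
  unfold eigParam
  fun_prop

end BranchFamily

open PerFun

namespace BranchFamily

variable {γ : ℝ} (b : BranchFamily γ)

/-- Regularity of the family at the parameter `a`. -/
structure Regular (h a : ℝ) : Prop where
  good : ∀ᶠ a' in 𝓝 a, b.Good a'
  y : HasDerivAt b.y (deriv b.y a) a
  χ : HasDerivAt b.χ (deriv b.χ a) a
  E : HasDerivAt b.E (deriv b.E a) a
  d : HasDerivAt b.d (deriv b.d a) a
  Lam : HasDerivAt b.Lam (deriv b.Lam a) a
  waveCoeff : HasDerivAt (b.waveCoeff h) (deriv (b.waveCoeff h) a) a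
  isUnit : IsUnit (b.intensity a)
  pos : 0 < 1 + a ^ 2 * b.waveCoeff h a

theorem eventually_regular (h : ℝ) (hg : ∀ᶠ a in 𝓝 (0 : ℝ), b.Good a) :
    ∀ᶠ a in 𝓝 (0 : ℝ), b.Regular h a := by
  have ev : ∀ {F : Type} [NormedAddCommGroup F] [NormedSpace ℝ F] {f : ℝ → F},
      ContDiffAt ℝ 1 f 0 → ∀ᶠ a in 𝓝 (0 : ℝ), HasDerivAt f (deriv f a) a := by
    intro F _ _ f hf
    filter_upwards [hf.eventually (by simp)] with a ha
    exact (ha.differentiableAt one_ne_zero).hasDerivAt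
  have hN : ContinuousAt b.intensity 0 := by
    have hE := b.contDiff_E.continuousAt
    have hL := b.contDiff_Lam.continuousAt
    unfold intensity
    fun_prop
  have hu : ∀ᶠ a in 𝓝 (0 : ℝ), IsUnit (b.intensity a) := by
    refine hN.eventually (Units.isOpen.mem_nhds ?_)
    rw [Set.mem_ofPred_eq, intensity_zero]
    exact isUnit_one
  have hp : ∀ᶠ a in 𝓝 (0 : ℝ), 0 < 1 + a ^ 2 * b.waveCoeff h a := by
    have hk := (b.contDiff_waveCoeff h).continuousAt
    have : ContinuousAt (fun a => 1 + a ^ 2 * b.waveCoeff h a) 0 := by fun_prop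
    exact this.eventually (lt_mem_nhds (by simp))
  filter_upwards [eventually_eventually_nhds.mpr hg, ev b.contDiff_y, ev b.contDiff_χ,
    ev b.contDiff_E, ev b.contDiff_d, ev b.contDiff_Lam, ev (b.contDiff_waveCoeff h), hu, hp]
    with a h1 h2 h3 h4 h5 h6 h7 h8 h9
  exact ⟨h1, h2, h3, h4, h5, h6, h7, h8, h9⟩

variable {b} {h a : ℝ}

theorem Regular.isDeriv_y (hr : b.Regular h a) : IsDeriv (deriv b.y a)
    (deriv b.d a • (1 : PerFun) - deriv b.E a - 2 * (b.y a * deriv b.y a)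
      + (2 * γ ^ 2) • (b.χ a * deriv b.χ a)) := by
  have hG := (((hr.d.smul_const (1 : PerFun)).sub hr.E).sub (hr.y.pow 2)).add
    ((hr.χ.pow 2).const_smul (γ ^ 2))
  refine (isDeriv_of_hasDerivAt (hr.good.mono fun a' ha' => ha'.deriv_y) hr.y hG).congr ?_
  refine ext_coe fun s => ?_
  simp
  ring

theorem Regular.isDeriv_χ (hr : b.Regular h a) : IsDeriv (deriv b.χ a)
    (deriv b.E a - 2 * (deriv b.y a * b.χ a) - 2 * (b.y a * deriv b.χ a)) := by
  have hG := hr.E.sub ((hr.y.mul hr.χ).const_mul 2)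
  refine (isDeriv_of_hasDerivAt (hr.good.mono fun a' ha' => ha'.deriv_χ) hr.χ hG).congr ?_
  ring

theorem Regular.isDeriv_E (hr : b.Regular h a) : IsDeriv (deriv b.E a)
    (deriv b.Lam a • b.y a + b.Lam a • deriv b.y a + 2 * (deriv b.y a * b.E a)
      + 2 * (b.y a * deriv b.E a)) := by
  have hG := (hr.Lam.smul hr.y).add ((hr.y.mul hr.E).const_mul 2)
  refine (isDeriv_of_hasDerivAt (hr.good.mono fun a' ha' => ha'.deriv_E) hr.E hG).congr ?_
  ring

theorem Regular.intensity_mul (hr : b.Regular h a) (s : ℝ) :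
    (b.Lam a + 2 * b.E a (s : AddCircle (2 * Real.pi)))
      * Ring.inverse (b.intensity a) (s : AddCircle (2 * Real.pi)) = 1 := by
  have := congrArg (fun f : PerFun => f (s : AddCircle (2 * Real.pi)))
    (Ring.mul_inverse_cancel _ hr.isUnit)
  simpa [intensity] using this

theorem Regular.isDeriv_rhoDot (hr : b.Regular h a) : IsDeriv (b.rhoDot h a) (deriv b.y a) := by
  intro s
  set c : AddCircle (2 * Real.pi) := (s : AddCircle (2 * Real.pi)) with hc
  have hn : ∀ s : ℝ, b.Lam a + 2 * b.E a (s : AddCircle (2 * Real.pi)) ≠ 0 := fun s h0 => by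
    have := hr.intensity_mul s
    rw [h0, zero_mul] at this
    exact zero_ne_one this
  have h1 := ((hr.good.self_of_nhds.deriv_E s).const_mul 2).const_add (b.Lam a)
  have h2 := (hr.isDeriv_E s).const_add (deriv b.Lam a / 2)
  have h3 := (h2.div h1 (hn s)).add_const (a * b.logSlope h a / 2)
  refine (h3.congr_deriv ?_).congr_of_eventuallyEq (Eventually.of_forall fun s => ?_)
  · have := hn s
    simp
    field_simp
    ring
  · have h4 := hr.intensity_mul s
    have h5 := hn s
    simp [rhoDot]
    field_simp
    linear_combination (deriv b.Lam a + 2 * deriv b.E a (s : AddCircle (2 * Real.pi))) * h4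

/-- Differentiate Λ − 2hd = 1 + a²k; the logarithmic derivative of the right-hand side is −a times
`logSlope`. -/
theorem Regular.deriv_Lam (hr : b.Regular h a) :
    deriv b.Lam a = 2 * h * deriv b.d a
      - a * b.logSlope h a * (b.Lam a - 2 * h * b.d a) := by
  have h1 := hr.Lam.sub (hr.d.const_mul (2 * h))
  have h2 : HasDerivAt (fun a => 1 + a ^ 2 * b.waveCoeff h a)
      (2 * a * b.waveCoeff h a + a ^ 2 * deriv (b.waveCoeff h) a) a := by
    refine (((hasDerivAt_pow 2 a).mul hr.waveCoeff).const_add 1).congr_deriv ?_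
    simp
  have h3 : (fun a => b.Lam a - 2 * h * b.d a) = fun a => 1 + a ^ 2 * b.waveCoeff h a :=
    funext fun a => b.Lam_sub h a
  have h4 := h1.unique (h2.congr_of_eventuallyEq (Eventually.of_forall fun a => b.Lam_sub h a))
  have h5 := hr.pos.ne'
  rw [b.Lam_sub]
  unfold logSlope
  field_simp
  linear_combination h4

/-- The parity of Ê follows from that of E = a cos + a²Ê on dividing by a²; hence a ≠ 0. -/
theorem Regular.sym (hr : b.Regular h a) (ha : a ≠ 0) (α q₀ : ℝ) : (b.eigParam α h q₀ a).Sym := by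
  have hg := hr.good.self_of_nhds
  have rχ : reflect (deriv b.χ a) = -deriv b.χ a := by
    have := reflect_of_hasDerivAt (c := -1)
      (hr.good.mono fun a' ha' => by rw [ha'.reflect_χ, neg_one_smul]) hr.χ
    rwa [neg_one_smul] at this
  have rE : reflect (deriv b.E a) = deriv b.E a := by
    have := reflect_of_hasDerivAt (c := 1)
      (hr.good.mono fun a' ha' => by rw [ha'.reflect_E, one_smul]) hr.E
    rwa [one_smul] at this
  have rN : reflect (b.intensity a) = b.intensity a := by
    rw [intensity, map_add, map_smul, map_one, map_mul, reflect_two, hg.reflect_E]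
  have rI : reflect (Ring.inverse (b.intensity a)) = Ring.inverse (b.intensity a) := by
    have h1 := Ring.mul_inverse_cancel _ hr.isUnit
    have h2 := congrArg reflect h1
    rw [map_mul, map_one, rN] at h2
    linear_combination Ring.inverse (b.intensity a) * h2
      - reflect (Ring.inverse (b.intensity a)) * h1
  have rEh : reflect (b.Eh a) = b.Eh a := by
    have h1 := hg.reflect_E
    rw [BranchFamily.E, map_add, map_smul, map_smul, reflect_cosP] at h1
    exact smul_right_injective PerFun (pow_ne_zero 2 ha) (add_left_cancel h1)
  constructor
  · exact hg.reflect_y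
  · exact hg.reflect_χ
  · simp only [eigParam, map_sub, rN, map_one]
  · simp only [eigParam, rhoDot, map_add, map_mul, map_smul, map_one, rI, rE]
  · simp only [eigParam, map_smul, reflect_J, rχ, map_neg, neg_neg]
  · simp only [eigParam, map_neg, map_smul, map_sub, map_add, map_one, reflect_cosP, rEh]
  · simp only [eigParam, map_smul, map_add, reflect_cosP, rEh]

theorem Regular.mean_deriv_χ (hr : b.Regular h a) : mean (deriv b.χ a) = 0 := by
  refine mean_eq_zero_of_reflect ?_
  have := reflect_of_hasDerivAt (c := -1)
    (hr.good.mono fun a' ha' => by rw [ha'.reflect_χ, neg_one_smul]) hr.χ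
  rwa [neg_one_smul] at this

end BranchFamily

/-! ### The critical eigenvalue along the branch -/

open PerFun

namespace BranchFamily

variable {γ : ℝ} (b : BranchFamily γ)

/-- The intensity `R²` along the branch in the scaled variable. -/
def intensityFn (h q₀ a : ℝ) (s : ℝ) : ℝ := b.lam h q₀ a * (b.Lam a + 2 * (b.E a).fn s) / (2 * h)

/-- The phase gradient along the branch in the scaled variable. -/
def phaseFn (a : ℝ) (s : ℝ) : ℝ := γ * (b.χ a).fn s

/-- The hypotheses are the scaled eigenvalue equations solved for the second derivatives, by
inverting the matrix with rows (1, −α) and (α, 1) of determinant 1 + α². The constant S is allowed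
because a constant added to θ can absorb it. -/
theorem scaledOp_of_first_order {α β h q₀ a σ S : ℝ} (hh : 0 < h) (hq₀ : q₀ ≠ 0) (hγ : γ ≠ 0)
    (h₁ : h * (1 + α * γ) = -1) (h₂ : h * γ = h * α + β) (hpos : 1 + a ^ 2 * b.waveCoeff h a ≠ 0)
    {ρ θ p ϑ p' ϑ' : PerFun} (hρ : IsDeriv ρ p) (hp : IsDeriv p p') (hθ : IsDeriv θ (γ • ϑ))
    (hϑ : IsDeriv ϑ ϑ')
    (e₁ : p' = -2 * (b.y a * p) + (2 * γ ^ 2) • (b.χ a * ϑ) - b.intensity a * ρ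
      + ((1 + a ^ 2 * b.waveCoeff h a) / (q₀ * (1 + α ^ 2)))
        • (σ • (ρ + α • θ) + (α * S) • (1 : PerFun)))
    (e₂ : ϑ' = -2 * (b.y a * ϑ) - 2 * (b.χ a * p) + b.intensity a * ρ
      + ((1 + a ^ 2 * b.waveCoeff h a) / (q₀ * (1 + α ^ 2)) / γ)
        • (σ • (θ - α • ρ) + S • (1 : PerFun))) (s : ℝ) :
    scaledOp₁ α (b.lam h q₀ a) (b.intensityFn h q₀ a) (b.y a).fn (b.phaseFn a) ρ.cx θ.cx s
        = σ * ρ.cx s ∧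
      scaledOp₂ α β (b.lam h q₀ a) (b.intensityFn h q₀ a) (b.y a).fn (b.phaseFn a) ρ.cx θ.cx s
        = σ * θ.cx s + S := by
  have hθ' : IsDeriv (γ • ϑ) (γ • ϑ') := hϑ.smul γ
  have hα : (1 + α ^ 2) ≠ 0 := by positivity
  have E₁ := congrArg (fun f : PerFun => f (s : AddCircle (2 * Real.pi))) e₁
  have E₂ := congrArg (fun f : PerFun => f (s : AddCircle (2 * Real.pi))) e₂
  simp [intensity] at E₁ E₂
  set k := 1 + a ^ 2 * b.waveCoeff h a with hk
  have R₁ : b.lam h q₀ a * (p' (s : AddCircle (2 * Real.pi))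
      - α * (γ * ϑ' (s : AddCircle (2 * Real.pi)))
      + 2 * (b.y a (s : AddCircle (2 * Real.pi)) * p (s : AddCircle (2 * Real.pi))
        - γ * b.χ a (s : AddCircle (2 * Real.pi)) * (γ * ϑ (s : AddCircle (2 * Real.pi))))
      - 2 * α * (b.y a (s : AddCircle (2 * Real.pi)) * (γ * ϑ (s : AddCircle (2 * Real.pi)))
        + γ * b.χ a (s : AddCircle (2 * Real.pi)) * p (s : AddCircle (2 * Real.pi))))
      - 2 * (b.lam h q₀ a * (b.Lam a + 2 * b.E a (s : AddCircle (2 * Real.pi))) / (2 * h))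
        * ρ (s : AddCircle (2 * Real.pi)) = σ * ρ (s : AddCircle (2 * Real.pi)) := by
    rw [E₁, E₂]
    unfold lam
    rw [← hk]
    field_simp
    linear_combination -(q₀ * (b.Lam a + 2 * b.E a (s : AddCircle (2 * Real.pi)))
      * ρ (s : AddCircle (2 * Real.pi)) * (1 + α ^ 2)) * h₁
  have R₂ : b.lam h q₀ a * (α * p' (s : AddCircle (2 * Real.pi))
      + γ * ϑ' (s : AddCircle (2 * Real.pi))
      + 2 * α * (b.y a (s : AddCircle (2 * Real.pi)) * p (s : AddCircle (2 * Real.pi))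
        - γ * b.χ a (s : AddCircle (2 * Real.pi)) * (γ * ϑ (s : AddCircle (2 * Real.pi))))
      + 2 * (b.y a (s : AddCircle (2 * Real.pi)) * (γ * ϑ (s : AddCircle (2 * Real.pi)))
        + γ * b.χ a (s : AddCircle (2 * Real.pi)) * p (s : AddCircle (2 * Real.pi))))
      - 2 * β * (b.lam h q₀ a * (b.Lam a + 2 * b.E a (s : AddCircle (2 * Real.pi))) / (2 * h))
        * ρ (s : AddCircle (2 * Real.pi)) = σ * θ (s : AddCircle (2 * Real.pi)) + S := by
    rw [E₁, E₂]
    unfold lam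
    rw [← hk]
    field_simp
    linear_combination (q₀ * (b.Lam a + 2 * b.E a (s : AddCircle (2 * Real.pi)))
      * ρ (s : AddCircle (2 * Real.pi)) * (1 + α ^ 2)) * h₂
  constructor
  · unfold scaledOp₁
    rw [hρ.deriv_cx, hθ.deriv_cx, hp.deriv_cx, hθ'.deriv_cx]
    simp only [cx, fn, intensityFn, phaseFn, ContinuousMap.smul_apply, smul_eq_mul]
    exact_mod_cast R₁
  · unfold scaledOp₂
    rw [hρ.deriv_cx, hθ.deriv_cx, hp.deriv_cx, hθ'.deriv_cx]
    simp only [cx, fn, intensityFn, phaseFn, ContinuousMap.smul_apply, smul_eq_mul]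
    exact_mod_cast R₂

/-- Existence of the critical real eigenvalue `a² τ(a)` along the branch. -/
theorem exists_critical_eigenvalue (hg : ∀ᶠ a in 𝓝 (0 : ℝ), b.Good a) {α β h q₀ : ℝ} (hh : 0 < h)
    (hq₀ : 0 < q₀) (hγ : γ ≠ 0) (h₁ : h * (1 + α * γ) = -1) (h₂ : h * γ = h * α + β)
    (h₃ : 2 ≤ 1 - α * γ) :
    ∃ τ : ℝ → ℝ, Tendsto τ (𝓝 0)
        (𝓝 (-2 * b.waveCoeff h 0 * q₀ * (1 + α ^ 2) / (1 - α * γ))) ∧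
      ∀ᶠ a in 𝓝[≠] (0 : ℝ), ∃ ρ θ : ℝ → ℂ, IsC2Per ρ ∧ IsC2Per θ ∧ ¬(ρ = 0 ∧ θ = 0) ∧
        (∀ x, scaledOp₁ α (b.lam h q₀ a) (b.intensityFn h q₀ a) (b.y a).fn (b.phaseFn a) ρ θ x
          = ((a ^ 2 * τ a : ℝ) : ℂ) * ρ x) ∧
        (∀ x, scaledOp₂ α β (b.lam h q₀ a) (b.intensityFn h q₀ a) (b.y a).fn (b.phaseFn a) ρ θ x
          = ((a ^ 2 * τ a : ℝ) : ℂ) * θ x) := by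
  have hα : 0 < 1 + α ^ 2 := by positivity
  have hk₀ := b.waveCoeff_zero_pos hh
  have h₁' : 1 + α * γ ≠ 0 := fun h0 => by rw [h0, mul_zero] at h₁; norm_num at h₁
  obtain ⟨ξ, hξc, hξ0, hξ⟩ := exists_eigSolution (α := α) (ν₀ := 1 / (q₀ * (1 + α ^ 2))) hγ
    (by positivity) (by linarith) h₁' (b.waveCoeff h 0)
  rw [← b.eigParam_zero α h q₀] at hξc hξ0 hξ
  have hpc := b.continuousAt_eigParam α h q₀
  have hξp : ContinuousAt (fun a => ξ (b.eigParam α h q₀ a)) 0 :=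
    ContinuousAt.comp (f := b.eigParam α h q₀) hξc hpc
  set x : ℝ → BranchSpace := fun a => ξ (b.eigParam α h q₀ a) with hx
  have hτc : ContinuousAt (fun a => (x a).2.2.2.1) 0 := by fun_prop
  have hτ0 : (x 0).2.2.2.1 = -2 * b.waveCoeff h 0 * q₀ * (1 + α ^ 2) / (1 - α * γ) := by
    rw [hx]
    simp only [hξ0]
    field_simp
  refine ⟨fun a => (x a).2.2.2.1, ?_, ?_⟩
  · rw [← hτ0]
    exact hτc
  have hτne : ∀ᶠ a in 𝓝 (0 : ℝ), (x a).2.2.2.1 ≠ 0 := by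
    refine hτc.eventually_ne ?_
    rw [hτ0]
    have : 0 < 2 * b.waveCoeff h 0 * q₀ * (1 + α ^ 2) / (1 - α * γ) :=
      div_pos (by positivity) (by linarith)
    intro h0
    have h1 : -2 * b.waveCoeff h 0 * q₀ * (1 + α ^ 2) / (1 - α * γ)
      = -(2 * b.waveCoeff h 0 * q₀ * (1 + α ^ 2) / (1 - α * γ)) := by ring
    rw [h1] at h0
    linarith
  -- Ensures a nonzero eigenvector: ρ' tends to −sin.
  have hpne : ∀ᶠ a in 𝓝 (0 : ℝ), deriv b.y a + a ^ 2 • (x a).1 ≠ 0 := by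
    have hdy := b.contDiff_y.continuousAt_deriv_one
    have hc : ContinuousAt (fun a => deriv b.y a + a ^ 2 • (x a).1) 0 := by fun_prop
    refine hc.eventually_ne ?_
    rw [b.deriv_y_zero]
    intro h0
    have := congrArg (fun f : PerFun => f ((Real.pi / 2 : ℝ) : AddCircle (2 * Real.pi))) h0
    simp at this
  have hev := hpc.eventually hξ
  have hall : ∀ᶠ a in 𝓝 (0 : ℝ), a ≠ 0 → ∃ ρ θ : ℝ → ℂ, IsC2Per ρ ∧ IsC2Per θ ∧ ¬(ρ = 0 ∧ θ = 0) ∧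
        (∀ s, scaledOp₁ α (b.lam h q₀ a) (b.intensityFn h q₀ a) (b.y a).fn (b.phaseFn a) ρ θ s
          = ((a ^ 2 * (x a).2.2.2.1 : ℝ) : ℂ) * ρ s) ∧
        (∀ s, scaledOp₂ α β (b.lam h q₀ a) (b.intensityFn h q₀ a) (b.y a).fn (b.phaseFn a) ρ θ s
          = ((a ^ 2 * (x a).2.2.2.1 : ℝ) : ℂ) * θ s) := by
    filter_upwards [hτne, hpne, hev, b.eventually_regular h hg] with a hτne hpne hev hr ha
    obtain ⟨m₂, hd₁, hd₂, hd₃⟩ := hev (hr.sym ha α q₀)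
    have hxa : ξ (b.eigParam α h q₀ a) = x a := rfl
    rw [hxa] at m₂ hd₁ hd₂ hd₃
    have hν : (1 + a ^ 2 * b.waveCoeff h a) / (q₀ * (1 + α ^ 2)) ≠ 0 := by
      have := hr.pos
      positivity
    set ν := (1 + a ^ 2 * b.waveCoeff h a) / (q₀ * (1 + α ^ 2)) with hνd
    set ρ : PerFun := b.rhoDot h a + a ^ 2 • (x a).2.2.1 with hρ
    set θ : PerFun := γ • J (deriv b.χ a) + (a ^ 2 * γ) • J (x a).2.1 with hθ
    set p : PerFun := deriv b.y a + a ^ 2 • (x a).1 with hp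
    set ϑ : PerFun := deriv b.χ a + a ^ 2 • (x a).2.1 with hϑ
    set σ := a ^ 2 * (x a).2.2.2.1 with hσ
    -- S gathers the constants left over when the branch is differentiated. Chosen from the second
    -- equation, it also fits the first because h(1 + αγ) = −1.
    set S := a ^ 2 * (x a).2.2.2.2
      - γ * h * (deriv b.d a + a * b.logSlope h a * b.d a) / ν with hS
    have hσ0 : σ ≠ 0 := mul_ne_zero (pow_ne_zero 2 ha) hτne
    have dρ : IsDeriv ρ p := hr.isDeriv_rhoDot.add (hd₃.smul _)
    have dθ : IsDeriv θ (γ • ϑ) := by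
      refine (((isDeriv_J hr.mean_deriv_χ).smul γ).add ((isDeriv_J m₂).smul (a ^ 2 * γ))).congr ?_
      rw [hϑ, smul_add, smul_smul, mul_comm γ]
    -- Shifting θ by S/σ removes the constant; this needs σ ≠ 0. The operators see only derivatives
    -- of θ.
    have dθ' : IsDeriv (θ + (S / σ) • (1 : PerFun)) (γ • ϑ) := by
      intro s
      refine ((dθ s).add_const (S / σ)).congr_of_eventuallyEq (Eventually.of_forall fun s => ?_)
      simp
    have dp := hr.isDeriv_y.add (hd₁.smul (a ^ 2))
    have dϑ := hr.isDeriv_χ.add (hd₂.smul (a ^ 2))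
    have F₁ : ∀ s : ℝ, (b.Lam a + 2 * b.E a (s : AddCircle (2 * Real.pi)))
        * b.rhoDot h a (s : AddCircle (2 * Real.pi)) = deriv b.Lam a / 2
          + deriv b.E a (s : AddCircle (2 * Real.pi))
          + (b.Lam a + 2 * b.E a (s : AddCircle (2 * Real.pi))) * (a * b.logSlope h a / 2) := by
      intro s
      have := hr.intensity_mul s
      simp only [rhoDot, ContinuousMap.add_apply, ContinuousMap.mul_apply,
        ContinuousMap.smul_apply, ContinuousMap.one_apply, smul_eq_mul]
      linear_combination (deriv b.Lam a / 2 + deriv b.E a (s : AddCircle (2 * Real.pi))) * this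
    have F₂ : ∀ s : ℝ, b.E a (s : AddCircle (2 * Real.pi))
        = a * Real.cos s + a ^ 2 * b.Eh a (s : AddCircle (2 * Real.pi)) := fun s => rfl
    have F₃ : b.d a = a ^ 2 * b.dh a := rfl
    have hS₁ : ν * S = ν * (a ^ 2 * (x a).2.2.2.2)
        - γ * h * (deriv b.d a + a * b.logSlope h a * b.d a) := by
      rw [hS]
      field_simp
    have hS₂ : ν / γ * S = ν / γ * (a ^ 2 * (x a).2.2.2.2)
        - h * (deriv b.d a + a * b.logSlope h a * b.d a) := by
      have : ν / γ * S = (ν * S) / γ := by ring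
      rw [this, hS₁]
      field_simp
    have hmain := fun s => b.scaledOp_of_first_order (α := α) (β := β) (σ := σ) (S := S) hh hq₀.ne' hγ h₁ h₂
      hr.pos.ne' dρ dp dθ dϑ ?_ ?_ s
    · refine ⟨ρ.cx, (θ + (S / σ) • (1 : PerFun)).cx, isC2Per_cx dρ dp, isC2Per_cx dθ' (dϑ.smul γ),
        ?_, fun s => (hmain s).1 ▸ ?_, fun s => ?_⟩
      · rintro ⟨h0, -⟩
        refine hpne (ext_coe fun s => ?_)
        have := congrFun dρ.deriv_cx s
        rw [h0] at this
        simp [cx] at this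
        simpa using this.symm
      · unfold scaledOp₁
        rw [dθ'.deriv_cx, dθ.deriv_cx]
      · have h5 : (S : ℂ) = σ * ((S / σ : ℝ) : ℂ) := by
          rw [← Complex.ofReal_mul, mul_div_cancel₀ _ hσ0]
        have h6 : (θ + (S / σ) • (1 : PerFun)).cx s = θ.cx s + ((S / σ : ℝ) : ℂ) := by
          simp [cx]
        rw [h6, mul_add, ← h5, ← (hmain s).2]
        unfold scaledOp₂
        rw [dθ'.deriv_cx, dθ.deriv_cx]
    · refine ext_coe fun s => ?_
      simp only [eigParam, eigRho, eigTheta, ContinuousMap.add_apply, ContinuousMap.sub_apply,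
        ContinuousMap.mul_apply, ContinuousMap.smul_apply, ContinuousMap.neg_apply,
        ContinuousMap.one_apply, two_coe, cosP_coe, smul_eq_mul, ← hνd, hp, hϑ, hρ, hθ, hσ]
      simp [intensity]
      linear_combination F₁ s - α * hS₁ + (1 / 2 : ℝ) * hr.deriv_Lam
        + (deriv b.d a + a * b.logSlope h a * b.d a) * h₁ + a * b.logSlope h a * F₂ s
        - a * b.logSlope h a * F₃
    · refine ext_coe fun s => ?_
      simp only [eigParam, eigRho, eigTheta, ContinuousMap.add_apply, ContinuousMap.sub_apply,
        ContinuousMap.mul_apply, ContinuousMap.smul_apply, ContinuousMap.neg_apply,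
        ContinuousMap.one_apply, two_coe, cosP_coe, smul_eq_mul, ← hνd, hp, hϑ, hρ, hθ, hσ]
      simp [intensity]
      linear_combination -F₁ s - hS₂ - (1 / 2 : ℝ) * hr.deriv_Lam
        - a * b.logSlope h a * F₂ s
  exact eventually_nhdsWithin_iff.mpr hall

end BranchFamily

/-! ### From the scaled operator to linear stability -/

/-- A stationary state together with its coefficient functions in the variable `s = Ωx`. -/
structure ScaledState (μ α β ω Ω : ℝ) (R φ P y ψ : ℝ → ℝ) : Prop where
  ne_zero : ∀ x, R x ≠ 0
  contDiff : ContDiff ℝ 2 R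
  polar : ∀ x, PolarEq μ α β ω R φ x
  wavenumber_ne : Ω ≠ 0
  periodic : Function.Periodic R (2 * Real.pi / Ω)
  deriv_R : ∀ x, deriv R x = Ω * y (Ω * x) * R x
  deriv_φ : ∀ x, deriv φ x = Ω * ψ (Ω * x)
  intensity : ∀ x, P (Ω * x) = R x ^ 2
  isC2Per_y : IsC2Per fun s => (y s : ℂ)
  isC2Per_ψ : IsC2Per fun s => (ψ s : ℂ)
  kernel₁ : ∀ s, scaledOp₁ α (Ω ^ 2) P y ψ (fun s => (y s : ℂ)) (fun s => (ψ s : ℂ)) s = 0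
  kernel₂ : ∀ s, scaledOp₂ α β (Ω ^ 2) P y ψ (fun s => (y s : ℂ)) (fun s => (ψ s : ℂ)) s = 0

namespace ScaledState

variable {μ α β ω Ω : ℝ} {R φ P y ψ : ℝ → ℝ}

theorem linearization_eq (h : ScaledState μ α β ω Ω R φ P y ψ) {ρ θ : ℝ → ℂ} (hρ : IsC2Per ρ)
    (hθ : IsC2Per θ) : linearization μ α β ω R φ (toPert R Ω ρ θ) =
      toPert R Ω (scaledOp₁ α (Ω ^ 2) P y ψ ρ θ) (scaledOp₂ α β (Ω ^ 2) P y ψ ρ θ) :=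
  linearization_toPert h.ne_zero h.contDiff h.polar h.wavenumber_ne h.deriv_R h.deriv_φ h.intensity
    hρ.1 hθ.1

theorem isStabilityEigenvalue_iff (h : ScaledState μ α β ω Ω R φ P y ψ) (σ : ℂ) :
    IsStabilityEigenvalue μ α β (2 * Real.pi / Ω) ω R φ σ ↔
      ∃ ρ θ : ℝ → ℂ, IsC2Per ρ ∧ IsC2Per θ ∧ ¬(ρ = 0 ∧ θ = 0) ∧
        (∀ s, scaledOp₁ α (Ω ^ 2) P y ψ ρ θ s = σ * ρ s) ∧
        ∀ s, scaledOp₂ α β (Ω ^ 2) P y ψ ρ θ s = σ * θ s := by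
  have h0 : toPert R Ω (fun _ => 0) (fun _ => 0) = 0 := by
    simp only [toPert, mul_zero]
    rfl
  constructor
  · rintro ⟨w, hw, ha, he⟩
    obtain ⟨ρ, θ, hρ, hθ, rfl⟩ := exists_eq_toPert h.wavenumber_ne h.ne_zero h.contDiff h.periodic ha
    rw [h.linearization_eq hρ hθ, smul_toPert, toPert_inj h.wavenumber_ne h.ne_zero] at he
    refine ⟨ρ, θ, hρ, hθ, ?_, fun s => congrFun he.1 s, fun s => congrFun he.2 s⟩
    rintro ⟨rfl, rfl⟩
    exact hw h0
  · rintro ⟨ρ, θ, hρ, hθ, hne, e₁, e₂⟩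
    refine ⟨toPert R Ω ρ θ, fun hw => hne ?_,
      isAdmissible_toPert h.wavenumber_ne h.contDiff h.periodic hρ hθ, ?_⟩
    · rw [← h0, toPert_inj h.wavenumber_ne h.ne_zero] at hw
      exact hw
    · rw [h.linearization_eq hρ hθ, smul_toPert, funext e₁, funext e₂]

theorem mem_neutralModes_iff (h : ScaledState μ α β ω Ω R φ P y ψ) (w : Perturbation) :
    w ∈ neutralModes R φ ↔
      ∃ a b : ℂ, w = toPert R Ω (fun s => b * (y s : ℂ)) (fun s => a + b * (ψ s : ℂ)) := by
  have hΩ : (Ω : ℂ) ≠ 0 := by exact_mod_cast h.wavenumber_ne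
  have key : ∀ a b : ℂ, a • phaseMode + b • translationMode R φ
      = toPert R Ω (fun s => (b * Ω) * (y s : ℂ)) (fun s => a + (b * Ω) * (ψ s : ℂ)) := by
    intro a b
    rw [phaseMode_eq_toPert R Ω, translationMode_eq_toPert h.deriv_R h.deriv_φ, smul_smul,
      smul_toPert, smul_toPert, add_toPert]
    simp
  rw [neutralModes, Submodule.mem_span_pair]
  constructor
  · rintro ⟨a, b, rfl⟩
    exact ⟨a, b * Ω, key a b⟩
  · rintro ⟨a, b, rfl⟩
    refine ⟨a, b / Ω, ?_⟩
    rw [key, div_mul_cancel₀ _ hΩ]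

theorem isC2Per_span (h : ScaledState μ α β ω Ω R φ P y ψ) (a b : ℂ) :
    (IsC2Per fun s => b * (y s : ℂ)) ∧ IsC2Per fun s => a + b * (ψ s : ℂ) :=
  ⟨h.isC2Per_y.const_mul b, (isC2Per_const a).add_const_mul h.isC2Per_ψ b⟩

theorem scaledOp_span (h : ScaledState μ α β ω Ω R φ P y ψ) (a b : ℂ) (s : ℝ) :
    scaledOp₁ α (Ω ^ 2) P y ψ (fun s => b * (y s : ℂ)) (fun s => a + b * (ψ s : ℂ)) s = 0 ∧
    scaledOp₂ α β (Ω ^ 2) P y ψ (fun s => b * (y s : ℂ)) (fun s => a + b * (ψ s : ℂ)) s = 0 := by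
  have z₁ : scaledOp₁ α (Ω ^ 2) P y ψ (fun _ => 0) (fun _ => a) s = 0 := by simp [scaledOp₁]
  have z₂ : scaledOp₂ α β (Ω ^ 2) P y ψ (fun _ => 0) (fun _ => a) s = 0 := by simp [scaledOp₂]
  have h1 := scaledOp₁_add_const_mul (isC2Per_const 0) (isC2Per_const a) h.isC2Per_y h.isC2Per_ψ b
    α (Ω ^ 2) P y ψ s
  have h2 := scaledOp₂_add_const_mul (isC2Per_const 0) (isC2Per_const a) h.isC2Per_y h.isC2Per_ψ b
    α β (Ω ^ 2) P y ψ s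
  rw [h.kernel₁, z₁] at h1
  rw [h.kernel₂, z₂] at h2
  simp only [zero_add, mul_zero] at h1 h2
  exact ⟨h1, h2⟩

/-- Linear stability follows if generalized eigenvectors of eigenvalues in the closed right half
plane are neutral. -/
theorem isLinearlyStable (h : ScaledState μ α β ω Ω R φ P y ψ)
    (H : ∀ (z₁ z₂ : ℝ → ℂ) (σ s t : ℂ), IsC2Per z₁ → IsC2Per z₂ → 0 ≤ σ.re →
      (∀ x, scaledOp₁ α (Ω ^ 2) P y ψ z₁ z₂ x - σ * z₁ x = t * y x) →
      (∀ x, scaledOp₂ α β (Ω ^ 2) P y ψ z₁ z₂ x - σ * z₂ x = s + t * ψ x) →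
      ∃ a b : ℂ, (∀ x, z₁ x = b * y x) ∧ ∀ x, z₂ x = a + b * ψ x) :
    IsLinearlyStable μ α β (2 * Real.pi / Ω) ω R φ := by
  have h0 : toPert R Ω (fun _ => 0) (fun _ => 0) = 0 := by
    simp only [toPert, mul_zero]
    rfl
  have hker : ∀ w, w ∈ neutralModes R φ → IsAdmissible (2 * Real.pi / Ω) w ∧
      linearization μ α β ω R φ w = 0 := by
    intro w hw
    obtain ⟨a, b, rfl⟩ := (h.mem_neutralModes_iff w).mp hw
    obtain ⟨c₁, c₂⟩ := h.isC2Per_span a b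
    refine ⟨isAdmissible_toPert h.wavenumber_ne h.contDiff h.periodic c₁ c₂, ?_⟩
    rw [h.linearization_eq c₁ c₂, funext fun s => (h.scaledOp_span a b s).1,
      funext fun s => (h.scaledOp_span a b s).2, h0]
  have hgen : ∀ w, IsAdmissible (2 * Real.pi / Ω) w →
      linearization μ α β ω R φ w ∈ neutralModes R φ → w ∈ neutralModes R φ := by
    intro w ha hw
    obtain ⟨ρ, θ, hρ, hθ, rfl⟩ := exists_eq_toPert h.wavenumber_ne h.ne_zero h.contDiff h.periodic ha
    obtain ⟨s, t, hst⟩ := (h.mem_neutralModes_iff _).mp hw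
    rw [h.linearization_eq hρ hθ, toPert_inj h.wavenumber_ne h.ne_zero] at hst
    obtain ⟨a, b, hz₁, hz₂⟩ := H ρ θ 0 s t hρ hθ le_rfl
      (fun x => by rw [hst.1]; ring) (fun x => by rw [hst.2]; ring)
    exact (h.mem_neutralModes_iff _).mpr ⟨a, b, by rw [← funext hz₁, ← funext hz₂]⟩
  refine ⟨fun w => ⟨fun hw => hgen w hw.1 ?_, hker w⟩, fun w ha hw => (hker w (hgen w ha hw)).2, ?_⟩
  · rw [hw.2]
    exact zero_mem _
  · intro σ hσ hσ0
    by_contra hre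
    push Not at hre
    obtain ⟨ρ, θ, hρ, hθ, hne, e₁, e₂⟩ := (h.isStabilityEigenvalue_iff σ).mp hσ
    obtain ⟨a, b, hz₁, hz₂⟩ := H ρ θ σ 0 0 hρ hθ hre
      (fun x => by rw [e₁]; ring) (fun x => by rw [e₂]; ring)
    apply hne
    constructor
    · funext x
      have h1 := (h.scaledOp_span a b x).1
      rw [← funext hz₁, ← funext hz₂, e₁] at h1
      exact (mul_eq_zero.mp h1).resolve_left hσ0
    · funext x
      have h1 := (h.scaledOp_span a b x).2
      rw [← funext hz₁, ← funext hz₂, e₂] at h1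
      exact (mul_eq_zero.mp h1).resolve_left hσ0

end ScaledState

/-! ### The spectrum of the homogeneous state -/

theorem hos_scaledState {μ α β Ω : ℝ} (hμ : 0 < μ) (hΩ : Ω ≠ 0) :
    ScaledState μ α β (hosFreq μ β) Ω (hosR μ) hosPhase (fun _ => μ) (fun _ => 0) (fun _ => 0) := by
  have hs : Real.sqrt μ ^ 2 = μ := Real.sq_sqrt hμ.le
  have hs3 : Real.sqrt μ ^ 3 = μ * Real.sqrt μ := by rw [pow_succ, hs]
  have d : deriv (hosR μ) = fun _ => 0 := funext fun x => deriv_const x _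
  have d' : deriv hosPhase = fun _ => 0 := funext fun x => deriv_const x _
  refine ⟨fun x => (Real.sqrt_pos.mpr hμ).ne', contDiff_const, fun x => ?_, hΩ, fun _ => rfl,
    fun x => ?_, fun x => ?_, fun x => hs.symm, isC2Per_const _, isC2Per_const _, fun s => ?_,
    fun s => ?_⟩
  · simp only [PolarEq, d, d', deriv_const, hosR, hs3, hosFreq]
    constructor <;> ring
  · rw [d]; ring
  · rw [d']; ring
  · simp [scaledOp₁]
  · simp [scaledOp₂]

/-- The imaginary part of the equation forces the root to be real or to have real part −A/2;
positive coefficients exclude a nonnegative real root. -/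
theorem quadratic_root_re_neg {A B : ℝ} (hA : 0 < A) (hB : 0 < B) {σ : ℂ}
    (h : σ ^ 2 + A * σ + B = 0) : σ.re < 0 := by
  have hre := congrArg Complex.re h
  have him := congrArg Complex.im h
  simp [pow_two] at hre him
  by_contra hn
  push Not at hn
  have : σ.im * (2 * σ.re + A) = 0 := by linarith
  rcases mul_eq_zero.mp this with h1 | h1
  · rw [h1] at hre
    nlinarith
  · linarith

/-- A nonzero solution of the mode equations is a root of the characteristic polynomial. -/
theorem mode_eq_zero {μ q₀ α β q : ℝ} (hκ : (1 + α ^ 2) * q₀ = -2 * μ * (1 + α * β)) {σ u v : ℂ}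
    (h₁ : -(q : ℂ) * (u - α * v) - 2 * μ * u - σ * u = 0)
    (h₂ : -(q : ℂ) * (α * u + v) - 2 * β * μ * u - σ * v = 0)
    (hp : σ ^ 2 + ((2 * q + 2 * μ : ℝ) : ℂ) * σ + (((1 + α ^ 2) * (q * (q - q₀)) : ℝ) : ℂ) ≠ 0) :
    u = 0 ∧ v = 0 := by
  have hκ' : ((1 + α ^ 2) * q₀ : ℂ) = -2 * μ * (1 + α * β) := by exact_mod_cast hκ
  push_cast at hp
  constructor
  · refine (mul_eq_zero.mp (?_ : _ * u = 0)).resolve_left hp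
    linear_combination -(q + σ) * h₁ - α * q * h₂ - q * u * hκ'
  · refine (mul_eq_zero.mp (?_ : _ * v = 0)).resolve_left hp
    linear_combination (α * q + 2 * β * μ) * h₁ - (q + 2 * μ + σ) * h₂ - q * v * hκ'

theorem hos_mode_eq {μ α β lam : ℝ} {ρ θ : ℝ → ℂ} (hρ : IsC2Per ρ) (hθ : IsC2Per θ) {σ s : ℂ}
    (e₁ : ∀ x, scaledOp₁ α lam (fun _ => μ) (fun _ => 0) (fun _ => 0) ρ θ x - σ * ρ x = 0)
    (e₂ : ∀ x, scaledOp₂ α β lam (fun _ => μ) (fun _ => 0) (fun _ => 0) ρ θ x - σ * θ x = s)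
    (k : ℤ) :
    -((lam * (k : ℝ) ^ 2 : ℝ) : ℂ) * (fc ρ k - α * fc θ k) - 2 * μ * fc ρ k - σ * fc ρ k = 0 ∧
    -((lam * (k : ℝ) ^ 2 : ℝ) : ℂ) * (α * fc ρ k + fc θ k) - 2 * β * μ * fc ρ k - σ * fc θ k
      = s * fc (fun _ => 1) k := by
  constructor
  · have h := fc_base₁ hρ hθ α μ lam σ k
    rw [funext e₁] at h
    have h0 : fc (fun _ => (0 : ℂ)) k = 0 := by simpa using fc_const_mul 0 (fun _ => 1) k
    rw [h0] at h
    exact h.symm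
  · have h := fc_base₂ hρ hθ α β μ lam σ k
    rw [funext e₂] at h
    have h0 : fc (fun _ => s) k = s * fc (fun _ => 1) k := by
      simpa using fc_const_mul s (fun _ => 1) k
    rw [h0] at h
    exact h.symm

theorem one_le_int_sq {k : ℤ} (hk : k ≠ 0) : (1 : ℝ) ≤ (k : ℝ) ^ 2 := by
  have : (1 : ℤ) ≤ k ^ 2 := by
    have := sq_pos_of_ne_zero hk
    omega
  exact_mod_cast this

/-- Below the critical size the homogeneous state is linearly stable. -/
theorem hos_isLinearlyStable {μ α β Ω q₀ : ℝ} (hμ : 0 < μ) (hΩ : 0 < Ω) (hq₀ : 0 < q₀)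
    (hκ : (1 + α ^ 2) * q₀ = -2 * μ * (1 + α * β)) (hΩq : q₀ < Ω ^ 2) :
    IsLinearlyStable μ α β (2 * Real.pi / Ω) (hosFreq μ β) (hosR μ) hosPhase := by
  refine (hos_scaledState hμ hΩ.ne').isLinearlyStable ?_
  intro z₁ z₂ σ s t hz₁ hz₂ hσ e₁ e₂
  have e₁' : ∀ x, scaledOp₁ α (Ω ^ 2) (fun _ => μ) (fun _ => 0) (fun _ => 0) z₁ z₂ x - σ * z₁ x
      = 0 := fun x => by rw [e₁]; simp
  have e₂' : ∀ x, scaledOp₂ α β (Ω ^ 2) (fun _ => μ) (fun _ => 0) (fun _ => 0) z₁ z₂ x - σ * z₂ x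
      = s := fun x => by rw [e₂]; simp
  have hmode := hos_mode_eq hz₁ hz₂ e₁' e₂'
  have hne : ∀ k : ℤ, k ≠ 0 → fc z₁ k = 0 ∧ fc z₂ k = 0 := by
    intro k hk
    obtain ⟨m₁, m₂⟩ := hmode k
    rw [fc_one_of_ne hk, mul_zero] at m₂
    refine mode_eq_zero hκ m₁ m₂ fun h0 => ?_
    have hk1 := one_le_int_sq hk
    have hq : q₀ < Ω ^ 2 * (k : ℝ) ^ 2 := by nlinarith
    have h2 : 0 < Ω ^ 2 * (k : ℝ) ^ 2 := hq₀.trans hq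
    have := quadratic_root_re_neg (by positivity)
      (mul_pos (by positivity) (mul_pos h2 (sub_pos.mpr hq))) h0
    linarith
  -- At k = 0 only the amplitude equation is informative. The mean of z₂ stays free and becomes the
  -- phase component.
  have h0 : fc z₁ 0 = 0 := by
    obtain ⟨m₁, -⟩ := hmode 0
    have : (2 * μ + σ) * fc z₁ 0 = 0 := by
      push_cast at m₁
      linear_combination -m₁
    refine (mul_eq_zero.mp this).resolve_left fun h => ?_
    have := congrArg Complex.re h
    simp at this
    linarith
  have hz : z₁ = 0 := by
    refine eq_zero_of_fc_eq_zero hz₁.continuous hz₁.2 fun k => ?_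
    by_cases hk : k = 0
    · rw [hk, h0]
    · exact (hne k hk).1
  have hw : (fun x => z₂ x + (-fc z₂ 0) * 1) = 0 := by
    have hc := hz₂.add_const_mul (isC2Per_const 1) (-fc z₂ 0)
    refine eq_zero_of_fc_eq_zero hc.continuous hc.2 fun k => ?_
    rw [hz₂.fc_add_const_mul (isC2Per_const 1)]
    by_cases hk : k = 0
    · rw [hk, fc_one_zero]
      ring
    · rw [(hne k hk).2, fc_one_of_ne hk]
      ring
  refine ⟨fc z₂ 0, 0, fun x => ?_, fun x => ?_⟩
  · rw [hz]
    simp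
  · have := congrFun hw x
    simp only [Pi.zero_apply] at this
    linear_combination this

/-- The unstable eigenvalue of the homogeneous state at squared wavenumber `lam`. -/
def hosEigenvalue (μ α q₀ lam : ℝ) : ℝ :=
  -(lam + μ) + Real.sqrt ((lam + μ) ^ 2 + (1 + α ^ 2) * (lam * (q₀ - lam)))

/-- It is the larger root of the characteristic quadratic at k = ±1, whose constant term is negative
when λ < q₀. -/
theorem hosEigenvalue_root {μ α q₀ lam : ℝ} (hlam : 0 < lam) (hq : lam < q₀) :
    hosEigenvalue μ α q₀ lam ^ 2 + (2 * lam + 2 * μ) * hosEigenvalue μ α q₀ lam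
      = (1 + α ^ 2) * (lam * (q₀ - lam)) := by
  have h : 0 ≤ (lam + μ) ^ 2 + (1 + α ^ 2) * (lam * (q₀ - lam)) :=
    add_nonneg (sq_nonneg _) (mul_nonneg (by positivity) (mul_nonneg hlam.le (by linarith)))
  have := Real.sq_sqrt h
  unfold hosEigenvalue
  linear_combination this

theorem hosEigenvalue_pos {μ α q₀ lam : ℝ} (hlam : 0 < lam) (hμ : 0 < μ)
    (hq : lam < q₀) : 0 < hosEigenvalue μ α q₀ lam := by
  unfold hosEigenvalue
  have h1 : 0 < (1 + α ^ 2) * (lam * (q₀ - lam)) :=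
    mul_pos (by positivity) (mul_pos hlam (by linarith))
  have h2 : lam + μ < Real.sqrt ((lam + μ) ^ 2 + (1 + α ^ 2) * (lam * (q₀ - lam))) :=
    Real.lt_sqrt_of_sq_lt (by linarith)
  linarith

/-- Slightly above the critical size the homogeneous state has exactly one unstable eigenvalue. -/
theorem hos_isCriticalEigenvalue {μ α β Ω q₀ c m : ℝ} (hμ : 0 < μ) (hΩ : 0 < Ω) (hq₀ : 0 < q₀)
    (hκ : (1 + α ^ 2) * q₀ = -2 * μ * (1 + α * β)) (hc : c ≤ μ) (hm : 0 < m)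
    (hp : ∀ q : ℝ, 3 * q₀ ≤ q → ∀ σ : ℂ, -c ≤ σ.re → m * (q * (q + ‖σ‖)) ≤
        ‖σ ^ 2 + ((2 * q + 2 * μ : ℝ) : ℂ) * σ + (((1 + α ^ 2) * (q * (q - q₀)) : ℝ) : ℂ)‖)
    (hΩq : Ω ^ 2 < q₀) (hΩ3 : 3 * q₀ ≤ 4 * Ω ^ 2) :
    IsCriticalEigenvalue μ α β (2 * Real.pi / Ω) (hosFreq μ β) (hosR μ) hosPhase c
      (hosEigenvalue μ α q₀ (Ω ^ 2)) := by
  have hS := hos_scaledState (α := α) (β := β) hμ hΩ.ne'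
  have hlam : 0 < Ω ^ 2 := by positivity
  set e := hosEigenvalue μ α q₀ (Ω ^ 2) with he
  have hroot := hosEigenvalue_root (μ := μ) (α := α) hlam hΩq
  have hpos := hosEigenvalue_pos (α := α) hlam hμ hΩq
  rw [← he] at hroot hpos
  constructor
  · rw [hS.isStabilityEigenvalue_iff]
    have hd : ∀ r : ℂ, deriv (fun x => r * ccos x) = fun x => r * -csin x := fun r =>
      funext fun x => ((hasDerivAt_ccos x).const_mul r).deriv
    have hdd : ∀ (r : ℂ) (x : ℝ), deriv (fun x => r * -csin x) x = -(r * ccos x) := fun r x => by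
      have := ((hasDerivAt_csin x).neg.const_mul r).deriv
      rw [mul_neg] at this
      exact this
    have hroot' : ((e : ℂ) ^ 2 + (2 * Ω ^ 2 + 2 * μ) * e) = (1 + α ^ 2) * (Ω ^ 2 * (q₀ - Ω ^ 2)) := by
      exact_mod_cast hroot
    have hκ' : ((1 + α ^ 2) * q₀ : ℂ) = -2 * μ * (1 + α * β) := by exact_mod_cast hκ
    -- These coefficients satisfy the second row of the mode matrix identically; the first row is
    -- then the characteristic equation.
    refine ⟨fun x => ((Ω ^ 2 + e : ℝ) : ℂ) * ccos x,
      fun x => ((-(α * Ω ^ 2 + 2 * β * μ) : ℝ) : ℂ) * ccos x, isC2Per_ccos.const_mul _,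
      isC2Per_ccos.const_mul _, ?_, fun s => ?_, fun s => ?_⟩
    · rintro ⟨h0, -⟩
      have := congrFun h0 0
      simp only [ccos, Real.cos_zero, Complex.ofReal_one, mul_one, Pi.zero_apply] at this
      have h1 : Ω ^ 2 + e = 0 := by exact_mod_cast this
      linarith
    · unfold scaledOp₁
      rw [hd, hd, hdd, hdd]
      push_cast
      linear_combination -ccos s * hroot' - Ω ^ 2 * ccos s * hκ'
    · unfold scaledOp₂
      rw [hd, hd, hdd, hdd]
      push_cast
      ring
  · intro σ hσ hσc
    obtain ⟨ρ, θ, hρ, hθ, hne, e₁, e₂⟩ := (hS.isStabilityEigenvalue_iff σ).mp hσ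
    have hmode := hos_mode_eq (s := 0) hρ hθ (fun x => by rw [e₁, sub_self])
      (fun x => by rw [e₂, sub_self])
    obtain ⟨k, hk⟩ : ∃ k : ℤ, ¬(fc ρ k = 0 ∧ fc θ k = 0) := by
      by_contra hcon
      push Not at hcon
      exact hne ⟨eq_zero_of_fc_eq_zero hρ.continuous hρ.2 fun k => (hcon k).1,
        eq_zero_of_fc_eq_zero hθ.continuous hθ.2 fun k => (hcon k).2⟩
    obtain ⟨m₁, m₂⟩ := hmode k
    rw [zero_mul] at m₂
    have hpk : σ ^ 2 + ((2 * (Ω ^ 2 * (k : ℝ) ^ 2) + 2 * μ : ℝ) : ℂ) * σ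
        + (((1 + α ^ 2) * ((Ω ^ 2 * (k : ℝ) ^ 2) * ((Ω ^ 2 * (k : ℝ) ^ 2) - q₀)) : ℝ) : ℂ) = 0 := by
      by_contra hpne
      exact hk (mode_eq_zero hκ m₁ m₂ hpne)
    by_cases hk0 : k = 0
    · left
      have h1 : σ * (σ + 2 * μ) = 0 := by
        rw [hk0] at hpk
        push_cast at hpk
        linear_combination hpk
      refine (mul_eq_zero.mp h1).resolve_right fun h2 => ?_
      have := congrArg Complex.re h2
      simp at this
      linarith
    by_cases hk1 : k = 1 ∨ k = -1
    · right
      have hk2 : (k : ℝ) ^ 2 = 1 := by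
        rcases hk1 with h | h <;> simp [h]
      rw [hk2] at hpk
      have hroot' : ((e : ℂ) ^ 2 + (2 * Ω ^ 2 + 2 * μ) * e)
          = (1 + α ^ 2) * (Ω ^ 2 * (q₀ - Ω ^ 2)) := by
        exact_mod_cast hroot
      -- The other root −(2Ω² + 2μ + e) lies to the left of −c, as c ≤ μ.
      have h1 : (σ - e) * (σ + ((2 * Ω ^ 2 + 2 * μ + e : ℝ) : ℂ)) = 0 := by
        push_cast at hpk ⊢
        linear_combination hpk - hroot'
      refine sub_eq_zero.mp ((mul_eq_zero.mp h1).resolve_right fun h2 => ?_)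
      have := congrArg Complex.re h2
      rw [Complex.add_re, Complex.ofReal_re, Complex.zero_re] at this
      linarith
    · exfalso
      have hk4 : (4 : ℝ) ≤ (k : ℝ) ^ 2 := by
        have : (2 : ℤ) ≤ |k| := by
          push Not at hk1
          rcases abs_cases k with h | h <;> omega
        have h2 : (4 : ℤ) ≤ k ^ 2 := by
          rw [← sq_abs]
          nlinarith
        exact_mod_cast h2
      have hq : 3 * q₀ ≤ Ω ^ 2 * (k : ℝ) ^ 2 := by nlinarith
      have := hp _ hq σ hσc.le
      rw [hpk, norm_zero] at this
      have hq' : 0 < Ω ^ 2 * (k : ℝ) ^ 2 := by linarith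
      have : 0 < m * (Ω ^ 2 * (k : ℝ) ^ 2 * (Ω ^ 2 * (k : ℝ) ^ 2 + ‖σ‖)) := by positivity
      linarith

/-! ### The stationary states on the branch -/

open PerFun

theorem IsProfile.hasDerivAt_rhs {γ d Λ : ℝ} {y χ E : ℝ → ℝ} (h : IsProfile γ d Λ y χ E) (s : ℝ) :
    HasDerivAt (fun s => d - E s - y s ^ 2 + γ ^ 2 * χ s ^ 2)
      (-(Λ * y s + 2 * (y s * E s)) - 2 * y s * (d - E s - y s ^ 2 + γ ^ 2 * χ s ^ 2)
        + γ ^ 2 * (2 * χ s * (E s - 2 * (y s * χ s)))) s ∧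
    HasDerivAt (fun s => E s - 2 * (y s * χ s))
      ((Λ * y s + 2 * (y s * E s)) - 2 * ((d - E s - y s ^ 2 + γ ^ 2 * χ s ^ 2) * χ s
        + y s * (E s - 2 * (y s * χ s)))) s := by
  have hy := h.deriv_y s
  have hχ := h.deriv_χ s
  have hE := h.deriv_E s
  constructor
  · refine (((hE.const_sub d).sub (hy.pow 2)).add ((hχ.pow 2).const_mul (γ ^ 2))).congr_deriv ?_
    push_cast
    ring
  · exact hE.sub ((hy.mul hχ).const_mul 2)

/-- The translation mode is in the kernel of the scaled linearization. -/
theorem IsProfile.scaledOp_translation {α β h γ d Λ lam : ℝ} {y χ E : ℝ → ℝ}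
    (hp : IsProfile γ d Λ y χ E) (hh : 0 < h) (h₁ : h * (1 + α * γ) = -1)
    (h₂ : h * γ = h * α + β) (s : ℝ) :
    scaledOp₁ α lam (fun s => lam * (Λ + 2 * E s) / (2 * h)) y (fun s => γ * χ s)
        (fun s => (y s : ℂ)) (fun s => ((γ * χ s : ℝ) : ℂ)) s = 0 ∧
      scaledOp₂ α β lam (fun s => lam * (Λ + 2 * E s) / (2 * h)) y (fun s => γ * χ s)
        (fun s => (y s : ℂ)) (fun s => ((γ * χ s : ℝ) : ℂ)) s = 0 := by
  have dy : deriv (fun s => (y s : ℂ))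
      = fun s => ((d - E s - y s ^ 2 + γ ^ 2 * χ s ^ 2 : ℝ) : ℂ) :=
    funext fun s => (hp.deriv_y s).ofReal_comp.deriv
  have dχ : deriv (fun s => ((γ * χ s : ℝ) : ℂ))
      = fun s => ((γ * (E s - 2 * (y s * χ s)) : ℝ) : ℂ) :=
    funext fun s => ((hp.deriv_χ s).const_mul γ).ofReal_comp.deriv
  have ddy := (hp.hasDerivAt_rhs s).1.ofReal_comp.deriv
  have ddχ := ((hp.hasDerivAt_rhs s).2.const_mul γ).ofReal_comp.deriv
  have hh' : (h : ℂ) ≠ 0 := by exact_mod_cast hh.ne'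
  have h₁' : (h * (1 + α * γ) : ℂ) = -1 := by exact_mod_cast h₁
  have h₂' : (h * γ : ℂ) = h * α + β := by exact_mod_cast h₂
  constructor
  · unfold scaledOp₁
    rw [dy, dχ, ddy, ddχ]
    push_cast
    field_simp
    linear_combination -(lam * y s * (Λ + 2 * E s)) * h₁'
  · unfold scaledOp₂
    rw [dy, dχ, ddy, ddχ]
    push_cast
    field_simp
    linear_combination (lam * y s * (Λ + 2 * E s)) * h₂'

namespace BranchFamily

section

variable {γ : ℝ} {b : BranchFamily γ} {a : ℝ}

theorem Good.isEvenProfile (hg : b.Good a) :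
    IsEvenProfile γ (b.d a) (b.Lam a) (b.y a).fn (b.χ a).fn (b.E a).fn where
  deriv_y := fun s => (hg.deriv_y s).congr_deriv (by simp [fn])
  deriv_χ := fun s => (hg.deriv_χ s).congr_deriv (by simp [fn])
  deriv_E := fun s => (hg.deriv_E s).congr_deriv (by simp [fn])
  periodic_y := (b.y a).periodic_coe
  periodic_χ := (b.χ a).periodic_coe
  periodic_E := (b.E a).periodic_coe
  odd_y := fun s => congrArg (fun f : PerFun => f (s : AddCircle (2 * Real.pi))) hg.reflect_y
  odd_χ := fun s => congrArg (fun f : PerFun => f (s : AddCircle (2 * Real.pi))) hg.reflect_χ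
  even_E := fun s => congrArg (fun f : PerFun => f (s : AddCircle (2 * Real.pi))) hg.reflect_E

end

variable {α β : ℝ} (b : BranchFamily (phaseRatio α β))

/-- The wavenumber along the branch. -/
def wavenumber (μ a : ℝ) : ℝ := Real.sqrt (b.lam (bfParam α β) (2 * bfParam α β * μ) a)

/-- The amplitude of the stationary solution along the branch. -/
def amplitude (μ a : ℝ) : ℝ → ℝ :=
  profileR (bfParam α β) (b.Lam a) (b.wavenumber μ a) (b.E a).fn

/-- The phase of the stationary solution along the branch. -/
def phase (μ a : ℝ) : ℝ → ℝ := profilePhase (phaseRatio α β) (b.wavenumber μ a) (b.χ a).fn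

/-- The frequency along the branch. -/
def freq (μ a : ℝ) : ℝ :=
  α * μ + (β - α) * (b.Lam a * b.wavenumber μ a ^ 2 / (2 * bfParam α β))

/-- Conditions under which the member of amplitude `a` defines a stationary solution. -/
structure Sound (a : ℝ) : Prop where
  good : b.Good a
  pos : 0 < 1 + a ^ 2 * b.waveCoeff (bfParam α β) a
  intensity_pos : ∀ s, 0 < b.Lam a + 2 * (b.E a).fn s

variable {b} {μ a : ℝ}

theorem Sound.lam_pos (hs : b.Sound a) (hBF : 1 + α * β < 0) (hμ : 0 < μ) :
    0 < b.lam (bfParam α β) (2 * bfParam α β * μ) a :=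
  div_pos (mul_pos (mul_pos two_pos (bfParam_pos hBF)) hμ) hs.pos

theorem Sound.wavenumber_pos (hs : b.Sound a) (hBF : 1 + α * β < 0) (hμ : 0 < μ) :
    0 < b.wavenumber μ a := Real.sqrt_pos.mpr (hs.lam_pos hBF hμ)

theorem Sound.wavenumber_sq (hs : b.Sound a) (hBF : 1 + α * β < 0) (hμ : 0 < μ) :
    b.wavenumber μ a ^ 2 = b.lam (bfParam α β) (2 * bfParam α β * μ) a :=
  Real.sq_sqrt (hs.lam_pos hBF hμ).le

theorem Sound.isEvenStationarySolution (hs : b.Sound a) (hBF : 1 + α * β < 0) (hμ : 0 < μ) :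
    IsEvenStationarySolution μ α β (2 * Real.pi / b.wavenumber μ a) (b.freq μ a)
      (b.amplitude μ a) (b.phase μ a) := by
  refine isEvenStationarySolution_of_profile hBF hs.good.isEvenProfile (hs.wavenumber_pos hBF hμ)
    hs.intensity_pos ?_
  rw [hs.wavenumber_sq hBF hμ, b.Lam_sub, lam, div_mul_cancel₀ _ hs.pos.ne']

theorem Sound.scaledState (hs : b.Sound a) (hBF : 1 + α * β < 0) (hμ : 0 < μ) :
    ScaledState μ α β (b.freq μ a) (b.wavenumber μ a) (b.amplitude μ a) (b.phase μ a)
      (b.intensityFn (bfParam α β) (2 * bfParam α β * μ) a) (b.y a).fn (b.phaseFn a) := by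
  have hh := bfParam_pos hBF
  have hsol := hs.isEvenStationarySolution hBF hμ
  have hΩ := hs.wavenumber_pos hBF hμ
  have hprof := hs.good.isEvenProfile
  have hsq := hs.wavenumber_sq hBF hμ
  have hC := hprof.toIsProfile.contDiff 2
  have hker := hprof.toIsProfile.scaledOp_translation (lam := b.wavenumber μ a ^ 2) hh
    (bfParam_mul_one_add hBF) (bfParam_mul_phaseRatio_eq hBF)
  have hP : b.intensityFn (bfParam α β) (2 * bfParam α β * μ) a
      = fun s => b.wavenumber μ a ^ 2 * (b.Lam a + 2 * (b.E a).fn s) / (2 * bfParam α β) := by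
    rw [hsq]
    rfl
  refine ⟨fun x => (hsol.amplitude_pos x).ne', hsol.contDiff_amplitude,
    (isCGLSolution_stationaryField_iff hsol.contDiff_amplitude hsol.contDiff_phase
      hsol.periodic_amplitude hsol.periodic_phase).mp hsol.solves, hΩ.ne',
    hsol.periodic_amplitude, fun x => ?_, fun x => ?_, fun x => ?_, ⟨?_, ?_⟩, ⟨?_, ?_⟩, ?_, ?_⟩
  · exact (hasDerivAt_profileR hprof.toIsProfile hh hΩ.ne' hs.intensity_pos x).deriv
  · refine (hasDerivAt_profilePhase hprof.toIsProfile x).deriv.trans ?_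
    rw [phaseFn]
    ring
  · rw [hP]
    exact (profileR_sq hh hs.intensity_pos x).symm
  · exact Complex.ofRealCLM.contDiff.comp hC.1
  · exact (b.y a).periodic_cx
  · exact Complex.ofRealCLM.contDiff.comp (contDiff_const.mul hC.2.1)
  · intro s
    simp only [phaseFn]
    rw [show (b.χ a).fn (s + 2 * Real.pi) = (b.χ a).fn s from (b.χ a).periodic_coe s]
  · rw [hP]
    exact fun s => (hker s).1
  · rw [hP]
    exact fun s => (hker s).2

end BranchFamily

/-! ### The spectrum along the branch -/

open PerFun

theorem fc_neg_of_odd {f : ℝ → ℂ} (hp : Function.Periodic f (2 * Real.pi))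
    (ho : ∀ x, f (-x) = -f x) (k : ℤ) : fc f (-k) = -fc f k := by
  rw [fc_eq_integral, fc_eq_integral, ← smul_neg, ← intervalIntegral.integral_neg]
  congr 1
  set g : ℝ → ℂ := fun x => fourier (- -k) (x : AddCircle (2 * Real.pi - 0)) * f x with hg
  have hper : Function.Periodic g (2 * Real.pi) := by
    intro x
    have : ((x + 2 * Real.pi : ℝ) : AddCircle (2 * Real.pi - 0)) = (x : AddCircle _) := by
      have h0 : x + 2 * Real.pi = x + (2 * Real.pi - 0) := by ring
      rw [h0]
      exact AddCircle.coe_add_period (2 * Real.pi - 0) x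
    simp only [hg, this, hp x]
  have h1 : ∫ x in (0 : ℝ)..(2 * Real.pi), g x = ∫ x in (0 : ℝ)..(2 * Real.pi), g (-x) := by
    rw [intervalIntegral.integral_comp_neg g, neg_zero]
    have := hper.intervalIntegral_add_eq (-(2 * Real.pi)) 0
    rw [neg_add_cancel, zero_add] at this
    exact this.symm
  rw [h1]
  congr 1
  funext x
  simp only [hg, ho x, neg_neg]
  have : ((-x : ℝ) : AddCircle (2 * Real.pi - 0)) = -(x : AddCircle _) := by simp
  rw [this]
  simp [fourier_apply]

theorem norm_fc_cx_le (f : PerFun) (k : ℤ) : ‖fc f.cx k‖ ≤ ‖f‖ := by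
  have h1 := norm_fc_sq_le f.continuous_cx k
  have h2 : msq f.cx ≤ ‖f‖ ^ 2 := by
    refine msq_le_of_bound f.continuous_cx fun x => ?_
    rw [cx, Complex.norm_real]
    exact pow_le_pow_left₀ (norm_nonneg _) (f.abs_coe_le x) 2
  exact (le_abs_self _).trans (abs_le_of_sq_le_sq (h1.trans h2) (norm_nonneg _))

namespace BranchFamily

variable {α β : ℝ} (b : BranchFamily (phaseRatio α β))

theorem eventually_sound (hg : ∀ᶠ a in 𝓝 (0 : ℝ), b.Good a) : ∀ᶠ a in 𝓝 (0 : ℝ), b.Sound a := by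
  have hE := b.contDiff_E.continuousAt
  have hL := b.contDiff_Lam.continuousAt
  have hc : ContinuousAt (fun a => b.Lam a - 2 * ‖b.E a‖) 0 := by fun_prop
  have hpos : ∀ᶠ a in 𝓝 (0 : ℝ), 0 < b.Lam a - 2 * ‖b.E a‖ :=
    hc.eventually (lt_mem_nhds (by simp [Lam, E]))
  filter_upwards [hg, b.eventually_regular (bfParam α β) hg, hpos] with a h1 h2 h3
  refine ⟨h1, h2.pos, fun s => ?_⟩
  have := (abs_le.mp ((b.E a).abs_coe_le s)).1
  rw [fn]
  linarith

/-- All coefficients depend continuously on a in the uniform norm and equal those of the critical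
HOS at a = 0. -/
theorem eventually_nearCritical (hBF : 1 + α * β < 0) (μ : ℝ) {ϵ : ℝ} (hϵ : 0 < ϵ) :
    ∀ᶠ a in 𝓝 (0 : ℝ), NearCritical μ (2 * bfParam α β * μ) ϵ
      (b.lam (bfParam α β) (2 * bfParam α β * μ) a)
      (b.intensityFn (bfParam α β) (2 * bfParam α β * μ) a) (b.y a).fn (b.phaseFn a) := by
  have hh := bfParam_pos hBF
  set h := bfParam α β with hhd
  have hE := b.contDiff_E.continuousAt
  have hL := b.contDiff_Lam.continuousAt
  have hy := b.contDiff_y.continuousAt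
  have hχ := b.contDiff_χ.continuousAt
  have hk := (b.contDiff_waveCoeff h).continuousAt
  have hlam : ContinuousAt (b.lam h (2 * h * μ)) 0 := by
    unfold lam
    exact ContinuousAt.div (by fun_prop) (by fun_prop) (by simp)
  have e1 : ContinuousAt (fun a => |b.lam h (2 * h * μ) a - 2 * h * μ|) 0 := by fun_prop
  have e2 : ContinuousAt (fun a => ‖(b.lam h (2 * h * μ) a / (2 * h)) • b.intensity a
      - μ • (1 : PerFun)‖) 0 := by
    unfold intensity
    fun_prop
  have e3 : ContinuousAt (fun a => ‖b.y a‖) 0 := by fun_prop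
  have e4 : ContinuousAt (fun a => ‖phaseRatio α β • b.χ a‖) 0 := by fun_prop
  have z1 : |b.lam h (2 * h * μ) 0 - 2 * h * μ| < ϵ := by simpa [lam] using hϵ
  have z2 : ‖(b.lam h (2 * h * μ) 0 / (2 * h)) • b.intensity 0 - μ • (1 : PerFun)‖ < ϵ := by
    have : b.lam h (2 * h * μ) 0 / (2 * h) = μ := by
      simp only [lam]
      field_simp
      ring
    rw [this, intensity_zero, sub_self, norm_zero]
    exact hϵ
  have z3 : ‖b.y 0‖ < ϵ := by simpa [y] using hϵ
  have z4 : ‖phaseRatio α β • b.χ 0‖ < ϵ := by simpa [χ] using hϵ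
  filter_upwards [e1.eventually (gt_mem_nhds z1), e2.eventually (gt_mem_nhds z2),
    e3.eventually (gt_mem_nhds z3), e4.eventually (gt_mem_nhds z4)] with a h1 h2 h3 h4
  refine ⟨?_, (b.y a).continuous_coe, continuous_const.mul (b.χ a).continuous_coe, h1.le,
    fun s => ?_, fun s => ((b.y a).abs_coe_le s).trans h3.le, fun s => ?_⟩
  · have := (b.E a).continuous_coe
    unfold intensityFn fn
    fun_prop
  · refine le_trans (le_of_eq ?_) ((abs_coe_le _ s).trans h2.le)
    simp [intensityFn, intensity, fn]
    congr 1
    ring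
  · exact (abs_coe_le (phaseRatio α β • b.χ a) s).trans h4.le

/-- First component of the normalized translation mode. -/
def oddMode₁ (a : ℝ) (s : ℝ) : ℂ := (a : ℂ)⁻¹ * ((b.y a).fn s : ℂ)

/-- Second component of the normalized translation mode. -/
def oddMode₂ (a : ℝ) (s : ℝ) : ℂ := (a : ℂ)⁻¹ * (b.phaseFn a s : ℂ)

theorem oddMode₁_eq {a : ℝ} (ha : a ≠ 0) : b.oddMode₁ a = (-sinP + a • b.yh a).cx := by
  have ha' : (a : ℂ) ≠ 0 := by exact_mod_cast ha
  funext s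
  simp [oddMode₁, fn, cx, y]
  field_simp

theorem oddMode₂_eq {a : ℝ} (ha : a ≠ 0) :
    b.oddMode₂ a = (phaseRatio α β • (sinP + a • b.xh a)).cx := by
  have ha' : (a : ℂ) ≠ 0 := by exact_mod_cast ha
  funext s
  simp [oddMode₂, phaseFn, fn, cx, χ]
  field_simp

/-- Divided by a, the translation mode tends to (−sin, γ sin). There the functional (1, α) at k = 1
has modulus (1 − αγ)/2 ≥ 1, and the correction is below 1/2. -/
theorem eventually_transversal (hg : ∀ᶠ a in 𝓝 (0 : ℝ), b.Good a) (hBF : 1 + α * β < 0)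
    (hγ : 2 ≤ 1 - α * phaseRatio α β) {μ : ℝ} (hμ : 0 < μ) :
    ∀ᶠ a in 𝓝[≠] (0 : ℝ), TransversalOddPair α (2 + 2 * |phaseRatio α β|) (1 / 2)
      (b.oddMode₁ a) (b.oddMode₂ a) := by
  have hyh := b.contDiff_yh.continuousAt
  have hxh := b.contDiff_xh.continuousAt
  have e1 : ContinuousAt (fun a => |a| * ‖b.yh a‖) 0 := by fun_prop
  have e2 : ContinuousAt (fun a => |a| * ‖b.xh a‖) 0 := by fun_prop
  have e3 : ContinuousAt (fun a => |a| * (‖b.yh a‖ + |α| * |phaseRatio α β| * ‖b.xh a‖)) 0 := by fun_prop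
  have z1 : |(0 : ℝ)| * ‖b.yh 0‖ < 1 := by simp
  have z2 : |(0 : ℝ)| * ‖b.xh 0‖ < 1 := by simp
  have z3 : |(0 : ℝ)| * (‖b.yh 0‖ + |α| * |phaseRatio α β| * ‖b.xh 0‖) < 1 / 2 := by simp
  have h := ((b.eventually_sound hg).and (e1.eventually (gt_mem_nhds z1))).and
    ((e2.eventually (gt_mem_nhds z2)).and (e3.eventually (gt_mem_nhds z3)))
  refine eventually_nhdsWithin_iff.mpr (h.mono ?_)
  rintro a ⟨⟨hs, h1⟩, h2, h3⟩ ha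
  have ha : a ≠ 0 := ha
  have hst := hs.scaledState hBF hμ
  have o₁ : ∀ x, b.oddMode₁ a (-x) = -b.oddMode₁ a x := fun x => by
    simp only [oddMode₁, hs.good.isEvenProfile.odd_y x]
    push_cast
    ring
  have o₂ : ∀ x, b.oddMode₂ a (-x) = -b.oddMode₂ a x := fun x => by
    simp only [oddMode₂, phaseFn, hs.good.isEvenProfile.odd_χ x]
    push_cast
    ring
  have c₁ : IsC2Per (b.oddMode₁ a) := hst.isC2Per_y.const_mul _
  have c₂ : IsC2Per (b.oddMode₂ a) := hst.isC2Per_ψ.const_mul _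
  have n₁ := fc_neg_of_odd c₁.2 o₁
  have n₂ := fc_neg_of_odd c₂.2 o₂
  have z : ∀ w : ℂ, w = -w → w = 0 := fun w hw => by
    have : (2 : ℂ) * w = 0 := by linear_combination hw
    simpa using this
  have hsin : ∀ k, fc sinP.cx k = fc csin k := fun k => rfl
  have f₁ : fc (b.oddMode₁ a) 1 = Complex.I / 2 + a * fc (b.yh a).cx 1 := by
    have e : b.oddMode₁ a = fun x => (-1 : ℂ) * csin x + (a : ℂ) * (b.yh a).cx x := by
      rw [b.oddMode₁_eq ha]
      funext x
      simp [cx, csin]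
    have hc : Continuous fun x => (-1 : ℂ) * csin x :=
      continuous_const.mul isC2Per_csin.continuous
    have hc' : Continuous fun x => (a : ℂ) * (b.yh a).cx x :=
      continuous_const.mul (b.yh a).continuous_cx
    rw [e, fc_add hc hc', fc_const_mul, fc_const_mul, fc_csin_one]
    ring
  have f₂ : fc (b.oddMode₂ a) 1 = phaseRatio α β * (-Complex.I / 2 + a * fc (b.xh a).cx 1) := by
    have e : b.oddMode₂ a = fun x => ((phaseRatio α β : ℝ) : ℂ) * csin x + ((phaseRatio α β : ℝ) * a : ℂ) * (b.xh a).cx x := by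
      rw [b.oddMode₂_eq ha]
      funext x
      simp [cx, csin]
      ring
    have hc : Continuous fun x => ((phaseRatio α β : ℝ) : ℂ) * csin x :=
      continuous_const.mul isC2Per_csin.continuous
    have hc' : Continuous fun x => ((phaseRatio α β : ℝ) * a : ℂ) * (b.xh a).cx x :=
      continuous_const.mul (b.xh a).continuous_cx
    rw [e, fc_add hc hc', fc_const_mul, fc_const_mul, fc_csin_one]
    ring
  refine ⟨c₁, c₂, fun s => ?_, fun s => ?_, z _ (n₁ 0), z _ (n₂ 0), n₁ 1, n₂ 1, ?_⟩
  · rw [b.oddMode₁_eq ha, cx, Complex.norm_real]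
    refine (abs_coe_le _ s).trans ((norm_add_le _ _).trans ?_)
    rw [norm_neg, norm_smul, Real.norm_eq_abs]
    linarith [norm_sinP_le, abs_nonneg (phaseRatio α β)]
  · rw [b.oddMode₂_eq ha, cx, Complex.norm_real]
    refine (abs_coe_le _ s).trans ?_
    rw [norm_smul, Real.norm_eq_abs]
    have : ‖sinP + a • b.xh a‖ ≤ 2 := by
      refine (norm_add_le _ _).trans ?_
      rw [norm_smul, Real.norm_eq_abs]
      linarith [norm_sinP_le]
    nlinarith [abs_nonneg (phaseRatio α β)]
  · have e : fc (b.oddMode₁ a) 1 + α * fc (b.oddMode₂ a) 1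
        = ((1 - α * phaseRatio α β : ℝ) : ℂ) * (Complex.I / 2)
          - -((a : ℂ) * (fc (b.yh a).cx 1 + α * phaseRatio α β * fc (b.xh a).cx 1)) := by
      rw [f₁, f₂]
      push_cast
      ring
    have n1 : ‖((1 - α * phaseRatio α β : ℝ) : ℂ) * (Complex.I / 2)‖ = (1 - α * phaseRatio α β) / 2 := by
      rw [norm_mul, Complex.norm_real, Real.norm_eq_abs, abs_of_nonneg (by linarith), norm_div,
        Complex.norm_I, Complex.norm_two]
      ring
    have n2 : ‖-((a : ℂ) * (fc (b.yh a).cx 1 + α * phaseRatio α β * fc (b.xh a).cx 1))‖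
        ≤ |a| * (‖b.yh a‖ + |α| * |phaseRatio α β| * ‖b.xh a‖) := by
      rw [norm_neg, norm_mul, Complex.norm_real, Real.norm_eq_abs]
      refine mul_le_mul_of_nonneg_left ((norm_add_le _ _).trans ?_) (abs_nonneg _)
      rw [norm_mul, norm_mul, Complex.norm_real, Complex.norm_real, Real.norm_eq_abs,
        Real.norm_eq_abs]
      exact add_le_add (norm_fc_cx_le _ _)
        (mul_le_mul_of_nonneg_left (norm_fc_cx_le _ _) (by positivity))
    rw [e]
    have := norm_sub_norm_le (((1 - α * phaseRatio α β : ℝ) : ℂ) * (Complex.I / 2))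
      (-((a : ℂ) * (fc (b.yh a).cx 1 + α * phaseRatio α β * fc (b.xh a).cx 1)))
    linarith

/-- The spectrum of the linearization along the bifurcating branch. -/
theorem exists_spectrum (hg : ∀ᶠ a in 𝓝 (0 : ℝ), b.Good a) (hBF : 1 + α * β < 0) {μ c M : ℝ}
    (hμ : 0 < μ) (hc : 0 < c) (hM : 0 < M)
    (hmode : ∀ σ : ℂ, -c ≤ σ.re → ∀ k : ℤ, ∀ u v f₁ f₂ : ℂ,
        (k = 0 → v = β * u) → (k = 1 ∨ k = -1 → u + α * v = 0) →
        f₁ = -(2 * bfParam α β * μ * k ^ 2 : ℝ) * (u - α * v) - 2 * μ * u - σ * u →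
        f₂ = -(2 * bfParam α β * μ * k ^ 2 : ℝ) * (α * u + v) - 2 * β * μ * u - σ * v →
        (1 + (k : ℝ) ^ 2) ^ 2 * (‖u‖ ^ 2 + ‖v‖ ^ 2) ≤ M * (‖f₁‖ ^ 2 + ‖f₂‖ ^ 2)) :
    ∃ τ : ℝ → ℝ, Tendsto τ (𝓝 0) (𝓝 (-2 * b.waveCoeff (bfParam α β) 0
        * (2 * bfParam α β * μ) * (1 + α ^ 2) / (1 - α * phaseRatio α β))) ∧
      ∀ᶠ a in 𝓝[≠] (0 : ℝ),
        IsLinearlyStable μ α β (2 * Real.pi / b.wavenumber μ a) (b.freq μ a) (b.amplitude μ a)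
          (b.phase μ a) ∧ a ^ 2 * τ a < 0 ∧
        IsCriticalEigenvalue μ α β (2 * Real.pi / b.wavenumber μ a) (b.freq μ a)
          (b.amplitude μ a) (b.phase μ a) c (a ^ 2 * τ a) := by
  have hh := bfParam_pos hBF
  have k₁ := bfParam_mul_one_add hBF
  have k₂ := bfParam_mul_phaseRatio_eq hBF
  set h := bfParam α β with hhd
  set q₀ := 2 * h * μ with hq₀d
  have hq₀ : 0 < q₀ := by positivity
  -- Because h(1 − αγ) = 2h + 1 exceeds 2h.
  have hγ2 : 2 ≤ 1 - α * phaseRatio α β := by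
    have : h * (1 - α * phaseRatio α β) = 2 * h + 1 := by linear_combination -k₁
    by_contra hcon
    push Not at hcon
    nlinarith
  have hκ : (1 + α ^ 2) * q₀ = -2 * μ * (1 + α * β) := by
    rw [hq₀d, hhd, bfParam]
    field_simp
  obtain ⟨ϵ₀, hϵ₀, hϵ₀1, C, hC, hco⟩ := exists_coercive hκ hγ2 hM hmode
    (B := 2 + 2 * |phaseRatio α β|) (m₀ := 1 / 2) (by positivity) (by norm_num)
  obtain ⟨ϵ₁, hϵ₁, halt⟩ := hco.exists_alternative hϵ₀ hϵ₀1 hC hγ2 (by norm_num)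
    (by rw [hq₀d]; linear_combination 2 * μ * k₁) (by rw [hq₀d]; linear_combination 2 * μ * k₂)
  obtain ⟨τ, hτ, hev⟩ := b.exists_critical_eigenvalue hg hh hq₀ (phaseRatio_ne_zero hBF) k₁ k₂ hγ2
  refine ⟨τ, hτ, ?_⟩
  have hk₀ := b.waveCoeff_zero_pos hh
  have hneg : -2 * b.waveCoeff h 0 * q₀ * (1 + α ^ 2) / (1 - α * phaseRatio α β) < 0 := by
    refine div_neg_of_neg_of_pos ?_ (by linarith)
    have : 0 < b.waveCoeff h 0 * q₀ * (1 + α ^ 2) := by positivity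
    linarith
  have hσ : Tendsto (fun a => a ^ 2 * τ a) (𝓝 0) (𝓝 0) := by
    have h1 : Tendsto (fun a : ℝ => a ^ 2) (𝓝 0) (𝓝 0) := by
      have : ContinuousAt (fun a : ℝ => a ^ 2) 0 := by fun_prop
      simpa [ContinuousAt] using this
    simpa using h1.mul hτ
  have ev1 := (hτ.eventually (gt_mem_nhds hneg)).filter_mono (nhdsWithin_le_nhds (s := {0}ᶜ))
  have ev2 := (hσ.eventually (lt_mem_nhds (neg_lt_zero.mpr hc))).filter_mono
    (nhdsWithin_le_nhds (s := {0}ᶜ))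
  have ev3 := (b.eventually_sound hg).filter_mono (nhdsWithin_le_nhds (s := {0}ᶜ))
  have ev4 := (b.eventually_nearCritical hBF μ hϵ₁).filter_mono (nhdsWithin_le_nhds (s := {0}ᶜ))
  filter_upwards [hev, ev1, ev2, ev3, ev4, b.eventually_transversal hg hBF hγ2 hμ,
    self_mem_nhdsWithin] with a hev h1 h2 hs hN hT ha
  have ha : a ≠ 0 := ha
  have ha' : (a : ℂ) ≠ 0 := by exact_mod_cast ha
  obtain ⟨w₁, w₂, hw₁, hw₂, hw, e₁, e₂⟩ := hev
  have hst := hs.scaledState hBF hμ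
  have hsq := hs.wavenumber_sq hBF hμ
  have hσneg : a ^ 2 * τ a < 0 := mul_neg_of_pos_of_neg (by positivity) h1
  have hσ0 : ((a ^ 2 * τ a : ℝ) : ℂ) ≠ 0 := by exact_mod_cast hσneg.ne
  have kk := hst.scaledOp_span 0 ((a : ℂ)⁻¹)
  simp only [zero_add] at kk
  rw [hsq] at kk
  have key := halt ϵ₁ _ _ _ _ hN le_rfl _ _ hT (fun s => (kk s).1) (fun s => (kk s).2) w₁ w₂ _
    hw₁ hw₂ hw hσ0 (by rw [Complex.ofReal_re]; exact h2.le) e₁ e₂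
  -- The alternative is restated for the unnormalized translation mode; the factor a is moved into
  -- the coefficients.
  have key' : ∀ (z₁ z₂ : ℝ → ℂ) (σ s t : ℂ), IsC2Per z₁ → IsC2Per z₂ → -c ≤ σ.re →
      (∀ x, scaledOp₁ α (b.wavenumber μ a ^ 2) (b.intensityFn h q₀ a) (b.y a).fn (b.phaseFn a)
        z₁ z₂ x - σ * z₁ x = t * (b.y a).fn x) →
      (∀ x, scaledOp₂ α β (b.wavenumber μ a ^ 2) (b.intensityFn h q₀ a) (b.y a).fn (b.phaseFn a)
        z₁ z₂ x - σ * z₂ x = s + t * b.phaseFn a x) →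
      (∃ p q : ℂ, (∀ x, z₁ x = q * (b.y a).fn x) ∧ ∀ x, z₂ x = p + q * b.phaseFn a x) ∨
        σ = ((a ^ 2 * τ a : ℝ) : ℂ) := by
    intro z₁ z₂ σ s t hz₁ hz₂ hσc r₁ r₂
    rw [hsq] at r₁ r₂
    rcases key z₁ z₂ σ s (t * a) hz₁ hz₂ hσc
      (fun x => by rw [r₁, oddMode₁]; field_simp)
      (fun x => by rw [r₂, oddMode₂]; field_simp) with ⟨p, q, hp, hq⟩ | h
    · left
      refine ⟨p, q * (a : ℂ)⁻¹, fun x => ?_, fun x => ?_⟩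
      · rw [hp, oddMode₁]; ring
      · rw [hq, oddMode₂]; ring
    · exact Or.inr h
  refine ⟨hst.isLinearlyStable ?_, hσneg, (hst.isStabilityEigenvalue_iff _).mpr
    ⟨w₁, w₂, hw₁, hw₂, hw, by rw [hsq]; exact e₁, by rw [hsq]; exact e₂⟩, ?_⟩
  · intro z₁ z₂ σ s t hz₁ hz₂ hσ0 r₁ r₂
    rcases key' z₁ z₂ σ s t hz₁ hz₂ (by linarith) r₁ r₂ with hspan | hσe
    · exact hspan
    · exfalso
      rw [hσe, Complex.ofReal_re] at hσ0
      linarith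
  · intro σ hσe hσc
    obtain ⟨ρ, θ, hρ, hθ, hne, r₁, r₂⟩ := (hst.isStabilityEigenvalue_iff σ).mp hσe
    rcases key' ρ θ σ 0 0 hρ hθ hσc.le (fun x => by rw [r₁]; ring) (fun x => by rw [r₂]; ring)
      with ⟨p, q, hp, hq⟩ | h
    · left
      by_contra hσ0
      apply hne
      constructor
      · funext x
        have h1 := (hst.scaledOp_span p q x).1
        rw [← funext hp, ← funext hq, r₁] at h1
        exact (mul_eq_zero.mp h1).resolve_left hσ0
      · funext x
        have h1 := (hst.scaledOp_span p q x).2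
        rw [← funext hp, ← funext hq, r₂] at h1
        exact (mul_eq_zero.mp h1).resolve_left hσ0
    · exact Or.inr h

end BranchFamily

/-! ### Stationary states near the HOS have small profiles -/

open PerFun

theorem abs_le_of_abs_deriv_le {f f' : ℝ → ℝ} {C : ℝ} (hf : ∀ s, HasDerivAt f (f' s) s)
    (hC : ∀ s, |f' s| ≤ C) (h0 : f 0 = 0) {s : ℝ} (hs : s ∈ Set.Ico 0 (2 * Real.pi)) :
    |f s| ≤ C * (2 * Real.pi) := by
  have h := convex_univ.norm_image_sub_le_of_norm_hasDerivWithin_le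
    (fun x _ => (hf x).hasDerivWithinAt) (fun x _ => hC x) (Set.mem_univ 0) (Set.mem_univ s)
  rw [h0, sub_zero, sub_zero, Real.norm_eq_abs, Real.norm_eq_abs, abs_of_nonneg hs.1] at h
  exact h.trans (mul_le_mul_of_nonneg_left hs.2.le ((abs_nonneg _).trans (hC 0)))

/-- A periodic function cannot be strictly monotone. -/
theorem exists_deriv_nonpos {f f' : ℝ → ℝ} (hf : ∀ s, HasDerivAt f (f' s) s)
    (hp : Function.Periodic f (2 * Real.pi)) : ∃ s, f' s ≤ 0 := by
  by_contra hcon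
  push Not at hcon
  have hm : StrictMono f := strictMono_of_deriv_pos fun s => by rw [(hf s).deriv]; exact hcon s
  have h1 := hm (show (0 : ℝ) < 0 + 2 * Real.pi by linarith [Real.pi_pos])
  rw [hp 0] at h1
  exact lt_irrefl _ h1

section

variable {γ d Λ : ℝ} {y χ E r : ℝ → ℝ}

theorem IsProfile.hasDerivAt_flux (hp : IsProfile γ d Λ y χ E)
    (hr : ∀ s, HasDerivAt r (y s * r s) s) (s : ℝ) :
    HasDerivAt (fun s => r s ^ 2 * χ s) (r s ^ 2 * E s) s := by
  refine (((hr s).pow 2).mul (hp.deriv_χ s)).congr_deriv ?_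
  simp only [Pi.pow_apply]
  push_cast
  ring

/-- The flux r²χ is periodic with derivative r²E, so E cannot keep a strict sign. -/
theorem IsEvenProfile.exists_sign (hp : IsEvenProfile γ d Λ y χ E)
    (hr : ∀ s, HasDerivAt r (y s * r s) s) (hrp : Function.Periodic r (2 * Real.pi))
    (hr0 : ∀ s, 0 < r s) : (∃ s, E s ≤ 0) ∧ ∃ s, 0 ≤ E s := by
  have hper : Function.Periodic (fun s => r s ^ 2 * χ s) (2 * Real.pi) := fun s => by
    simp only [hrp s, hp.periodic_χ s]
  obtain ⟨s, hs⟩ := exists_deriv_nonpos (hp.toIsProfile.hasDerivAt_flux hr) hper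
  obtain ⟨t, ht⟩ := exists_deriv_nonpos (fun s => (hp.toIsProfile.hasDerivAt_flux hr s).neg)
    (fun s => congrArg Neg.neg (hper s))
  refine ⟨⟨s, ?_⟩, t, ?_⟩
  · by_contra hcon
    push Not at hcon
    have := mul_pos (pow_pos (hr0 s) 2) hcon
    linarith
  · by_contra hcon
    push Not at hcon
    have := mul_neg_of_pos_of_neg (pow_pos (hr0 t) 2) hcon
    linarith

theorem Function.Periodic.abs_le_of_Ico {f : ℝ → ℝ} (hf : Function.Periodic f (2 * Real.pi))
    {C : ℝ} (h : ∀ s ∈ Set.Ico 0 (2 * Real.pi), |f s| ≤ C) (s : ℝ) : |f s| ≤ C := by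
  obtain ⟨t, ht, hst⟩ := hf.exists_mem_Ico₀ Real.two_pi_pos s
  rw [hst]
  exact h t ht

/-- By oddness χ and y vanish at 0, so they can be bounded by integrating (r²χ)' = r²E and (ry)' =
r(d − E + γ²χ²), where the term y² has cancelled. The comparison m ≤ r ≤ 4m transfers the bounds to
χ and y without any prior smallness of y. -/
theorem IsEvenProfile.abs_le (hp : IsEvenProfile γ d Λ y χ E)
    (hr : ∀ s, HasDerivAt r (y s * r s) s) {m e : ℝ} (hm : 0 < m) (hrm : ∀ s, m ≤ r s)
    (hrM : ∀ s, r s ≤ 4 * m) (hE : ∀ s, |E s| ≤ e) (hd : |d| ≤ e) (s : ℝ) :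
    |χ s| ≤ 32 * Real.pi * e ∧
      |y s| ≤ 8 * Real.pi * (2 * e + γ ^ 2 * (32 * Real.pi * e) ^ 2) := by
  have he : 0 ≤ e := (abs_nonneg _).trans hd
  have z : ∀ f : ℝ → ℝ, (∀ s, f (-s) = -f s) → f 0 = 0 := fun f hf => by
    have := hf 0
    rw [neg_zero] at this
    linarith
  have hχ : ∀ s, |χ s| ≤ 32 * Real.pi * e := by
    refine hp.periodic_χ.abs_le_of_Ico fun s hs => ?_
    have h1 := abs_le_of_abs_deriv_le (C := (4 * m) ^ 2 * e)
      (hp.toIsProfile.hasDerivAt_flux hr) (fun s => by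
        rw [abs_mul, abs_of_nonneg (sq_nonneg (r s))]
        exact mul_le_mul (pow_le_pow_left₀ (hm.le.trans (hrm s)) (hrM s) 2) (hE s) (abs_nonneg _)
          (by positivity)) (by simp [z χ hp.odd_χ]) hs
    rw [abs_mul, abs_of_nonneg (sq_nonneg (r s))] at h1
    have h2 : m ^ 2 * |χ s| ≤ r s ^ 2 * |χ s| :=
      mul_le_mul_of_nonneg_right (pow_le_pow_left₀ hm.le (hrm s) 2) (abs_nonneg _)
    have h3 : m ^ 2 * |χ s| ≤ m ^ 2 * (32 * Real.pi * e) := by linarith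
    exact le_of_mul_le_mul_left h3 (by positivity)
  refine ⟨hχ s, hp.periodic_y.abs_le_of_Ico (fun s hs => ?_) s⟩
  have h1 := abs_le_of_abs_deriv_le (f := fun s => r s * y s)
    (f' := fun s => r s * (d - E s + γ ^ 2 * χ s ^ 2))
    (C := 4 * m * (2 * e + γ ^ 2 * (32 * Real.pi * e) ^ 2))
    (fun s => ((hr s).mul (hp.deriv_y s)).congr_deriv (by ring)) (fun s => by
      rw [abs_mul, abs_of_nonneg (hm.le.trans (hrm s))]
      refine mul_le_mul (hrM s) ?_ (abs_nonneg _) (by positivity)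
      have k1 : |γ ^ 2 * χ s ^ 2| ≤ γ ^ 2 * (32 * Real.pi * e) ^ 2 := by
        rw [abs_mul, abs_of_nonneg (sq_nonneg γ), abs_pow]
        exact mul_le_mul_of_nonneg_left (pow_le_pow_left₀ (abs_nonneg _) (hχ s) 2) (sq_nonneg γ)
      have k2 := abs_add_le (d - E s) (γ ^ 2 * χ s ^ 2)
      have k3 := abs_sub d (E s)
      linarith [hE s]) (by simp [z y hp.odd_y]) hs
  simp only [abs_mul, abs_of_nonneg (hm.le.trans (hrm s))] at h1
  have h2 : m * |y s| ≤ r s * |y s| := mul_le_mul_of_nonneg_right (hrm s) (abs_nonneg _)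
  refine le_of_mul_le_mul_left ?_ hm
  linarith

end

theorem IsNearHOS.abs_sub_lt {μ η : ℝ} {R φ : ℝ → ℝ} (hn : IsNearHOS μ η R φ)
    (hR : ∀ x, 0 < R x) (x : ℝ) : |R x - Real.sqrt μ| < η := by
  obtain ⟨c, hc⟩ := hn
  have h1 := (abs_norm_sub_norm_le (stationaryField 0 R φ x 0)
    ((Real.sqrt μ : ℂ) * Complex.exp (Complex.I * (c : ℂ)))).trans_lt (hc x)
  have e : ∀ t : ℝ, ‖Complex.exp (Complex.I * (t : ℂ))‖ = 1 := fun t => by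
    rw [mul_comm, Complex.norm_exp_ofReal_mul_I]
  rw [stationaryField, norm_mul, norm_mul, e, e, Complex.norm_real, Complex.norm_real,
    Real.norm_eq_abs, Real.norm_eq_abs, abs_of_pos (hR x), abs_of_nonneg (Real.sqrt_nonneg _),
    mul_one, mul_one] at h1
  exact h1

/-- Symmetric stationary solutions near the homogeneous state have small profile variables. -/
theorem exists_small_profile {μ α β : ℝ} (hμ : 0 < μ) (hBF : 1 + α * β < 0) {τ : ℝ}
    (hτ : 0 < τ) : ∃ η ϱ : ℝ, 0 < η ∧ 0 < ϱ ∧ ∀ (L ω : ℝ) (R φ : ℝ → ℝ), 0 < L →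
      |(2 * Real.pi / L) ^ 2 - 2 * bfParam α β * μ| ≤ ϱ →
      IsEvenStationarySolution μ α β L ω R φ → IsNearHOS μ η R φ →
      (∀ s, |solY (2 * Real.pi / L) R s| ≤ τ) ∧
      (∀ s, |solχ (phaseRatio α β) (2 * Real.pi / L) φ s| ≤ τ) ∧
      (∀ s, |solE (bfParam α β) (refIntensity μ α β ω) (2 * Real.pi / L) R s| ≤ τ) ∧
      |2 * bfParam α β * refIntensity μ α β ω / (2 * Real.pi / L) ^ 2 - 1| ≤ τ := by
  have hh := bfParam_pos hBF
  set h := bfParam α β with hhd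
  set γ := phaseRatio α β with hγd
  have hπ := Real.pi_pos
  set m := Real.sqrt μ with hmd
  have hm : 0 < m := Real.sqrt_pos.mpr hμ
  have hm2 : m ^ 2 = μ := Real.sq_sqrt hμ.le
  -- N adds up the constants in the bounds for E, χ and y, the quadratic term being linearized by
  -- 32πe ≤ 1. With e = min(1, τ)/N all three are at most τ.
  set N := 1 + 48 * Real.pi + 8 * Real.pi * γ ^ 2 * (32 * Real.pi) with hN
  have hN1 : 1 ≤ N := by rw [hN]; nlinarith [mul_nonneg (mul_nonneg hπ.le hπ.le) (sq_nonneg γ)]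
  set e := min 1 τ / N with hed
  have hmin : 0 < min 1 τ := lt_min one_pos hτ
  have he : 0 < e := by positivity
  have hNe : N * e = min 1 τ := by rw [hed]; field_simp
  have hg2 : 0 ≤ 8 * Real.pi * γ ^ 2 * (32 * Real.pi) * e := by positivity
  have hpe : 0 ≤ Real.pi * e := by positivity
  have hNe' : e + 48 * (Real.pi * e) + 8 * Real.pi * γ ^ 2 * (32 * Real.pi) * e = min 1 τ := by
    rw [← hNe, hN]; ring
  have heτ : e ≤ τ := by linarith [min_le_right 1 τ]
  have h32 : 32 * Real.pi * e ≤ 1 := by linarith [min_le_left 1 τ]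
  have h32τ : 32 * Real.pi * e ≤ τ := by linarith [min_le_right 1 τ]
  have hyτ : 8 * Real.pi * (2 * e + γ ^ 2 * (32 * Real.pi * e) ^ 2) ≤ τ := by
    have h1 : (32 * Real.pi * e) ^ 2 ≤ 32 * Real.pi * e := by
      rw [sq]
      exact mul_le_of_le_one_left (by positivity) h32
    have h2 : 8 * Real.pi * (γ ^ 2 * (32 * Real.pi * e) ^ 2)
        ≤ 8 * Real.pi * (γ ^ 2 * (32 * Real.pi * e)) := by gcongr
    nlinarith [min_le_right 1 τ]
  -- Tolerance for |R² − μ|: small enough for |E| and |d| to be at most e and |Λ − 1| at most τ once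
  -- Ω² ≥ hμ.
  set D := e * (h * μ) / (2 * (2 * h + 1)) with hD
  have hDpos : 0 < D := by positivity
  have hDe : 2 * (2 * h + 1) * D = e * (h * μ) := by rw [hD]; field_simp
  refine ⟨min (m / 2) (D / (3 * m)), min (h * μ) (e * (h * μ) / 2), by positivity, by positivity, ?_⟩
  intro L ω R φ hL hΩL hs hn
  set Ω := 2 * Real.pi / L with hΩd
  set c₀ := refIntensity μ α β ω with hc₀
  have hΩ : 0 < Ω := by positivity
  have hR := hn.abs_sub_lt hs.amplitude_pos
  have hR1 : ∀ x, m / 2 ≤ R x ∧ R x ≤ 4 * (m / 2) := fun x => by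
    have := abs_lt.mp ((hR x).trans_le (min_le_left _ _))
    constructor <;> linarith
  have hR2 : ∀ x, |R x ^ 2 - μ| ≤ D := fun x => by
    have h1 := (hR x).le.trans (min_le_right _ _)
    have h2 : R x ^ 2 - μ = (R x - m) * (R x + m) := by rw [← hm2]; ring
    have h3 : |R x + m| ≤ 3 * m := by
      rw [abs_of_pos (by linarith [(hR1 x).1])]
      linarith [(hR1 x).2]
    rw [h2, abs_mul]
    refine (mul_le_mul h1 h3 (abs_nonneg _) (by positivity)).trans (le_of_eq ?_)
    field_simp
  have hprof := hs.isEvenProfile hBF hL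
  rw [← hhd, ← hγd, ← hΩd, ← hc₀] at hprof
  have hper : ∀ s, (s + 2 * Real.pi) / Ω = s / Ω + L := by
    intro s
    rw [hΩd]
    field_simp
  have hr : ∀ s, HasDerivAt (fun s => R (s / Ω)) (solY Ω R s * R (s / Ω)) s := fun s => by
    have hR0 := hs.amplitude_pos (s / Ω)
    refine (hasDerivAt_comp_div
      (hasDerivAt_of_contDiff_two hs.contDiff_amplitude (s / Ω)).1).congr_deriv ?_
    rw [solY]
    field_simp
  have hrp : Function.Periodic (fun s => R (s / Ω)) (2 * Real.pi) := fun s => by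
    simp only [hper, hs.periodic_amplitude (s / Ω)]
  obtain ⟨⟨s₁, hs₁⟩, s₂, hs₂⟩ := hprof.exists_sign hr hrp fun s => hs.amplitude_pos _
  have hΩ2 : 0 < Ω ^ 2 := by positivity
  have hsign : ∀ s, solE h c₀ Ω R s * Ω ^ 2 = h * (R (s / Ω) ^ 2 - c₀) := fun s => by
    rw [solE]
    field_simp
  -- The sign change of E places c₀ between two values of R². This is how closeness of the profile
  -- alone controls the frequency.
  have hcD : |c₀ - μ| ≤ D := by
    have k1 : h * (R (s₁ / Ω) ^ 2 - c₀) ≤ 0 := by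
      rw [← hsign]
      exact mul_nonpos_of_nonpos_of_nonneg hs₁ hΩ2.le
    have k2 : 0 ≤ h * (R (s₂ / Ω) ^ 2 - c₀) := by
      rw [← hsign]
      exact mul_nonneg hs₂ hΩ2.le
    have k1' : R (s₁ / Ω) ^ 2 - c₀ ≤ 0 := by
      by_contra hcon
      push Not at hcon
      linarith [mul_pos hh hcon]
    have k2' := nonneg_of_mul_nonneg_right k2 hh
    have j1 := abs_le.mp (hR2 (s₁ / Ω))
    have j2 := abs_le.mp (hR2 (s₂ / Ω))
    rw [abs_le]
    constructor <;> linarith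
  have hΩlow : h * μ ≤ Ω ^ 2 := by
    have := (abs_le.mp (hΩL.trans (min_le_left _ _))).1
    linarith
  have hΩϱ := hΩL.trans (min_le_right _ _)
  have heΩ : e * (h * μ) ≤ e * Ω ^ 2 := mul_le_mul_of_nonneg_left hΩlow he.le
  have hhD : 0 < h * D := by positivity
  have hE : ∀ s, |solE h c₀ Ω R s| ≤ e := fun s => by
    have k : |solE h c₀ Ω R s| * Ω ^ 2 ≤ e * Ω ^ 2 := by
      rw [← abs_of_pos hΩ2, ← abs_mul, abs_of_pos hΩ2, hsign, abs_mul, abs_of_pos hh]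
      have k1 : |R (s / Ω) ^ 2 - c₀| ≤ 2 * D := by
        have := abs_sub (R (s / Ω) ^ 2 - μ) (c₀ - μ)
        rw [sub_sub_sub_cancel_right] at this
        linarith [hR2 (s / Ω)]
      have := mul_le_mul_of_nonneg_left k1 hh.le
      linarith
    exact le_of_mul_le_mul_right k hΩ2
  have hd : |(c₀ - μ) / Ω ^ 2| ≤ e := by
    rw [abs_div, abs_of_pos hΩ2, div_le_iff₀ hΩ2]
    linarith
  have hb := fun s => hprof.abs_le hr (by positivity : 0 < m / 2) (fun s => (hR1 _).1)
    (fun s => (hR1 _).2) hE hd s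
  refine ⟨fun s => (hb s).2.trans hyτ, fun s => (hb s).1.trans h32τ,
    fun s => (hE s).trans heτ, ?_⟩
  have e1 : 2 * h * c₀ / Ω ^ 2 - 1 = (2 * h * (c₀ - μ) - (Ω ^ 2 - 2 * h * μ)) / Ω ^ 2 := by
    field_simp
    ring
  rw [e1, abs_div, abs_of_pos hΩ2, div_le_iff₀ hΩ2]
  have k1 := abs_sub (2 * h * (c₀ - μ)) (Ω ^ 2 - 2 * h * μ)
  rw [abs_mul, abs_of_pos (by positivity : 0 < 2 * h)] at k1
  have k2 := mul_le_mul_of_nonneg_left hcD hh.le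
  have k3 : e * Ω ^ 2 ≤ τ * Ω ^ 2 := mul_le_mul_of_nonneg_right heτ hΩ2.le
  linarith

/-! ### Half-period translation and uniqueness of the branch -/

open PerFun

namespace PerFun

/-- Translation by half a period. -/
def shift : PerFun →ₐ[ℝ] PerFun :=
  ContinuousMap.compRightAlgHom ℝ ℝ ⟨fun x : AddCircle (2 * Real.pi) => x + (Real.pi : ℝ),
    continuous_id.add continuous_const⟩

@[simp] theorem shift_coe (f : PerFun) (s : ℝ) :
    shift f (s : AddCircle (2 * Real.pi)) = f ((s + Real.pi : ℝ) : AddCircle (2 * Real.pi)) := rfl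

theorem shift_cosP : shift cosP = -cosP := by
  refine ext_coe fun s => ?_
  rw [shift_coe, ContinuousMap.neg_apply, cosP_coe, cosP_coe, Real.cos_add_pi]

theorem shift_sinP : shift sinP = -sinP := by
  refine ext_coe fun s => ?_
  rw [shift_coe, ContinuousMap.neg_apply, sinP_coe, sinP_coe, Real.sin_add_pi]

theorem mean_shift (f : PerFun) : mean (shift f) = mean f := by
  rw [mean_apply, mean_apply]
  simp only [shift_coe]
  rw [intervalIntegral.integral_comp_add_right (fun t : ℝ => f (t : AddCircle (2 * Real.pi)))]
  have := (f.periodic_coe).intervalIntegral_add_eq Real.pi 0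
  rw [zero_add] at this
  rw [zero_add, add_comm (2 * Real.pi), this]

theorem norm_shift_le (f : PerFun) : ‖shift f‖ ≤ ‖f‖ := by
  refine norm_le_of_coe (norm_nonneg _) fun s _ => ?_
  rw [shift_coe]
  exact abs_coe_le f _

theorem reflect_shift (f : PerFun) : reflect (shift f) = shift (reflect f) := by
  refine ext_coe fun s => ?_
  rw [reflect_coe, shift_coe, shift_coe, reflect_coe]
  have := f.periodic_coe (-(s + Real.pi))
  rw [show -(s + Real.pi) + 2 * Real.pi = -s + Real.pi by ring] at this
  exact this

theorem IsDeriv.shift {Y G : PerFun} (h : IsDeriv Y G) : IsDeriv (shift Y) (shift G) := fun s => by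
  simp only [shift_coe]
  exact (h (s + Real.pi)).comp_add_const s Real.pi

end PerFun

theorem eq_add_const_of_hasDerivAt {f g f' : ℝ → ℝ} (hf : ∀ x, HasDerivAt f (f' x) x)
    (hg : ∀ x, HasDerivAt g (f' x) x) : ∃ p, f = fun x => g x + p := by
  refine ⟨f 0 - g 0, funext fun x => ?_⟩
  have h := is_const_of_deriv_eq_zero (f := fun x => f x - g x)
    (fun x => ((hf x).sub (hg x)).differentiableAt)
    (fun x => (((hf x).sub (hg x)).congr_deriv (sub_self _)).deriv) x 0
  linarith

namespace BranchFamily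

section

variable {γ : ℝ} (b : BranchFamily γ)

/-- Conditions under which the member of amplitude `a` is unique. -/
structure Isolated (τ a : ℝ) : Prop where
  good : b.Good a
  norm_y : ‖b.y a‖ ≤ τ
  norm_χ : ‖b.χ a‖ ≤ τ
  norm_E : ‖b.E a‖ ≤ τ
  norm_yh : |a| * ‖b.yh a‖ ≤ 1 / 4
  abs_Lam : |b.Lam a - 1| ≤ τ

theorem eventually_isolated (hg : ∀ᶠ a in 𝓝 (0 : ℝ), b.Good a) {τ : ℝ} (hτ : 0 < τ) :
    ∀ᶠ a in 𝓝 (0 : ℝ), b.Isolated τ a := by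
  have hE := b.contDiff_E.continuousAt
  have hL := b.contDiff_Lam.continuousAt
  have hy := b.contDiff_y.continuousAt
  have hχ := b.contDiff_χ.continuousAt
  have hyh := b.contDiff_yh.continuousAt
  have e1 : ContinuousAt (fun a => ‖b.y a‖) 0 := by fun_prop
  have e2 : ContinuousAt (fun a => ‖b.χ a‖) 0 := by fun_prop
  have e3 : ContinuousAt (fun a => ‖b.E a‖) 0 := by fun_prop
  have e4 : ContinuousAt (fun a => |a| * ‖b.yh a‖) 0 := by fun_prop
  have e5 : ContinuousAt (fun a => |b.Lam a - 1|) 0 := by fun_prop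
  have z1 : ‖b.y 0‖ < τ := by simpa [y] using hτ
  have z2 : ‖b.χ 0‖ < τ := by simpa [χ] using hτ
  have z3 : ‖b.E 0‖ < τ := by simpa [E] using hτ
  have z4 : |(0 : ℝ)| * ‖b.yh 0‖ < 1 / 4 := by simp
  have z5 : |b.Lam 0 - 1| < τ := by simpa [Lam] using hτ
  filter_upwards [hg, e1.eventually (gt_mem_nhds z1), e2.eventually (gt_mem_nhds z2),
    e3.eventually (gt_mem_nhds z3), e4.eventually (gt_mem_nhds z4),
    e5.eventually (gt_mem_nhds z5)] with a h0 h1 h2 h3 h4 h5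
  exact ⟨h0, h1.le, h2.le, h3.le, h4.le, h5.le⟩

variable {b}

/-- Translation by π changes the sign of cos and sin, so the shifted member has amplitude −a; local
uniqueness identifies it. Recovering Λ needs a ≠ 0. -/
theorem Isolated.shift_eq {τ a : ℝ} (hτ : 10000 * (1 + γ ^ 2) * τ ≤ 1) (h₁ : b.Isolated τ a)
    (h₂ : b.Isolated τ (-a)) (ha : a ≠ 0) :
    shift (b.χ a) = b.χ (-a) ∧ shift (b.E a) = b.E (-a) ∧ b.d a = b.d (-a) ∧
      b.Lam a = b.Lam (-a) := by
  have hg := h₁.good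
  have hn : mean (cosP * shift (b.E a) - sinP * shift (b.y a)) = -a := by
    have e : cosP * shift (b.E a) - sinP * shift (b.y a)
        = -shift (cosP * b.E a - sinP * b.y a) := by
      rw [map_sub, map_mul, map_mul, shift_cosP, shift_sinP]
      ring
    rw [e, map_neg, mean_shift, hg.normalized]
  obtain ⟨-, hχ, hE, hd, hL⟩ := b.eq_of_small (d := b.d a) (Λ := b.Lam a) h₂.good hτ
    (IsDeriv.congr (IsDeriv.shift (G := b.d a • (1 : PerFun) - b.E a - b.y a ^ 2
      + γ ^ 2 • b.χ a ^ 2) hg.deriv_y) (by simp only [map_add, map_sub, map_smul, map_pow, map_one]))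
    (IsDeriv.congr (IsDeriv.shift (G := b.E a - 2 * (b.y a * b.χ a)) hg.deriv_χ)
      (by simp only [map_sub, map_mul, map_ofNat]))
    (IsDeriv.congr (IsDeriv.shift (G := b.Lam a • b.y a + 2 * (b.y a * b.E a)) hg.deriv_E)
      (by simp only [map_add, map_smul, map_mul, map_ofNat]))
    (by rw [reflect_shift, hg.reflect_y, map_neg]) (by rw [reflect_shift, hg.reflect_χ, map_neg])
    (by rw [reflect_shift, hg.reflect_E]) hn h₁.abs_Lam ((norm_shift_le _).trans h₁.norm_y)
    h₂.norm_y ((norm_shift_le _).trans h₁.norm_χ) h₂.norm_χ ((norm_shift_le _).trans h₁.norm_E)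
    h₂.norm_E h₂.norm_yh
  exact ⟨hχ, hE, hd, hL.resolve_left (neg_ne_zero.mpr ha)⟩

end

variable {α β : ℝ} {b : BranchFamily (phaseRatio α β)} {μ a : ℝ}

theorem Sound.hasDerivAt_phase (hs : b.Sound a) (x : ℝ) :
    HasDerivAt (b.phase μ a)
      (b.wavenumber μ a * phaseRatio α β * (b.χ a).fn (b.wavenumber μ a * x)) x :=
  hasDerivAt_profilePhase hs.good.isEvenProfile.toIsProfile x

/-- The members of amplitude `a` and `-a` are translates of each other. -/
theorem Isolated.neg_eq {τ : ℝ} (hBF : 1 + α * β < 0) (hμ : 0 < μ)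
    (hτ : 10000 * (1 + phaseRatio α β ^ 2) * τ ≤ 1)
    (h₁ : b.Isolated τ a) (h₂ : b.Isolated τ (-a)) (hs : b.Sound a) (hs' : b.Sound (-a))
    (ha : a ≠ 0) :
    b.wavenumber μ (-a) = b.wavenumber μ a ∧ b.freq μ (-a) = b.freq μ a ∧
      b.amplitude μ (-a) = (fun x => b.amplitude μ a (x + 2 * Real.pi / b.wavenumber μ a / 2)) ∧
      ∃ p, b.phase μ (-a)
        = fun x => b.phase μ a (x + 2 * Real.pi / b.wavenumber μ a / 2) + p := by
  obtain ⟨hχ, hE, hd, hL⟩ := h₁.shift_eq hτ h₂ ha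
  have hw : b.wavenumber μ (-a) = b.wavenumber μ a := by
    rw [wavenumber, wavenumber, lam, lam, ← b.Lam_sub, ← b.Lam_sub, hd, hL]
  have hΩ := hs.wavenumber_pos hBF hμ
  have hx : ∀ x, b.wavenumber μ a * (x + 2 * Real.pi / b.wavenumber μ a / 2)
      = b.wavenumber μ a * x + Real.pi := fun x => by
    field_simp
  refine ⟨hw, by rw [freq, freq, hw, hL], funext fun x => ?_, ?_⟩
  · simp only [amplitude, profileR, hw, hx, ← hL, ← hE, fn, shift_coe]
  · refine eq_add_const_of_hasDerivAt hs'.hasDerivAt_phase fun x => ?_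
    refine ((hs.hasDerivAt_phase (μ := μ) (x + _)).comp_add_const x _).congr_deriv ?_
    rw [hw, hx, ← hχ, fn, fn, shift_coe]

/-- Symmetric stationary solutions near the homogeneous state lie on the branch. -/
theorem exists_uniqueness (hg : ∀ᶠ a in 𝓝 (0 : ℝ), b.Good a) (hBF : 1 + α * β < 0) (hμ : 0 < μ)
    {P : ℝ → Prop} (hP : ∀ᶠ a in 𝓝 (0 : ℝ), P a) :
    ∃ η ϱ : ℝ, 0 < η ∧ 0 < ϱ ∧ ∀ (L ω : ℝ) (R φ : ℝ → ℝ), 0 < L →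
      |(2 * Real.pi / L) ^ 2 - 2 * bfParam α β * μ| ≤ ϱ →
      IsEvenStationarySolution μ α β L ω R φ → IsNearHOS μ η R φ →
      IsHOS μ β ω R φ ∨ ∃ a, a ≠ 0 ∧ P a ∧ 2 * Real.pi / L = b.wavenumber μ a ∧
        ω = b.freq μ a ∧ R = b.amplitude μ a ∧ ∃ p, φ = fun x => b.phase μ a x + p := by
  have hh := bfParam_pos hBF
  have hγ0 := phaseRatio_ne_zero hBF
  have hβα := beta_sub_alpha_ne_zero hBF
  obtain ⟨τ, hτd⟩ : ∃ τ, τ = 1 / (10000 * (1 + phaseRatio α β ^ 2)) := ⟨_, rfl⟩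
  have hτ0 : 0 < τ := by rw [hτd]; positivity
  have hτ1 : 10000 * (1 + phaseRatio α β ^ 2) * τ ≤ 1 := by
    rw [hτd]
    exact le_of_eq (by field_simp)
  obtain ⟨r, hr, hball⟩ := Metric.eventually_nhds_iff.mp
    ((b.eventually_isolated hg hτ0).and ((b.eventually_sound hg).and hP))
  obtain ⟨η, ϱ, hη, hϱ, hsmall⟩ := exists_small_profile hμ hBF (τ := min τ (r / 3)) (by positivity)
  refine ⟨η, ϱ, hη, hϱ, fun L ω R φ hL hΩL hs hn => ?_⟩
  obtain ⟨by₁, bχ₁, bE₁, hΛ⟩ := hsmall L ω R φ hL hΩL hs hn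
  have hprof := hs.isEvenProfile hBF hL
  obtain ⟨Ω, hΩd⟩ : ∃ Ω, Ω = 2 * Real.pi / L := ⟨_, rfl⟩
  obtain ⟨c₀, hc₀⟩ : ∃ c₀, c₀ = refIntensity μ α β ω := ⟨_, rfl⟩
  have hΩ : 0 < Ω := by rw [hΩd]; positivity
  rw [← hΩd, ← hc₀] at hprof
  rw [← hΩd] at by₁ bχ₁ bE₁ hΛ
  rw [← hc₀] at bE₁ hΛ
  have hω : ω = α * μ + (β - α) * c₀ := by
    rw [hc₀, refIntensity]
    field_simp
    ring
  have hcd := hprof.toIsProfile.contDiff 0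
  set y := ofPeriodic _ hcd.1.continuous hprof.periodic_y with hyd
  set χ := ofPeriodic _ hcd.2.1.continuous hprof.periodic_χ with hχd
  set E := ofPeriodic _ hcd.2.2.continuous hprof.periodic_E with hEd
  have ny : ‖y‖ ≤ min τ (r / 3) := norm_le_of_coe (by positivity) fun s _ => by₁ s
  have nχ : ‖χ‖ ≤ min τ (r / 3) := norm_le_of_coe (by positivity) fun s _ => bχ₁ s
  have nE : ‖E‖ ≤ min τ (r / 3) := norm_le_of_coe (by positivity) fun s _ => bE₁ s
  -- The amplitude of the given solution is read off by the normalization functional; it is at most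
  -- 2r/3 in modulus, hence within the range of the branch.
  obtain ⟨a, ha⟩ : ∃ a, mean (cosP * E - sinP * y) = a := ⟨_, rfl⟩
  have har : dist a 0 < r := by
    rw [Real.dist_eq, sub_zero, ← ha]
    have h1 := (abs_mean_le (cosP * E - sinP * y)).trans (norm_sub_le _ _)
    have := norm_cosP_mul_le E
    have := norm_sinP_mul_le y
    have := min_le_right τ (r / 3)
    linarith
  obtain ⟨hiso, hsnd, hPa⟩ := hball har
  obtain ⟨-, eχ, eE, ed, eL⟩ := b.eq_of_small (d := (c₀ - μ) / Ω ^ 2)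
    (Λ := 2 * bfParam α β * c₀ / Ω ^ 2) hiso.good hτ1 (y := y) (χ := χ) (E := E)
    (fun s => (hprof.deriv_y s).congr_deriv (by simp [hyd, hχd, hEd]))
    (fun s => (hprof.deriv_χ s).congr_deriv (by simp [hyd, hχd, hEd]))
    (fun s => (hprof.deriv_E s).congr_deriv (by simp [hyd, hEd]))
    (ext_coe fun s => hprof.odd_y s) (ext_coe fun s => hprof.odd_χ s)
    (ext_coe fun s => hprof.even_E s) ha (hΛ.trans (min_le_left _ _))
    (ny.trans (min_le_left _ _)) hiso.norm_y (nχ.trans (min_le_left _ _)) hiso.norm_χ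
    (nE.trans (min_le_left _ _)) hiso.norm_E hiso.norm_yh
  have hΩ2 : Ω ^ 2 ≠ 0 := by positivity
  have hx : ∀ x, Ω * x / Ω = x := fun x => by field_simp
  have fE : ∀ x, bfParam α β * (R x ^ 2 - c₀) = Ω ^ 2 * (b.E a).fn (Ω * x) := fun x => by
    have h1 : E ((Ω * x : ℝ) : AddCircle (2 * Real.pi)) = (b.E a).fn (Ω * x) := by rw [eE, fn]
    rw [← h1, hEd, ofPeriodic_coe, solE, hx]
    field_simp
  have fχ : ∀ x, deriv φ x = Ω * phaseRatio α β * (b.χ a).fn (Ω * x) := fun x => by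
    have h1 : χ ((Ω * x : ℝ) : AddCircle (2 * Real.pi)) = (b.χ a).fn (Ω * x) := by rw [eχ, fn]
    rw [← h1, hχd, ofPeriodic_coe, solχ, hx]
    field_simp
  have hφ : ∀ x, HasDerivAt φ (Ω * phaseRatio α β * (b.χ a).fn (Ω * x)) x := fun x => by
    rw [← fχ]
    exact (hasDerivAt_of_contDiff_two hs.contDiff_phase x).1
  have hcd' : c₀ - μ = Ω ^ 2 * b.d a := by
    rw [← ed]
    field_simp
  -- At amplitude zero Λ is not determined by uniqueness, but E = 0, χ = 0 and d = 0 already force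
  -- the HOS.
  by_cases ha0 : a = 0
  · left
    subst ha0
    have hc : c₀ = μ := by
      have h0 : b.d 0 = 0 := by simp [d]
      rw [h0] at hcd'
      linarith
    refine ⟨by rw [hω, hc, hosFreq]; ring, funext fun x => ?_, ?_⟩
    · have h1 := fE x
      have h0 : (b.E 0).fn (Ω * x) = 0 := by simp [BranchFamily.E, fn]
      rw [h0, mul_zero, hc] at h1
      have h2 := (mul_eq_zero.mp h1).resolve_left hh.ne'
      rw [hosR, ← Real.sqrt_sq (hs.amplitude_pos x).le, sub_eq_zero.mp h2]
    · refine eq_add_const_of_hasDerivAt hφ fun x => (hasDerivAt_const x (0 : ℝ)).congr_deriv ?_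
      simp [BranchFamily.χ, fn]
  · right
    have eL := eL.resolve_left ha0
    have hL' : 2 * bfParam α β * c₀ = Ω ^ 2 * b.Lam a := by
      rw [← eL]
      field_simp
    have hlam : Ω ^ 2 = b.lam (bfParam α β) (2 * bfParam α β * μ) a := by
      rw [lam, eq_div_iff hsnd.pos.ne', ← b.Lam_sub]
      linear_combination 2 * bfParam α β * hcd' - hL'
    have hw : Ω = b.wavenumber μ a := by
      rw [wavenumber, ← hlam, Real.sqrt_sq hΩ.le]
    refine ⟨a, ha0, hPa, by rw [← hw, hΩd], ?_, funext fun x => ?_, ?_⟩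
    · rw [hω, freq, ← hw]
      congr 2
      rw [eq_div_iff (by positivity)]
      linarith
    · rw [amplitude, profileR, ← hw, ← Real.sqrt_sq (hs.amplitude_pos x).le]
      congr 1
      rw [eq_div_iff (by positivity)]
      linear_combination 2 * fE x + hL'
    · refine eq_add_const_of_hasDerivAt hφ fun x => ?_
      rw [hw]
      exact hsnd.hasDerivAt_phase x

end BranchFamily

/-! ### Leading-order expansion of the branch -/

open PerFun

theorem ContinuousAt.exists_eventually_abs_le {f : ℝ → ℝ} {x : ℝ} (hf : ContinuousAt f x) :
    ∃ K > 0, ∀ᶠ a in 𝓝 x, |f a| ≤ K :=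
  ⟨|f x| + 1, by positivity, (hf.abs.eventually (gt_mem_nhds (lt_add_one _))).mono
    fun _ h => h.le⟩

/-- Local inversion of `a ↦ a² k(a)` on the positive half line. -/
theorem exists_sq_inverse {k : ℝ → ℝ} (hk : ContDiffAt ℝ 1 k 0) (h0 : 0 < k 0) :
    ∃ A : ℝ → ℝ, Tendsto A (𝓝[>] 0) (𝓝 0) ∧
      (∀ᶠ t in 𝓝[>] (0 : ℝ), 0 < A t ∧ A t ^ 2 * k (A t) = t) ∧
      ∀ᶠ a in 𝓝 (0 : ℝ), 0 < a → A (a ^ 2 * k a) = a := by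
  -- The square root of a²k(a) for a > 0; unlike a²k(a) it has nonzero derivative √k(0) at 0, so the
  -- inverse function theorem applies, and t is replaced by √t.
  set f : ℝ → ℝ := fun a => a * Real.sqrt (k a) with hf
  have hs0 : Real.sqrt (k 0) ≠ 0 := (Real.sqrt_pos.mpr h0).ne'
  have hfc : ContDiffAt ℝ 1 f 0 := contDiffAt_id.mul (hk.sqrt h0.ne')
  have hfd : HasStrictDerivAt f (Real.sqrt (k 0)) 0 := by
    have h1 := hfc.hasStrictDerivAt (one_ne_zero)
    have h2 := (hasDerivAt_id (0 : ℝ)).mul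
      ((hk.sqrt h0.ne').differentiableAt one_ne_zero).hasDerivAt
    have h3 : deriv f 0 = Real.sqrt (k 0) := by
      refine h2.deriv.trans ?_
      simp
    rwa [h3] at h1
  set B := hfd.localInverse f _ 0 hs0 with hB
  have hf0 : f 0 = 0 := by simp [hf]
  have hBc : Tendsto B (𝓝 0) (𝓝 0) := by
    have h1 := (hfd.hasStrictFDerivAt_equiv hs0).localInverse_tendsto
    rwa [hf0] at h1
  have hr : ∀ᶠ u in 𝓝 (0 : ℝ), f (B u) = u := by
    have := (hfd.hasStrictFDerivAt_equiv hs0).eventually_right_inverse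
    rwa [hf0] at this
  have hl : ∀ᶠ a in 𝓝 (0 : ℝ), B (f a) = a :=
    (hfd.hasStrictFDerivAt_equiv hs0).eventually_left_inverse
  have hkp : ∀ᶠ a in 𝓝 (0 : ℝ), 0 < k a := hk.continuousAt.eventually (lt_mem_nhds h0)
  have hsq : Tendsto Real.sqrt (𝓝[>] 0) (𝓝 0) := by
    have := Real.continuous_sqrt.tendsto 0
    rw [Real.sqrt_zero] at this
    exact this.mono_left nhdsWithin_le_nhds
  refine ⟨fun t => B (Real.sqrt t), hBc.comp hsq, ?_, ?_⟩
  · filter_upwards [hsq.eventually hr, (hBc.comp hsq).eventually hkp, self_mem_nhdsWithin]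
      with t h1 h2 ht
    have ht : 0 < t := ht
    simp only [hf, Function.comp] at h1 h2 ⊢
    have hpos : 0 < B √t := by
      by_contra hcon
      push Not at hcon
      have := mul_nonpos_of_nonpos_of_nonneg hcon (Real.sqrt_nonneg (k (B √t)))
      rw [h1] at this
      linarith [Real.sqrt_pos.mpr ht]
    refine ⟨hpos, ?_⟩
    rw [← Real.sq_sqrt h2.le, ← mul_pow, h1, Real.sq_sqrt ht.le]
  · filter_upwards [hl, hkp] with a h1 h2 ha
    have : Real.sqrt (a ^ 2 * k a) = f a := by
      rw [Real.sqrt_mul (sq_nonneg a), Real.sqrt_sq ha.le]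
    rw [this, h1]

theorem norm_stationaryField_sub_le {μ : ℝ} (hμ : 0 < μ) (R φ : ℝ → ℝ) (x : ℝ) (hR : 0 < R x) :
    ‖stationaryField 0 R φ x 0 - (Real.sqrt μ : ℂ) * Complex.exp (Complex.I * ((0 : ℝ) : ℂ))‖
      ≤ |R x ^ 2 - μ| / Real.sqrt μ + Real.sqrt μ * |φ x| := by
  have hm := Real.sqrt_pos.mpr hμ
  set m := Real.sqrt μ with hmd
  have hm2 : m ^ 2 = μ := Real.sq_sqrt hμ.le
  have e : stationaryField 0 R φ x 0 - (m : ℂ) * Complex.exp (Complex.I * ((0 : ℝ) : ℂ))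
      = ((R x - m : ℝ) : ℂ) * Complex.exp (Complex.I * (φ x : ℂ))
        + (m : ℂ) * (Complex.exp (Complex.I * (φ x : ℂ)) - 1) := by
    simp [stationaryField]
    ring
  rw [e]
  refine (norm_add_le _ _).trans (add_le_add ?_ ?_)
  · rw [norm_mul, mul_comm Complex.I, Complex.norm_exp_ofReal_mul_I, mul_one, Complex.norm_real,
      Real.norm_eq_abs, le_div_iff₀ hm]
    have h1 : R x ^ 2 - μ = (R x - m) * (R x + m) := by rw [← hm2]; ring
    rw [h1, abs_mul, abs_of_pos (by linarith : 0 < R x + m)]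
    exact mul_le_mul_of_nonneg_left (by linarith) (abs_nonneg _)
  · rw [norm_mul, Complex.norm_real, Real.norm_eq_abs, abs_of_pos hm]
    exact mul_le_mul_of_nonneg_left (Real.norm_exp_I_mul_ofReal_sub_one_le) hm.le

namespace BranchFamily

variable {α β : ℝ} {b : BranchFamily (phaseRatio α β)} {μ a : ℝ}

theorem Sound.abs_phase_le (hs : b.Sound a) (hBF : 1 + α * β < 0) (hμ : 0 < μ) (x : ℝ) :
    |b.phase μ a x| ≤ |phaseRatio α β| * ‖b.χ a‖ * (2 * Real.pi) := by
  have hΩ := hs.wavenumber_pos hBF hμ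
  have hsol := hs.isEvenStationarySolution hBF hμ
  have hd : ∀ s, HasDerivAt (fun s => b.phase μ a (s / b.wavenumber μ a))
      (phaseRatio α β * (b.χ a).fn s) s := fun s => by
    refine (hasDerivAt_comp_div (hs.hasDerivAt_phase (s / b.wavenumber μ a))).congr_deriv ?_
    rw [mul_div_cancel₀ _ hΩ.ne']
    field_simp
  have hp : Function.Periodic (fun s => b.phase μ a (s / b.wavenumber μ a)) (2 * Real.pi) :=
    fun s => by
      simp only [add_div]
      exact hsol.periodic_phase _
  have h := hp.abs_le_of_Ico (fun s hs => abs_le_of_abs_deriv_le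
    (C := |phaseRatio α β| * ‖b.χ a‖) hd (fun s => by
      rw [abs_mul]
      exact mul_le_mul_of_nonneg_left ((b.χ a).abs_coe_le s) (abs_nonneg _))
    (by simp [phase, profilePhase]) hs) (b.wavenumber μ a * x)
  simp only [mul_div_cancel_left₀ x hΩ.ne'] at h
  exact h

/-- An exact remainder with factor a², so bounding its coefficients near a = 0 gives an estimate
uniform in x. The linear coefficient 2μ comes from λ/h at a = 0. -/
theorem Sound.amplitude_sq (hs : b.Sound a) (hBF : 1 + α * β < 0) (hμ : 0 < μ) (x : ℝ) :
    b.amplitude μ a x ^ 2 - (μ + 2 * μ * a * Real.cos (b.wavenumber μ a * x))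
      = μ * a ^ 2 * (b.ell a + 2 * (b.Eh a).fn (b.wavenumber μ a * x)
        - (1 + 2 * a * Real.cos (b.wavenumber μ a * x)) * b.waveCoeff (bfParam α β) a)
        / (1 + a ^ 2 * b.waveCoeff (bfParam α β) a) := by
  have hh := bfParam_pos hBF
  have hp := hs.pos
  rw [amplitude, profileR_sq hh hs.intensity_pos, hs.wavenumber_sq hBF hμ, lam]
  simp only [Lam, E, fn, ContinuousMap.add_apply, ContinuousMap.smul_apply, smul_eq_mul, cosP_coe]
  field_simp
  ring

/-- The coefficient of sin equals Ωγa(1 + a²k), by hγ(1 + α²) = β − α and the formula for Ω²; it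
differs from Ωγa only at order a³. -/
theorem Sound.deriv_phase_sub (hs : b.Sound a) (hBF : 1 + α * β < 0) (hμ : 0 < μ) (x : ℝ) :
    deriv (b.phase μ a) x - 2 * μ * (β - α) * a / (b.wavenumber μ a * (1 + α ^ 2))
        * Real.sin (b.wavenumber μ a * x)
      = b.wavenumber μ a * phaseRatio α β * a ^ 2 * ((b.xh a).fn (b.wavenumber μ a * x)
        - a * b.waveCoeff (bfParam α β) a * Real.sin (b.wavenumber μ a * x)) := by
  have hΩ := hs.wavenumber_pos hBF hμ
  have hsq := hs.wavenumber_sq hBF hμ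
  rw [lam, eq_div_iff hs.pos.ne'] at hsq
  have h1 : 2 * μ * (β - α) * a / (b.wavenumber μ a * (1 + α ^ 2))
      = b.wavenumber μ a * phaseRatio α β * a * (1 + a ^ 2 * b.waveCoeff (bfParam α β) a) := by
    rw [div_eq_iff (by positivity), ← bfParam_mul_phaseRatio hBF]
    linear_combination -(phaseRatio α β * a * (1 + α ^ 2)) * hsq
  rw [(hs.hasDerivAt_phase x).deriv, h1]
  simp only [χ, fn, ContinuousMap.add_apply, ContinuousMap.smul_apply, smul_eq_mul, sinP_coe]
  ring

variable (b)

theorem continuousAt_lam (h q₀ : ℝ) : ContinuousAt (b.lam h q₀) 0 := by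
  have hk := (b.contDiff_waveCoeff h).continuousAt
  unfold lam
  exact ContinuousAt.div (by fun_prop) (by fun_prop) (by simp)

theorem continuousAt_wavenumber (μ : ℝ) : ContinuousAt (b.wavenumber μ) 0 :=
  (b.continuousAt_lam _ _).sqrt

theorem tendsto_freq (hBF : 1 + α * β < 0) (hμ : 0 < μ) :
    Tendsto (b.freq μ) (𝓝 0) (𝓝 (hosFreq μ β)) := by
  have hh := bfParam_pos hBF
  have hL := b.contDiff_Lam.continuousAt
  have hw := b.continuousAt_wavenumber μ
  have hc : ContinuousAt (b.freq μ) 0 := by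
    unfold freq
    fun_prop
  have h0 : b.freq μ 0 = hosFreq μ β := by
    have : b.wavenumber μ 0 ^ 2 = 2 * bfParam α β * μ := by
      have hl : b.lam (bfParam α β) (2 * bfParam α β * μ) 0 = 2 * bfParam α β * μ := by simp [lam]
      rw [wavenumber, hl, Real.sq_sqrt (by positivity)]
    rw [freq, this, hosFreq]
    simp only [Lam]
    field_simp
    ring
  rw [← h0]
  exact hc

/-- Leading-order form of the branch. -/
theorem exists_expansion (hg : ∀ᶠ a in 𝓝 (0 : ℝ), b.Good a) (hBF : 1 + α * β < 0) (hμ : 0 < μ) :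
    ∃ K > 0, ∀ᶠ a in 𝓝 (0 : ℝ),
      (∀ x, |b.amplitude μ a x ^ 2 - (μ + 2 * μ * a * Real.cos (b.wavenumber μ a * x))|
        ≤ K * a ^ 2) ∧
      ∀ x, |deriv (b.phase μ a) x - 2 * μ * (β - α) * a / (b.wavenumber μ a * (1 + α ^ 2))
        * Real.sin (b.wavenumber μ a * x)| ≤ K * a ^ 2 := by
  have hk := (b.contDiff_waveCoeff (bfParam α β)).continuousAt
  have hl := b.contDiff_ell.continuousAt
  have hE := b.contDiff_Eh.continuousAt
  have hx := b.contDiff_xh.continuousAt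
  have hw := b.continuousAt_wavenumber μ
  have c1 : ContinuousAt (fun a => μ * (|b.ell a| + 2 * ‖b.Eh a‖
      + (1 + 2 * |a|) * |b.waveCoeff (bfParam α β) a|)
        / (1 + a ^ 2 * b.waveCoeff (bfParam α β) a)) 0 :=
    ContinuousAt.div (by fun_prop) (by fun_prop) (by simp)
  have c2 : ContinuousAt (fun a => b.wavenumber μ a * |phaseRatio α β| * (‖b.xh a‖
      + |a| * |b.waveCoeff (bfParam α β) a|)) 0 := by fun_prop
  obtain ⟨K₁, hK₁, h₁⟩ := c1.exists_eventually_abs_le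
  obtain ⟨K₂, hK₂, h₂⟩ := c2.exists_eventually_abs_le
  refine ⟨max K₁ K₂, by positivity, ?_⟩
  filter_upwards [h₁, h₂, b.eventually_sound hg] with a h1 h2 hs
  have hΩ := hs.wavenumber_pos hBF hμ
  have h1 := (le_abs_self _).trans h1
  have h2 := (le_abs_self _).trans h2
  refine ⟨fun x => ?_, fun x => ?_⟩
  · rw [hs.amplitude_sq hBF hμ, abs_div, abs_of_pos hs.pos, abs_mul, abs_mul, abs_of_pos hμ,
      abs_of_nonneg (sq_nonneg a)]
    have e : |b.ell a + 2 * (b.Eh a).fn (b.wavenumber μ a * x)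
        - (1 + 2 * a * Real.cos (b.wavenumber μ a * x)) * b.waveCoeff (bfParam α β) a|
        ≤ |b.ell a| + 2 * ‖b.Eh a‖ + (1 + 2 * |a|) * |b.waveCoeff (bfParam α β) a| := by
      refine (abs_sub _ _).trans (add_le_add ((abs_add_le _ _).trans (add_le_add le_rfl ?_)) ?_)
      · rw [abs_mul, abs_two]
        exact mul_le_mul_of_nonneg_left ((b.Eh a).abs_coe_le _) two_pos.le
      · rw [abs_mul]
        refine mul_le_mul_of_nonneg_right ?_ (abs_nonneg _)
        refine (abs_add_le _ _).trans ?_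
        rw [abs_one, abs_mul, abs_mul, abs_two]
        have := mul_le_mul_of_nonneg_left (Real.abs_cos_le_one (b.wavenumber μ a * x))
          (by positivity : 0 ≤ 2 * |a|)
        linarith
    calc _ ≤ μ * a ^ 2 * (|b.ell a| + 2 * ‖b.Eh a‖
          + (1 + 2 * |a|) * |b.waveCoeff (bfParam α β) a|)
            / (1 + a ^ 2 * b.waveCoeff (bfParam α β) a) :=
          div_le_div_of_nonneg_right (mul_le_mul_of_nonneg_left e (by positivity)) hs.pos.le
      _ = μ * (|b.ell a| + 2 * ‖b.Eh a‖ + (1 + 2 * |a|) * |b.waveCoeff (bfParam α β) a|)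
            / (1 + a ^ 2 * b.waveCoeff (bfParam α β) a) * a ^ 2 := by ring
      _ ≤ K₁ * a ^ 2 := mul_le_mul_of_nonneg_right h1 (sq_nonneg a)
      _ ≤ _ := mul_le_mul_of_nonneg_right (le_max_left _ _) (sq_nonneg a)
  · rw [hs.deriv_phase_sub hBF hμ, abs_mul, abs_mul, abs_mul, abs_of_pos hΩ,
      abs_of_nonneg (sq_nonneg a)]
    have e : |(b.xh a).fn (b.wavenumber μ a * x)
        - a * b.waveCoeff (bfParam α β) a * Real.sin (b.wavenumber μ a * x)|
        ≤ ‖b.xh a‖ + |a| * |b.waveCoeff (bfParam α β) a| := by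
      refine (abs_sub _ _).trans (add_le_add ((b.xh a).abs_coe_le _) ?_)
      rw [abs_mul, abs_mul]
      exact mul_le_of_le_one_right (by positivity) (Real.abs_sin_le_one _)
    calc _ ≤ b.wavenumber μ a * |phaseRatio α β| * a ^ 2
            * (‖b.xh a‖ + |a| * |b.waveCoeff (bfParam α β) a|) :=
          mul_le_mul_of_nonneg_left e (by positivity)
      _ = b.wavenumber μ a * |phaseRatio α β|
            * (‖b.xh a‖ + |a| * |b.waveCoeff (bfParam α β) a|) * a ^ 2 := by ring
      _ ≤ K₂ * a ^ 2 := mul_le_mul_of_nonneg_right h2 (sq_nonneg a)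
      _ ≤ _ := mul_le_mul_of_nonneg_right (le_max_right _ _) (sq_nonneg a)

/-- At x = 0 and x = π/Ω the leading terms of R² differ by 4μa, more than twice the error Ka². -/
theorem eventually_isMAW (hg : ∀ᶠ a in 𝓝 (0 : ℝ), b.Good a) (hBF : 1 + α * β < 0) (hμ : 0 < μ) :
    ∀ᶠ a in 𝓝[≠] (0 : ℝ), IsMAW μ α β (2 * Real.pi / b.wavenumber μ a) (b.freq μ a)
      (b.amplitude μ a) (b.phase μ a) := by
  obtain ⟨K, hK, hexp⟩ := b.exists_expansion hg hBF hμ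
  have hsm : ∀ᶠ a in 𝓝 (0 : ℝ), K * |a| < 2 * μ := by
    have hc : ContinuousAt (fun a : ℝ => K * |a|) 0 := by fun_prop
    exact hc.eventually (gt_mem_nhds (by simpa using hμ))
  refine eventually_nhdsWithin_iff.mpr ?_
  filter_upwards [hexp, hsm, b.eventually_sound hg] with a h1 h2 hs ha
  have ha : a ≠ 0 := ha
  refine ⟨hs.isEvenStationarySolution hBF hμ, 0, Real.pi / b.wavenumber μ a, fun heq => ?_⟩
  have k1 := h1.1 0
  have k2 := h1.1 (Real.pi / b.wavenumber μ a)
  rw [mul_zero, Real.cos_zero] at k1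
  rw [mul_div_cancel₀ _ (hs.wavenumber_pos hBF hμ).ne', Real.cos_pi, ← heq] at k2
  have k3 := abs_sub (b.amplitude μ a 0 ^ 2 - (μ + 2 * μ * a * 1))
    (b.amplitude μ a 0 ^ 2 - (μ + 2 * μ * a * -1))
  have k4 : b.amplitude μ a 0 ^ 2 - (μ + 2 * μ * a * 1)
      - (b.amplitude μ a 0 ^ 2 - (μ + 2 * μ * a * -1)) = -(4 * μ * a) := by ring
  rw [k4, abs_neg, abs_mul, abs_of_pos (by positivity : 0 < 4 * μ)] at k3
  have hpos := abs_pos.mpr ha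
  have k5 : K * |a| * |a| < 2 * μ * |a| := mul_lt_mul_of_pos_right h2 hpos
  have k6 : K * |a| * |a| = K * a ^ 2 := by rw [mul_assoc, ← sq, sq_abs]
  linarith

theorem eventually_isNearHOS (hg : ∀ᶠ a in 𝓝 (0 : ℝ), b.Good a) (hBF : 1 + α * β < 0)
    (hμ : 0 < μ) {η : ℝ} (hη : 0 < η) :
    ∀ᶠ a in 𝓝 (0 : ℝ), IsNearHOS μ η (b.amplitude μ a) (b.phase μ a) := by
  obtain ⟨K, hK, hexp⟩ := b.exists_expansion hg hBF hμ
  have hm := Real.sqrt_pos.mpr hμ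
  have hsm : ∀ᶠ a in 𝓝 (0 : ℝ), (K * a ^ 2 + 2 * μ * |a|) / Real.sqrt μ
      + Real.sqrt μ * (|phaseRatio α β| * ‖b.χ a‖ * (2 * Real.pi)) < η := by
    have hχ := b.contDiff_χ.continuousAt
    have hc : ContinuousAt (fun a : ℝ => (K * a ^ 2 + 2 * μ * |a|) / Real.sqrt μ
      + Real.sqrt μ * (|phaseRatio α β| * ‖b.χ a‖ * (2 * Real.pi))) 0 := by fun_prop
    exact hc.eventually (gt_mem_nhds (by simpa [χ] using hη))
  filter_upwards [hexp, hsm, b.eventually_sound hg] with a h1 h2 hs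
  refine ⟨0, fun x => (norm_stationaryField_sub_le hμ _ _ x
    ((hs.isEvenStationarySolution hBF hμ).amplitude_pos x)).trans_lt (lt_of_le_of_lt ?_ h2)⟩
  refine add_le_add (div_le_div_of_nonneg_right ?_ hm.le)
    (mul_le_mul_of_nonneg_left (hs.abs_phase_le hBF hμ x) hm.le)
  have e : b.amplitude μ a x ^ 2 - μ
      = (b.amplitude μ a x ^ 2 - (μ + 2 * μ * a * Real.cos (b.wavenumber μ a * x)))
        + 2 * μ * a * Real.cos (b.wavenumber μ a * x) := by ring
  rw [e]
  refine (abs_add_le _ _).trans (add_le_add (h1.1 x) ?_)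
  rw [abs_mul, abs_mul, abs_of_pos (by positivity : 0 < 2 * μ)]
  exact mul_le_of_le_one_right (by positivity) (Real.abs_cos_le_one _)

end BranchFamily

/-! ### The critical length and parametrization by the box length -/

open PerFun

theorem criticalWavenumber_sq {μ α β : ℝ} (hμ : 0 < μ) (hBF : 1 + α * β < 0) :
    criticalWavenumber μ α β ^ 2 = 2 * bfParam α β * μ ∧ 0 < criticalWavenumber μ α β := by
  have hh := bfParam_pos hBF
  have e : -2 * μ * (1 + α * β) / (1 + α ^ 2) = 2 * bfParam α β * μ := by
    rw [bfParam]
    ring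
  rw [criticalWavenumber, e]
  exact ⟨Real.sq_sqrt (by positivity), Real.sqrt_pos.mpr (by positivity)⟩

theorem criticalLength_pos {μ α β : ℝ} (hμ : 0 < μ) (hBF : 1 + α * β < 0) :
    0 < criticalLength μ α β := by
  have := (criticalWavenumber_sq hμ hBF).2
  unfold criticalLength
  positivity

/-- The squared wavenumber in terms of the box length. -/
theorem two_pi_div_sq {μ α β L : ℝ} (hμ : 0 < μ) (hBF : 1 + α * β < 0) (hL : L ≠ 0) :
    (2 * Real.pi / L) ^ 2 * (L / criticalLength μ α β) ^ 2 = 2 * bfParam α β * μ := by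
  obtain ⟨h1, h2⟩ := criticalWavenumber_sq hμ hBF
  rw [← h1, criticalLength, ← mul_pow]
  field_simp

theorem lt_criticalLength_iff {μ α β L : ℝ} (hμ : 0 < μ) (hBF : 1 + α * β < 0) (hL : 0 < L) :
    L < criticalLength μ α β ↔ 2 * bfParam α β * μ < (2 * Real.pi / L) ^ 2 := by
  have h0 := criticalLength_pos hμ hBF
  have hΩ : 0 < (2 * Real.pi / L) ^ 2 := by positivity
  rw [← two_pi_div_sq hμ hBF hL.ne', mul_lt_iff_lt_one_right hΩ,
    sq_lt_one_iff₀ (by positivity), div_lt_one h0]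

theorem criticalLength_lt_iff {μ α β L : ℝ} (hμ : 0 < μ) (hBF : 1 + α * β < 0) (hL : 0 < L) :
    criticalLength μ α β < L ↔ (2 * Real.pi / L) ^ 2 < 2 * bfParam α β * μ := by
  have h0 := criticalLength_pos hμ hBF
  have hΩ : 0 < (2 * Real.pi / L) ^ 2 := by positivity
  rw [← two_pi_div_sq hμ hBF hL.ne', lt_mul_iff_one_lt_right hΩ,
    one_lt_sq_iff₀ (by positivity), one_lt_div h0]

namespace BranchFamily

variable {α β : ℝ} (b : BranchFamily (phaseRatio α β)) {μ : ℝ}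

theorem eventually_neg_eq (hg : ∀ᶠ a in 𝓝 (0 : ℝ), b.Good a) (hBF : 1 + α * β < 0)
    (hμ : 0 < μ) : ∀ᶠ a in 𝓝 (0 : ℝ), a ≠ 0 →
      b.wavenumber μ (-a) = b.wavenumber μ a ∧ b.freq μ (-a) = b.freq μ a ∧
      b.amplitude μ (-a) = (fun x => b.amplitude μ a (x + 2 * Real.pi / b.wavenumber μ a / 2)) ∧
      ∃ p, b.phase μ (-a)
        = fun x => b.phase μ a (x + 2 * Real.pi / b.wavenumber μ a / 2) + p := by
  have hτ : 0 < 1 / (10000 * (1 + phaseRatio α β ^ 2)) := by positivity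
  have h1 := (b.eventually_isolated hg hτ).and (b.eventually_sound hg)
  have hneg : Tendsto (fun a : ℝ => -a) (𝓝 0) (𝓝 0) := by
    simpa using (continuous_neg (G := ℝ)).tendsto 0
  filter_upwards [h1, hneg.eventually h1] with a h2 h3 ha
  exact h2.1.neg_eq hBF hμ (le_of_eq (by field_simp)) h3.1 h2.2 h3.2 ha

/-- Positive amplitudes on the branch are parametrized by the box length. -/
theorem exists_parametrization (hg : ∀ᶠ a in 𝓝 (0 : ℝ), b.Good a) (hBF : 1 + α * β < 0)
    (hμ : 0 < μ) : ∃ A : ℝ → ℝ, Tendsto A (𝓝[>] (criticalLength μ α β)) (𝓝 0) ∧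
      (∀ᶠ L in 𝓝[>] (criticalLength μ α β), 0 < A L ∧
        A L ^ 2 * b.waveCoeff (bfParam α β) (A L) = (L / criticalLength μ α β) ^ 2 - 1) ∧
      (∀ᶠ L in 𝓝[>] (criticalLength μ α β), b.wavenumber μ (A L) = 2 * Real.pi / L) ∧
      ∀ᶠ a in 𝓝 (0 : ℝ), 0 < a → ∀ L, 0 < L → 2 * Real.pi / L = b.wavenumber μ a →
        criticalLength μ α β < L ∧ a = A L := by
  have hh := bfParam_pos hBF
  have h0 := criticalLength_pos hμ hBF
  obtain ⟨B, hB0, hB1, hB2⟩ := exists_sq_inverse (b.contDiff_waveCoeff (bfParam α β))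
    (b.waveCoeff_zero_pos hh)
  have ht : Tendsto (fun L => (L / criticalLength μ α β) ^ 2 - 1) (𝓝[>] (criticalLength μ α β))
      (𝓝[>] 0) := by
    refine tendsto_nhdsWithin_iff.mpr ⟨?_, ?_⟩
    · have hc : ContinuousAt (fun L => (L / criticalLength μ α β) ^ 2 - 1)
          (criticalLength μ α β) := by fun_prop
      have := hc.tendsto
      rw [div_self h0.ne', one_pow, sub_self] at this
      exact this.mono_left nhdsWithin_le_nhds
    · filter_upwards [self_mem_nhdsWithin] with L hL
      have : 1 < L / criticalLength μ α β := (one_lt_div h0).mpr hL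
      exact sub_pos.mpr (one_lt_pow₀ this two_ne_zero)
  refine ⟨fun L => B ((L / criticalLength μ α β) ^ 2 - 1), hB0.comp ht, ht.eventually hB1, ?_, ?_⟩
  · filter_upwards [ht.eventually hB1, self_mem_nhdsWithin] with L hL1 hL
    have hL0 : 0 < L := h0.trans hL
    have h1 : 1 + (L / criticalLength μ α β) ^ 2 - 1 = (L / criticalLength μ α β) ^ 2 := by ring
    rw [wavenumber, lam, hL1.2, ← add_sub_assoc, h1, ← two_pi_div_sq hμ hBF hL0.ne',
      mul_div_cancel_right₀ _ (by positivity), Real.sqrt_sq (by positivity)]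
  · have hk : ∀ᶠ a in 𝓝 (0 : ℝ), 0 < b.waveCoeff (bfParam α β) a :=
      (b.contDiff_waveCoeff _).continuousAt.eventually (lt_mem_nhds (b.waveCoeff_zero_pos hh))
    filter_upwards [hB2, hk, b.eventually_sound hg] with a h1 h2 hs ha L hL hw
    have h3 := hs.wavenumber_sq hBF hμ
    rw [← hw, lam, eq_div_iff hs.pos.ne', ← two_pi_div_sq hμ hBF hL.ne'] at h3
    have h4 := mul_left_cancel₀ (by positivity) h3
    have h5 : (L / criticalLength μ α β) ^ 2 - 1 = a ^ 2 * b.waveCoeff (bfParam α β) a := by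
      linarith
    refine ⟨?_, ?_⟩
    · have h6 : 1 < (L / criticalLength μ α β) ^ 2 := by
        have : 0 < a ^ 2 * b.waveCoeff (bfParam α β) a := by positivity
        linarith
      rwa [one_lt_sq_iff₀ (by positivity), one_lt_div h0] at h6
    · simp only [h5]
      exact (h1 ha).symm

/-- The unstable eigenvalue of the homogeneous state, compared with the squared amplitude. -/
theorem tendsto_hosEigenvalue (hg : ∀ᶠ a in 𝓝 (0 : ℝ), b.Good a) (hBF : 1 + α * β < 0)
    (hμ : 0 < μ) :
    Tendsto (fun a => hosEigenvalue μ α (2 * bfParam α β * μ) (b.wavenumber μ a ^ 2)) (𝓝 0) (𝓝 0) ∧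
    Tendsto (fun a => hosEigenvalue μ α (2 * bfParam α β * μ) (b.wavenumber μ a ^ 2) / a ^ 2)
      (𝓝[≠] 0) (𝓝 ((1 + α ^ 2) * (2 * bfParam α β * μ) ^ 2 * b.waveCoeff (bfParam α β) 0
        / (2 * (2 * bfParam α β * μ + μ)))) := by
  have hh := bfParam_pos hBF
  obtain ⟨h, hhd⟩ : ∃ h, h = bfParam α β := ⟨_, rfl⟩
  rw [← hhd] at hh ⊢
  obtain ⟨q, hqd⟩ : ∃ q, q = 2 * h * μ := ⟨_, rfl⟩
  have hq : 0 < q := by rw [hqd]; positivity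
  rw [← hqd]
  have hk := (b.contDiff_waveCoeff h).continuousAt
  have hw := b.continuousAt_wavenumber μ
  have hw0 : b.wavenumber μ 0 ^ 2 = q := by
    have hl : b.lam (bfParam α β) (2 * bfParam α β * μ) 0 = q := by
      rw [hqd, hhd]
      simp [lam]
    rw [wavenumber, hl, Real.sq_sqrt hq.le]
  have hσc : ContinuousAt (fun a => hosEigenvalue μ α q (b.wavenumber μ a ^ 2)) 0 := by
    unfold hosEigenvalue
    fun_prop
  have hσ0 : hosEigenvalue μ α q (b.wavenumber μ 0 ^ 2) = 0 := by
    rw [hw0, hosEigenvalue, sub_self, mul_zero, mul_zero, add_zero, Real.sqrt_sq (by positivity)]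
    ring
  have h1 : Tendsto (fun a => hosEigenvalue μ α q (b.wavenumber μ a ^ 2)) (𝓝 0) (𝓝 0) := by
    have := hσc.tendsto
    rwa [hσ0] at this
  refine ⟨h1, ?_⟩
  -- The quadratic gives σ(σ + 2(λ + μ)) = (1 + α²)λ(q₀ − λ), and q₀ − λ = λa²k. So σ/a² equals this
  -- quotient, which is continuous at a = 0.
  have hc : ContinuousAt (fun a => (1 + α ^ 2) * (b.wavenumber μ a ^ 2) ^ 2 * b.waveCoeff h a
      / (hosEigenvalue μ α q (b.wavenumber μ a ^ 2) + 2 * (b.wavenumber μ a ^ 2 + μ))) 0 := by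
    refine ContinuousAt.div (by fun_prop) (by fun_prop) ?_
    rw [hσ0, hw0]
    positivity
  have ht := hc.tendsto
  rw [hσ0, hw0, zero_add] at ht
  refine (ht.mono_left nhdsWithin_le_nhds).congr' ?_
  have hkp : ∀ᶠ a in 𝓝 (0 : ℝ), 0 < b.waveCoeff h a :=
    hk.eventually (lt_mem_nhds (b.waveCoeff_zero_pos hh))
  filter_upwards [hkp.filter_mono nhdsWithin_le_nhds,
    (b.eventually_sound hg).filter_mono nhdsWithin_le_nhds, self_mem_nhdsWithin] with a ka hs ha
  have ha : a ≠ 0 := ha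
  have hsq := hs.wavenumber_sq hBF hμ
  have hΩ := hs.wavenumber_pos hBF hμ
  rw [lam, eq_div_iff hs.pos.ne', ← hhd, ← hqd] at hsq
  have hlt : b.wavenumber μ a ^ 2 < q := by
    have : 0 < b.wavenumber μ a ^ 2 * (a ^ 2 * b.waveCoeff h a) := by positivity
    linarith
  have hroot := hosEigenvalue_root (μ := μ) (α := α) (pow_pos hΩ 2) hlt
  have hpos := hosEigenvalue_pos (α := α) (pow_pos hΩ 2) hμ hlt
  rw [div_eq_div_iff (by positivity) (by positivity)]
  linear_combination -hroot + (1 + α ^ 2) * b.wavenumber μ a ^ 2 * hsq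

end BranchFamily

end

/-! ### The theorem -/

theorem mainTheorem3 (μ α β : ℝ) (hμ : 0 < μ) (hBF : 1 + α * β < 0) :
    ∃ (δ η c K C : ℝ) (ω ε σm σp : ℝ → ℝ) (R φ : ℝ → ℝ → ℝ),
      0 < δ ∧ 0 < η ∧ 0 < c ∧ 0 < C ∧
      -- for box sizes slightly above the critical one: the MAW, its stability, and the HOS
      (∀ L ∈ Set.Ioo (criticalLength μ α β) (criticalLength μ α β + δ),
        -- the MAW and its leading-order form
        IsMAW μ α β L (ω L) (R L) (φ L) ∧ IsNearHOS μ η (R L) (φ L) ∧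
        0 < ε L ∧
        (∀ x, |R L x ^ 2 - (μ + ε L / (β - α) * Real.cos (2 * Real.pi / L * x))|
          ≤ K * ε L ^ 2) ∧
        (∀ x, |deriv (φ L) x
            - ε L / (2 * Real.pi / L * (1 + α ^ 2)) * Real.sin (2 * Real.pi / L * x)|
          ≤ K * ε L ^ 2) ∧
        -- linear stability of the MAW, with its critical eigenvalue
        IsLinearlyStable μ α β L (ω L) (R L) (φ L) ∧
        σm L < 0 ∧ IsCriticalEigenvalue μ α β L (ω L) (R L) (φ L) c (σm L) ∧
        -- instability of the HOS, with its unstable eigenvalue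
        0 < σp L ∧ IsCriticalEigenvalue μ α β L (hosFreq μ β) (hosR μ) hosPhase c (σp L) ∧
        -- near the HOS there are three branches of symmetric stationary solutions:
        -- the HOS, the MAW, and the MAW shifted by half a period
        (∀ (ω' : ℝ) (R' φ' : ℝ → ℝ), IsEvenStationarySolution μ α β L ω' R' φ' →
          IsNearHOS μ η R' φ' →
          IsHOS μ β ω' R' φ' ∨
          (ω' = ω L ∧ R' = R L ∧ ∃ p : ℝ, φ' = fun x => φ L x + p) ∨
          (ω' = ω L ∧ R' = (fun x => R L (x + L / 2)) ∧
            ∃ p : ℝ, φ' = fun x => φ L (x + L / 2) + p))) ∧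
      -- below the critical size the HOS is linearly stable
      (∀ L ∈ Set.Ioo 0 (criticalLength μ α β),
        IsLinearlyStable μ α β L (hosFreq μ β) (hosR μ) hosPhase) ∧
      -- up to and including the critical size there is no MAW near the HOS
      (∀ L ∈ Set.Ioc (criticalLength μ α β - δ) (criticalLength μ α β),
        ∀ (ω' : ℝ) (R' φ' : ℝ → ℝ), IsEvenStationarySolution μ α β L ω' R' φ' →
          IsNearHOS μ η R' φ' → IsHOS μ β ω' R' φ') ∧
      -- behaviour at the bifurcation
      Tendsto ω (𝓝[>] (criticalLength μ α β)) (𝓝 (hosFreq μ β)) ∧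
      Tendsto (fun L => ε L ^ 2 / (L - criticalLength μ α β))
        (𝓝[>] (criticalLength μ α β)) (𝓝 C) ∧
      Tendsto σm (𝓝[>] (criticalLength μ α β)) (𝓝 0) ∧
      Tendsto σp (𝓝[>] (criticalLength μ α β)) (𝓝 0) ∧
      Tendsto (fun L => σm L / σp L) (𝓝[>] (criticalLength μ α β)) (𝓝 (-2)) := by
  have hh := bfParam_pos hBF
  have hβα := beta_sub_alpha_ne_zero hBF
  have hL₀ := criticalLength_pos hμ hBF
  have hq₀ : 0 < 2 * bfParam α β * μ := by positivity
  have hκ : (1 + α ^ 2) * (2 * bfParam α β * μ) = -2 * μ * (1 + α * β) := by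
    rw [bfParam]
    field_simp
  obtain ⟨b, hg⟩ := exists_branchFamily (phaseRatio α β)
  obtain ⟨c, hc, hcμ, ⟨m, hm, hchar⟩, M, hM, hmode⟩ := exists_mode_estimate hμ hq₀ hκ
  obtain ⟨τ, hτ, hspec⟩ := b.exists_spectrum hg hBF hμ hc hM hmode
  obtain ⟨K, hK, hexp⟩ := b.exists_expansion hg hBF hμ
  obtain ⟨A, hA0, hA1, hA2, hA3⟩ := b.exists_parametrization hg hBF hμ
  have hsymm := b.eventually_neg_eq hg hBF hμ
  have hneg : Tendsto (fun a : ℝ => -a) (𝓝 0) (𝓝 0) := by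
    simpa using (continuous_neg (G := ℝ)).tendsto 0
  obtain ⟨η, ϱ, hη, hϱ, huniq⟩ := BranchFamily.exists_uniqueness (μ := μ) hg hBF hμ
    (hsymm.and (hA3.and (hneg.eventually hA3)))
  obtain ⟨hσp0, hσp1⟩ := b.tendsto_hosEigenvalue hg hBF hμ
  have hk₀ := b.waveCoeff_zero_pos hh
  -- The sign selects the half of the branch for which ε is positive, since the sign of β − α is not
  -- prescribed.
  obtain ⟨ς, hς, hςβ⟩ : ∃ ς : ℝ, (ς = 1 ∨ ς = -1) ∧ ς * (β - α) = |β - α| := by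
    rcases lt_or_gt_of_ne hβα with h | h
    · exact ⟨-1, Or.inr rfl, by rw [abs_of_neg h]; ring⟩
    · exact ⟨1, Or.inl rfl, by rw [abs_of_pos h]; ring⟩
  have hς0 : ς ≠ 0 := by rcases hς with rfl | rfl <;> norm_num
  have hς2 : ς ^ 2 = 1 := by rcases hς with rfl | rfl <;> norm_num
  have hβα' : 0 < |β - α| := abs_pos.mpr hβα
  have ha0 : Tendsto (fun L => ς * A L) (𝓝[>] (criticalLength μ α β)) (𝓝 0) := by
    simpa using hA0.const_mul ς
  have ha1 : Tendsto (fun L => ς * A L) (𝓝[>] (criticalLength μ α β)) (𝓝[≠] 0) :=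
    tendsto_nhdsWithin_iff.mpr ⟨ha0, hA1.mono fun L hL => mul_ne_zero hς0 hL.1.ne'⟩
  have hw : ∀ᶠ L in 𝓝[>] (criticalLength μ α β),
      b.wavenumber μ (ς * A L) = 2 * Real.pi / L := by
    filter_upwards [hA0.eventually hsymm, hA1, hA2] with L h1 h2 h3
    rcases hς with rfl | rfl
    · rw [one_mul, h3]
    · rw [neg_one_mul, (h1 h2.1.ne').1, h3]
  have hΩ3 : ∀ᶠ L in 𝓝 (criticalLength μ α β),
      3 * (2 * bfParam α β * μ) < 4 * (2 * Real.pi / L) ^ 2 ∧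
        |(2 * Real.pi / L) ^ 2 - 2 * bfParam α β * μ| < ϱ ∧ 0 < L := by
    have hval : (2 * Real.pi / criticalLength μ α β) ^ 2 = 2 * bfParam α β * μ := by
      rw [← two_pi_div_sq hμ hBF hL₀.ne', div_self hL₀.ne', one_pow, mul_one]
    have c1 : ContinuousAt (fun L => 4 * (2 * Real.pi / L) ^ 2) (criticalLength μ α β) := by
      fun_prop (disch := exact hL₀.ne')
    have c2 : ContinuousAt (fun L => |(2 * Real.pi / L) ^ 2 - 2 * bfParam α β * μ|)
        (criticalLength μ α β) := by
      fun_prop (disch := exact hL₀.ne')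
    refine (c1.eventually (lt_mem_nhds ?_)).and
      ((c2.eventually (gt_mem_nhds ?_)).and (lt_mem_nhds hL₀))
    · beta_reduce
      rw [hval]
      linarith
    · beta_reduce
      rw [hval, sub_self, abs_zero]
      exact hϱ
  obtain ⟨r, hr, hball⟩ := Metric.eventually_nhds_iff.mp hΩ3
  have hev := (ha1.eventually (hspec.and (b.eventually_isMAW hg hBF hμ))).and
    ((ha0.eventually (hexp.and ((b.eventually_isNearHOS hg hBF hμ hη).and hsymm))).and (hA1.and hw))
  obtain ⟨u, hu, hsub⟩ := mem_nhdsGT_iff_exists_Ioo_subset.mp hev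
  -- Negative amplitudes are handled by passing to −a, which has the same wavenumber; either sign
  -- forces L > L₀.
  have huniq' : ∀ L, |L - criticalLength μ α β| < r → ∀ (ω' : ℝ) (R' φ' : ℝ → ℝ),
      IsEvenStationarySolution μ α β L ω' R' φ' → IsNearHOS μ η R' φ' →
      IsHOS μ β ω' R' φ' ∨ ∃ a, criticalLength μ α β < L ∧ (a = A L ∨ a = -A L) ∧
        ω' = b.freq μ a ∧ R' = b.amplitude μ a ∧ ∃ p, φ' = fun x => b.phase μ a x + p := by
    intro L hL ω' R' φ' hs hn
    obtain ⟨-, hL1, hL2⟩ := hball (by rwa [Real.dist_eq] : dist L (criticalLength μ α β) < r)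
    rcases huniq L ω' R' φ' hL2 hL1.le hs hn with h | ⟨a, ha, ⟨p1, p2, p3⟩, hΩ, h1, h2, h3⟩
    · exact Or.inl h
    · right
      rcases lt_or_gt_of_ne ha with hneg | hpos
      · obtain ⟨k1, k2⟩ := p3 (by linarith) L hL2 (by rw [(p1 ha).1, hΩ])
        exact ⟨a, k1, Or.inr (by rw [← k2, neg_neg]), h1, h2, h3⟩
      · obtain ⟨k1, k2⟩ := p2 hpos L hL2 hΩ
        exact ⟨a, k1, Or.inl k2, h1, h2, h3⟩
  -- With ε = 2μ(β − α)a the leading term 2μa of R² is ε/(β − α), and K is rescaled to ε². The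
  -- constant C comes from a²k = (L/L₀)² − 1, which is asymptotic to 2(L − L₀)/L₀.
  refine ⟨min (u - criticalLength μ α β) r, η, c, K / (2 * μ * (β - α)) ^ 2,
    (2 * μ * (β - α)) ^ 2 * (2 / (criticalLength μ α β * b.waveCoeff (bfParam α β) 0)),
    fun L => b.freq μ (ς * A L), fun L => 2 * μ * (β - α) * (ς * A L),
    fun L => (ς * A L) ^ 2 * τ (ς * A L),
    fun L => hosEigenvalue μ α (2 * bfParam α β * μ) ((2 * Real.pi / L) ^ 2),
    fun L => b.amplitude μ (ς * A L), fun L => b.phase μ (ς * A L),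
    lt_min (sub_pos.mpr hu) hr, hη, hc, by positivity, ?_, ?_, ?_, ?_, ?_, ?_, ?_, ?_⟩
  · intro L hL
    obtain ⟨⟨⟨hst, hσneg, hcrit⟩, hmaw⟩, ⟨⟨hR, hφ⟩, hnear, hsy⟩, ⟨hApos, -⟩, hwL⟩ :=
      hsub (show L ∈ Set.Ioo (criticalLength μ α β) u from
        ⟨hL.1, by linarith [hL.2, min_le_left (u - criticalLength μ α β) r]⟩)
    have hLr : |L - criticalLength μ α β| < r := by
      rw [abs_of_pos (sub_pos.mpr hL.1)]
      linarith [hL.2, min_le_right (u - criticalLength μ α β) r]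
    obtain ⟨hL3, -, hLpos⟩ := hball (by rwa [Real.dist_eq] : dist L (criticalLength μ α β) < r)
    have hΩ : 0 < 2 * Real.pi / L := by positivity
    have hLL : 2 * Real.pi / b.wavenumber μ (ς * A L) = L := by
      rw [hwL]
      field_simp
    have hΩq := (criticalLength_lt_iff hμ hBF hLpos).mp hL.1
    rw [hLL] at hst hcrit hmaw
    have hε : K / (2 * μ * (β - α)) ^ 2 * (2 * μ * (β - α) * (ς * A L)) ^ 2
        = K * (ς * A L) ^ 2 := by
      field_simp
    have hHOS := hos_isCriticalEigenvalue hμ hΩ hq₀ hκ hcμ hm hchar hΩq hL3.le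
    rw [show 2 * Real.pi / (2 * Real.pi / L) = L by field_simp] at hHOS
    refine ⟨hmaw, hnear, ?_, fun x => ?_, fun x => ?_, hst, hσneg, hcrit,
      hosEigenvalue_pos (pow_pos hΩ 2) hμ hΩq, hHOS, ?_⟩
    · have : 2 * μ * (β - α) * (ς * A L) = 2 * μ * (ς * (β - α)) * A L := by ring
      simp only [this, hςβ]
      positivity
    · have := hR x
      rw [hwL] at this
      simp only [hε]
      rw [show 2 * μ * (β - α) * (ς * A L) / (β - α) = 2 * μ * (ς * A L) by field_simp]
      exact this
    · have := hφ x
      rw [hwL] at this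
      simp only [hε]
      exact this
    · intro ω' R' φ' hs hn
      rcases huniq' L hLr ω' R' φ' hs hn with h | ⟨a, -, ha, h1, h2, h3⟩
      · exact Or.inl h
      · right
        -- The member of amplitude −a is the half-period translate of the chosen one.
        have hcase : a = ς * A L ∨ a = -(ς * A L) := by
          rcases hς with rfl | rfl <;> rcases ha with rfl | rfl <;> simp
        rcases hcase with rfl | rfl
        · exact Or.inl ⟨h1, h2, h3⟩
        · obtain ⟨-, e1, e2, p, e3⟩ := hsy (mul_ne_zero hς0 hApos.ne')
          rw [hLL] at e2 e3
          obtain ⟨p', h3⟩ := h3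
          refine Or.inr ⟨h1.trans e1, h2.trans e2, p + p', ?_⟩
          rw [h3, e3]
          funext x
          ring
  · intro L hL
    have h1 := (lt_criticalLength_iff hμ hBF hL.1).mp hL.2
    have h2 := hos_isLinearlyStable hμ (div_pos Real.two_pi_pos hL.1) hq₀ hκ h1
    have hLne := hL.1.ne'
    rwa [show 2 * Real.pi / (2 * Real.pi / L) = L by field_simp] at h2
  · intro L hL ω' R' φ' hs hn
    have hLr : |L - criticalLength μ α β| < r := by
      rw [abs_of_nonpos (sub_nonpos.mpr hL.2)]
      linarith [hL.1, min_le_right (u - criticalLength μ α β) r]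
    rcases huniq' L hLr ω' R' φ' hs hn with h | ⟨a, h, -⟩
    · exact h
    · exact absurd h hL.2.not_gt
  · exact (b.tendsto_freq hBF hμ).comp ha0
  · have hkA : Tendsto (fun L => b.waveCoeff (bfParam α β) (A L))
        (𝓝[>] (criticalLength μ α β)) (𝓝 (b.waveCoeff (bfParam α β) 0)) :=
      (b.contDiff_waveCoeff _).continuousAt.tendsto.comp hA0
    have hLt : Tendsto (fun L => L) (𝓝[>] (criticalLength μ α β)) (𝓝 (criticalLength μ α β)) :=
      tendsto_id.mono_left nhdsWithin_le_nhds
    have h1 := ((hLt.add_const (criticalLength μ α β)).div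
      (hkA.const_mul (criticalLength μ α β ^ 2)) (by positivity)).const_mul
        ((2 * μ * (β - α)) ^ 2)
    have e : (criticalLength μ α β + criticalLength μ α β)
        / (criticalLength μ α β ^ 2 * b.waveCoeff (bfParam α β) 0)
        = 2 / (criticalLength μ α β * b.waveCoeff (bfParam α β) 0) := by
      field_simp
      ring
    rw [e] at h1
    refine h1.congr' ?_
    filter_upwards [hA1, hkA.eventually (lt_mem_nhds hk₀), self_mem_nhdsWithin] with L h2 h3 hL
    have hL' : L - criticalLength μ α β ≠ 0 := (sub_pos.mpr hL).ne'
    have h4 : criticalLength μ α β ^ 2 * (A L ^ 2 * b.waveCoeff (bfParam α β) (A L))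
        = L ^ 2 - criticalLength μ α β ^ 2 := by
      rw [h2.2]
      field_simp
    rw [mul_pow _ (ς * A L), mul_pow ς, hς2, one_mul, mul_div_assoc]
    congr 1
    simp only [Pi.div_apply]
    rw [div_eq_div_iff (by positivity) hL']
    linear_combination -h4
  · have h1 : Tendsto (fun a : ℝ => a ^ 2 * τ a) (𝓝 0) (𝓝 0) := by
      have hsq : Tendsto (fun a : ℝ => a ^ 2) (𝓝 0) (𝓝 0) := by
        simpa using (continuous_pow 2 (M := ℝ)).tendsto 0
      simpa using hsq.mul hτ
    exact h1.comp ha0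
  · refine (hσp0.comp ha0).congr' ?_
    filter_upwards [hw] with L h1
    simp only [Function.comp, h1]
  · have h1 := (hτ.comp ha0).div (hσp1.comp ha1) (by positivity)
    have k₁ := bfParam_mul_one_add hBF
    have hγ : 0 < 1 - α * phaseRatio α β := by
      have : bfParam α β * (1 - α * phaseRatio α β) = 2 * bfParam α β + 1 := by
        linear_combination -k₁
      by_contra hcon
      push Not at hcon
      nlinarith
    -- The factors k(0) and 1 + α² cancel; with q₀ = 2hμ and h(1 − αγ) = 2h + 1 the quotient is −2.
    have e : -2 * b.waveCoeff (bfParam α β) 0 * (2 * bfParam α β * μ) * (1 + α ^ 2)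
          / (1 - α * phaseRatio α β)
        / ((1 + α ^ 2) * (2 * bfParam α β * μ) ^ 2 * b.waveCoeff (bfParam α β) 0
          / (2 * (2 * bfParam α β * μ + μ))) = -2 := by
      rw [div_div_div_eq, div_eq_iff (by positivity)]
      linear_combination (-8 * b.waveCoeff (bfParam α β) 0 * bfParam α β * μ ^ 2 * (1 + α ^ 2)) * k₁
    rw [e] at h1
    refine h1.congr' ?_
    filter_upwards [hw, hA1] with L h2 h3
    have ha : ς * A L ≠ 0 := mul_ne_zero hς0 h3.1.ne'
    simp only [Pi.div_apply, Function.comp, h2]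
    rw [div_div_eq_mul_div, mul_comm (τ _)]
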